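/- \textbf{Conventions.} A \emph{polynomial monad} over a set $I$ consists of a set of operations, each with an output colour and a finite set of coloured inputs, such that the induced endofunctor of $\mathrm{Set}/I$ carries a monad structure whose unit and multiplication are cartesian. For a polynomial monad $M$ over $I$, its \emph{Baez--Dolan construction} $M^+$ is the polynomial monad whose colours are the operations of $M$, whose operations are the $M$-trees (finite trees whose nodes are decorated by operations of $M$, compatibly with colours; the trees without nodes are allowed), the inputs of a tree being its nodes and its output being the operation of $M$ to which it reduces, and whose multiplication is substitution of trees into nodes. Let $\mathfrak{Z}^0$ be the identity monad on $\mathrm{Set}$ and $\mathfrak{Z}^{n+1} = (\mathfrak{Z}^n)^+$. The set $\mathbb{O}_n$ of \emph{$n$-opetopes} is the set of colours of $\mathfrak{Z}^n$; thus an $(n+1)$-opetope $\omega$ is an operation of $\mathfrak{Z}^n$, its \emph{target} $\mathsf{t}\,\omega\in\mathbb{O}_n$ is the output colour and its \emph{sources} $\mathsf{s}_{[p]}\,\omega\in\mathbb{O}_n$ are the colours of its inputs. The category $\mathbb{O}$ of opetopes has all opetopes as objects and is generated by the embeddings $\mathsf{t}:\mathsf{t}\,\omega\to\omega$ and $\mathsf{s}_{[p]}:\mathsf{s}_{[p]}\,\omega\to\omega$,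 subject to the opetopic identities, for each opetope $\omega$ of dimension at least $2$: (Inner) $\mathsf{s}_{[p]}\mathsf{s}_{[q]}=\mathsf{s}_{[p[q]]}\mathsf{t}$ for each inner edge $[p[q]]$ of the tree $\omega$; (Glob1) $\mathsf{t}\,\mathsf{t}=\mathsf{s}_{[]}\mathsf{t}$ if $\omega$ has a node; (Glob2) $\mathsf{t}\,\mathsf{s}_{\wp[p[q]]}=\mathsf{s}_{[p]}\mathsf{s}_{[q]}$ for each leaf $[p[q]]$ of $\omega$ (with $\omega$ having a node), where $\wp$ is the readdressing bijection from the leaves of $\omega$ to the inputs of $\mathsf{t}\,\omega$; (Degen) $\mathsf{t}\,\mathsf{t}=\mathsf{t}\,\mathsf{s}_{[]}$ if $\omega$ has no node. Let $\mathbb{O}_{n-k,n}\subseteq\mathbb{O}$ be the full subcategory of opetopes of dimension $d$ with $n-k\le d\le n$. For $\nu\in\mathbb{O}_{n+1}$, the \emph{spine} $S[\nu]$ is the largest subpresheaf of the representable $O[\nu]$ containing neither the identity of $\nu$ nor the target embedding $\mathsf{t}$. For $k,n\in\mathbb{N}$ let $\mathfrak{Z}^n$ also denote the monad on the category of presheaves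 $\mathrm{Psh}(\mathbb{O}_{n-k,n})$ given by $(\mathfrak{Z}^nX)_\psi=X_\psi$ if $\dim\psi<n$ and $$(\mathfrak{Z}^nX)_\omega=\sum_{\nu\in\mathbb{O}_{n+1},\ \mathsf{t}\,\nu=\omega}\mathrm{Psh}(\mathbb{O}_{n-k,n})(S[\nu],X)\qquad(\omega\in\mathbb{O}_n),$$ with unit given by the corollas (the units of the polynomial monad $\mathfrak{Z}^n$) and multiplication given by the multiplication of the polynomial monad $\mathfrak{Z}^n$. The category $\mathrm{Alg}_{k,n}$ of \emph{$(k,n)$-opetopic algebras} is the Eilenberg--Moore category of this monad. \textbf{Proposition.} There are equivalences of categories \begin{itemize} \item $\mathrm{Alg}_{0,0}\simeq\mathrm{Set}$, the category of sets; \item $\mathrm{Alg}_{0,1}\simeq\mathrm{Mon}$, the category of monoids; \item $\mathrm{Alg}_{1,1}\simeq\mathrm{Cat}$, the category of small categories; \item $\mathrm{Alg}_{0,2}\simeq\mathrm{Op}$, the category of planar (nonsymmetric) uncoloured operads in sets; \item $\mathrm{Alg}_{1,2}\simeq\mathrm{Op}_{\mathrm{col}}$, the category of small planar coloured operads in sets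 (morphisms may change the colours); \item $\mathrm{Alg}_{0,3}\simeq\mathrm{Comb}_{\mathbb{PT}}$, the category of combinads in sets over the combinatorial pattern of planar trees: families of sets indexed by finite planar trees (vertices of any arity, and the trivial tree, being allowed), with a unit for each corolla and a composition for each substitution of planar trees into the vertices of a planar tree, that are unital and associative. \end{itemize} Moreover, for all $k\ge n$, the categories $\mathrm{Alg}_{k,n}$ and $\mathrm{Alg}_{n,n}$ are the same (isomorphic). -/

import Mathlib

namespace Opetopic

/-- A polynomial endofunctor `I ← E → B → I`, presented by its fibres: `Op i` is the set of
operations with output colour `i`, and `In b j` is the set of inputs of colour `j` of `b`. -/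
structure PolyEnd (I : Type) where
  Op : I → Type
  In : ∀ {i : I}, Op i → I → Type

namespace PolyEnd

variable {I : Type} (P : PolyEnd I)

/-- The functor `Set/I → Set/I` defined by a polynomial. -/
def Ext (X : I → Type) (i : I) : Type :=
  Σ b : P.Op i, ∀ j, P.In b j → X j

/-- `P`-trees whose leaves of colour `j` are labelled by elements of `X j`, indexed by the colour
of the root. -/
inductive Tree (X : I → Type) : I → Type
  | leaf {i : I} (x : X i) : Tree X i
  | node {i : I} (b : P.Op i) (c : ∀ j, P.In b j → Tree X j) : Tree X i

variable {P}

namespace Tree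

variable {X Y Z : I → Type}

/-- Grafting of trees on all leaves of a tree. -/
def graft : ∀ {i : I}, P.Tree X i → (∀ j, X j → P.Tree Y j) → P.Tree Y i
  | _, leaf x, f => f _ x
  | _, node b c, f => node b (fun j e => (c j e).graft f)

/-- `T.Node ⟨j, b⟩` is the set of (addresses of) nodes of the tree `T` that are decorated by the
operation `b`, which has output colour `j`. -/
inductive Node : ∀ {i : I}, P.Tree X i → (Σ i, P.Op i) → Type
  | here {i : I} {b : P.Op i} {c : ∀ j, P.In b j → P.Tree X j} : Node (node b c) ⟨i, b⟩
  | there {i : I} {b : P.Op i} {c : ∀ j, P.In b j → P.Tree X j} {j : I} (e : P.In b j)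
      {a : Σ i, P.Op i} (n : Node (c j e) a) : Node (node b c) a

/-- The set of leaves of `T` with label `x`. -/
inductive Leaf : ∀ {i : I}, P.Tree X i → (Σ i, X i) → Type
  | here {i : I} {x : X i} : Leaf (leaf x) ⟨i, x⟩
  | there {i : I} {b : P.Op i} {c : ∀ j, P.In b j → P.Tree X j} {j : I} (e : P.In b j)
      {a : Σ i, X i} (n : Leaf (c j e) a) : Leaf (node b c) a

theorem graft_assoc {i : I} (T : P.Tree X i) (f : ∀ j, X j → P.Tree Y j)
    (g : ∀ j, Y j → P.Tree Z j) :
    (T.graft f).graft g = T.graft (fun j x => (f j x).graft g) := by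
  induction T with
  | leaf x => rfl
  | node b c ih => simp only [graft, ih]

theorem graft_leaf {i : I} (T : P.Tree X i) : T.graft (fun _ x => leaf x) = T := by
  induction T with
  | leaf x => rfl
  | node b c ih => simp only [graft, ih]

/-- A node of a grafting is a node of the base or of one of the grafted trees. -/
def nodeGraft {a : Σ i, P.Op i} (f : ∀ j, X j → P.Tree Y j) :
    ∀ {i : I} (T : P.Tree X i), (T.graft f).Node a →
      T.Node a ⊕ (Σ x : (Σ j, X j), T.Leaf x × (f x.1 x.2).Node a)
  | _, leaf x, n => Sum.inr ⟨⟨_, x⟩, Leaf.here, n⟩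
  | _, node _ c, n =>
    match a, n with
    | _, Node.here => Sum.inl Node.here
    | _, Node.there e m =>
      match nodeGraft f (c _ e) m with
      | Sum.inl m' => Sum.inl (Node.there e m')
      | Sum.inr ⟨x, l, m'⟩ => Sum.inr ⟨x, Leaf.there e l, m'⟩

/-- The polynomial whose operations are those of `P` with a decoration. -/
def _root_.Opetopic.PolyEnd.dec (P : PolyEnd I) (D : (Σ i, P.Op i) → Type) : PolyEnd I where
  Op i := Σ b : P.Op i, D ⟨i, b⟩
  In b := P.In b.1

variable {D : (Σ i, P.Op i) → Type}

/-- A tree with decorated nodes, as a tree of decorated operations. -/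
def toDec : ∀ {i : I} (T : P.Tree X i), (∀ a, T.Node a → D a) → (P.dec D).Tree X i
  | _, leaf x, _ => leaf x
  | i, node b c, d =>
    node (P := P.dec D) (i := i) ⟨b, d ⟨i, b⟩ Node.here⟩ (fun j (e : P.In b j) =>
      (c j e).toDec (fun a n => d a (Node.there (b := b) (c := c) e n)))

/-- Decorated trees over a decorated node. -/
def decNode {i : I} (b : P.Op i) (x : D ⟨i, b⟩)
    (g : ∀ j, P.In b j → Σ T : P.Tree X j, ∀ a, T.Node a → D a) :
    Σ T : P.Tree X i, ∀ a, T.Node a → D a :=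
  ⟨node b (fun j e => (g j e).1), fun _ n =>
    match n with
    | .here => x
    | .there e m => (g _ e).2 _ m⟩

/-- The inverse of `toDec`. -/
def ofDec : ∀ {i : I}, (P.dec D).Tree X i → Σ T : P.Tree X i, ∀ a, T.Node a → D a
  | _, .leaf x => ⟨leaf x, fun _ n => nomatch n⟩
  | _, .node b c => decNode b.1 b.2 (fun j e => ofDec (c j e))

theorem ofDec_toDec {i : I} (T : P.Tree X i) (d : ∀ a, T.Node a → D a) :
    ofDec (T.toDec d) = ⟨T, d⟩ := by
  induction T with
  | leaf x =>
    have h : d = (fun _ n => nomatch n) := by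
      funext a n
      cases n
    rw [h]
    rfl
  | @node i b c ih =>
    have h : (fun j e => ofDec ((c j e).toDec (fun a n => d a (.there e n)))) =
        fun j e => ⟨c j e, fun a n => d a (.there e n)⟩ := by
      funext j e
      exact ih j e _
    refine (congrArg (decNode b (d _ .here)) h).trans ?_
    have h' : d = (decNode b (d _ .here) (fun j e => ⟨c j e, fun a n => d a (.there e n)⟩)).2 := by
      funext a n
      cases n <;> rfl
    conv_rhs => rw [h']
    rfl

theorem toDec_injective {i : I} {T T' : P.Tree X i} {d : ∀ a, T.Node a → D a}
    {d' : ∀ a, T'.Node a → D a} (h : T.toDec d = T'.toDec d') :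
    (⟨T, d⟩ : Σ T : P.Tree X i, ∀ a, T.Node a → D a) = ⟨T', d'⟩ := by
  rw [← ofDec_toDec T d, h, ofDec_toDec]

theorem toDec_graft (f : ∀ j, X j → P.Tree Y j) (df : ∀ j x a, (f j x).Node a → D a) {i : I}
    (T : P.Tree X i) (d : ∀ a, T.Node a → D a) :
    (T.graft f).toDec (fun a n => match nodeGraft f T n with
      | Sum.inl m => d a m
      | Sum.inr ⟨x, _, m⟩ => df x.1 x.2 a m) =
    (T.toDec d).graft (fun j x => (f j x).toDec (df j x)) := by
  induction T with
  | leaf x => rfl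
  | node b c ih =>
    simp only [graft, toDec]
    congr 1
    funext j e
    refine Eq.trans ?_ (ih j e _)
    congr 1
    funext a n
    simp only [nodeGraft]
    cases nodeGraft f (c j e) n <;> rfl

end Tree

end PolyEnd

/-- The data of a polynomial monad: a unit and a (two-level) multiplication of operations, along
with the comparison maps on inputs. -/
structure PolyMonadData (I : Type) extends PolyEnd I where
  one : ∀ i : I, Op i
  oneIn : ∀ {i j : I}, In (one i) j → i = j
  mul : ∀ {i : I} (b : Op i), (∀ j, In b j → Op j) → Op i
  mulIn : ∀ {i : I} (b : Op i) (c : ∀ j, In b j → Op j) {k : I},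
    In (mul b c) k → Σ j, Σ e : In b j, In (c j e) k

namespace PolyMonadData

variable {I : Type} (M : PolyMonadData I)

/-- The unit of the induced monad on `Set/I`. -/
def pure {X : I → Type} {i : I} (x : X i) : M.Ext X i :=
  ⟨M.one i, fun _ e => M.oneIn e ▸ x⟩

/-- The Kleisli extension of the induced monad on `Set/I`. -/
def bind {X Y : I → Type} {i : I} (z : M.Ext X i) (f : ∀ j, X j → M.Ext Y j) : M.Ext Y i :=
  ⟨M.mul z.1 (fun j e => (f j (z.2 j e)).1), fun k e =>
    let r := M.mulIn z.1 (fun j e => (f j (z.2 j e)).1) e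
    (f r.1 (z.2 r.1 r.2.1)).2 k r.2.2⟩

/-- The reduction of a tree of operations to a single operation, together with the resulting
labelling of the inputs of the latter. -/
def eval {X : I → Type} : ∀ {i : I}, M.Tree X i → M.Ext X i
  | _, .leaf x => M.pure x
  | _, .node b c => M.bind (X := M.Ext X) ⟨b, fun j e => eval (c j e)⟩ (fun _ z => z)

end PolyMonadData

/-- A (finitary) polynomial monad over `I`: the unit and the multiplication are cartesian, i.e.
they are bijective on inputs, and they satisfy the unit and associativity laws of a monad. -/
structure PolyMonad (I : Type) extends PolyMonadData I where
  finite : ∀ {i : I} (b : Op i), Finite (Σ j, In b j)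
  one_bij : ∀ i : I, Nonempty (Unique (In (one i) i))
  mul_bij : ∀ {i : I} (b : Op i) (c : ∀ j, In b j → Op j) (k : I),
    Function.Bijective (mulIn b c (k := k))
  pure_bind : ∀ {X Y : I → Type} {i : I} (x : X i) (f : ∀ j, X j → toPolyMonadData.Ext Y j),
    toPolyMonadData.bind (toPolyMonadData.pure x) f = f i x
  bind_pure : ∀ {X : I → Type} {i : I} (z : toPolyMonadData.Ext X i),
    toPolyMonadData.bind z (fun _ x => toPolyMonadData.pure x) = z
  bind_assoc : ∀ {X Y Z : I → Type} {i : I} (z : toPolyMonadData.Ext X i)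
    (f : ∀ j, X j → toPolyMonadData.Ext Y j) (g : ∀ j, Y j → toPolyMonadData.Ext Z j),
    toPolyMonadData.bind (toPolyMonadData.bind z f) g =
      toPolyMonadData.bind z (fun j x => toPolyMonadData.bind (f j x) g)

namespace PolyMonad

variable {I : Type} (M : PolyMonad I)

theorem eval_graft {X Y : I → Type} {i : I} (T : M.Tree X i) (f : ∀ j, X j → M.Tree Y j) :
    M.eval (T.graft f) = M.bind (M.eval T) (fun j x => M.eval (f j x)) := by
  induction T with
  | leaf x => exact (M.pure_bind x (fun j x => M.eval (f j x))).symm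
  | node b c ih =>
    simp only [PolyEnd.Tree.graft, PolyMonadData.eval, ih]
    exact (M.bind_assoc (X := M.Ext X) ⟨b, fun j e => M.eval (c j e)⟩ (fun _ z => z)
      (fun j x => M.eval (f j x))).symm

/-- The operations of the Baez--Dolan construction with output `b`: the trees of operations that
reduce to `b`, the leaves being identified with the inputs of `b` by the reduction. -/
def BDOp (a : Σ i, M.Op i) : Type :=
  {T : M.Tree (M.In a.2) a.1 // M.eval T = ⟨a.2, fun _ e => e⟩}

/-- The corolla on an operation. -/
def corolla (a : Σ i, M.Op i) : M.BDOp a :=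
  ⟨.node a.2 (fun _ e => .leaf e), M.bind_pure (X := M.In a.2) ⟨a.2, fun _ e => e⟩⟩

/-- Substitution of trees into all nodes of a tree. -/
def subst {X : I → Type} : ∀ {i : I} (T : M.Tree X i), (∀ a, T.Node a → M.BDOp a) → M.Tree X i
  | _, .leaf x, _ => .leaf x
  | _, .node _ c, U =>
    (U _ .here).1.graft (fun j e => subst (c j e) (fun a n => U a (.there e n)))

theorem eval_subst {X : I → Type} {i : I} (T : M.Tree X i) (U : ∀ a, T.Node a → M.BDOp a) :
    M.eval (M.subst T U) = M.eval T := by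
  induction T with
  | leaf x => rfl
  | node b c ih =>
    simp only [subst, eval_graft, ih, (U _ .here).2]
    rfl

/-- A node of a substitution is a node of one of the substituted trees. -/
def nodeSubst {X : I → Type} {a : Σ i, M.Op i} : ∀ {i : I} (T : M.Tree X i)
    (U : ∀ a, T.Node a → M.BDOp a), (M.subst T U).Node a →
      Σ a', Σ n : T.Node a', (U a' n).1.Node a
  | _, .leaf _, _, n => nomatch n
  | _, .node b c, U, n =>
    match PolyEnd.Tree.nodeGraft (fun j e => M.subst (c j e) (fun a n => U a (.there e n)))
      (U _ .here).1 n with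
    | Sum.inl m => ⟨⟨_, b⟩, .here, m⟩
    | Sum.inr ⟨x, _, m⟩ =>
      let r := nodeSubst (c x.1 x.2) (fun a n => U a (.there x.2 n)) m
      ⟨r.1, .there x.2 r.2.1, r.2.2⟩

theorem nodeSubst_inl {X : I → Type} {a : Σ i, M.Op i} {i : I} {b : M.Op i}
    {c : ∀ j, M.In b j → M.Tree X j} {U : ∀ a, (PolyEnd.Tree.node b c).Node a → M.BDOp a}
    {n : (M.subst (.node b c) U).Node a} {m : (U _ .here).1.Node a}
    (h : PolyEnd.Tree.nodeGraft (fun j e => M.subst (c j e) (fun a n => U a (.there e n)))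
      (U _ .here).1 n = Sum.inl m) :
    M.nodeSubst (.node b c) U n = ⟨⟨i, b⟩, .here, m⟩ := by
  simp only [nodeSubst, h]

theorem nodeSubst_inr {X : I → Type} {a : Σ i, M.Op i} {i : I} {b : M.Op i}
    {c : ∀ j, M.In b j → M.Tree X j} {U : ∀ a, (PolyEnd.Tree.node b c).Node a → M.BDOp a}
    {n : (M.subst (.node b c) U).Node a} {x : Σ j, M.In b j} {l : (U _ .here).1.Leaf x}
    {m : (M.subst (c x.1 x.2) (fun a n => U a (.there x.2 n))).Node a}
    (h : PolyEnd.Tree.nodeGraft (fun j e => M.subst (c j e) (fun a n => U a (.there e n)))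
      (U _ .here).1 n = Sum.inr ⟨x, l, m⟩) :
    M.nodeSubst (.node b c) U n =
      let r := M.nodeSubst (c x.1 x.2) (fun a n => U a (.there x.2 n)) m
      ⟨r.1, .there x.2 r.2.1, r.2.2⟩ := by
  simp only [nodeSubst, h]

/-- The data of the Baez--Dolan construction of a polynomial monad. -/
def bdData : PolyMonadData (Σ i, M.Op i) where
  Op := M.BDOp
  In T a := T.1.Node a
  one := M.corolla
  oneIn
    | .here => rfl
  mul T U := ⟨M.subst T.1 U, (M.eval_subst T.1 U).trans T.2⟩
  mulIn T U _ n := M.nodeSubst T.1 U n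

section laws

open PolyEnd.Tree

/-- For a tree that is an operation of the Baez--Dolan construction, leaves are in bijection with
inputs of its target. -/
theorem exists_leaf_bij {X : I → Type} {i : I} (T : M.Tree X i) :
    ∃ φ : ∀ j, M.In (M.eval T).1 j → Σ x : X j, T.Leaf ⟨j, x⟩,
      (∀ j, Function.Bijective (φ j)) ∧ ∀ j e, (φ j e).1 = (M.eval T).2 j e := by
  induction T with
  | @leaf i x =>
    refine ⟨fun j e => M.oneIn e ▸ ⟨x, .here⟩, fun j => ⟨?_, ?_⟩, ?_⟩
    · intro e e' _
      have h := M.oneIn e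
      subst h
      obtain ⟨u⟩ := M.one_bij i
      exact Subsingleton.elim (α := M.In (M.one i) i) e e'
    · rintro ⟨y, l⟩
      cases l
      obtain ⟨u⟩ := M.one_bij i
      exact ⟨u.default, rfl⟩
    · intro j e
      have h := M.oneIn e
      subst h
      rfl
  | @node i b c ih =>
    choose φ hb hv using ih
    refine ⟨fun k e =>
      let r := M.mulIn b (fun j e => (M.eval (c j e)).1) e
      ⟨(φ r.1 r.2.1 k r.2.2).1, .there r.2.1 (φ r.1 r.2.1 k r.2.2).2⟩, fun k => ?_, ?_⟩
    · have hm := M.mul_bij b (fun j e => (M.eval (c j e)).1) k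
      refine Function.Bijective.comp (g := fun r : (Σ j, Σ e : M.In b j, M.In (M.eval (c j e)).1 k) =>
        (⟨(φ r.1 r.2.1 k r.2.2).1, .there r.2.1 (φ r.1 r.2.1 k r.2.2).2⟩ :
          Σ x : X k, (PolyEnd.Tree.node b c).Leaf ⟨k, x⟩)) ⟨?_, ?_⟩ hm
      · rintro ⟨j, e, d⟩ ⟨j', e', d'⟩ h
        have h1 := (Sigma.mk.inj_iff.1 h).1
        have h2 := (Sigma.mk.inj_iff.1 h).2
        dsimp only at h1 h2
        generalize hp : φ j e k d = p at h1 h2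
        generalize hp' : φ j' e' k d' = p' at h1 h2
        obtain ⟨x, l⟩ := p
        obtain ⟨x', l'⟩ := p'
        dsimp only at h1 h2
        subst h1
        cases h2
        have := (hb j e k).1 (hp.trans hp'.symm)
        subst this
        rfl
      · rintro ⟨x, l⟩
        cases l with
        | there e l =>
          obtain ⟨d, hd⟩ := (hb _ e k).2 ⟨x, l⟩
          refine ⟨⟨_, e, d⟩, ?_⟩
          dsimp only
          rw [hd]
    · intro k e
      exact hv _ _ _ _

theorem leaf_unique {a : Σ i, M.Op i} (T : M.BDOp a) (x : Σ j, M.In a.2 j) :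
    Nonempty (Unique (T.1.Leaf x)) := by
  obtain ⟨φ, hb, hv⟩ := M.exists_leaf_bij T.1
  obtain ⟨T, hT⟩ := T
  obtain ⟨j, x⟩ := x
  dsimp only at φ hb hv ⊢
  revert φ hb hv
  rw [hT]
  intro φ hb hv
  have key : ∀ l : T.Leaf ⟨j, x⟩, φ j x = ⟨x, l⟩ := by
    intro l
    obtain ⟨e, he⟩ := (hb j).2 ⟨x, l⟩
    have := hv j e
    rw [he] at this
    subst this
    exact he
  have hx : (φ j x).1 = x := hv j x
  refine ⟨⟨⟨?_⟩, fun l => ?_⟩⟩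
  · exact (hx ▸ (φ j x).2 : T.Leaf ⟨j, x⟩)
  · have := (key l).symm.trans (key (hx ▸ (φ j x).2 : T.Leaf ⟨j, x⟩))
    exact eq_of_heq (Sigma.mk.inj_iff.1 this).2

theorem nodeGraft_bij {X Y : I → Type} {a : Σ i, M.Op i} (f : ∀ j, X j → M.Tree Y j) {i : I}
    (T : M.Tree X i) : Function.Bijective (nodeGraft (a := a) f T) := by
  induction T with
  | leaf x =>
    refine ⟨fun n n' h => ?_, ?_⟩
    · cases h
      rfl
    · rintro (n | ⟨x', l, n⟩)
      · cases n
      · cases l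
        exact ⟨n, rfl⟩
  | node b c ih =>
    refine ⟨?_, ?_⟩
    · intro n n' h
      cases n with
      | here =>
        cases n' with
        | here => rfl
        | there e' m' =>
          simp only [nodeGraft] at h
          split at h <;> cases h
      | there e m =>
        cases n' with
        | here =>
          simp only [nodeGraft] at h
          split at h <;> cases h
        | there e' m' =>
          simp only [nodeGraft] at h
          split at h <;> rename_i h1 <;> split at h <;> rename_i h2 <;> cases h
          all_goals
            have := (ih _ _).1 (h1.trans h2.symm)
            rw [this]
    · rintro (n | ⟨x, l, n⟩)
      · cases n with
        | here => exact ⟨.here, rfl⟩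
        | there e m =>
          obtain ⟨m', h⟩ := (ih _ e).2 (Sum.inl m)
          exact ⟨.there e m', by simp only [nodeGraft, h]⟩
      · cases l with
        | there e l =>
          obtain ⟨m', h⟩ := (ih _ e).2 (Sum.inr ⟨x, l, n⟩)
          exact ⟨.there e m', by simp only [nodeGraft, h]⟩

theorem nodeSubst_bij {X : I → Type} {a : Σ i, M.Op i} {i : I} (T : M.Tree X i)
    (U : ∀ a, T.Node a → M.BDOp a) : Function.Bijective (M.nodeSubst (a := a) T U) := by
  induction T with
  | leaf x =>
    exact ⟨fun n => (nomatch n), fun r => (nomatch r.2.1)⟩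
  | @node i b c ih =>
    have hg := M.nodeGraft_bij (a := a)
      (fun j e => M.subst (c j e) (fun a n => U a (.there e n))) (U _ .here).1
    have he : M.nodeSubst (a := a) (.node b c) U = (fun s => (match s with
      | Sum.inl m => ⟨⟨_, b⟩, .here, m⟩
      | Sum.inr ⟨x, _, m⟩ =>
        let r := M.nodeSubst (c x.1 x.2) (fun a n => U a (.there x.2 n)) m
        ⟨r.1, .there x.2 r.2.1, r.2.2⟩ :
        Σ a', Σ n : (PolyEnd.Tree.node b c).Node a', (U a' n).1.Node a)) ∘ nodeGraft (a := a)
          (fun j e => M.subst (c j e) (fun a n => U a (.there e n))) (U _ .here).1 := by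
      funext n
      simp only [nodeSubst, Function.comp]
    rw [he]
    refine Function.Bijective.comp ⟨?_, ?_⟩ hg
    · rintro (m | ⟨⟨j, x⟩, l, m⟩) (m' | ⟨⟨j', x'⟩, l', m'⟩) h
      · cases h
        rfl
      · dsimp only at h
        generalize M.nodeSubst (c j' x') (fun a n => U a (.there x' n)) m' = p at h
        obtain ⟨a1, n, q⟩ := p
        cases h
      · dsimp only at h
        generalize M.nodeSubst (c j x) (fun a n => U a (.there x n)) m = p at h
        obtain ⟨a1, n, q⟩ := p
        cases h
      · dsimp only at h
        generalize hp : M.nodeSubst (c j x) (fun a n => U a (.there x n)) m = p at h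
        generalize hp' : M.nodeSubst (c j' x') (fun a n => U a (.there x' n)) m' = p' at h
        obtain ⟨a1, n, q⟩ := p
        obtain ⟨a1', n', q'⟩ := p'
        dsimp only at h
        cases h
        have := (ih _ _ _).1 (hp.trans hp'.symm)
        subst this
        obtain ⟨u⟩ := M.leaf_unique (U _ .here) ⟨j, x⟩
        have : l = l' := Subsingleton.elim _ _
        rw [this]
    · rintro ⟨a', n, m⟩
      cases n with
      | here => exact ⟨Sum.inl m, rfl⟩
      | there e n =>
        obtain ⟨m', h⟩ := (ih _ e (fun a n => U a (.there e n))).2 ⟨a', n, m⟩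
        obtain ⟨u⟩ := M.leaf_unique (U _ .here) ⟨_, e⟩
        refine ⟨Sum.inr ⟨⟨_, e⟩, u.default, m'⟩, ?_⟩
        dsimp only
        rw [h]

theorem finite_node {X : I → Type} {i : I} (T : M.Tree X i) : Finite (Σ a, T.Node a) := by
  induction T with
  | leaf x => exact Finite.of_injective (β := Empty) (fun n => nomatch n.2) (fun n => nomatch n.2)
  | @node i b c ih =>
    have := M.finite b
    have : Finite (Option (Σ e : (Σ j, M.In b j), Σ a, (c e.1 e.2).Node a)) := by
      have := fun e : (Σ j, M.In b j) => ih e.1 e.2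
      infer_instance
    refine Finite.of_surjective (fun s : Option (Σ e : (Σ j, M.In b j), Σ a, (c e.1 e.2).Node a) =>
      (match s with
      | none => ⟨⟨i, b⟩, .here⟩
      | some ⟨e, a, n⟩ => ⟨a, .there e.2 n⟩ : Σ a, (PolyEnd.Tree.node b c).Node a)) ?_
    rintro ⟨a, n⟩
    cases n with
    | here => exact ⟨none, rfl⟩
    | there e n => exact ⟨some ⟨⟨_, e⟩, a, n⟩, rfl⟩

end laws


section laws

open PolyEnd.Tree

variable {D D' : (Σ i, M.Op i) → Type}

/-- Substitution in trees with decorated nodes. -/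
def decSubst {X : I → Type} (f : ∀ a, D a → M.bdData.Ext D' a) :
    ∀ {i : I}, (M.dec D).Tree X i → (M.dec D').Tree X i
  | _, .leaf x => .leaf x
  | _, .node b c =>
    (toDec (f _ b.2).1.1 (f _ b.2).2).graft (fun j e => decSubst f (c j e))

theorem toDec_subst {X : I → Type} (f : ∀ a, D a → M.bdData.Ext D' a) {i : I}
    (T : M.Tree X i) (d : ∀ a, T.Node a → D a) :
    toDec (M.subst T (fun a n => (f a (d a n)).1)) (fun a n =>
      let r := M.nodeSubst T (fun a n => (f a (d a n)).1) n
      (f r.1 (d r.1 r.2.1)).2 a r.2.2) = M.decSubst f (T.toDec d) := by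
  induction T with
  | leaf x => rfl
  | @node i b c ih =>
    simp only [subst, toDec, decSubst, ← ih]
    refine Eq.trans ?_ (toDec_graft _ _ _ _)
    congr 1
    funext a n
    let F : (Σ a', Σ n : (PolyEnd.Tree.node b c).Node a', (f a' (d a' n)).1.1.Node a) → D' a :=
      fun r => (f r.1 (d r.1 r.2.1)).2 a r.2.2
    rcases hs : nodeGraft (fun j e => M.subst (c j e) (fun a n => (f a (d a (.there e n))).1))
      (f _ (d _ .here)).1.1 n with m | ⟨x, l, m⟩
    · exact congrArg F (M.nodeSubst_inl (U := fun a n => (f a (d a n)).1) hs)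
    · exact congrArg F (M.nodeSubst_inr (U := fun a n => (f a (d a n)).1) hs)

theorem decSubst_graft {X Y : I → Type} (f : ∀ a, D a → M.bdData.Ext D' a) {i : I}
    (T : (M.dec D).Tree X i) (g : ∀ j, X j → (M.dec D).Tree Y j) :
    M.decSubst f (T.graft g) = (M.decSubst f T).graft (fun j x => M.decSubst f (g j x)) := by
  induction T with
  | leaf x => rfl
  | node b c ih =>
    simp only [graft, decSubst]
    refine Eq.trans ?_ (graft_assoc _ _ _).symm
    congr 1
    funext j e
    exact ih j e

theorem bd_ext {a : Σ i, M.Op i} {z z' : M.bdData.Ext D a}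
    (h : toDec z.1.1 z.2 = toDec z'.1.1 z'.2) : z = z' := by
  obtain ⟨⟨T, hT⟩, d⟩ := z
  obtain ⟨⟨T', hT'⟩, d'⟩ := z'
  have := toDec_injective h
  cases this
  rfl

theorem toDec_bind {a : Σ i, M.Op i} (z : M.bdData.Ext D a)
    (f : ∀ a, D a → M.bdData.Ext D' a) :
    toDec (M.bdData.bind z f).1.1 (M.bdData.bind z f).2 = M.decSubst f (toDec z.1.1 z.2) :=
  M.toDec_subst f z.1.1 z.2

/-- The Baez--Dolan construction of a polynomial monad. -/
def bd : PolyMonad (Σ i, M.Op i) where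
  toPolyMonadData := M.bdData
  finite T := M.finite_node T.1
  one_bij a := ⟨⟨⟨.here⟩, fun n => by
    cases n with
    | here => rfl
    | there e n => cases n⟩⟩
  mul_bij T U _ := M.nodeSubst_bij T.1 U
  pure_bind {D D' a} x f := by
    apply M.bd_ext
    rw [toDec_bind]
    exact graft_leaf _
  bind_pure {D a} z := by
    apply M.bd_ext
    rw [toDec_bind]
    have h : ∀ {i : I} (T : (M.dec D).Tree (M.In a.2) i),
        M.decSubst (fun _ x => M.bdData.pure x) T = T := by
      intro i T
      induction T with
      | leaf x => rfl
      | node b c ih =>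
        exact congrArg (fun c' => PolyEnd.Tree.node b c')
          (funext fun j => funext fun e => ih j e)
    exact h _
  bind_assoc {D D' D'' a} z f g := by
    apply M.bd_ext
    rw [toDec_bind, toDec_bind, toDec_bind]
    have h : ∀ {i : I} (T : (M.dec D).Tree (M.In a.2) i),
        M.decSubst g (M.decSubst f T) =
          M.decSubst (fun j x => M.bdData.bind (f j x) g) T := by
      intro i T
      induction T with
      | leaf x => rfl
      | node b c ih =>
        simp only [decSubst, decSubst_graft]
        rw [toDec_bind]
        congr 1
        funext j e
        exact ih j e
    exact h _

end laws

end PolyMonad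

/-- The identity polynomial monad on `Set`. -/
def idMonad : PolyMonad Unit where
  Op _ := Unit
  In _ _ := Unit
  one _ := ()
  oneIn _ := rfl
  mul _ _ := ()
  mulIn _ _ _ _ := ⟨(), (), ()⟩
  finite _ := inferInstance
  one_bij _ := ⟨inferInstance⟩
  mul_bij _ _ _ := ⟨fun _ _ _ => rfl, fun _ => ⟨(), rfl⟩⟩
  pure_bind _ _ := rfl
  bind_pure _ := rfl
  bind_assoc _ _ _ := rfl

/-- The sequence of polynomial monads obtained from the identity monad by iterating the
Baez--Dolan construction, each one with its set of colours. -/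
def tower : ℕ → Σ I : Type, PolyMonad I
  | 0 => ⟨Unit, idMonad⟩
  | n + 1 => ⟨Σ i, (tower n).2.Op i, (tower n).2.bd⟩

/-- The set of `n`-dimensional opetopes, defined as the set of colours of `𝔷ⁿ`. An
`(n+1)`-opetope is a pair of an `n`-opetope, its target, and an operation of `𝔷ⁿ` with this
output. -/
def Opetope (n : ℕ) : Type := (tower n).1

/-- The polynomial monad `𝔷ⁿ`. -/
def Z (n : ℕ) : PolyMonad (Opetope n) := (tower n).2


namespace PolyEnd.Tree

variable {I : Type} {P : PolyEnd I} {X : I → Type}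

/-- `T.IsRoot p`: the node `p` is the root node of the tree `T`, i.e. its address is `[]`. -/
inductive IsRoot : ∀ {i : I} (T : P.Tree X i) {b : P.Op i}, T.Node ⟨i, b⟩ → Prop
  | mk {i : I} (b : P.Op i) (c : ∀ j, P.In b j → P.Tree X j) : IsRoot (node b c) .here

/-- `T.IsChild p q p'`: if the address of the node `p` is `[p]`, then the address of the node `p'`
is `[p[q]]`, for `q` an input of `p`. -/
inductive IsChild : ∀ {i : I} (T : P.Tree X i) {a : Σ i, P.Op i} (_ : T.Node a) {k : I}
    (_ : P.In a.2 k) {b : P.Op k}, T.Node ⟨k, b⟩ → Prop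
  | here {i : I} (b : P.Op i) (c : ∀ j, P.In b j → P.Tree X j) {k : I} (q : P.In b k) {b' : P.Op k}
      {p' : (c k q).Node ⟨k, b'⟩} (h : (c k q).IsRoot p') :
      IsChild (node b c) (a := ⟨i, b⟩) .here q (.there q p')
  | there {i : I} (b : P.Op i) (c : ∀ j, P.In b j → P.Tree X j) {j : I} (e : P.In b j)
      {a : Σ i, P.Op i} {p : (c j e).Node a} {k : I} {q : P.In a.2 k} {b' : P.Op k}
      {p' : (c j e).Node ⟨k, b'⟩} (h : (c j e).IsChild p q p') :
      IsChild (node b c) (.there e p) q (.there e p')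

/-- `T.IsLeafAt p q x`: if the address of the node `p` is `[p]`, then there is a leaf at address
`[p[q]]`, for `q` an input of `p`, and its label is `x`. -/
inductive IsLeafAt : ∀ {i : I} (T : P.Tree X i) {a : Σ i, P.Op i} (_ : T.Node a) {k : I}
    (_ : P.In a.2 k), X k → Prop
  | here {i : I} (b : P.Op i) (c : ∀ j, P.In b j → P.Tree X j) {k : I} (q : P.In b k) (x : X k)
      (h : c k q = leaf x) : IsLeafAt (node b c) (a := ⟨i, b⟩) .here q x
  | there {i : I} (b : P.Op i) (c : ∀ j, P.In b j → P.Tree X j) {j : I} (e : P.In b j)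
      {a : Σ i, P.Op i} {p : (c j e).Node a} {k : I} {q : P.In a.2 k} {x : X k}
      (h : (c j e).IsLeafAt p q x) : IsLeafAt (node b c) (.there e p) q x

end PolyEnd.Tree

/-- The `(n+1)`-opetope given by an operation of `𝔷ⁿ`. -/
def opetope {n : ℕ} {i : Opetope n} (b : (Z n).Op i) : Opetope (n + 1) := ⟨i, b⟩

/-- Opetopes of all dimensions. -/
structure Opt where
  dim : ℕ
  shape : Opetope dim

/-- The generating morphisms of the category of opetopes: the target and the source embeddings
into an opetope of positive dimension. The sources of an operation of `𝔷ⁿ`, seen as an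
`(n+1)`-opetope, are its inputs. -/
inductive Face : Opt → Opt → Type
  | tgt {n : ℕ} {i : Opetope n} (b : (Z n).Op i) : Face ⟨n, i⟩ ⟨n + 1, opetope b⟩
  | src {n : ℕ} {i : Opetope n} (b : (Z n).Op i) {j : Opetope n} (p : (Z n).In b j) :
      Face ⟨n, j⟩ ⟨n + 1, opetope b⟩

instance : Quiver Opt := ⟨Face⟩

open CategoryTheory

/-- The composite of two generators. -/
def Face.comp {a b c : Opt} (f : Face a b) (g : Face b c) : (show Paths Opt from a) ⟶ c :=
  (Quiver.Path.nil.cons (show a ⟶ b from f)).cons (show b ⟶ c from g)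

/-- The relations between the generating morphisms, for an opetope `ω` of dimension `n + 2` with
target `b` and underlying tree `T`; the leaves of `T` are labelled by the sources of `b`
through the readdressing bijection. -/
inductive FaceRel : HomRel (Paths Opt)
  | inner {n : ℕ} {i : Opetope n} (b : (Z n).Op i) (T : (Z n).BDOp ⟨i, b⟩)
      {j : Opetope n} {s : (Z n).Op j} (p : T.1.Node ⟨j, s⟩) {k : Opetope n} (q : (Z n).In s k)
      {s' : (Z n).Op k} (p' : T.1.Node ⟨k, s'⟩) (h : T.1.IsChild p q p') :
      FaceRel
        (Face.comp (.src s q) (.src (n := n + 1) (i := opetope b) T (j := opetope s) p))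
        (Face.comp (.tgt s') (.src (n := n + 1) (i := opetope b) T (j := opetope s') p'))
  | glob1 {n : ℕ} {i : Opetope n} (b : (Z n).Op i) (T : (Z n).BDOp ⟨i, b⟩)
      {s : (Z n).Op i} (p : T.1.Node ⟨i, s⟩) (h : T.1.IsRoot p) :
      FaceRel
        (Face.comp (.tgt b) (.tgt (n := n + 1) (i := opetope b) T))
        (Face.comp (.tgt s) (.src (n := n + 1) (i := opetope b) T (j := opetope s) p))
  | glob2 {n : ℕ} {i : Opetope n} (b : (Z n).Op i) (T : (Z n).BDOp ⟨i, b⟩)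
      {j : Opetope n} {s : (Z n).Op j} (p : T.1.Node ⟨j, s⟩) {k : Opetope n} (q : (Z n).In s k)
      (x : (Z n).In b k) (h : T.1.IsLeafAt p q x) :
      FaceRel
        (Face.comp (.src b x) (.tgt (n := n + 1) (i := opetope b) T))
        (Face.comp (.src s q) (.src (n := n + 1) (i := opetope b) T (j := opetope s) p))
  | degen {n : ℕ} {i : Opetope n} (b : (Z n).Op i) (T : (Z n).BDOp ⟨i, b⟩)
      (x : (Z n).In b i) (h : T.1 = .leaf x) :
      FaceRel
        (Face.comp (.tgt b) (.tgt (n := n + 1) (i := opetope b) T))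
        (Face.comp (.src b x) (.tgt (n := n + 1) (i := opetope b) T))

/-- The category `𝕆` of opetopes. -/
abbrev OptCat : Type := CategoryTheory.Quotient FaceRel

/-- An opetope as an object of `𝕆`. -/
abbrev ob {n : ℕ} (ω : Opetope n) : OptCat := ⟨(⟨n, ω⟩ : Opt)⟩

/-- The target embedding of an opetope. -/
def tgtHom {n : ℕ} {i : Opetope n} (b : (Z n).Op i) : ob i ⟶ ob (opetope b) :=
  (Quotient.functor FaceRel).map ((Paths.of Opt).map (Face.tgt b))

/-- The source embeddings of an opetope. -/
def srcHom {n : ℕ} {i : Opetope n} (b : (Z n).Op i) {j : Opetope n} (p : (Z n).In b j) :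
    ob j ⟶ ob (opetope b) :=
  (Quotient.functor FaceRel).map ((Paths.of Opt).map (Face.src b p))

theorem hom_ind {a : OptCat} {c : OptCat} (f : a ⟶ c) :
    (∃ h : a = c, f = eqToHom h) ∨
      (∃ (n : ℕ) (i : Opetope n) (b : (Z n).Op i) (h : ob (opetope b) = c) (g : a ⟶ ob i),
        f = g ≫ tgtHom b ≫ eqToHom h) ∨
      ∃ (n : ℕ) (i : Opetope n) (b : (Z n).Op i) (h : ob (opetope b) = c) (j : Opetope n)
        (p : (Z n).In b j) (g : a ⟶ ob j), f = g ≫ srcHom b p ≫ eqToHom h := by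
  obtain ⟨a⟩ := a
  obtain ⟨c⟩ := c
  obtain ⟨f, rfl⟩ := (Quotient.functor FaceRel).map_surjective f
  change Quiver.Path _ _ at f
  cases f with
  | nil => exact Or.inl ⟨rfl, rfl⟩
  | cons g e =>
    right
    change Face _ _ at e
    cases e with
    | tgt b =>
      refine Or.inl ⟨_, _, b, rfl, (Quotient.functor FaceRel).map g, ?_⟩
      rw [eqToHom_refl, Category.comp_id]
      rfl
    | src b p =>
      refine Or.inr ⟨_, _, b, rfl, _, p, (Quotient.functor FaceRel).map g, ?_⟩
      rw [eqToHom_refl, Category.comp_id]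
      rfl


section edges

open PolyEnd.Tree

variable {I : Type} {P : PolyEnd I} {A : (Σ i, P.Op i) → Type} {C : I → Type}
  (tA : ∀ a, A a → C a.1) (sA : ∀ a, A a → ∀ k, P.In a.2 k → C k) {X Y : I → Type}

/-- Given labels of the nodes, of the root edge and of the leaves of a tree, `EdgeCond` says that
the colours of the labels agree along all edges of the tree. -/
structure EdgeCond {i : I} (T : P.Tree X i) (v : ∀ a, T.Node a → A a) (r : C i)
    (l : ∀ j, X j → C j) : Prop where
  inner : ∀ {a : Σ i, P.Op i} (p : T.Node a) {k : I} (q : P.In a.2 k) {b : P.Op k}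
    (p' : T.Node ⟨k, b⟩), T.IsChild p q p' → sA a (v a p) k q = tA ⟨k, b⟩ (v _ p')
  root : ∀ {b : P.Op i} (p : T.Node ⟨i, b⟩), T.IsRoot p → tA ⟨i, b⟩ (v _ p) = r
  leaves : ∀ {a : Σ i, P.Op i} (p : T.Node a) {k : I} (q : P.In a.2 k) (x : X k),
    T.IsLeafAt p q x → sA a (v a p) k q = l k x
  degen : ∀ x : X i, T = leaf x → r = l i x

theorem edgeCond_leaf {i : I} {x : X i} {v : ∀ a, (leaf (P := P) x).Node a → A a} {r : C i}
    {l : ∀ j, X j → C j} : EdgeCond tA sA (leaf x) v r l ↔ r = l i x := by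
  refine ⟨fun h => h.degen x rfl, fun h => ⟨?_, ?_, ?_, ?_⟩⟩
  · intro a p
    cases p
  · intro a p
    cases p
  · intro a p
    cases p
  · rintro y hy
    cases hy
    exact h

theorem edgeCond_node {i : I} {b : P.Op i} {c : ∀ j, P.In b j → P.Tree X j}
    {v : ∀ a, (node b c).Node a → A a} {r : C i} {l : ∀ j, X j → C j} :
    EdgeCond tA sA (node b c) v r l ↔ tA ⟨i, b⟩ (v _ .here) = r ∧
      ∀ j e, EdgeCond tA sA (c j e) (fun a n => v a (.there e n)) (sA ⟨i, b⟩ (v _ .here) j e) l := by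
  constructor
  · intro h
    refine ⟨h.root _ (.mk b c), fun j e => ⟨?_, ?_, ?_, ?_⟩⟩
    · intro a p k q b' p' hp
      exact h.inner (.there e p) q (.there e p') (.there b c e hp)
    · intro b' p hp
      exact (h.inner (a := ⟨i, b⟩) .here e (.there e p) (.here b c e hp)).symm
    · intro a p k q x hp
      exact h.leaves (.there e p) q x (.there b c e hp)
    · intro x hx
      exact h.leaves (a := ⟨i, b⟩) .here e x (.here b c e x hx)
  · rintro ⟨h, h'⟩
    refine ⟨?_, ?_, ?_, ?_⟩
    · intro a p k q b' p' hp
      cases hp with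
      | here _ _ _ hr => exact ((h' _ q).root _ hr).symm
      | there _ _ e hp => exact (h' _ e).inner _ q _ hp
    · intro b' p hp
      cases hp
      exact h
    · intro a p k q x hp
      cases hp with
      | here _ _ _ _ hr => exact (h' _ q).degen x hr
      | there _ _ e hp => exact (h' _ e).leaves _ q x hp
    · intro x hx
      cases hx

theorem EdgeCond.congr {i : I} {T : P.Tree X i} {v v' : ∀ a, T.Node a → A a} {r : C i}
    {l : ∀ j, X j → C j} (h : EdgeCond tA sA T v r l) (hv : ∀ a n, v' a n = v a n) :
    EdgeCond tA sA T v' r l := by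
  have : v' = v := funext fun a => funext fun n => hv a n
  rwa [this]

theorem EdgeCond.graft {i : I} {T : P.Tree X i} {v : ∀ a, T.Node a → A a} {r : C i}
    {l' : ∀ j, X j → C j} (h : EdgeCond tA sA T v r l') {l : ∀ j, Y j → C j}
    (f : ∀ j, X j → P.Tree Y j) (w : ∀ j x a, (f j x).Node a → A a)
    (hw : ∀ j x, EdgeCond tA sA (f j x) (w j x) (l' j x) l) :
    EdgeCond tA sA (T.graft f) (fun a n => match nodeGraft f T n with
      | Sum.inl m => v a m
      | Sum.inr ⟨x, _, m⟩ => w x.1 x.2 a m) r l := by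
  induction T with
  | leaf x =>
    rw [edgeCond_leaf] at h
    subst h
    exact hw _ x
  | node b c ih =>
    rw [edgeCond_node] at h
    simp only [PolyEnd.Tree.graft]
    rw [edgeCond_node]
    refine ⟨h.1, fun j e => ?_⟩
    refine (ih j e (h.2 j e)).congr tA sA fun a n => ?_
    simp only [nodeGraft]
    cases nodeGraft f (c j e) n <;> rfl

theorem EdgeCond.subst {M : PolyMonad I} {A : (Σ i, M.Op i) → Type}
    {tA : ∀ a, A a → C a.1} {sA : ∀ a, A a → ∀ k, M.In a.2 k → C k}
    {B : (Σ i, M.Op i) → Type} (U : ∀ a, B a → M.BDOp a)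
    (w : ∀ a (z : B a) a', (U a z).1.Node a' → A a')
    {tB : ∀ a, B a → C a.1} {sB : ∀ a, B a → ∀ k, M.In a.2 k → C k}
    (hU : ∀ a z, EdgeCond tA sA (U a z).1 (w a z) (tB a z) (sB a z))
    {i : I} {T : M.Tree X i} {d : ∀ a, T.Node a → B a} {r : C i} {l : ∀ j, X j → C j}
    (h : EdgeCond tB sB T d r l) :
    EdgeCond tA sA (M.subst T (fun a n => U a (d a n))) (fun a n =>
      let q := M.nodeSubst T (fun a n => U a (d a n)) n
      w q.1 (d q.1 q.2.1) a q.2.2) r l := by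
  induction T with
  | leaf x =>
    rw [edgeCond_leaf] at h
    simp only [PolyMonad.subst]
    rw [edgeCond_leaf]
    exact h
  | @node i b c ih =>
    rw [edgeCond_node] at h
    obtain ⟨rfl, h⟩ := h
    have := EdgeCond.graft tA sA (hU _ (d _ .here)) _ _ (fun j e => ih j e (h j e))
    simp only [PolyMonad.subst]
    refine this.congr tA sA fun a n => ?_
    let F : (Σ a', Σ n : (PolyEnd.Tree.node b c).Node a', (U a' (d a' n)).1.Node a) → A a :=
      fun r => w r.1 (d r.1 r.2.1) a r.2.2
    rcases hs : nodeGraft (fun j e => M.subst (c j e) (fun a n => U a (d a (.there e n))))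
      (U _ (d _ .here)).1 n with m | ⟨x, l, m⟩
    · exact congrArg F (M.nodeSubst_inl (U := fun a n => U a (d a n)) hs)
    · exact congrArg F (M.nodeSubst_inr (U := fun a n => U a (d a n)) hs)

end edges

theorem dim_eq {a c : Opt} (f : Quiver.Path a c) : a.dim + f.length = c.dim := by
  induction f with
  | nil => rfl
  | cons g e ih =>
    change Face _ _ at e
    cases e <;> simp only [Quiver.Path.length_cons] <;> dsimp only at ih <;> omega

theorem dim_le {a c : OptCat} (f : a ⟶ c) : a.as.dim ≤ c.as.dim := by
  obtain ⟨f, rfl⟩ := (Quotient.functor FaceRel).map_surjective f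
  have := dim_eq (a := a.as) (c := c.as) f
  change a.as.dim ≤ c.as.dim
  omega

theorem eq_of_dim {a c : OptCat} (f : a ⟶ c) (h : c.as.dim ≤ a.as.dim) :
    ∃ h : a = c, f = eqToHom h := by
  obtain ⟨a⟩ := a
  obtain ⟨c⟩ := c
  obtain ⟨f, rfl⟩ := (Quotient.functor FaceRel).map_surjective f
  change Quiver.Path _ _ at f
  have hd := dim_eq (a := a) (c := c) f
  cases f with
  | nil => exact ⟨rfl, rfl⟩
  | cons g e =>
    change Opt.dim a + (@Quiver.Path.length Opt _ _ _ g + 1) = Opt.dim c at hd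
    change Opt.dim c ≤ Opt.dim a at h
    omega

theorem hom_cases {n : ℕ} {i : Opetope n} (b : (Z n).Op i) {a : OptCat} (ha : a.as.dim ≤ n)
    (f : a ⟶ ob (opetope b)) : (∃ g : a ⟶ ob i, f = g ≫ tgtHom b) ∨
      ∃ (j : Opetope n) (p : (Z n).In b j) (g : a ⟶ ob j), f = g ≫ srcHom b p := by
  have key : ∀ (n' : ℕ) (i' : Opetope n') (b' : (Z n').Op i')
      (h : ob (opetope b') = ob (opetope b)), ∃ h1 : n' = n, h1 ▸ i' = i ∧ HEq b' b := by
    intro n' i' b' h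
    injection h with h
    injection h with h1 h2
    have h1 : n' = n := by omega
    subst h1
    have h2 := eq_of_heq h2
    have h3 := (Sigma.mk.inj_iff.1 (show (⟨i', b'⟩ : Σ i, (Z n').Op i) = ⟨i, b⟩ from h2))
    exact ⟨rfl, h3.1, h3.2⟩
  rcases hom_ind f with ⟨h, -⟩ | ⟨n', i', b', h, g, hf⟩ | ⟨n', i', b', h, j, p, g, hf⟩
  · rw [h] at ha
    change n + 1 ≤ n at ha
    omega
  · obtain ⟨h1, h2, h3⟩ := key _ _ _ h
    subst h1
    subst h2
    cases eq_of_heq h3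
    exact Or.inl ⟨g, by simpa using hf⟩
  · obtain ⟨h1, h2, h3⟩ := key _ _ _ h
    subst h1
    subst h2
    cases eq_of_heq h3
    exact Or.inr ⟨j, p, g, by simpa using hf⟩

/-- Whether a path consists of a single target embedding. -/
def isTgt {a c : Opt} (f : Quiver.Path a c) : Prop :=
  f.length = 1 ∧ match c, f with
    | _, .nil => False
    | _, .cons _ e => match (e : Face _ _) with
      | .tgt _ => True
      | .src _ _ => False

theorem length_faceRel {a c : Paths Opt} {f g : a ⟶ c} (h : FaceRel f g) :
    Quiver.Path.length f = 2 ∧ Quiver.Path.length g = 2 := by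
  cases h <;> exact ⟨rfl, rfl⟩

theorem srcHom_ne_tgtHom {n : ℕ} {i : Opetope n} (b : (Z n).Op i) (p : (Z n).In b i) :
    srcHom b p ≠ tgtHom b := by
  intro h
  let F : (ob i ⟶ ob (opetope b)) → Prop := Quot.lift
    (fun f : Quiver.Path (⟨n, i⟩ : Opt) ⟨n + 1, opetope b⟩ => isTgt f) (by
      rintro _ _ ⟨c, d, f, m₁, m₂, g, h⟩
      have hl := length_faceRel h
      have h1 : Quiver.Path.length (f ≫ m₁ ≫ g) ≠ 1 := by
        have : Quiver.Path.length (f ≫ m₁ ≫ g) =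
          Quiver.Path.length f + (Quiver.Path.length m₁ + Quiver.Path.length g) :=
          (Quiver.Path.length_comp _ _).trans (congrArg _ (Quiver.Path.length_comp _ _))
        omega
      have h2 : Quiver.Path.length (f ≫ m₂ ≫ g) ≠ 1 := by
        have : Quiver.Path.length (f ≫ m₂ ≫ g) =
          Quiver.Path.length f + (Quiver.Path.length m₂ + Quiver.Path.length g) :=
          (Quiver.Path.length_comp _ _).trans (congrArg _ (Quiver.Path.length_comp _ _))
        omega
      exact propext ⟨fun h => (h1 h.1).elim, fun h => (h2 h.1).elim⟩)
  have h1 : F (tgtHom b) := ⟨rfl, trivial⟩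
  rw [← h] at h1
  exact h1.2

/-- The largest subsieve not containing a given arrow. -/
def _root_.CategoryTheory.Sieve.avoid {C : Type*} [Category C] {X Y : C} (S : Sieve X)
    (f : Y ⟶ X) : Sieve X where
  arrows _ g := S g ∧ ∀ h, h ≫ g ≠ f
  downward_closed := by
    rintro Y Z g ⟨hg, hg'⟩ g'
    refine ⟨S.downward_closed hg g', fun h hh => hg' (h ≫ g') ?_⟩
    rw [Category.assoc, hh]

/-- The boundary `∂O[ω]`, as a sieve on `ω`. -/
def boundary (ω : OptCat) : Sieve ω := (⊤ : Sieve ω).avoid (𝟙 ω)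

/-- The spine `S[ω]` of an opetope of positive dimension, as a sieve on `ω`. -/
def spine {n : ℕ} {i : Opetope n} (b : (Z n).Op i) : Sieve (ob (opetope b)) :=
  (boundary (ob (opetope b))).avoid (tgtHom b)

theorem mem_spine_of_lt {n : ℕ} {i : Opetope n} (b : (Z n).Op i) {a : OptCat}
    (f : a ⟶ ob (opetope b)) (h : a.as.dim < n) : spine b f := by
  refine ⟨⟨trivial, fun g => ?_⟩, fun g => ?_⟩
  · have : n + 1 ≤ a.as.dim := dim_le g
    omega
  · have : n ≤ a.as.dim := dim_le g
    omega

theorem mem_spine_src {n : ℕ} {i : Opetope n} (b : (Z n).Op i) {j : Opetope n}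
    (p : (Z n).In b j) : spine b (srcHom b p) := by
  refine ⟨⟨trivial, fun g => ?_⟩, fun g hg => ?_⟩
  · have : n + 1 ≤ n := dim_le g
    omega
  · obtain ⟨h, h'⟩ := eq_of_dim g le_rfl
    have h1 : i = j := by
      injection h with h
      injection h with h1 h2
    subst h1
    rw [h', eqToHom_refl, Category.id_comp] at hg
    exact srcHom_ne_tgtHom b p hg

theorem not_mem_spine {n : ℕ} {i : Opetope n} (b : (Z n).Op i) : ¬ spine b (tgtHom b) :=
  fun h => h.2 (𝟙 _) (Category.id_comp _)

/-- Opetopes of dimension at least `n - k` and at most `n`. -/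
def InRange (k n : ℕ) : ObjectProperty OptCat := fun ω => n ≤ ω.as.dim + k ∧ ω.as.dim ≤ n

/-- The category `𝕆_{n-k,n}`. -/
abbrev OptRange (k n : ℕ) : Type := (InRange k n).FullSubcategory

/-- The category of presheaves on `𝕆_{n-k,n}`. -/
abbrev Psh (k n : ℕ) : Type 1 := (OptRange k n)ᵒᵖ ⥤ Type

variable {k n : ℕ}

/-- An `n`-opetope as an object of `𝕆_{n-k,n}`. -/
abbrev topOb (k : ℕ) {n : ℕ} (i : Opetope n) : OptRange k n :=
  ⟨ob i, Nat.le_add_right n k, le_refl n⟩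

/-- The spine of an `(n+1)`-opetope as a presheaf on `𝕆_{n-k,n}`. -/
def spinePsh (k : ℕ) {n : ℕ} {i : Opetope n} (b : (Z n).Op i) : Psh k n :=
  (InRange k n).ι.op ⋙ (spine b).functor

/-- The cells of the presheaf `𝔷ⁿX`, for `X` a presheaf on `𝕆_{n-k,n}`. Those of dimension less
than `n` are those of `X`, and a cell of shape `ω ∈ 𝕆_n` is an `(n+1)`-opetope `ν` with target
`ω` along with a morphism `S[ν] ⟶ X`. -/
inductive Cell (X : Psh k n) : OptRange k n → Type
  | low {ω : OptRange k n} (h : ω.obj.as.dim < n) (x : X.obj (.op ω)) : Cell X ω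
  | top {i : Opetope n} (b : (Z n).Op i) (y : spinePsh k b ⟶ X) : Cell X (topOb k i)

section hom

variable {X : Psh k n} {i : Opetope n} {b : (Z n).Op i}

/-- The value of a morphism out of a spine on a source. -/
def srcVal (y : spinePsh k b ⟶ X) (j : Opetope n) (p : (Z n).In b j) : X.obj (.op (topOb k j)) :=
  y.app (.op (topOb k j)) ⟨srcHom b p, mem_spine_src b p⟩

/-- The value of a morphism out of a spine on a face of the target. -/
def tgtVal (y : spinePsh k b ⟶ X) {ω : OptRange k n} (h : ω.obj.as.dim < n) (g : ω.obj ⟶ ob i) :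
    X.obj (.op ω) :=
  y.app (.op ω) ⟨g ≫ tgtHom b, mem_spine_of_lt b _ h⟩

theorem map_srcVal (y : spinePsh k b ⟶ X) (j : Opetope n) (p : (Z n).In b j) {ω : OptRange k n}
    (g : ω ⟶ topOb k j) (hg : spine b (g.hom ≫ srcHom b p)) :
    X.map g.op (srcVal y j p) = y.app (.op ω) ⟨g.hom ≫ srcHom b p, hg⟩ :=
  (ConcreteCategory.congr_hom (y.naturality g.op) ⟨srcHom b p, mem_spine_src b p⟩).symm

theorem map_tgtVal (y : spinePsh k b ⟶ X) {ω ω' : OptRange k n} (h : ω.obj.as.dim < n)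
    (h' : ω'.obj.as.dim < n) (g : ω.obj ⟶ ob i) (f : ω' ⟶ ω) :
    X.map f.op (tgtVal y h g) = tgtVal y h' (f.hom ≫ g) := by
  refine (ConcreteCategory.congr_hom (y.naturality f.op)
    ⟨g ≫ tgtHom b, mem_spine_of_lt b _ h⟩).symm.trans ?_
  exact congrArg (y.app (.op ω')) (Subtype.ext (Category.assoc _ _ _).symm)

theorem spine_hom_ext {y y' : spinePsh k b ⟶ X} (h : srcVal y = srcVal y')
    (h' : ∀ (ω : OptRange k n) (hω : ω.obj.as.dim < n) (g : ω.obj ⟶ ob i),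
      tgtVal y hω g = tgtVal y' hω g) : y = y' := by
  ext ⟨ω⟩ ⟨f, hf⟩
  change spine b f at hf
  rcases hom_cases b ω.property.2 f with ⟨g, rfl⟩ | ⟨j, p, g, rfl⟩
  · by_cases hω : ω.obj.as.dim < n
    · exact h' ω hω g
    · obtain ⟨h1, rfl⟩ := eq_of_dim g (not_lt.1 hω)
      refine absurd hf ?_
      intro hf
      exact hf.2 (eqToHom h1.symm) (by simp)
  · have h1 := map_srcVal y j p (ω := ω) (ObjectProperty.homMk g) hf
    have h2 := map_srcVal y' j p (ω := ω) (ObjectProperty.homMk g) hf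
    exact h1.symm.trans ((congrArg _ (congrFun (congrFun h j) p)).trans h2)

end hom

theorem eq_of_not_lt {ω ω' : OptRange k n} (f : ω' ⟶ ω) (h : ¬ ω'.obj.as.dim < n) :
    ∃ h : ω' = ω, f = eqToHom h := by
  obtain ⟨ω, hω⟩ := ω
  obtain ⟨ω', hω'⟩ := ω'
  obtain ⟨h1, h2⟩ := eq_of_dim f.hom (hω.2.trans (not_lt.1 h))
  dsimp only at h1
  subst h1
  refine ⟨rfl, ?_⟩
  apply ObjectProperty.hom_ext
  exact h2

namespace Cell

/-- The restriction of cells along morphisms of `𝕆_{n-k,n}`. -/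
def restrict {X : Psh k n} : ∀ {ω : OptRange k n} (_ : Cell X ω) {ω' : OptRange k n} (_ : ω' ⟶ ω),
    Cell X ω'
  | _, low h x, _, f => low (lt_of_le_of_lt (dim_le f.hom) h) (X.map f.op x)
  | _, top b y, ω', f =>
    if h : ω'.obj.as.dim < n then low h (tgtVal y h f.hom)
    else (eq_of_not_lt f h).1.symm ▸ top b y

variable {X Y : Psh k n}

theorem restrict_low {ω ω' : OptRange k n} (h : ω.obj.as.dim < n) (x : X.obj (.op ω))
    (f : ω' ⟶ ω) :
    (low h x).restrict f = low (lt_of_le_of_lt (dim_le f.hom) h) (X.map f.op x) := rfl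

theorem restrict_top {i : Opetope n} (b : (Z n).Op i) (y : spinePsh k b ⟶ X)
    {ω' : OptRange k n} (f : ω' ⟶ topOb k i) (h : ω'.obj.as.dim < n) :
    (top b y).restrict f = low h (tgtVal y h f.hom) := dif_pos h

theorem restrict_id {ω : OptRange k n} (c : Cell X ω) : c.restrict (𝟙 ω) = c := by
  cases c with
  | low h x =>
    rw [restrict_low, op_id, X.map_id]
    rfl
  | top b y => exact dif_neg (lt_irrefl n)

theorem restrict_comp {ω ω' ω'' : OptRange k n} (c : Cell X ω) (f : ω' ⟶ ω) (g : ω'' ⟶ ω') :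
    c.restrict (g ≫ f) = (c.restrict f).restrict g := by
  by_cases h : ω'.obj.as.dim < n
  · cases c with
    | low h x =>
      rw [restrict_low, restrict_low, restrict_low, op_comp, X.map_comp]
      rfl
    | top b y =>
      have h' := lt_of_le_of_lt (dim_le g.hom) h
      rw [restrict_top _ _ _ h, restrict_top _ _ _ h', restrict_low, map_tgtVal y h h']
      rfl
  · obtain ⟨rfl, rfl⟩ := eq_of_not_lt f h
    rw [eqToHom_refl, Category.comp_id, restrict_id]

/-- Functoriality of cells. -/
def map (α : X ⟶ Y) : ∀ {ω : OptRange k n}, Cell X ω → Cell Y ω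
  | _, low h x => low h (α.app _ x)
  | _, top b y => top b (y ≫ α)

theorem map_restrict (α : X ⟶ Y) {ω ω' : OptRange k n} (c : Cell X ω) (f : ω' ⟶ ω) :
    (c.restrict f).map α = (c.map α).restrict f := by
  by_cases h : ω'.obj.as.dim < n
  · cases c with
    | low h x =>
      simp only [map, restrict_low]
      exact congrArg _ (ConcreteCategory.congr_hom (α.naturality f.op) x)
    | top b y =>
      simp only [map, restrict_top _ _ _ h]
      rfl
  · obtain ⟨rfl, rfl⟩ := eq_of_not_lt f h
    rw [eqToHom_refl, restrict_id, restrict_id]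

theorem map_id {ω : OptRange k n} (c : Cell X ω) : c.map (𝟙 X) = c := by
  cases c with
  | low h x => rfl
  | top b y => exact congrArg (Cell.top b) (Category.comp_id y)

theorem map_comp {V : Psh k n} {ω : OptRange k n} (c : Cell X ω) (α : X ⟶ Y) (β : Y ⟶ V) :
    c.map (α ≫ β) = (c.map α).map β := by
  cases c with
  | low h x => rfl
  | top b y => exact congrArg (Cell.top b) (Category.assoc y α β).symm

/-- A cell of dimension less than `n` of `𝔷ⁿX`, as a cell of `X`. -/
def toLow {ω : OptRange k n} (h : ω.obj.as.dim < n) : Cell X ω → X.obj (.op ω)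
  | low _ x => x
  | top _ _ => absurd h (lt_irrefl n)

theorem low_toLow {ω : OptRange k n} (h : ω.obj.as.dim < n) (c : Cell X ω) :
    low h (c.toLow h) = c := by
  cases c with
  | low _ x => rfl
  | top _ _ => exact absurd h (lt_irrefl n)

theorem map_toLow {ω ω' : OptRange k n} (h : ω.obj.as.dim < n) (h' : ω'.obj.as.dim < n)
    (c : Cell X ω) (f : ω' ⟶ ω) : X.map f.op (c.toLow h) = (c.restrict f).toLow h' := by
  cases c with
  | low _ x => rfl
  | top _ _ => exact absurd h (lt_irrefl n)

end Cell

/-- The endofunctor `𝔷ⁿ` of the category of presheaves on `𝕆_{n-k,n}`. -/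
def zFunctor (k n : ℕ) : Psh k n ⥤ Psh k n where
  obj X :=
    { obj := fun ω => Cell X ω.unop
      map := fun f => ↾fun c => c.restrict f.unop
      map_id := fun ω => by
        ext c
        exact c.restrict_id
      map_comp := fun f g => by
        ext c
        exact c.restrict_comp f.unop g.unop }
  map α :=
    { app := fun ω => ↾fun c => c.map α
      naturality := fun ω ω' f => by
        ext c
        exact c.map_restrict α f.unop }
  map_id X := by
    ext ω c
    exact c.map_id
  map_comp α β := by
    ext ω c
    exact c.map_comp α β

section build

variable {X : Psh k n} {i : Opetope n} (b : (Z n).Op i)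
  (v : ∀ j, (Z n).In b j → X.obj (.op (topOb k j)))
  (β : ∀ ω : OptRange k n, ω.obj.as.dim < n → (ω.obj ⟶ ob i) → X.obj (.op ω))

/-- The value of a morphism out of a spine on a cell whose last generator is given. -/
def faceVal (ω : OptRange k n) : ∀ {m : Opt} (_ : Face m ⟨n + 1, opetope b⟩) (_ : ω.obj ⟶ ⟨m⟩),
    Option (X.obj (.op ω))
  | _, .tgt _, g => if h : ω.obj.as.dim < n then some (β ω h g) else none
  | _, .src _ p, g => some (X.map (Quiver.Hom.op (ObjectProperty.homMk g)) (v _ p))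

/-- Paths of generators. -/
abbrev OptPath (a c : Opt) : Type := Quiver.Path a c

/-- The last generator of a path of positive length. -/
def pathLast {a c : Opt} : ∀ (_ : OptPath a c), Option (Σ m : Opt, OptPath a m × Face m c)
  | .nil => none
  | .cons f e => some ⟨_, f, e⟩

/-- The value of a morphism out of a spine on a cell given by a path of generators. -/
def pathVal (ω : OptRange k n) (f : OptPath ω.obj.as ⟨n + 1, opetope b⟩) :
    Option (X.obj (.op ω)) :=
  (pathLast f).bind fun r => faceVal b v β ω r.2.2 ((Quotient.functor FaceRel).map r.2.1)

/-- Compatibility of the values with the relations. -/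
def Respects : Prop :=
  ∀ (ω : OptRange k n) (a : Opt) (f : OptPath ω.obj.as a)
    (m₁ m₂ : OptPath a ⟨n + 1, opetope b⟩),
    FaceRel (X := a) (Y := (⟨n + 1, opetope b⟩ : Opt)) m₁ m₂ → pathVal b v β ω (f.comp m₁) = pathVal b v β ω (f.comp m₂)

variable {b v β}

theorem pathVal_eq (hr : Respects b v β) (ω : OptRange k n) (f f' : OptPath ω.obj.as ⟨n + 1, opetope b⟩)
    (h : HomRel.CompClosure FaceRel (X := ω.obj.as) (Y := (⟨n + 1, opetope b⟩ : Opt)) f f') : pathVal b v β ω f = pathVal b v β ω f' := by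
  obtain ⟨c, d, f, m₁, m₂, g, h⟩ := h
  change Quiver.Path (V := Opt) _ _ at g
  cases g with
  | nil => exact hr ω c f m₁ m₂ h
  | cons g e =>
    have : (Quotient.functor FaceRel).map (f ≫ m₁ ≫ g) =
        (Quotient.functor FaceRel).map (f ≫ m₂ ≫ g) :=
      Quot.sound (HomRel.CompClosure.intro _ _ f m₁ m₂ g h)
    exact congrArg (faceVal b v β ω e) this

variable (hr : Respects b v β)

/-- The value of a morphism out of a spine on a cell. -/
def homVal (ω : OptRange k n) (f : ω.obj ⟶ ob (opetope b)) : Option (X.obj (.op ω)) :=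
  Quot.lift (pathVal b v β ω) (pathVal_eq hr ω) f

theorem homVal_tgt (ω : OptRange k n) (h : ω.obj.as.dim < n) (g : ω.obj ⟶ ob i) :
    homVal hr ω (g ≫ tgtHom b) = some (β ω h g) := by
  obtain ⟨g, rfl⟩ := (Quotient.functor FaceRel).map_surjective g
  exact dif_pos h

theorem homVal_src (ω : OptRange k n) {j : Opetope n} (p : (Z n).In b j) (g : ω.obj ⟶ ob j) :
    homVal hr ω (g ≫ srcHom b p) =
      some (X.map (Quiver.Hom.op (ObjectProperty.homMk (Y := topOb k j) g)) (v _ p)) := by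
  obtain ⟨g, rfl⟩ := (Quotient.functor FaceRel).map_surjective g
  rfl

theorem spine_cases {ω : OptRange k n} {f : ω.obj ⟶ ob (opetope b)} (hf : spine b f) :
    (∃ (_ : ω.obj.as.dim < n) (g : ω.obj ⟶ ob i), f = g ≫ tgtHom b) ∨
      ∃ (j : Opetope n) (p : (Z n).In b j) (g : ω.obj ⟶ ob j), f = g ≫ srcHom b p := by
  rcases hom_cases b ω.property.2 f with ⟨g, rfl⟩ | h
  · by_cases hω : ω.obj.as.dim < n
    · exact Or.inl ⟨hω, g, rfl⟩
    · obtain ⟨h1, rfl⟩ := eq_of_dim g (not_lt.1 hω)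
      exact absurd (by simp) (hf.2 (eqToHom h1.symm))
  · exact Or.inr h

theorem homVal_isSome (ω : OptRange k n) (f : ω.obj ⟶ ob (opetope b)) (hf : spine b f) :
    (homVal hr ω f).isSome := by
  rcases spine_cases hf with ⟨hω, g, rfl⟩ | ⟨j, p, g, rfl⟩
  · rw [homVal_tgt hr ω hω]
    rfl
  · rw [homVal_src hr ω p g]
    rfl

theorem homVal_comp (hβ : ∀ (ω ω' : OptRange k n) (h : ω.obj.as.dim < n) (h' : ω'.obj.as.dim < n)
  (g : ω.obj ⟶ ob i) (u : ω' ⟶ ω), X.map u.op (β ω h g) = β ω' h' (u.hom ≫ g))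
    {ω ω' : OptRange k n} (u : ω' ⟶ ω) (f : ω.obj ⟶ ob (opetope b))
    (hf : spine b f) : homVal hr ω' (u.hom ≫ f) = (homVal hr ω f).map (X.map u.op) := by
  rcases spine_cases hf with ⟨hω, g, rfl⟩ | ⟨j, p, g, rfl⟩
  · have hω' : ω'.obj.as.dim < n := lt_of_le_of_lt (dim_le u.hom) hω
    rw [homVal_tgt hr ω hω, ← Category.assoc, homVal_tgt hr ω' hω', Option.map_some,
      hβ ω ω' hω hω']
  · rw [homVal_src hr ω p g, ← Category.assoc, homVal_src hr ω' p (u.hom ≫ g), Option.map_some]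
    congr 1
    exact ConcreteCategory.congr_hom (X.map_comp
      (Quiver.Hom.op (ObjectProperty.homMk (Y := topOb k j) g)) u.op) (v _ p)

variable (hβ : ∀ (ω ω' : OptRange k n) (h : ω.obj.as.dim < n) (h' : ω'.obj.as.dim < n)
  (g : ω.obj ⟶ ob i) (u : ω' ⟶ ω), X.map u.op (β ω h g) = β ω' h' (u.hom ≫ g))

/-- The morphism out of a spine with given values on the sources and on the faces of the
target. -/
def mkHom : spinePsh k b ⟶ X where
  app ω := ↾fun f => (homVal hr ω.unop f.1).get (homVal_isSome hr _ _ f.2)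
  naturality ω ω' u := by
    ext f
    have := homVal_comp hr hβ u.unop f.1 f.2
    apply Option.some_injective
    refine (Option.some_get _).trans ?_
    refine this.trans ?_
    rw [← Option.some_get (homVal_isSome hr _ _ f.2)]
    rfl

theorem srcVal_mkHom (j : Opetope n) (p : (Z n).In b j) : srcVal (mkHom hr hβ) j p = v j p := by
  apply Option.some_injective
  refine (Option.some_get (homVal_isSome hr (topOb k j) _ (mem_spine_src b p))).trans ?_
  have := homVal_src hr (topOb k j) p (𝟙 _)
  rw [Category.id_comp] at this
  rw [this]
  congr 1
  exact ConcreteCategory.congr_hom (X.map_id (.op (topOb k j))) (v j p)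

theorem tgtVal_mkHom {ω : OptRange k n} (h : ω.obj.as.dim < n) (g : ω.obj ⟶ ob i) :
    tgtVal (mkHom hr hβ) h g = β ω h g := by
  apply Option.some_injective
  refine (Option.some_get _).trans ?_
  exact homVal_tgt hr ω h g

end build

section lower

variable {m : ℕ} (hk : m + 1 ≤ m + k)

/-- An `m`-opetope as an object of `𝕆_{m+1-k,m+1}`. -/
abbrev lowOb {k m : ℕ} (hk : m + 1 ≤ m + k) (j : Opetope m) : OptRange k (m + 1) :=
  ⟨ob j, hk, Nat.le_succ m⟩

/-- The target of an `(m+1)`-cell. -/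
def tgtFace (X : Psh k (m + 1)) (a : Σ i, (Z m).Op i) (x : X.obj (.op (topOb (n := m + 1) k a))) :
    X.obj (.op (lowOb hk a.1)) :=
  X.map (Quiver.Hom.op (ObjectProperty.homMk (X := lowOb hk a.1) (Y := topOb (n := m + 1) k a)
    (tgtHom a.2))) x

/-- The sources of an `(m+1)`-cell. -/
def srcFace (X : Psh k (m + 1)) (a : Σ i, (Z m).Op i) (x : X.obj (.op (topOb (n := m + 1) k a)))
    (j : Opetope m) (q : (Z m).In a.2 j) : X.obj (.op (lowOb hk j)) :=
  X.map (Quiver.Hom.op (ObjectProperty.homMk (X := lowOb hk j) (Y := topOb (n := m + 1) k a)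
    (srcHom a.2 q))) x

variable {X : Psh k (m + 1)} {i : Opetope m} {b : (Z m).Op i} (T : (Z m).BDOp ⟨i, b⟩)

theorem edgeCond_of_hom (y : spinePsh (n := m + 1) (i := opetope b) k T ⟶ X) :
    EdgeCond (tgtFace hk X) (srcFace hk X) T.1 (srcVal (n := m + 1) (i := opetope b) (b := T) y)
      (tgtVal (n := m + 1) (i := opetope b) (b := T) y (ω := lowOb hk i) (Nat.lt_succ_self m)
        (tgtHom b))
      (fun j x => tgtVal (n := m + 1) (i := opetope b) (b := T) y (ω := lowOb hk j)
        (Nat.lt_succ_self m) (srcHom b x)) := by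
  have hs : ∀ {ω : OptRange k (m + 1)} (h : ω.obj.as.dim < m + 1)
      (a : Σ i, (Z m).Op i) (p : T.1.Node a) (g : ω.obj ⟶ ob (n := m + 1) a),
      X.map (Quiver.Hom.op (ObjectProperty.homMk (Y := topOb (n := m + 1) k a) g))
        (srcVal (n := m + 1) (i := opetope b) (b := T) y a p) = y.app (.op ω)
          ⟨g ≫ srcHom (n := m + 1) (i := opetope b) T p, mem_spine_of_lt _ _ h⟩ :=
    fun h a p g => map_srcVal (n := m + 1) (i := opetope b) (b := T) y a p _ _
  refine ⟨?_, ?_, ?_, ?_⟩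
  · rintro ⟨j, s⟩ p k' q b' p' h
    refine (hs (ω := lowOb hk k') (Nat.lt_succ_self m) _ p (srcHom s q)).trans
      (Eq.trans ?_ (hs (ω := lowOb hk k') (Nat.lt_succ_self m) _ p' (tgtHom b')).symm)
    refine congrArg (y.app _) (Subtype.ext ?_)
    exact Quot.sound (HomRel.CompClosure.of (FaceRel.inner b T p q p' h))
  · intro s p h
    refine (hs (ω := lowOb hk i) (Nat.lt_succ_self m) _ p (tgtHom s)).trans ?_
    refine congrArg (y.app _) (Subtype.ext ?_)
    exact (Quot.sound (HomRel.CompClosure.of (FaceRel.glob1 b T p h))).symm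
  · rintro ⟨j, s⟩ p k' q x h
    refine (hs (ω := lowOb hk k') (Nat.lt_succ_self m) _ p (srcHom s q)).trans ?_
    refine congrArg (y.app _) (Subtype.ext ?_)
    exact (Quot.sound (HomRel.CompClosure.of (FaceRel.glob2 b T p q x h))).symm
  · intro x h
    refine congrArg (y.app _) (Subtype.ext ?_)
    exact Quot.sound (HomRel.CompClosure.of (FaceRel.degen b T x h))

variable (v : ∀ a, T.1.Node a → X.obj (.op (topOb (n := m + 1) k a)))
  (β : ∀ ω : OptRange k (m + 1), ω.obj.as.dim < m + 1 → (ω.obj ⟶ ob (opetope b)) →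
    X.obj (.op ω))

theorem respects_succ
    (hβ : ∀ (ω ω' : OptRange k (m + 1)) (h : ω.obj.as.dim < m + 1) (h' : ω'.obj.as.dim < m + 1)
      (g : ω.obj ⟶ ob (opetope b)) (u : ω' ⟶ ω), X.map u.op (β ω h g) = β ω' h' (u.hom ≫ g))
    (H : ∀ hk : m + 1 ≤ m + k, EdgeCond (tgtFace hk X) (srcFace hk X) T.1 v
      (β (lowOb hk i) (Nat.lt_succ_self m) (tgtHom b))
      (fun j x => β (lowOb hk j) (Nat.lt_succ_self m) (srcHom b x))) :
    Respects (n := m + 1) (i := opetope b) T v β := by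
  intro ω a f m₁ m₂ h
  have hd : ∀ {j : Opetope m} (f : OptPath ω.obj.as ⟨m, j⟩), ω.obj.as.dim < m + 1 :=
    fun f => Nat.lt_succ_of_le (dim_le ((Quotient.functor FaceRel).map f))
  have hk : ∀ {j : Opetope m} (f : OptPath ω.obj.as ⟨m, j⟩), m + 1 ≤ m + k := fun f => by
    have := ω.property.1
    have := hd f
    omega
  have hsrc : ∀ {j : Opetope m} (f : OptPath ω.obj.as ⟨m, j⟩) (a : Σ i, (Z m).Op i)
      (p : T.1.Node a) (e : Face ⟨m, j⟩ ⟨m + 1, a⟩) ,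
      faceVal (n := m + 1) (i := opetope b) T v β ω (.src (n := m + 1) (i := opetope b) T p)
        ((Quotient.functor FaceRel).map (f.cons e)) =
      some (X.map (Quiver.Hom.op (ObjectProperty.homMk (X := ω) (Y := lowOb (hk f) j)
        ((Quotient.functor FaceRel).map f)))
        (X.map (Quiver.Hom.op (ObjectProperty.homMk (X := lowOb (hk f) j)
          (Y := topOb (n := m + 1) k a)
          ((Quotient.functor FaceRel).map ((Paths.of Opt).map e)))) (v a p))) := by
    intro j f a p e
    refine congrArg some ?_
    exact ConcreteCategory.congr_hom (X.map_comp
      (Quiver.Hom.op (ObjectProperty.homMk (X := lowOb (hk f) j) (Y := topOb (n := m + 1) k a)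
          ((Quotient.functor FaceRel).map ((Paths.of Opt).map e))))
      (Quiver.Hom.op (ObjectProperty.homMk (X := ω) (Y := lowOb (hk f) j)
        ((Quotient.functor FaceRel).map f)))) (v a p)
  have htgt : ∀ {j : Opetope m} (f : OptPath ω.obj.as ⟨m, j⟩)
      (e : Face ⟨m, j⟩ ⟨m + 1, opetope b⟩) ,
      faceVal (n := m + 1) (i := opetope b) T v β ω (.tgt (n := m + 1) (i := opetope b) T)
        ((Quotient.functor FaceRel).map (f.cons e)) =
      some (X.map (Quiver.Hom.op (ObjectProperty.homMk (X := ω) (Y := lowOb (hk f) j)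
        ((Quotient.functor FaceRel).map f)))
        (β (lowOb (hk f) j) (Nat.lt_succ_self m)
          ((Quotient.functor FaceRel).map ((Paths.of Opt).map e)))) := by
    intro j f e
    refine (dif_pos (hd f)).trans (congrArg some ?_)
    rw [hβ (lowOb (hk f) j) ω _ (hd f)]
    rfl
  cases h with
  | inner _ _ p q p' h =>
    refine (hsrc f _ p (.src _ q)).trans (Eq.trans ?_ (hsrc f _ p' (.tgt _)).symm)
    exact congrArg (fun z => some (X.map _ z)) ((H (hk f)).inner p q p' h)
  | glob1 _ _ p h =>
    refine (htgt f (.tgt _)).trans (Eq.trans ?_ (hsrc f _ p (.tgt _)).symm)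
    exact congrArg (fun z => some (X.map _ z)) ((H (hk f)).root p h).symm
  | glob2 _ _ p q x h =>
    refine (htgt f (.src _ x)).trans (Eq.trans ?_ (hsrc f _ p (.src _ q)).symm)
    exact congrArg (fun z => some (X.map _ z)) ((H (hk f)).leaves p q x h).symm
  | degen _ _ x h =>
    refine (htgt f (.tgt _)).trans (Eq.trans ?_ (htgt f (.src _ x)).symm)
    exact congrArg (fun z => some (X.map _ z)) ((H (hk f)).degen x h)

end lower

theorem respects_zero {X : Psh k 0} {i : Opetope 0} (b : (Z 0).Op i)
    (v : ∀ j, (Z 0).In b j → X.obj (.op (topOb k j)))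
    (β : ∀ ω : OptRange k 0, ω.obj.as.dim < 0 → (ω.obj ⟶ ob i) → X.obj (.op ω)) :
    Respects b v β := by
  intro ω a f m₁ m₂ h
  cases h

/-- The family of the top-dimensional cells of a presheaf. -/
abbrev Top (X : Psh k n) (j : Opetope n) : Type := X.obj (.op (topOb k j))

/-- The restriction of cells of a presheaf along a morphism of `𝕆`. -/
abbrev face (X : Psh k n) {ω ω' : OptRange k n} (x : X.obj (.op ω)) (g : ω'.obj ⟶ ω.obj) :
    X.obj (.op ω') := X.map (Quiver.Hom.op (ObjectProperty.homMk g)) x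

theorem face_face (X : Psh k n) {ω ω' ω'' : OptRange k n} (x : X.obj (.op ω)) (g : ω'.obj ⟶ ω.obj)
    (u : ω'' ⟶ ω') : X.map u.op (face X x g) = face X x (u.hom ≫ g) :=
  (ConcreteCategory.congr_hom (X.map_comp (Quiver.Hom.op (ObjectProperty.homMk g)) u.op) x).symm

namespace Cell

variable {X : Psh k n}

/-- A top-dimensional cell as a labelled operation of `𝔷ⁿ`. -/
def ext {i : Opetope n} : Cell X (topOb k i) → (Z n).Ext (Top X) i
  | low h _ => absurd h (lt_irrefl n)
  | top b y => ⟨b, srcVal y⟩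

/-- The faces of a top-dimensional cell. -/
def bdry {i : Opetope n} (c : Cell X (topOb k i)) (ω : OptRange k n) (h : ω.obj.as.dim < n)
    (g : ω.obj ⟶ ob i) : X.obj (.op ω) :=
  (c.restrict (ObjectProperty.homMk (Y := topOb k i) g)).toLow h

theorem bdry_top {i : Opetope n} (b : (Z n).Op i) (y : spinePsh k b ⟶ X) (ω : OptRange k n)
    (h : ω.obj.as.dim < n) (g : ω.obj ⟶ ob i) : (top b y).bdry ω h g = tgtVal y h g := by
  unfold bdry
  rw [restrict_top _ _ _ h]
  rfl

theorem map_bdry {i : Opetope n} (c : Cell X (topOb k i)) (ω ω' : OptRange k n)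
    (h : ω.obj.as.dim < n) (h' : ω'.obj.as.dim < n) (g : ω.obj ⟶ ob i) (u : ω' ⟶ ω) :
    X.map u.op (c.bdry ω h g) = c.bdry ω' h' (u.hom ≫ g) := by
  unfold bdry
  rw [map_toLow h h', ← restrict_comp]
  rfl

theorem top_cases {i : Opetope n} (c : Cell X (topOb k i)) :
    ∃ (b : (Z n).Op i) (y : spinePsh k b ⟶ X), c = top b y := by
  cases c with
  | low h _ => exact absurd h (lt_irrefl n)
  | top b y => exact ⟨b, y, rfl⟩

theorem cell_ext {i : Opetope n} {c c' : Cell X (topOb k i)} (h : c.ext = c'.ext)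
    (h' : ∀ ω hω g, c.bdry ω hω g = c'.bdry ω hω g) : c = c' := by
  obtain ⟨b, y, rfl⟩ := c.top_cases
  obtain ⟨b', y', rfl⟩ := c'.top_cases
  simp only [bdry_top] at h'
  have h1 : b = b' := congrArg Sigma.fst h
  subst h1
  refine congrArg (top b) (spine_hom_ext (eq_of_heq (Sigma.mk.inj_iff.1 h).2) h')

theorem low_ext {ω : OptRange k n} (h : ω.obj.as.dim < n) {c c' : Cell X ω}
    (hc : c.toLow h = c'.toLow h) : c = c' := by
  rw [← low_toLow h c, hc, low_toLow]

theorem ext_map {Y : Psh k n} (α : X ⟶ Y) {i : Opetope n} (c : Cell X (topOb k i)) :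
    (c.map α).ext = ⟨c.ext.1, fun j p => α.app _ (c.ext.2 j p)⟩ := by
  obtain ⟨b, y, rfl⟩ := c.top_cases
  rfl

theorem bdry_map {Y : Psh k n} (α : X ⟶ Y) {i : Opetope n} (c : Cell X (topOb k i))
    (ω : OptRange k n) (h : ω.obj.as.dim < n) (g : ω.obj ⟶ ob i) :
    (c.map α).bdry ω h g = α.app _ (c.bdry ω h g) := by
  obtain ⟨b, y, rfl⟩ := c.top_cases
  rw [bdry_top]
  exact bdry_top b (y ≫ α) ω h g

end Cell

section unit

variable {X : Psh k n} {i : Opetope n} (x : X.obj (.op (topOb k i)))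

theorem respects_eta : Respects ((Z n).one i) ((Z n).pure (X := Top X) x).2
    (fun _ _ g => face X (ω := topOb k i) x g) := by
  cases n with
  | zero => exact respects_zero _ _ _
  | succ m =>
    obtain ⟨i, b⟩ := i
    refine respects_succ (i := i) (b := b) _ _ _ (fun _ _ _ _ g u => face_face X x g u) fun hk => ?_
    refine (edgeCond_node _ _).2 ⟨rfl, fun j e => ?_⟩
    exact (edgeCond_leaf _ _).2 rfl

/-- The unit of `𝔷ⁿ` on top-dimensional cells: a cell of shape `ω` is sent to the spine of the
corolla on `ω` labelled by it. -/
def etaTop : Cell X (topOb k i) :=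
  .top ((Z n).one i) (mkHom (respects_eta x) (fun _ _ _ _ g u => face_face X x g u))

theorem ext_etaTop : (etaTop x).ext = (Z n).pure (X := Top X) x :=
  Sigma.ext rfl (heq_of_eq (funext fun _ => funext fun _ => srcVal_mkHom _ _ _ _))

theorem bdry_etaTop (ω : OptRange k n) (h : ω.obj.as.dim < n) (g : ω.obj ⟶ ob i) :
    (etaTop x).bdry ω h g = face X (ω := topOb k i) x g := by
  unfold etaTop
  rw [Cell.bdry_top]
  exact tgtVal_mkHom (respects_eta x) (fun _ _ _ _ g u => face_face X x g u) h g

end unit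

theorem exists_topOb (ω : OptRange k n) (h : ¬ ω.obj.as.dim < n) :
    ∃ i : Opetope n, topOb k i = ω := by
  obtain ⟨⟨⟨d, i⟩⟩, h1, h2⟩ := ω
  change ¬ d < n at h
  change d ≤ n at h2
  obtain rfl : d = n := by omega
  exact ⟨i, rfl⟩

/-- The unit of `𝔷ⁿ` on cells. -/
def etaCell (X : Psh k n) : ∀ ω : OptRange k n, X.obj (.op ω) → Cell X ω
  | ⟨⟨⟨d, i⟩⟩, hi⟩, x =>
    if h : d < n then .low h x
    else
      have hd : n = d := le_antisymm (not_lt.1 h) hi.2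
      (show ∀ (d : ℕ) (_ : n = d) (i : Opetope d) (hi : InRange k n (ob i)),
        X.obj (.op ⟨ob i, hi⟩) → Cell X ⟨ob i, hi⟩ from
        fun _ hd => hd ▸ fun _ _ x => etaTop x) d hd i hi x

theorem etaCell_low (X : Psh k n) (ω : OptRange k n) (h : ω.obj.as.dim < n) (x : X.obj (.op ω)) :
    etaCell X ω x = .low h x := dif_pos h

theorem etaCell_top (X : Psh k n) (i : Opetope n) (x : X.obj (.op (topOb k i))) :
    etaCell X (topOb k i) x = etaTop x := dif_neg (lt_irrefl n)

theorem etaCell_restrict (X : Psh k n) {ω ω' : OptRange k n} (x : X.obj (.op ω)) (f : ω' ⟶ ω) :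
    etaCell X ω' (X.map f.op x) = (etaCell X ω x).restrict f := by
  by_cases h : ω'.obj.as.dim < n
  · rw [etaCell_low X ω' h]
    by_cases hω : ω.obj.as.dim < n
    · rw [etaCell_low X ω hω]
      rfl
    · obtain ⟨i, rfl⟩ := exists_topOb ω hω
      rw [etaCell_top]
      refine (congrArg (Cell.low h) (bdry_etaTop x ω' h f.hom)).symm.trans ?_
      exact Cell.low_toLow h _
  · obtain ⟨rfl, rfl⟩ := eq_of_not_lt f h
    rw [eqToHom_refl, Cell.restrict_id, op_id, X.map_id]
    rfl

theorem etaCell_map {X Y : Psh k n} (α : X ⟶ Y) (ω : OptRange k n) (x : X.obj (.op ω)) :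
    etaCell Y ω (α.app _ x) = (etaCell X ω x).map α := by
  by_cases hω : ω.obj.as.dim < n
  · rw [etaCell_low _ ω hω, etaCell_low _ ω hω]
    rfl
  · obtain ⟨i, rfl⟩ := exists_topOb ω hω
    rw [etaCell_top, etaCell_top]
    refine Cell.cell_ext ?_ fun _ _ g => ?_
    · rw [Cell.ext_map, ext_etaTop, ext_etaTop]
      refine Sigma.ext rfl (heq_of_eq (funext fun j => funext fun e => ?_))
      have hj : i = j := (Z n).oneIn e
      subst hj
      rfl
    · rw [Cell.bdry_map, bdry_etaTop, bdry_etaTop]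
      exact (ConcreteCategory.congr_hom
        (α.naturality (Quiver.Hom.op (ObjectProperty.homMk (Y := topOb k i) g))) x).symm

theorem EdgeCond.congr_edges {I : Type} {P : PolyEnd I} {A : (Σ i, P.Op i) → Type} {C : I → Type}
    {tA : ∀ a, A a → C a.1} {sA : ∀ a, A a → ∀ k, P.In a.2 k → C k} {X : I → Type} {i : I}
    {T : P.Tree X i} {v : ∀ a, T.Node a → A a} {r r' : C i} {l l' : ∀ j, X j → C j}
    (h : EdgeCond tA sA T v r l) (hr : r = r') (hl : l = l') : EdgeCond tA sA T v r' l' := by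
  subst hr
  subst hl
  exact h

theorem edgeCond_of_cell {m : ℕ} (hk : m + 1 ≤ m + k) {X : Psh k (m + 1)} {i : Opetope m}
    {b : (Z m).Op i} (d : Cell X (topOb (n := m + 1) k (opetope b))) :
    EdgeCond (tgtFace hk X) (srcFace hk X) d.ext.1.1 d.ext.2
      (d.bdry (lowOb hk i) (Nat.lt_succ_self m) (tgtHom b))
      (fun j q => d.bdry (lowOb hk j) (Nat.lt_succ_self m) (srcHom b q)) := by
  obtain ⟨T, y, rfl⟩ := d.top_cases
  exact (edgeCond_of_hom hk T y).congr_edges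
    (Cell.bdry_top (n := m + 1) (i := opetope b) T y _ _ _).symm
    (funext fun _ => funext fun _ =>
      (Cell.bdry_top (n := m + 1) (i := opetope b) T y _ _ _).symm)

section mult

variable {X : Psh k n} {i : Opetope n} (c : Cell ((zFunctor k n).obj X) (topOb k i))

/-- The labelled operation obtained by composing a labelled operation of labelled operations. -/
def muExt : (Z n).Ext (Top X) i :=
  (Z n).bind (X := Top ((zFunctor k n).obj X)) (Y := Top X) c.ext (fun _ d => Cell.ext d)

/-- The faces of the composite. -/
def muBdry (ω : OptRange k n) (h : ω.obj.as.dim < n) (g : ω.obj ⟶ ob i) : X.obj (.op ω) :=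
  (show Cell X ω from c.bdry ω h g).toLow h

theorem map_muBdry (ω ω' : OptRange k n) (h : ω.obj.as.dim < n) (h' : ω'.obj.as.dim < n)
    (g : ω.obj ⟶ ob i) (u : ω' ⟶ ω) :
    X.map u.op (muBdry c ω h g) = muBdry c ω' h' (u.hom ≫ g) := by
  unfold muBdry
  rw [Cell.map_toLow h h', ← c.map_bdry ω ω' h h' g u]
  rfl

theorem respects_mu : Respects (muExt c).1 (muExt c).2 (muBdry c) := by
  cases n with
  | zero => exact respects_zero _ _ _
  | succ m =>
    obtain ⟨i, b⟩ := i
    refine respects_succ (i := i) (b := b) (muExt c).1 _ _ (map_muBdry c) fun hk => ?_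
    refine EdgeCond.subst (M := Z m) (A := fun a => X.obj (.op (topOb (n := m + 1) k a)))
      (B := fun a => Cell X (topOb (n := m + 1) k a))
      (tA := tgtFace hk X) (sA := srcFace hk X) (X := (Z m).In b)
      (fun a d => d.ext.1) (fun a d => d.ext.2)
      (tB := fun a d => d.bdry (lowOb hk a.1) (Nat.lt_succ_self m) (tgtHom a.2))
      (sB := fun a d j q => d.bdry (lowOb hk j) (Nat.lt_succ_self m) (srcHom a.2 q))
      ?_ (T := c.ext.1.1) (d := c.ext.2) ?_
    · rintro ⟨j, s⟩ d
      exact edgeCond_of_cell hk d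
    · have h := edgeCond_of_cell hk c
      let tl : ∀ j, Cell X (lowOb hk j) → X.obj (.op (lowOb hk j)) :=
        fun j c => c.toLow (Nat.lt_succ_self m)
      exact ⟨fun p _ q _ p' hp => congrArg (tl _) (h.inner p q p' hp),
        fun p hp => congrArg (tl _) (h.root p hp),
        fun p _ q x hp => congrArg (tl _) (h.leaves p q x hp),
        fun x hx => congrArg (tl _) (h.degen x hx)⟩

/-- The multiplication of `𝔷ⁿ` on top-dimensional cells. -/
def muTop : Cell X (topOb k i) := .top (muExt c).1 (mkHom (respects_mu c) (map_muBdry c))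

theorem ext_muTop : (muTop c).ext = muExt c :=
  Sigma.ext rfl (heq_of_eq (funext fun _ => funext fun _ => srcVal_mkHom _ _ _ _))

theorem bdry_muTop (ω : OptRange k n) (h : ω.obj.as.dim < n) (g : ω.obj ⟶ ob i) :
    (muTop c).bdry ω h g = muBdry c ω h g := by
  unfold muTop
  rw [Cell.bdry_top]
  exact tgtVal_mkHom (respects_mu c) (map_muBdry c) h g

end mult

/-- The multiplication of `𝔷ⁿ` on cells. -/
def muCell (X : Psh k n) : ∀ {ω : OptRange k n}, Cell ((zFunctor k n).obj X) ω → Cell X ω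
  | _, .low _ x => x
  | _, .top b y => muTop (.top b y)

theorem muCell_low (X : Psh k n) {ω : OptRange k n} (h : ω.obj.as.dim < n)
    (c : Cell ((zFunctor k n).obj X) ω) : muCell X c = c.toLow h := by
  cases c with
  | low _ _ => rfl
  | top _ _ => exact absurd h (lt_irrefl n)

theorem muCell_top (X : Psh k n) {i : Opetope n} (c : Cell ((zFunctor k n).obj X) (topOb k i)) :
    muCell X c = muTop c := by
  obtain ⟨b, y, rfl⟩ := c.top_cases
  rfl

theorem muCell_restrict (X : Psh k n) {ω ω' : OptRange k n}
    (c : Cell ((zFunctor k n).obj X) ω) (f : ω' ⟶ ω) :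
    muCell X (c.restrict f) = (muCell X c).restrict f := by
  by_cases h : ω'.obj.as.dim < n
  · rw [muCell_low X h]
    by_cases hω : ω.obj.as.dim < n
    · rw [muCell_low X hω]
      exact (Cell.map_toLow hω h c f).symm
    · obtain ⟨i, rfl⟩ := exists_topOb ω hω
      rw [muCell_top]
      exact Cell.low_ext h (bdry_muTop c ω' h f.hom).symm
  · obtain ⟨rfl, rfl⟩ := eq_of_not_lt f h
    rw [eqToHom_refl, Cell.restrict_id, Cell.restrict_id]

theorem bind_map {M : PolyMonadData (Opetope n)} {A B A' B' : Opetope n → Type} {i : Opetope n}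
    (z : M.Ext A i) (f : ∀ j, A j → M.Ext B j) (α : ∀ j, A j → A' j) (β : ∀ j, B j → B' j)
    (f' : ∀ j, A' j → M.Ext B' j)
    (h : ∀ j x, f' j (α j x) = ⟨(f j x).1, fun l p => β l ((f j x).2 l p)⟩) :
    M.bind (X := A') (Y := B') ⟨z.1, fun j p => α j (z.2 j p)⟩ f' =
      ⟨(M.bind z f).1, fun l p => β l ((M.bind z f).2 l p)⟩ := by
  have e : (fun j p => f' j (α j (z.2 j p))) =
    fun j (p : M.In z.1 j) => (⟨(f j (z.2 j p)).1, fun l q => β l ((f j (z.2 j p)).2 l q)⟩ :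
      M.Ext B' j) := by
    funext j p
    exact h j _
  exact congrArg (fun w => M.bind (X := M.Ext B') (Y := B') ⟨z.1, w⟩ (fun _ z => z)) e

theorem muCell_map {X Y : Psh k n} (α : X ⟶ Y) {ω : OptRange k n}
    (c : Cell ((zFunctor k n).obj X) ω) :
    muCell Y (c.map ((zFunctor k n).map α)) = (muCell X c).map α := by
  by_cases hω : ω.obj.as.dim < n
  · cases c with
    | low h x => rfl
    | top b y => exact absurd hω (lt_irrefl n)
  · obtain ⟨i, rfl⟩ := exists_topOb ω hω
    rw [muCell_top, muCell_top]
    refine Cell.cell_ext ?_ fun ω' h g => ?_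
    · rw [Cell.ext_map, ext_muTop, ext_muTop]
      unfold muExt
      rw [Cell.ext_map]
      exact bind_map c.ext (fun _ d => Cell.ext d)
        (fun j (d : Cell X (topOb k j)) => (d.map α : Cell Y (topOb k j)))
        (fun j => α.app (.op (topOb k j))) (fun _ d => Cell.ext d) (fun j d => Cell.ext_map α d)
    · rw [Cell.bdry_map, bdry_muTop, bdry_muTop]
      unfold muBdry
      rw [Cell.bdry_map]
      generalize c.bdry ω' h g = d
      change Cell X ω' at d
      cases d with
      | low _ _ => rfl
      | top _ _ => exact absurd h (lt_irrefl n)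

/-- The unit of `𝔷ⁿ`. -/
def zUnit (k n : ℕ) : 𝟭 (Psh k n) ⟶ zFunctor k n where
  app X :=
    { app := fun ω => ↾fun x => etaCell X ω.unop x
      naturality := fun _ _ f => by
        ext x
        exact etaCell_restrict X x f.unop }
  naturality X Y α := by
    ext ω x
    exact etaCell_map α ω.unop x

/-- The multiplication of `𝔷ⁿ`. -/
def zMult (k n : ℕ) : zFunctor k n ⋙ zFunctor k n ⟶ zFunctor k n where
  app X :=
    { app := fun ω => ↾fun c => muCell X c
      naturality := fun _ _ f => by
        ext c
        exact muCell_restrict X c f.unop }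
  naturality X Y α := by
    ext ω c
    exact muCell_map α c

theorem mu_eta (X : Psh k n) (ω : OptRange k n) (c : ((zFunctor k n).obj X).obj (.op ω)) :
    muCell X (etaCell ((zFunctor k n).obj X) ω c) = c := by
  by_cases hω : ω.obj.as.dim < n
  · exact congrArg (muCell X) (etaCell_low ((zFunctor k n).obj X) ω hω c)
  · obtain ⟨i, rfl⟩ := exists_topOb ω hω
    refine (congrArg (muCell X) (etaCell_top ((zFunctor k n).obj X) i c)).trans ?_
    rw [muCell_top]
    refine Cell.cell_ext ?_ fun ω' h g => ?_
    · rw [ext_muTop]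
      unfold muExt
      rw [ext_etaTop]
      exact (Z n).pure_bind (X := Top ((zFunctor k n).obj X)) (Y := Top X) c (fun _ d => Cell.ext d)
    · rw [bdry_muTop]
      unfold muBdry
      rw [bdry_etaTop]
      rfl

theorem mu_map_eta (X : Psh k n) (ω : OptRange k n) (c : Cell X ω) :
    muCell X (c.map ((zUnit k n).app X)) = c := by
  by_cases hω : ω.obj.as.dim < n
  · cases c with
    | low h x => exact etaCell_low X ω hω x
    | top b y => exact absurd hω (lt_irrefl n)
  · obtain ⟨i, rfl⟩ := exists_topOb ω hω
    rw [muCell_top]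
    refine Cell.cell_ext ?_ fun ω' h g => ?_
    · rw [ext_muTop]
      unfold muExt
      rw [Cell.ext_map]
      have e : (fun j p => Cell.ext (etaCell X (topOb k j) (c.ext.2 j p))) =
          fun j (p : (Z n).In c.ext.1 j) => (Z n).pure (X := Top X) (c.ext.2 j p) := by
        funext j p
        rw [etaCell_top]
        exact ext_etaTop _
      refine Eq.trans ?_ ((Z n).bind_pure (X := Top X) c.ext)
      exact congrArg (fun w => (Z n).bind (X := (Z n).Ext (Top X)) (Y := Top X) ⟨c.ext.1, w⟩
        (fun _ z => z)) e
    · rw [bdry_muTop]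
      unfold muBdry
      rw [Cell.bdry_map]
      change (etaCell X ω' (c.bdry ω' h g)).toLow h = _
      rw [etaCell_low X ω' h]
      rfl

theorem mu_assoc (X : Psh k n) (ω : OptRange k n)
    (c : Cell ((zFunctor k n).obj ((zFunctor k n).obj X)) ω) :
    muCell X (c.map ((zMult k n).app X)) = muCell X (muCell ((zFunctor k n).obj X) c) := by
  by_cases hω : ω.obj.as.dim < n
  · cases c with
    | low h x => rfl
    | top b y => exact absurd hω (lt_irrefl n)
  · obtain ⟨i, rfl⟩ := exists_topOb ω hω
    rw [muCell_top, muCell_top, muCell_top]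
    refine Cell.cell_ext ?_ fun ω' h g => ?_
    · rw [ext_muTop, ext_muTop]
      unfold muExt
      rw [Cell.ext_map, ext_muTop]
      refine Eq.trans ?_ ((Z n).bind_assoc
        (X := Top ((zFunctor k n).obj ((zFunctor k n).obj X)))
        (Y := Top ((zFunctor k n).obj X)) (Z := Top X) c.ext (fun _ d => Cell.ext d)
        (fun _ d => Cell.ext d)).symm
      have e : (fun j p => Cell.ext (muCell X (c.ext.2 j p))) =
          fun j (p : (Z n).In c.ext.1 j) => muExt (X := X) (i := j) (c.ext.2 j p) := by
        funext j p
        exact (congrArg Cell.ext (muCell_top X (i := j) (c.ext.2 j p))).trans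
          (ext_muTop (X := X) (i := j) (c.ext.2 j p))
      exact congrArg (fun w => (Z n).bind (X := (Z n).Ext (Top X)) (Y := Top X) ⟨c.ext.1, w⟩
        (fun _ z => z)) e
    · rw [bdry_muTop, bdry_muTop]
      unfold muBdry
      rw [Cell.bdry_map, bdry_muTop]
      unfold muBdry
      exact congrArg (Cell.toLow h) (muCell_low X h (c.bdry ω' h g))

/-- The monad `𝔷ⁿ` on the category of presheaves on `𝕆_{n-k,n}`. -/
def zMonad (k n : ℕ) : Monad (Psh k n) where
  toFunctor := zFunctor k n
  η := zUnit k n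
  μ := zMult k n
  assoc X := by
    ext ω c
    exact mu_assoc X ω.unop c
  left_unit X := by
    ext ω c
    exact mu_eta X ω.unop c
  right_unit X := by
    ext ω c
    exact mu_map_eta X ω.unop c

/-- The category of `(k,n)`-opetopic algebras. -/
abbrev OAlg (k n : ℕ) : Type 1 := (zMonad k n).Algebra

/-- An uncoloured planar (i.e. nonsymmetric) operad in sets. The inputs of a composite are ordered
lexicographically. -/
structure PlanarOperad where
  Op : ℕ → Type
  one : Op 1
  comp : ∀ {k : ℕ} (_ : Op k) (m : Fin k → ℕ) (_ : ∀ i, Op (m i)), Op (∑ i, m i)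
  one_comp : ∀ {m : ℕ} (q : Op m),
    (⟨_, comp one (fun _ => m) (fun _ => q)⟩ : Σ n, Op n) = ⟨m, q⟩
  comp_one : ∀ {k : ℕ} (p : Op k),
    (⟨_, comp p (fun _ => 1) (fun _ => one)⟩ : Σ n, Op n) = ⟨k, p⟩
  comp_assoc : ∀ {k : ℕ} (p : Op k) (m : Fin k → ℕ) (q : ∀ i, Op (m i))
    (l : ∀ i, Fin (m i) → ℕ) (r : ∀ i j, Op (l i j)),
    (⟨_, comp (comp p m q)
      (fun x => l (finSigmaFinEquiv.symm x).1 (finSigmaFinEquiv.symm x).2)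
      (fun x => r (finSigmaFinEquiv.symm x).1 (finSigmaFinEquiv.symm x).2)⟩ : Σ n, Op n) =
    ⟨_, comp p (fun i => ∑ j, l i j) (fun i => comp (q i) (l i) (r i))⟩

namespace PlanarOperad

/-- Morphisms of planar operads. -/
@[ext]
structure Hom (P Q : PlanarOperad) where
  map : ∀ {k : ℕ}, P.Op k → Q.Op k
  map_one : map P.one = Q.one
  map_comp : ∀ {k : ℕ} (p : P.Op k) (m : Fin k → ℕ) (q : ∀ i, P.Op (m i)),
    map (P.comp p m q) = Q.comp (map p) m (fun i => map (q i))

instance : Category PlanarOperad where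
  Hom := Hom
  id P := ⟨fun p => p, rfl, fun _ _ _ => rfl⟩
  comp f g := ⟨fun p => g.map (f.map p), by rw [f.map_one, g.map_one], fun p m q => by
    rw [f.map_comp, g.map_comp]⟩

end PlanarOperad

/-- A (small) coloured planar operad in sets: `Op a c` is the set of operations with input colours
`a` and output colour `c`. -/
structure ColPlanarOperad where
  Col : Type
  Op : ∀ {k : ℕ} (_ : Fin k → Col) (_ : Col), Type
  one : ∀ c : Col, Op (fun _ : Fin 1 => c) c
  comp : ∀ {k : ℕ} {a : Fin k → Col} {c : Col} (_ : Op a c) (m : Fin k → ℕ)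
    (b : ∀ i, Fin (m i) → Col) (_ : ∀ i, Op (b i) (a i)),
    Op (fun x : Fin (∑ i, m i) => b (finSigmaFinEquiv.symm x).1 (finSigmaFinEquiv.symm x).2) c
  one_comp : ∀ {m : ℕ} {b : Fin m → Col} {c : Col} (q : Op b c),
    (⟨_, _, comp (one c) (fun _ => m) (fun _ => b) (fun _ => q)⟩ :
      Σ n, Σ a : Fin n → Col, Op a c) = ⟨m, b, q⟩
  comp_one : ∀ {k : ℕ} {a : Fin k → Col} {c : Col} (p : Op a c),
    (⟨_, _, comp p (fun _ => 1) (fun i _ => a i) (fun i => one (a i))⟩ :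
      Σ n, Σ a : Fin n → Col, Op a c) = ⟨k, a, p⟩
  comp_assoc : ∀ {k : ℕ} {a : Fin k → Col} {c : Col} (p : Op a c) (m : Fin k → ℕ)
    (b : ∀ i, Fin (m i) → Col) (q : ∀ i, Op (b i) (a i)) (l : ∀ i, Fin (m i) → ℕ)
    (d : ∀ i j, Fin (l i j) → Col) (r : ∀ i j, Op (d i j) (b i j)),
    (⟨_, _, comp (comp p m b q)
      (fun x => l (finSigmaFinEquiv.symm x).1 (finSigmaFinEquiv.symm x).2)
      (fun x => d (finSigmaFinEquiv.symm x).1 (finSigmaFinEquiv.symm x).2)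
      (fun x => r (finSigmaFinEquiv.symm x).1 (finSigmaFinEquiv.symm x).2)⟩ :
      Σ n, Σ a : Fin n → Col, Op a c) =
    ⟨_, _, comp p (fun i => ∑ j, l i j) _ (fun i => comp (q i) (l i) (d i) (r i))⟩

namespace ColPlanarOperad

/-- Morphisms of coloured planar operads. -/
structure Hom (P Q : ColPlanarOperad) where
  col : P.Col → Q.Col
  map : ∀ {k : ℕ} {a : Fin k → P.Col} {c : P.Col}, P.Op a c → Q.Op (fun i => col (a i)) (col c)
  map_one : ∀ c : P.Col, map (P.one c) = Q.one (col c)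
  map_comp : ∀ {k : ℕ} {a : Fin k → P.Col} {c : P.Col} (p : P.Op a c) (m : Fin k → ℕ)
    (b : ∀ i, Fin (m i) → P.Col) (q : ∀ i, P.Op (b i) (a i)),
    map (P.comp p m b q) = Q.comp (map p) m (fun i j => col (b i j)) (fun i => map (q i))

instance : Category ColPlanarOperad where
  Hom := Hom
  id P := ⟨fun c => c, fun p => p, fun _ => rfl, fun _ _ _ _ => rfl⟩
  comp f g := ⟨fun c => g.col (f.col c), fun p => g.map (f.map p),
    fun c => by rw [f.map_one, g.map_one], fun p m b q => by rw [f.map_comp, g.map_comp]⟩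

end ColPlanarOperad

/-- Finite planar trees: a tree is either the trivial tree or consists of a root vertex with a
finite list of subtrees. Vertices can have any finite number of inputs. -/
inductive PTree
  | leaf : PTree
  | node (k : ℕ) (c : Fin k → PTree) : PTree

namespace PTree

/-- The number of leaves. -/
def leaves : PTree → ℕ
  | leaf => 1
  | node _ c => ∑ i, (c i).leaves

/-- The set of vertices. -/
inductive Vert : PTree → Type
  | root {k : ℕ} {c : Fin k → PTree} : Vert (node k c)
  | child {k : ℕ} {c : Fin k → PTree} (i : Fin k) (v : Vert (c i)) : Vert (node k c)

/-- The number of inputs of a vertex. -/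
def Vert.arity : ∀ {T : PTree}, T.Vert → ℕ
  | node k _, .root => k
  | node _ _, .child _ v => v.arity

/-- The tree with one vertex, that has `k` inputs. -/
def corolla (k : ℕ) : PTree := node k (fun _ => leaf)

theorem leaves_corolla (k : ℕ) : (corolla k).leaves = k := by
  simp [corolla, leaves]

theorem arity_corolla {k : ℕ} (v : (corolla k).Vert) : v.arity = k := by
  cases v with
  | root => rfl
  | child i v => cases v

/-- Grafting of trees on the leaves of a tree. -/
def graft : ∀ (T : PTree) (_ : Fin T.leaves → PTree), PTree
  | leaf, f => f (0 : Fin 1)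
  | node k c, f => node k (fun i => (c i).graft (fun x => f (finSigmaFinEquiv ⟨i, x⟩)))

theorem leaves_graft (T : PTree) (f : Fin T.leaves → PTree) :
    (T.graft f).leaves = ∑ x, (f x).leaves := by
  induction T with
  | leaf => exact (Fin.sum_univ_one (fun x : Fin 1 => (f x).leaves)).symm
  | node k c ih =>
    simp only [graft, leaves, ih]
    have := Fintype.sum_equiv (finSigmaFinEquiv (n := fun i => (c i).leaves))
      (fun x => (f (finSigmaFinEquiv x)).leaves) (fun x => (f x).leaves) (fun _ => rfl)
    rw [← Finset.univ_sigma_univ, Finset.sum_sigma] at this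
    exact this

/-- Substitution of a tree `U v` with the right number of leaves for each vertex `v` of a tree. -/
def subst : ∀ (T : PTree) (U : T.Vert → PTree) (_ : ∀ v, (U v).leaves = v.arity), PTree
  | leaf, _, _ => leaf
  | node _ c, U, h => (U .root).graft (fun x =>
      (c (Fin.cast (h .root) x)).subst (fun v => U (.child _ v)) (fun v => h (.child _ v)))

theorem leaves_subst (T : PTree) (U : T.Vert → PTree) (h : ∀ v, (U v).leaves = v.arity) :
    (T.subst U h).leaves = T.leaves := by
  induction T with
  | leaf => rfl
  | node k c ih =>
    simp only [subst, leaves_graft, leaves]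
    exact Fintype.sum_equiv (finCongr (h .root)) _ _ (fun _ => ih _ _ _)

/-- The vertices of the base of a grafting. -/
def vertBase : ∀ {T : PTree} (f : Fin T.leaves → PTree), T.Vert → (T.graft f).Vert
  | node _ _, _, .root => .root
  | node _ _, _, .child i v => .child i (vertBase _ v)

/-- The vertices of the grafted trees. -/
def vertGraft : ∀ {T : PTree} (f : Fin T.leaves → PTree) (x : Fin T.leaves),
    (f x).Vert → (T.graft f).Vert
  | leaf, f, x, v => cast (congrArg (fun y => (f y).Vert) (Subsingleton.elim (α := Fin 1) x 0)) v
  | node _ c, f, x, v =>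
    let y := (finSigmaFinEquiv (n := fun i => (c i).leaves)).symm x
    .child y.1 (vertGraft (fun z => f (finSigmaFinEquiv ⟨y.1, z⟩)) y.2
      (cast (congrArg (fun z => (f z).Vert) (Equiv.apply_symm_apply _ x).symm) v))

theorem arity_cast {T T' : PTree} (h : T = T') (v : T.Vert) :
    (cast (congrArg Vert h) v).arity = v.arity := by
  subst h
  rfl

theorem arity_vertBase {T : PTree} (f : Fin T.leaves → PTree) (v : T.Vert) :
    (vertBase f v).arity = v.arity := by
  induction v with
  | root => rfl
  | child i v ih => exact ih _

theorem arity_vertGraft {T : PTree} (f : Fin T.leaves → PTree) (x : Fin T.leaves)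
    (v : (f x).Vert) : (vertGraft f x v).arity = v.arity := by
  induction T with
  | leaf => exact arity_cast (congrArg f (Subsingleton.elim (α := Fin 1) x 0)) v
  | node k c ih =>
    exact (ih _ _ _ _).trans (arity_cast (congrArg f (Equiv.apply_symm_apply _ x).symm) v)

/-- The vertices of a substitution: they correspond to the vertices of the substituted trees. -/
def vertSubst : ∀ {T : PTree} (U : T.Vert → PTree) (h : ∀ v, (U v).leaves = v.arity) (v : T.Vert),
    (U v).Vert → (T.subst U h).Vert
  | node _ _, _, _, .root, u => vertBase _ u
  | node _ c, U, h, .child i v, u =>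
    vertGraft (fun x => (c (Fin.cast (h .root) x)).subst (fun v => U (.child _ v))
      (fun v => h (.child _ v))) (Fin.cast (h .root).symm i)
      (vertSubst (fun v => U (.child i v)) (fun v => h (.child i v)) v u)

theorem arity_vertSubst {T : PTree} (U : T.Vert → PTree) (h : ∀ v, (U v).leaves = v.arity)
    (v : T.Vert) (u : (U v).Vert) : (vertSubst U h v u).arity = u.arity := by
  induction v with
  | root => exact arity_vertBase _ u
  | child i v ih => exact (arity_vertGraft _ _ _).trans (ih (fun v => U (.child i v)) (fun v => h (.child i v)) u)

end PTree

/-- A combinad (in sets) over the combinatorial pattern of planar trees: a set for every planar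
tree, with a unit for each corolla and a composition for each substitution of trees, subject to
unit and associativity laws. -/
structure Combinad where
  Op : PTree → Type
  one : ∀ k : ℕ, Op (PTree.corolla k)
  comp : ∀ {T : PTree} (_ : Op T) (U : T.Vert → PTree) (h : ∀ v, (U v).leaves = v.arity)
    (_ : ∀ v, Op (U v)), Op (T.subst U h)
  one_comp : ∀ {T : PTree} (y : Op T),
    (⟨_, comp (one T.leaves) (fun _ => T) (fun v => (PTree.arity_corolla v).symm) (fun _ => y)⟩ :
      Σ T, Op T) = ⟨T, y⟩
  comp_one : ∀ {T : PTree} (x : Op T),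
    (⟨_, comp x (fun v => PTree.corolla v.arity) (fun v => PTree.leaves_corolla v.arity)
      (fun v => one v.arity)⟩ : Σ T, Op T) = ⟨T, x⟩
  comp_assoc : ∀ {T : PTree} (x : Op T) (U : T.Vert → PTree) (h : ∀ v, (U v).leaves = v.arity)
    (y : ∀ v, Op (U v)) (V : (T.subst U h).Vert → PTree) (h' : ∀ w, (V w).leaves = w.arity)
    (z : ∀ w, Op (V w)),
    (⟨_, comp (comp x U h y) V h' z⟩ : Σ T, Op T) =
    ⟨_, comp x (fun v => (U v).subst (fun u => V (PTree.vertSubst U h v u))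
        (fun u => (h' _).trans (PTree.arity_vertSubst U h v u)))
      (fun v => (PTree.leaves_subst _ _ _).trans (h v))
      (fun v => comp (y v) (fun u => V (PTree.vertSubst U h v u))
        (fun u => (h' _).trans (PTree.arity_vertSubst U h v u)) (fun u => z (PTree.vertSubst U h v u)))⟩

namespace Combinad

/-- Morphisms of combinads. -/
@[ext]
structure Hom (M N : Combinad) where
  map : ∀ {T : PTree}, M.Op T → N.Op T
  map_one : ∀ k : ℕ, map (M.one k) = N.one k
  map_comp : ∀ {T : PTree} (x : M.Op T) (U : T.Vert → PTree) (h : ∀ v, (U v).leaves = v.arity)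
    (y : ∀ v, M.Op (U v)), map (M.comp x U h y) = N.comp (map x) U h (fun v => map (y v))

instance : Category Combinad where
  Hom := Hom
  id M := ⟨fun x => x, fun _ => rfl, fun _ _ _ _ => rfl⟩
  comp f g := ⟨fun x => g.map (f.map x), fun k => by rw [f.map_one, g.map_one],
    fun x U h y => by rw [f.map_comp, g.map_comp]⟩

end Combinad

end Opetopic

/-! Let n = m+1 and k ≤ 1. A (k,n)-opetopic algebra then lives in dimensions m and m+1 only, and for
k = 0 in dimension m+1 only. A top cell of `𝔷ⁿX` is a spine in X: a tree of operations of `𝔷ᵐ` whose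
nodes carry (m+1)-cells and whose edges carry m-cells, the opetopic identities saying exactly that
colours agree along inner edges, at the root, at the leaves and on the trivial tree. For k = 0 the
edges carry no information. Hence an algebra is a family of cells with a composition of coloured
trees that is associative for substitution (`EAlg`). The comparison rests on the bijection between
cells and coloured trees (`labOf`, `cellOf`).

Composition along all trees is generated by the trivial tree and the trees with two levels, just as
a category is given by identities and binary composites. So coloured algebras over M are equivalent
to generalized multicategories (`Multi`) for the monad that M induces on families of sets
(`EAlg.toMulti`); `actT_graft` and `evN_graft` carry the two directions. Cartesianness of M enters
through `taut`, which labels the leaves of a tree by the inputs of the operation to which the tree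
reduces. Altogether, algebras embed fully faithfully into `Multi (Z m).toF`; the essential image is
everything for k = 1, and for k = 0 the multicategories with one object of each sort
(`toMultiFunctor_essImage`).

It remains to identify three monads. `𝔷⁰` is the identity monad, whose multicategories are
categories, with monoids as the case of one object. `𝔷¹` is the monad of finite sequences, which
gives coloured planar operads and planar operads. `𝔷²` is presented by planar trees with labelled
vertices (`zTwoRep`), and its multicategories with one object of each sort are combinads. In each
case the classical structure has a fully faithful functor to multicategories with the essential
image found above, and `nonempty_equivalence_of_essImage` concludes.

In dimension 0 the unit of `𝔷⁰` is invertible, so algebras are just sets. For k ≥ n the lower bound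
on dimensions is void; changing k then affects neither presheaves nor cells, and the comparison
functors are strictly inverse to each other. -/

namespace Opetopic

open CategoryTheory

/-! ### Monads on families of sets. -/

/-- A monad on the category of families of sets indexed by `I`, in Kleisli form. -/
structure FMonad (I : Type) where
  F : (I → Type) → I → Type
  map : ∀ {X Y : I → Type} (_ : ∀ j, X j → Y j) {i : I}, F X i → F Y i
  pure : ∀ {X : I → Type} {i : I}, X i → F X i
  bind : ∀ {X Y : I → Type} {i : I}, F X i → (∀ j, X j → F Y j) → F Y i
  pure_bind : ∀ {X Y : I → Type} {i : I} (x : X i) (f : ∀ j, X j → F Y j),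
    bind (pure x) f = f i x
  bind_pure : ∀ {X : I → Type} {i : I} (z : F X i), bind z (fun _ x => pure x) = z
  bind_assoc : ∀ {X Y W : I → Type} {i : I} (z : F X i) (f : ∀ j, X j → F Y j)
    (g : ∀ j, Y j → F W j), bind (bind z f) g = bind z (fun j x => bind (f j x) g)
  map_eq : ∀ {X Y : I → Type} (f : ∀ j, X j → Y j) {i : I} (z : F X i),
    map f z = bind z (fun j x => pure (f j x))

namespace FMonad

variable {I : Type} (T : FMonad I) {X Y W : I → Type} {i : I}

theorem map_id (z : T.F X i) : T.map (fun _ x => x) z = z := by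
  rw [T.map_eq, T.bind_pure]

theorem map_map (f : ∀ j, X j → Y j) (g : ∀ j, Y j → W j) (z : T.F X i) :
    T.map g (T.map f z) = T.map (fun j x => g j (f j x)) z := by
  simp only [T.map_eq, T.bind_assoc, T.pure_bind]

theorem map_pure (f : ∀ j, X j → Y j) (x : X i) : T.map f (T.pure x) = T.pure (f i x) := by
  rw [T.map_eq, T.pure_bind]

theorem map_bind (f : ∀ j, X j → T.F Y j) (g : ∀ j, Y j → W j) (z : T.F X i) :
    T.map g (T.bind z f) = T.bind z (fun j x => T.map g (f j x)) := by
  simp only [T.map_eq, T.bind_assoc]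

theorem bind_map (f : ∀ j, X j → Y j) (g : ∀ j, Y j → T.F W j) (z : T.F X i) :
    T.bind (T.map f z) g = T.bind z (fun j x => g j (f j x)) := by
  simp only [T.map_eq, T.bind_assoc, T.pure_bind]

end FMonad

/-- The monad induced by a polynomial monad. -/
def PolyMonad.toF {I : Type} (M : PolyMonad I) : FMonad I where
  F := M.Ext
  map f _ z := ⟨z.1, fun j e => f j (z.2 j e)⟩
  pure := M.pure
  bind := M.bind
  pure_bind := M.pure_bind
  bind_pure := M.bind_pure
  bind_assoc := M.bind_assoc
  map_eq {_ Y} f {i} z :=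
    (M.bind_pure (X := Y) (⟨z.1, fun j e => f j (z.2 j e)⟩ : M.Ext Y i)).symm

/-! ### Generalized multicategories. -/

/-- A composable pair: a cell together with a labelled operation of cells whose targets are the
sources of the former. -/
def CompPair {I : Type} (T : FMonad I) {C X : I → Type} (t : ∀ j, X j → C j)
    (s : ∀ j, X j → T.F C j) (j : I) : Type :=
  {p : X j × T.F X j // T.map t p.2 = s j p.1}

/-- Generalized multicategories for a monad on families of sets: the inputs of an arrow form a
`T`-labelled family of objects. -/
structure Multi {I : Type} (T : FMonad I) where
  C : I → Type
  X : I → Type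
  t : ∀ j, X j → C j
  s : ∀ j, X j → T.F C j
  one : ∀ j, C j → X j
  comp : ∀ {i : I} (x : X i) (z : T.F X i), T.map t z = s i x → X i
  t_one : ∀ {i : I} (c : C i), t i (one i c) = c
  s_one : ∀ {i : I} (c : C i), s i (one i c) = T.pure c
  t_comp : ∀ {i : I} (x : X i) (z : T.F X i) (h : T.map t z = s i x), t i (comp x z h) = t i x
  s_comp : ∀ {i : I} (x : X i) (z : T.F X i) (h : T.map t z = s i x),
    s i (comp x z h) = T.bind z s
  one_comp : ∀ {i : I} (x : X i) (h : T.map t (T.pure x) = s i (one i (t i x))),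
    comp (one i (t i x)) (T.pure x) h = x
  comp_one : ∀ {i : I} (x : X i) (h : T.map t (T.map one (s i x)) = s i x),
    comp x (T.map one (s i x)) h = x
  -- Both levels above `x` are encoded by a single `T`-labelled family of composable pairs, so the
  -- law makes sense without `T` preserving pullbacks. The conditions `h'` and `h''` follow from `h`
  -- and the laws for `s` and `t`; as arguments they can be instantiated by any proof at hand.
  comp_assoc : ∀ {i : I} (x : X i) (ζ : T.F (CompPair T t s) i)
    (h : T.map t (T.map (fun _ p => p.1.1) ζ) = s i x)
    (h' : T.map t (T.bind ζ (fun _ p => p.1.2)) = s i (comp x (T.map (fun _ p => p.1.1) ζ) h))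
    (h'' : T.map t (T.map (fun _ p => comp p.1.1 p.1.2 p.2) ζ) = s i x),
    comp (comp x (T.map (fun _ p => p.1.1) ζ) h) (T.bind ζ (fun _ p => p.1.2)) h' =
      comp x (T.map (fun _ p => comp p.1.1 p.1.2 p.2) ζ) h''

namespace Multi

variable {I : Type} {T : FMonad I}

/-- The composability proof depends on both arguments, so they cannot be rewritten in place; all
later replacements inside a composite go through this. -/
theorem comp_congr (N : Multi T) {i : I} {x x' : N.X i} {z z' : T.F N.X i}
    (h : T.map N.t z = N.s i x) (hx : x = x') (hz : z = z') :
    N.comp x z h = N.comp x' z' (hx ▸ hz ▸ h) := by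
  subst hx
  subst hz
  rfl

/-- Morphisms of generalized multicategories. -/
@[ext]
structure Hom (N N' : Multi T) where
  c : ∀ j, N.C j → N'.C j
  x : ∀ j, N.X j → N'.X j
  t : ∀ {j : I} (y : N.X j), N'.t j (x j y) = c j (N.t j y)
  s : ∀ {j : I} (y : N.X j), N'.s j (x j y) = T.map c (N.s j y)
  one : ∀ {j : I} (y : N.C j), x j (N.one j y) = N'.one j (c j y)
  comp : ∀ {i : I} (y : N.X i) (z : T.F N.X i) (h : T.map N.t z = N.s i y)
    (h' : T.map N'.t (T.map x z) = N'.s i (x i y)),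
    x i (N.comp y z h) = N'.comp (x i y) (T.map x z) h'

/-- Composability is preserved by everything that commutes with `t` and `s`, so the hypothesis `h'`
in `Hom.comp` is always available. -/
theorem Hom.compat {N N' : Multi T} (f : Hom N N') {i : I} {y : N.X i} {z : T.F N.X i}
    (h : T.map N.t z = N.s i y) : T.map N'.t (T.map f.x z) = N'.s i (f.x i y) := by
  rw [T.map_map, f.s, ← h, T.map_map]
  congr 1
  funext j y
  exact f.t y

instance : Category (Multi T) where
  Hom := Hom
  id N := ⟨fun _ c => c, fun _ x => x, fun _ => rfl, fun _ => (T.map_id _).symm, fun _ => rfl,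
    fun y z h h' => N.comp_congr h rfl (T.map_id _).symm⟩
  comp {N N' N''} f g :=
    { c := fun j y => g.c j (f.c j y)
      x := fun j y => g.x j (f.x j y)
      t := fun y => by rw [g.t, f.t]
      s := fun y => by rw [g.s, f.s, T.map_map]
      one := fun y => by rw [f.one, g.one]
      comp := fun y z h h' => by
        rw [f.comp y z h (f.compat h), g.comp _ _ _ (g.compat (f.compat h))]
        exact N''.comp_congr _ rfl (T.map_map _ _ _) }

/-- The structure is algebraic: each law for the inverse maps can be tested after applying `f`,
where it becomes the law for `f`. Essential surjectivity below is always proved by exhibiting such a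
bijective morphism. -/
theorem isIso_of_bijective {N N' : Multi T} (f : N ⟶ N')
    (hc : ∀ j, Function.Bijective (Hom.c f j)) (hx : ∀ j, Function.Bijective (Hom.x f j)) :
    IsIso f := by
  choose gc hgc using fun j => (hc j).2
  choose gx hgx using fun j => (hx j).2
  have hc1 : ∀ j c, gc j (Hom.c f j c) = c := fun j c => (hc j).1 (hgc j _)
  have hx1 : ∀ j c, gx j (Hom.x f j c) = c := fun j c => (hx j).1 (hgx j _)
  have mc : ∀ {i : I} (z : T.F N.C i), T.map gc (T.map (Hom.c f) z) = z := fun z => by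
    rw [T.map_map]
    simp only [hc1]
    exact T.map_id z
  have mx : ∀ {i : I} (z : T.F N'.X i), T.map (Hom.x f) (T.map gx z) = z := fun z => by
    rw [T.map_map]
    simp only [hgx]
    exact T.map_id z
  have hs : ∀ {j : I} (y : N'.X j), N.s j (gx j y) = T.map gc (N'.s j y) := fun {j} y => by
    conv_rhs => rw [← hgx j y, Hom.s f, mc]
  have ht : ∀ {j : I} (y : N'.X j), N.t j (gx j y) = gc j (N'.t j y) := fun {j} y => by
    conv_rhs => rw [← hgx j y, Hom.t f, hc1]
  let g : Hom N' N :=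
    { c := gc
      x := gx
      t := ht
      s := hs
      one := fun {j} y => by
        apply (hx j).1
        rw [hgx, Hom.one f, hgc]
      comp := fun {i} y z h h' => by
        apply (hx i).1
        rw [hgx, Hom.comp f _ _ h' (Hom.compat f h')]
        exact N'.comp_congr _ (hgx _ _).symm (mx z).symm }
  refine ⟨g, Hom.ext ?_ ?_, Hom.ext ?_ ?_⟩
  · exact funext fun j => funext fun c => hc1 j c
  · exact funext fun j => funext fun c => hx1 j c
  · exact funext fun j => funext fun c => hgc j c
  · exact funext fun j => funext fun c => hgx j c

/-- The generalized multicategories with exactly one object of each sort. -/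
def OneObj (T : FMonad I) : ObjectProperty (Multi T) := fun N => ∀ i, Nonempty (Unique (N.C i))

theorem OneObj.of_iso {N N' : Multi T} (e : N ≅ N') (h : OneObj T N) : OneObj T N' := by
  intro i
  obtain ⟨u⟩ := h i
  have h1 : ∀ c, Hom.c e.hom i (Hom.c e.inv i c) = c := fun c =>
    congrFun (congrFun (congrArg Hom.c e.inv_hom_id) i) c
  exact ⟨⟨⟨Hom.c e.hom i u.default⟩, fun c => by
    rw [← h1 c]
    exact congrArg _ (u.uniq _)⟩⟩

end Multi

/-- Isomorphisms of monads on families of sets. -/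
structure FMonad.Iso {I : Type} (T T' : FMonad I) where
  e : ∀ (X : I → Type) (i : I), T.F X i ≃ T'.F X i
  pure : ∀ {X : I → Type} {i : I} (x : X i), e X i (T.pure x) = T'.pure x
  bind : ∀ {X Y : I → Type} {i : I} (z : T.F X i) (f : ∀ j, X j → T.F Y j),
    e Y i (T.bind z f) = T'.bind (e X i z) (fun j x => e Y j (f j x))

namespace FMonad.Iso

variable {I : Type} {T T' : FMonad I} (φ : T.Iso T')

theorem map {X Y : I → Type} {i : I} (f : ∀ j, X j → Y j) (z : T.F X i) :
    φ.e Y i (T.map f z) = T'.map f (φ.e X i z) := by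
  rw [T.map_eq, T'.map_eq, φ.bind]
  simp only [φ.pure]

/-- The inverse of an isomorphism of monads. -/
def symm : T'.Iso T where
  e X i := (φ.e X i).symm
  pure x := by rw [Equiv.symm_apply_eq, φ.pure]
  bind z f := by
    rw [Equiv.symm_apply_eq, φ.bind]
    simp only [Equiv.apply_symm_apply]

theorem comp_cond {C X : I → Type} {t : ∀ j, X j → C j} {i : I} {w : T'.F C i} {z : T.F X i}
    (h : T.map t z = (φ.e C i).symm w) : T'.map t (φ.e X i z) = w := by
  rw [← φ.map, h, Equiv.apply_symm_apply]

/-- The transport of a generalized multicategory along an isomorphism of monads. -/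
def transportObj (N : Multi T') : Multi T where
  C := N.C
  X := N.X
  t := N.t
  s j x := (φ.e _ _).symm (N.s j x)
  one := N.one
  comp x z h := N.comp x (φ.e _ _ z) (φ.comp_cond h)
  t_one := N.t_one
  s_one c := by rw [N.s_one]; exact φ.symm.pure c
  t_comp x z h := N.t_comp x _ _
  s_comp x z h := by
    rw [N.s_comp]
    refine (φ.symm.bind _ _).trans ?_
    exact congrArg (fun w => T.bind w _) (Equiv.symm_apply_apply _ _)
  one_comp x h := by
    refine Eq.trans ?_ (N.one_comp x (φ.pure x ▸ φ.comp_cond h))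
    exact N.comp_congr _ rfl (φ.pure x)
  comp_one x h := by
    have e : φ.e N.X _ (T.map N.one ((φ.e N.C _).symm (N.s _ x))) = T'.map N.one (N.s _ x) := by
      rw [φ.map, Equiv.apply_symm_apply]
    exact (N.comp_congr (φ.comp_cond h) rfl e).trans (N.comp_one x _)
  comp_assoc {i} x ζ h h' h'' := by
    -- Composable pairs for `T` become composable pairs for `T'` when `φ` is applied to the second
    -- component. Pushing `ζ` along `φ` and `θ` matches the three families in the two associativity
    -- laws.
    let θ : ∀ j, CompPair T N.t (fun j x => (φ.e _ _).symm (N.s j x)) j →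
        CompPair T' N.t N.s j := fun j p => ⟨(p.1.1, φ.e _ _ p.1.2), φ.comp_cond p.2⟩
    have e1 : φ.e _ _ (T.map (fun _ p => p.1.1) ζ) =
        T'.map (fun _ p => p.1.1) (T'.map θ (φ.e _ _ ζ)) := by
      rw [φ.map, T'.map_map]
    have e2 : φ.e _ _ (T.bind ζ (fun _ p => p.1.2)) =
        T'.bind (T'.map θ (φ.e _ _ ζ)) (fun _ p => p.1.2) := by
      rw [φ.bind, T'.bind_map]
    have e3 : φ.e _ _ (T.map (fun _ p => N.comp p.1.1 (φ.e _ _ p.1.2) (φ.comp_cond p.2)) ζ) =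
        T'.map (fun _ p => N.comp p.1.1 p.1.2 p.2) (T'.map θ (φ.e _ _ ζ)) := by
      rw [φ.map, T'.map_map]
    refine (N.comp_congr _ (N.comp_congr _ rfl e1) e2).trans ?_
    refine (N.comp_assoc x _ _ _ ?_).trans (N.comp_congr _ rfl e3.symm)
    rw [← e3]
    exact φ.comp_cond h''

/-- Transport of generalized multicategories along an isomorphism of monads. -/
def transport : Multi T' ⥤ Multi T where
  obj := φ.transportObj
  map {N N'} f :=
    { c := Multi.Hom.c (N := N) (N' := N') f
      x := Multi.Hom.x (N := N) (N' := N') f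
      t := Multi.Hom.t (N := N) (N' := N') f
      s := fun y => (congrArg _ (Multi.Hom.s f y)).trans (φ.symm.map _ _)
      one := Multi.Hom.one (N := N) (N' := N') f
      comp := fun y z h h' => by
        refine (Multi.Hom.comp f y _ (φ.comp_cond h) (Multi.Hom.compat f (φ.comp_cond h))).trans ?_
        exact N'.comp_congr _ rfl (φ.map _ _).symm }

instance : φ.transport.Faithful where
  map_injective {N N'} _ _ h := Multi.Hom.ext
    (congrArg (Multi.Hom.c (N := φ.transportObj N) (N' := φ.transportObj N')) h)
    (congrArg (Multi.Hom.x (N := φ.transportObj N) (N' := φ.transportObj N')) h)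

instance : φ.transport.Full where
  map_surjective {N N'} := fun (f : Multi.Hom (φ.transportObj N) (φ.transportObj N')) => ⟨
    { c := f.c
      x := f.x
      t := f.t
      s := fun {j} y => by
        have := congrArg (φ.e _ _) ((f.s y).trans (φ.symm.map _ (N.s j y)).symm)
        exact (Equiv.apply_symm_apply _ _).symm.trans (this.trans (Equiv.apply_symm_apply _ _))
      one := f.one
      comp := fun {i} y z h h' => by
        have hz : φ.e N.X i ((φ.e N.X i).symm z) = z := Equiv.apply_symm_apply _ _
        have h1 : T.map N.t ((φ.e N.X i).symm z) = (φ.e _ _).symm (N.s i y) :=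
          (φ.symm.map N.t z).symm.trans (congrArg _ h)
        have := f.comp y _ h1 (f.compat h1)
        refine (congrArg (f.x i) (N.comp_congr h rfl hz.symm)).trans (this.trans ?_)
        refine N'.comp_congr _ rfl ?_
        refine (φ.map _ _).trans ?_
        exact congrArg (T'.map f.x) hz }, rfl⟩

/-- Transport along `φ.symm` followed by transport along `φ` changes neither objects nor arrows, and
changes sources by a map and its inverse; the identity functions are therefore a bijective morphism.
-/
instance : φ.transport.EssSurj where
  mem_essImage N := by
    let f : Multi.Hom (φ.transport.obj (φ.symm.transportObj N)) N :=
      { c := fun _ c => c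
        x := fun _ x => x
        t := fun _ => rfl
        s := fun y => (Equiv.symm_apply_apply (φ.e _ _) _).symm.trans (T.map_id _).symm
        one := fun _ => rfl
        comp := fun y z h h' => N.comp_congr _ rfl
          ((Equiv.symm_apply_apply (φ.e _ _) _).trans (T.map_id _).symm) }
    have := Multi.isIso_of_bijective f (fun _ => Function.bijective_id)
      (fun _ => Function.bijective_id)
    exact ⟨_, ⟨asIso (C := Multi T) f⟩⟩

end FMonad.Iso

/-- Fully faithful functors with the same essential image have equivalent domains. -/
theorem nonempty_equivalence_of_essImage {A B D : Type*} [Category A] [Category B] [Category D]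
    (F : A ⥤ D) (G : B ⥤ D) [F.Full] [F.Faithful] [G.Full] [G.Faithful]
    (h : ∀ d, F.essImage d ↔ G.essImage d) : Nonempty (A ≌ B) := by
  have h' : F.essImage = G.essImage := by
    ext d
    exact h d
  exact ⟨F.toEssImage.asEquivalence.trans
    ((ObjectProperty.fullSubcategoryCongr h').trans G.toEssImage.asEquivalence.symm)⟩

/-! ### Trees with decorated nodes over a polynomial monad. -/

namespace PolyMonad

open PolyEnd.Tree

variable {I : Type} (M : PolyMonad I) {D D' D'' : (Σ i, M.Op i) → Type} {X Y W : I → Type}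

/-- The reduction of a tree of decorated operations. -/
def evalD : ∀ {i : I}, (M.dec D).Tree Y i → M.Ext Y i
  | _, .leaf x => M.pure x
  | _, .node b c => M.bind (X := M.Ext Y) ⟨b.1, fun j e => evalD (c j e)⟩ (fun _ z => z)

theorem evalD_graft {i : I} (T : (M.dec D).Tree X i) (f : ∀ j, X j → (M.dec D).Tree Y j) :
    M.evalD (T.graft f) = M.bind (M.evalD T) (fun j x => M.evalD (f j x)) := by
  induction T with
  | leaf x => exact (M.pure_bind x (fun j x => M.evalD (f j x))).symm
  | node b c ih =>
    refine (congrArg (fun w => M.bind (X := M.Ext Y) (Y := Y) ⟨b.1, w⟩ (fun _ z => z))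
      (funext fun j => funext fun e => ih j e)).trans ?_
    exact (M.bind_assoc (X := M.Ext X) ⟨b.1, fun j e => M.evalD (c j e)⟩ (fun _ z => z)
      (fun j x => M.evalD (f j x))).symm

/-- Reduction does not see decorations, so the condition defining the operations of the Baez--Dolan
construction can be tested on decorated trees. These carry labels inside their nodes and avoid
families indexed by node addresses. -/
theorem evalD_toDec {i : I} (T : M.Tree Y i) (d : ∀ a, T.Node a → D a) :
    M.evalD (T.toDec d) = M.eval T := by
  induction T with
  | leaf x => rfl
  | node b c ih =>
    simp only [toDec, evalD, PolyMonadData.eval, ih]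

/-- The relabelling of the leaves of a tree. -/
def mapLeaf (g : ∀ j, X j → Y j) {i : I} (T : (M.dec D).Tree X i) : (M.dec D).Tree Y i :=
  T.graft (fun j x => .leaf (g j x))

theorem mapLeaf_graft (g : ∀ j, X j → Y j) {i : I} (T : (M.dec D).Tree X i)
    (f : ∀ j, Y j → (M.dec D).Tree W j) :
    (M.mapLeaf g T).graft f = T.graft (fun j x => f j (g j x)) :=
  graft_assoc _ _ _

theorem mapLeaf_mapLeaf (g : ∀ j, X j → Y j) (g' : ∀ j, Y j → W j) {i : I}
    (T : (M.dec D).Tree X i) :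
    M.mapLeaf g' (M.mapLeaf g T) = M.mapLeaf (fun j x => g' j (g j x)) T :=
  graft_assoc _ _ _

theorem mapLeaf_id {i : I} (T : (M.dec D).Tree X i) : M.mapLeaf (fun _ x => x) T = T :=
  graft_leaf T

theorem evalD_mapLeaf (g : ∀ j, X j → Y j) {i : I} (T : (M.dec D).Tree X i) :
    M.evalD (M.mapLeaf g T) = M.toF.map g (M.evalD T) :=
  (M.evalD_graft T _).trans (M.toF.map_eq g (M.evalD T)).symm

/-- The action of a map on the decorations of a tree. -/
def mapDec (α : ∀ a, D a → D' a) : ∀ {i : I}, (M.dec D).Tree Y i → (M.dec D').Tree Y i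
  | _, .leaf x => .leaf x
  | i, .node b c =>
    .node (P := M.dec D') (i := i) ⟨b.1, α _ b.2⟩ (fun j e => mapDec α (c j e))

theorem evalD_mapDec (α : ∀ a, D a → D' a) {i : I} (T : (M.dec D).Tree Y i) :
    M.evalD (M.mapDec α T) = M.evalD T := by
  induction T with
  | leaf x => rfl
  | node b c ih =>
    exact congrArg (fun w => M.bind (X := M.Ext Y) (Y := Y) ⟨b.1, w⟩ (fun _ z => z))
      (funext fun j => funext fun e => ih j e)

theorem mapDec_graft (α : ∀ a, D a → D' a) {i : I} (T : (M.dec D).Tree X i)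
    (f : ∀ j, X j → (M.dec D).Tree Y j) :
    M.mapDec α (T.graft f) = (M.mapDec α T).graft (fun j x => M.mapDec α (f j x)) := by
  induction T with
  | leaf x => rfl
  | node b c ih =>
    exact congrArg (PolyEnd.Tree.node _) (funext fun j => funext fun e => ih j e)

theorem mapDec_mapLeaf (α : ∀ a, D a → D' a) {i : I} (T : (M.dec D).Tree X i)
    (g : ∀ j, X j → Y j) : M.mapDec α (M.mapLeaf g T) = M.mapLeaf g (M.mapDec α T) :=
  M.mapDec_graft α T _

theorem mapDec_mapDec (α : ∀ a, D a → D' a) (β : ∀ a, D' a → D'' a) {i : I}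
    (T : (M.dec D).Tree X i) :
    M.mapDec β (M.mapDec α T) = M.mapDec (fun a d => β a (α a d)) T := by
  induction T with
  | leaf x => rfl
  | node b c ih =>
    exact congrArg (PolyEnd.Tree.node _) (funext fun j => funext fun e => ih j e)

theorem mapDec_id {i : I} (T : (M.dec D).Tree X i) : M.mapDec (fun _ d => d) T = T := by
  induction T with
  | leaf x => rfl
  | node b c ih =>
    exact congrArg (PolyEnd.Tree.node _) (funext fun j => funext fun e => ih j e)

theorem mapDec_toDec (α : ∀ a, D a → D' a) {i : I} (T : M.Tree Y i) (d : ∀ a, T.Node a → D a) :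
    M.mapDec α (T.toDec d) = T.toDec (fun a n => α a (d a n)) := by
  induction T with
  | leaf x => rfl
  | node b c ih =>
    exact congrArg (PolyEnd.Tree.node _) (funext fun j => funext fun e => ih j e _)

/-- The operations of the Baez--Dolan construction with decorated nodes. -/
def DOp (D : (Σ i, M.Op i) → Type) (a : Σ i, M.Op i) : Type :=
  {T : (M.dec D).Tree (M.In a.2) a.1 // M.evalD T = ⟨a.2, fun _ e => e⟩}

/-- The decorated corolla. -/
def corD {a : Σ i, M.Op i} (x : D a) : M.DOp D a :=
  ⟨.node (P := M.dec D) (i := a.1) ⟨a.2, x⟩ (fun _ e => .leaf e),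
    M.bind_pure (X := M.In a.2) ⟨a.2, fun _ e => e⟩⟩

/-- The substitution of trees into all nodes of a decorated tree. -/
def bindD (f : ∀ a, D a → M.DOp D' a) : ∀ {i : I}, (M.dec D).Tree Y i → (M.dec D').Tree Y i
  | _, .leaf x => .leaf x
  | _, .node b c => (f _ b.2).1.graft (fun j e => bindD f (c j e))

theorem bindD_graft (f : ∀ a, D a → M.DOp D' a) {i : I} (T : (M.dec D).Tree X i)
    (g : ∀ j, X j → (M.dec D).Tree Y j) :
    M.bindD f (T.graft g) = (M.bindD f T).graft (fun j x => M.bindD f (g j x)) := by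
  induction T with
  | leaf x => rfl
  | node b c ih =>
    simp only [graft, bindD]
    refine Eq.trans ?_ (graft_assoc _ _ _).symm
    congr 1
    funext j e
    exact ih j e

theorem bindD_mapLeaf (f : ∀ a, D a → M.DOp D' a) {i : I} (T : (M.dec D).Tree X i)
    (g : ∀ j, X j → Y j) : M.bindD f (M.mapLeaf g T) = M.mapLeaf g (M.bindD f T) :=
  M.bindD_graft f T _

theorem evalD_bindD (f : ∀ a, D a → M.DOp D' a) {i : I} (T : (M.dec D).Tree X i) :
    M.evalD (M.bindD f T) = M.evalD T := by
  induction T with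
  | leaf x => rfl
  | node b c ih =>
    refine (M.evalD_graft _ _).trans ?_
    rw [(f _ b.2).2]
    exact congrArg (fun w => M.bind (X := M.Ext X) (Y := X) ⟨b.1, w⟩ (fun _ z => z))
      (funext fun j => funext fun e => ih j e)

theorem bindD_mapDec (α : ∀ a, D a → D' a) (f : ∀ a, D' a → M.DOp D'' a) {i : I}
    (T : (M.dec D).Tree X i) :
    M.bindD f (M.mapDec α T) = M.bindD (fun a d => f a (α a d)) T := by
  induction T with
  | leaf x => rfl
  | node b c ih =>
    exact congrArg (PolyEnd.Tree.graft _) (funext fun j => funext fun e => ih j e)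

/-- The action of a map on decorated operations of the Baez--Dolan construction. -/
def DOp.map (α : ∀ a, D a → D' a) {a : Σ i, M.Op i} (T : M.DOp D a) : M.DOp D' a :=
  ⟨M.mapDec α T.1, (M.evalD_mapDec α T.1).trans T.2⟩

theorem mapDec_bindD (α : ∀ a, D' a → D'' a) (f : ∀ a, D a → M.DOp D' a) {i : I}
    (T : (M.dec D).Tree X i) :
    M.mapDec α (M.bindD f T) = M.bindD (fun a d => (f a d).map M α) T := by
  induction T with
  | leaf x => rfl
  | node b c ih =>
    refine (M.mapDec_graft α _ _).trans ?_
    exact congrArg (PolyEnd.Tree.graft _) (funext fun j => funext fun e => ih j e)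

/-- Substitution into decorated operations of the Baez--Dolan construction. -/
def DOp.bind {a : Σ i, M.Op i} (T : M.DOp D a) (f : ∀ a, D a → M.DOp D' a) : M.DOp D' a :=
  ⟨M.bindD f T.1, (M.evalD_bindD f T.1).trans T.2⟩

/-! ### Labelling leaves by the inputs of the reduction. -/

section taut

/-- The unique input of a unit. -/
noncomputable def oneEl (i : I) : M.In (M.one i) i := (M.one_bij i).some.default

theorem eq_oneEl {i : I} (e : M.In (M.one i) i) : e = M.oneEl i := (M.one_bij i).some.uniq e

/-- The input of a composite that corresponds to an input of one of its parts. -/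
noncomputable def mulInv {i : I} (b : M.Op i) (c : ∀ j, M.In b j → M.Op j) {k j : I}
    (e : M.In b j) (e' : M.In (c j e) k) : M.In (M.mul b c) k :=
  (Equiv.ofBijective _ (M.mul_bij b c k)).symm ⟨j, e, e'⟩

theorem mulIn_mulInv {i : I} (b : M.Op i) (c : ∀ j, M.In b j → M.Op j) {k j : I}
    (e : M.In b j) (e' : M.In (c j e) k) : M.mulIn b c (M.mulInv b c e e') = ⟨j, e, e'⟩ :=
  (Equiv.ofBijective _ (M.mul_bij b c k)).apply_symm_apply _

theorem mulInv_mulIn {i : I} (b : M.Op i) (c : ∀ j, M.In b j → M.Op j) {k : I}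
    (e : M.In (M.mul b c) k) :
    M.mulInv b c (M.mulIn b c e).2.1 (M.mulIn b c e).2.2 = e :=
  (Equiv.ofBijective _ (M.mul_bij b c k)).symm_apply_apply e

/-- The tautological labelling of the leaves of a tree by the inputs of its reduction. -/
noncomputable def taut : ∀ {i : I} (T : (M.dec D).Tree Y i), (M.dec D).Tree (M.In (M.evalD T).1) i
  | i, .leaf _ => .leaf (M.oneEl i)
  | i, .node b c => .node (P := M.dec D) (i := i) b (fun j e =>
      M.mapLeaf (fun _ e' => M.mulInv b.1 (fun j e => (M.evalD (c j e)).1) e e') (taut (c j e)))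

/-- The multiplication is bijective on inputs, so each leaf corresponds to an input of the reduction
and keeps its label there. Every tree is thus a relabelling of an operation of the Baez--Dolan
construction, and statements about such operations extend to all trees. -/
theorem mapLeaf_taut {i : I} (T : (M.dec D).Tree Y i) :
    M.mapLeaf (M.evalD T).2 (M.taut T) = T := by
  induction T with
  | leaf x => rfl
  | node b c ih =>
    refine congrArg (PolyEnd.Tree.node b) (funext fun j => funext fun e => ?_)
    refine (M.mapLeaf_mapLeaf _ _ _).trans (Eq.trans ?_ (ih j e))
    refine congrArg (fun g => M.mapLeaf g _) (funext fun k => funext fun e' => ?_)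
    have := M.mulIn_mulInv b.1 (fun j e => (M.evalD (c j e)).1) e e'
    exact congrArg (fun r : (Σ j, Σ e : M.In b.1 j, M.In (M.evalD (c j e)).1 k) =>
      (M.evalD (c r.1 r.2.1)).2 k r.2.2) this

theorem evalD_taut {i : I} (T : (M.dec D).Tree Y i) :
    M.evalD (M.taut T) = ⟨(M.evalD T).1, fun _ e => e⟩ := by
  induction T with
  | @leaf i x =>
    refine Sigma.ext rfl (heq_of_eq (funext fun j => funext fun e => ?_))
    have h := M.oneIn e
    subst h
    exact (M.eq_oneEl _).symm
  | node b c ih =>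
    have h : ∀ j e, M.evalD (M.mapLeaf (fun _ e' =>
        M.mulInv b.1 (fun j e => (M.evalD (c j e)).1) e e') (M.taut (c j e))) =
        ⟨(M.evalD (c j e)).1, fun _ e' =>
          M.mulInv b.1 (fun j e => (M.evalD (c j e)).1) e e'⟩ := fun j e => by
      refine (M.evalD_mapLeaf _ _).trans ?_
      exact congrArg (M.toF.map _) (ih j e)
    refine (congrArg (fun w => M.bind (X := M.Ext _) (Y := M.In (M.evalD (.node b c)).1) ⟨b.1, w⟩
      (fun _ z => z)) (funext fun j => funext fun e => h j e)).trans ?_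
    refine Sigma.ext rfl (heq_of_eq (funext fun k => funext fun e => ?_))
    exact M.mulInv_mulIn b.1 (fun j e => (M.evalD (c j e)).1) e

/-- The operation with decorated nodes given by an arbitrary decorated tree. -/
noncomputable def tautOp {i : I} (T : (M.dec D).Tree Y i) : M.DOp D ⟨i, (M.evalD T).1⟩ :=
  ⟨M.taut T, M.evalD_taut T⟩

theorem taut_mapLeaf (g : ∀ j, X j → Y j) {i : I} (T : (M.dec D).Tree X i) :
    (⟨(M.evalD (M.mapLeaf g T)).1, M.taut (M.mapLeaf g T)⟩ :
      Σ b : M.Op i, (M.dec D).Tree (M.In b) i) = ⟨(M.evalD T).1, M.taut T⟩ := by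
  induction T with
  | leaf x => rfl
  | @node i b c ih =>
    let F : (∀ j, M.In b.1 j → Σ b : M.Op j, (M.dec D).Tree (M.In b) j) →
        Σ b : M.Op i, (M.dec D).Tree (M.In b) i := fun w =>
      ⟨M.mul b.1 (fun j e => (w j e).1), .node (P := M.dec D) (i := i) b (fun j e =>
        M.mapLeaf (fun _ e' => M.mulInv b.1 (fun j e => (w j e).1) e e') (w j e).2)⟩
    exact congrArg F (funext fun j => funext fun e => ih j e)

/-- On an operation of the Baez--Dolan construction the tautological labelling gives nothing new.
The reduction equals `a.2` only up to a proof, hence the equality in a sigma type over the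
operation. -/
theorem taut_dop {a : Σ i, M.Op i} (T : M.DOp D a)
    {h : ∀ j, M.In a.2 j → Y j} :
    (⟨(M.evalD (M.mapLeaf h T.1)).1, M.taut (M.mapLeaf h T.1), (M.evalD (M.mapLeaf h T.1)).2⟩ :
      Σ b : M.Op a.1, (M.dec D).Tree (M.In b) a.1 × (∀ j, M.In b j → Y j)) = ⟨a.2, T.1, h⟩ := by
  have h1 := M.taut_mapLeaf h T.1
  have h2 := M.mapLeaf_taut T.1
  have h3 : M.evalD (M.mapLeaf h T.1) = ⟨a.2, h⟩ := by
    rw [evalD_mapLeaf, T.2]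
    rfl
  have h4 := T.2
  -- With reductions and labellings turned into variables, the equations for the reductions can be
  -- substituted. Then `h2` says that `τ'`, relabelled by the identity, is `T.1`, and `h1` says that
  -- `τ` is `τ'`.
  generalize M.taut (M.mapLeaf h T.1) = τ at *
  generalize M.evalD (M.mapLeaf h T.1) = z at *
  generalize M.taut T.1 = τ' at *
  generalize M.evalD T.1 = z' at *
  subst h3
  subst h4
  have h5 := (M.mapLeaf_id τ').symm.trans h2
  subst h5
  have h6 := eq_of_heq (Sigma.mk.inj_iff.1 h1).2
  subst h6
  rfl

end taut

/-! ### Colours of edges in decorated trees. -/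

section cond

variable {C : I → Type} (t : ∀ a, D a → C a.1) (s : ∀ a, D a → ∀ k, M.In a.2 k → C k)

/-- The agreement of colours along all edges of a decorated tree. -/
def CondD : ∀ {i : I} (_ : (M.dec D).Tree Y i) (_ : C i) (_ : ∀ j, Y j → C j), Prop
  | _, .leaf y, r, l => r = l _ y
  | i, .node b c, r, l => t ⟨i, b.1⟩ b.2 = r ∧ ∀ j e, CondD (c j e) (s ⟨i, b.1⟩ b.2 j e) l

variable {t s}

theorem CondD.graft {i : I} {T : (M.dec D).Tree X i} {r : C i} {l' : ∀ j, X j → C j}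
    {l : ∀ j, Y j → C j} (h : M.CondD t s T r l') {f : ∀ j, X j → (M.dec D).Tree Y j}
    (hf : ∀ j x, M.CondD t s (f j x) (l' j x) l) : M.CondD t s (T.graft f) r l := by
  induction T with
  | leaf x =>
    cases h
    exact hf _ x
  | node b c ih => exact ⟨h.1, fun j e => ih j e (h.2 j e)⟩

theorem condD_mapLeaf {i : I} {T : (M.dec D).Tree X i} {r : C i} {g : ∀ j, X j → Y j}
    {l : ∀ j, Y j → C j} :
    M.CondD t s (M.mapLeaf g T) r l ↔ M.CondD t s T r (fun j x => l j (g j x)) := by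
  induction T with
  | leaf x => exact Iff.rfl
  | node b c ih => exact and_congr Iff.rfl (forall_congr' fun j => forall_congr' fun e => ih j e)

theorem CondD.bindD {tB : ∀ a, D' a → C a.1} {sB : ∀ a, D' a → ∀ k, M.In a.2 k → C k}
    {f : ∀ a, D' a → M.DOp D a} (hf : ∀ a d, M.CondD t s (f a d).1 (tB a d) (sB a d)) {i : I}
    {T : (M.dec D').Tree X i} {r : C i} {l : ∀ j, X j → C j} (h : M.CondD tB sB T r l) :
    M.CondD t s (M.bindD f T) r l := by
  induction T with
  | leaf x => exact h
  | node b c ih =>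
    obtain ⟨rfl, h⟩ := h
    exact CondD.graft M (hf _ b.2) (fun j e => ih j e (h j e))

theorem CondD.mapDec {C' : I → Type} {tB : ∀ a, D' a → C' a.1}
    {sB : ∀ a, D' a → ∀ k, M.In a.2 k → C' k} {α : ∀ a, D a → D' a} {γ : ∀ j, C j → C' j}
    (ht : ∀ a d, tB a (α a d) = γ _ (t a d)) (hs : ∀ a d k e, sB a (α a d) k e = γ _ (s a d k e))
    {i : I} {T : (M.dec D).Tree X i} {r : C i} {l : ∀ j, X j → C j} (h : M.CondD t s T r l) :
    M.CondD tB sB (M.mapDec α T) (γ _ r) (fun j x => γ _ (l j x)) := by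
  induction T with
  | leaf x =>
    cases h
    rfl
  | @node i b c ih =>
    obtain ⟨rfl, h⟩ := h
    refine ⟨ht _ _, fun j e => ?_⟩
    have := ih j e (h j e)
    rwa [← hs ⟨i, b.1⟩ b.2 j e] at this

/-- Relabelling leaves moves the colouring along the labels, and by `mapLeaf_taut` the tree itself
is such a relabelling of its tautological version. -/
theorem condD_taut {i : I} {T : (M.dec D).Tree Y i} {r : C i} {l : ∀ j, Y j → C j}
    (h : M.CondD t s T r l) :
    M.CondD t s (M.taut T) r (fun j e => l j ((M.evalD T).2 j e)) := by
  rw [← condD_mapLeaf, mapLeaf_taut]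
  exact h

theorem condD_corD {a : Σ i, M.Op i} (x : D a) : M.CondD t s (M.corD x).1 (t a x) (s a x) :=
  ⟨rfl, fun _ _ => rfl⟩

variable (t s)

/-- Operations of the Baez--Dolan construction with decorated nodes and coloured edges. -/
structure ELab (a : Σ i, M.Op i) where
  op : M.DOp D a
  r : C a.1
  l : ∀ j, M.In a.2 j → C j
  cond : M.CondD t s op.1 r l

end cond

end PolyMonad

/-! ### Coloured algebras for the Baez--Dolan construction. -/

/-- Coloured algebras for the Baez--Dolan construction of `M`: cells that have the operations of
`M` as shapes, with coloured edges, such that trees of cells can be composed. -/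
structure EAlg {I : Type} (M : PolyMonad I) where
  C : I → Type
  X : (Σ i, M.Op i) → Type
  t : ∀ a, X a → C a.1
  s : ∀ a, X a → ∀ k, M.In a.2 k → C k
  act : ∀ a, M.ELab t s a → X a
  t_act : ∀ a (d : M.ELab t s a), t a (act a d) = d.r
  s_act : ∀ a (d : M.ELab t s a), s a (act a d) = d.l
  act_unit : ∀ a (x : X a), act a ⟨M.corD x, t a x, s a x, M.condD_corD x⟩ = x
  act_bind : ∀ a (ζ : M.DOp (M.ELab t s) a) r l
    (_ : M.CondD (fun _ d => d.r) (fun _ d => d.l) ζ.1 r l)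
    (h1 : M.CondD t s (ζ.bind M (fun _ d => d.op)).1 r l)
    (h2 : M.CondD t s (ζ.map M act).1 r l),
    act a ⟨ζ.bind M (fun _ d => d.op), r, l, h1⟩ = act a ⟨ζ.map M act, r, l, h2⟩

namespace EAlg

variable {I : Type} {M : PolyMonad I}

/-- Morphisms of coloured algebras. -/
@[ext]
structure Hom (E E' : EAlg M) where
  c : ∀ j, E.C j → E'.C j
  x : ∀ a, E.X a → E'.X a
  t : ∀ a (y : E.X a), E'.t a (x a y) = c _ (E.t a y)
  s : ∀ a (y : E.X a) k e, E'.s a (x a y) k e = c _ (E.s a y k e)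
  act : ∀ a (d : M.ELab E.t E.s a), x a (E.act a d) =
    E'.act a ⟨d.op.map M x, c _ d.r, fun j e => c _ (d.l j e), d.cond.mapDec M t s⟩

theorem act_congr (E : EAlg M) {a : Σ i, M.Op i} {d d' : M.ELab E.t E.s a} (h : d.op.1 = d'.op.1)
    (hr : d.r = d'.r) (hl : d.l = d'.l) : E.act a d = E.act a d' := by
  obtain ⟨⟨T, hT⟩, r, l, h1⟩ := d
  obtain ⟨⟨T', hT'⟩, r', l', h1'⟩ := d'
  cases h
  cases hr
  cases hl
  rfl

instance : Category (EAlg M) where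
  Hom := Hom
  id E := ⟨fun _ c => c, fun _ x => x, fun _ _ => rfl, fun _ _ _ _ => rfl,
    fun a d => E.act_congr (M.mapDec_id _).symm rfl rfl⟩
  comp {E E' E''} f g :=
    { c := fun j y => g.c j (f.c j y)
      x := fun j y => g.x j (f.x j y)
      t := fun a y => by rw [g.t, f.t]
      s := fun a y k e => by rw [g.s, f.s]
      act := fun a d => by
        rw [f.act, g.act]
        exact E''.act_congr (M.mapDec_mapDec _ _ _) rfl rfl }

end EAlg

/-! ### From coloured algebras to generalized multicategories. -/

namespace EAlg

open PolyMonad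

variable {I : Type} {M : PolyMonad I} (E : EAlg M) {X Y W : I → Type}

/-- The composite of an arbitrary tree of cells. -/
noncomputable def actT {i : I} (T : (M.dec E.X).Tree Y i) (r : E.C i) (l : ∀ j, Y j → E.C j)
    (h : M.CondD E.t E.s T r l) : Σ b : M.Op i, E.X ⟨i, b⟩ :=
  ⟨(M.evalD T).1, E.act ⟨i, (M.evalD T).1⟩ ⟨M.tautOp T, r, _, M.condD_taut h⟩⟩

variable {E}

theorem actT_congr {i : I} {T T' : (M.dec E.X).Tree Y i} {r : E.C i} {l : ∀ j, Y j → E.C j}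
    (h : M.CondD E.t E.s T r l) (hT : T = T') : E.actT T r l h = E.actT T' r l (hT ▸ h) := by
  subst hT
  rfl

/-- `actT` goes through the tautological labelling of its argument; `taut_dop` shows that for an
operation with relabelled leaves this recovers the original action. -/
theorem actT_mapLeaf_dop {a : Σ i, M.Op i} (T : M.DOp E.X a) (g : ∀ j, M.In a.2 j → Y j)
    (r : E.C a.1) (l : ∀ j, Y j → E.C j) (h : M.CondD E.t E.s (M.mapLeaf g T.1) r l) :
    E.actT (M.mapLeaf g T.1) r l h =
      ⟨a.2, E.act a ⟨T, r, fun j e => l j (g j e), (M.condD_mapLeaf).1 h⟩⟩ := by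
  have h1 := M.taut_dop T (h := g)
  have h2 := M.evalD_taut (M.mapLeaf g T.1)
  have h3 := M.condD_taut h
  have h4 : E.actT (M.mapLeaf g T.1) r l h = ⟨_, E.act ⟨a.1, _⟩ ⟨⟨_, h2⟩, r, _, h3⟩⟩ := rfl
  rw [h4]
  clear h4
  generalize M.taut (M.mapLeaf g T.1) = τ at *
  generalize M.evalD (M.mapLeaf g T.1) = z at *
  obtain ⟨b, g'⟩ := z
  cases h1
  rfl

theorem actT_mapLeaf (g : ∀ j, X j → Y j) {i : I} (T : (M.dec E.X).Tree X i) (r : E.C i)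
    (l : ∀ j, Y j → E.C j) (h : M.CondD E.t E.s (M.mapLeaf g T) r l) :
    E.actT (M.mapLeaf g T) r l h =
      E.actT T r (fun j x => l j (g j x)) ((M.condD_mapLeaf).1 h) := by
  have e : M.mapLeaf g T = M.mapLeaf (fun j x => g j ((M.evalD T).2 j x)) (M.taut T) := by
    conv_lhs => rw [← M.mapLeaf_taut T]
    exact M.mapLeaf_mapLeaf _ _ _
  rw [actT_congr h e]
  exact actT_mapLeaf_dop (M.tautOp T) _ r l _

/-- The axiom `act_bind` without the constraint on leaf labels: both trees are relabellings, along
the same map, of trees built from `M.tautOp T`. -/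
theorem actT_bindD {i : I} (T : (M.dec (M.ELab E.t E.s)).Tree Y i) (r : E.C i)
    (l : ∀ j, Y j → E.C j) (h : M.CondD (fun _ d => d.r) (fun _ d => d.l) T r l)
    (h1 : M.CondD E.t E.s (M.bindD (fun _ d => d.op) T) r l)
    (h2 : M.CondD E.t E.s (M.mapDec E.act T) r l) :
    E.actT (M.bindD (fun _ d => d.op) T) r l h1 = E.actT (M.mapDec E.act T) r l h2 := by
  have e1 : M.bindD (fun _ d => d.op) T =
      M.mapLeaf (M.evalD T).2 ((M.tautOp T).bind M (fun _ d => d.op)).1 := by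
    conv_lhs => rw [← M.mapLeaf_taut T]
    exact M.bindD_mapLeaf _ _ _
  have e2 : M.mapDec E.act T = M.mapLeaf (M.evalD T).2 ((M.tautOp T).map M E.act).1 := by
    conv_lhs => rw [← M.mapLeaf_taut T]
    exact M.mapDec_mapLeaf _ _ _
  rw [actT_congr h1 e1, actT_congr h2 e2]
  refine (actT_mapLeaf_dop _ _ _ _ _).trans (Eq.trans ?_ (actT_mapLeaf_dop _ _ _ _ _).symm)
  refine congrArg (Sigma.mk (M.evalD T).1) ?_
  exact E.act_bind _ (M.tautOp T) r _ (M.condD_taut h) _ _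

theorem t_actT {i : I} (T : (M.dec E.X).Tree Y i) (r : E.C i) (l : ∀ j, Y j → E.C j)
    (h : M.CondD E.t E.s T r l) : E.t _ (E.actT T r l h).2 = r := E.t_act _ _

theorem s_actT {i : I} (T : (M.dec E.X).Tree Y i) (r : E.C i) (l : ∀ j, Y j → E.C j)
    (h : M.CondD E.t E.s T r l) :
    (⟨(E.actT T r l h).1, E.s _ (E.actT T r l h).2⟩ : M.Ext E.C i) = M.toF.map l (M.evalD T) :=
  congrArg (Sigma.mk (M.evalD T).1) (E.s_act _ _)

variable (E)

/-- The family of all cells. -/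
abbrev Tot (i : I) : Type := Σ b : M.Op i, E.X ⟨i, b⟩

/-- The targets of cells. -/
abbrev totT (i : I) (x : E.Tot i) : E.C i := E.t _ x.2

/-- The sources of cells. -/
abbrev totS (i : I) (x : E.Tot i) : M.Ext E.C i := ⟨x.1, E.s _ x.2⟩

variable {E}

/-- The corolla on a cell. -/
def cor {i : I} (x : E.Tot i) : (M.dec E.X).Tree E.C i :=
  .node (P := M.dec E.X) (i := i) x (fun j e => .leaf (E.s _ x.2 j e))

theorem condD_cor {i : I} (x : E.Tot i) : M.CondD E.t E.s (cor x) (E.totT i x) (fun _ c => c) :=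
  ⟨rfl, fun _ _ => rfl⟩

theorem evalD_cor {i : I} (x : E.Tot i) : M.evalD (cor x) = E.totS i x :=
  M.bind_pure (X := E.C) (E.totS i x)

theorem actT_cor {i : I} (x : E.Tot i) : E.actT (cor x) _ _ (condD_cor x) = x := by
  have e : cor x = M.mapLeaf (E.s _ x.2) (M.corD (D := E.X) (a := ⟨i, x.1⟩) x.2).1 := rfl
  rw [actT_congr _ e]
  refine (actT_mapLeaf_dop (a := ⟨i, x.1⟩) _ _ _ _ _).trans ?_
  exact Sigma.ext rfl (heq_of_eq (E.act_unit _ x.2))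

/-- A cell, as a cell over an equal operation. -/
def castX {i : I} {b b' : M.Op i} (h : b' = b) (x : E.X ⟨i, b⟩) : E.X ⟨i, b'⟩ := h ▸ x

/-- Over one and the same operation `b`, composability is an equation for each input. This is why
the bases of `x` and `z` are identified before anything else in the proofs below. -/
theorem cond_iff {i : I} {b : M.Op i} {x : E.X ⟨i, b⟩} {z : ∀ j, M.In b j → E.Tot j} :
    M.toF.map E.totT ⟨b, z⟩ = E.totS i ⟨b, x⟩ ↔ ∀ j e, E.totT j (z j e) = E.s _ x j e := by
  refine ⟨fun h j e => ?_, fun h => ?_⟩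
  · exact congrFun (congrFun (eq_of_heq (Sigma.mk.inj_iff.1 h).2) j) e
  · exact congrArg (Sigma.mk b) (funext fun j => funext fun e => h j e)

/-- The tree with two levels given by a cell and cells grafted onto it. -/
def two {i : I} (x : E.Tot i) (z : M.Ext E.Tot i) (h : z.1 = x.1) : (M.dec E.X).Tree E.C i :=
  .node (P := M.dec E.X) (i := i) ⟨z.1, castX h x.2⟩ (fun j e => cor (z.2 j e))

theorem condD_two {i : I} (x : E.Tot i) (z : M.Ext E.Tot i)
    (h : M.toF.map E.totT z = E.totS i x) :
    M.CondD E.t E.s (two x z (congrArg Sigma.fst h)) (E.totT i x) (fun _ c => c) := by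
  obtain ⟨b, x⟩ := x
  obtain ⟨b', z⟩ := z
  obtain rfl : b' = b := congrArg Sigma.fst h
  refine ⟨rfl, fun j e => ?_⟩
  have := condD_cor (z j e)
  rwa [cond_iff.1 h j e] at this

theorem evalD_two {i : I} (x : E.Tot i) (z : M.Ext E.Tot i) (h : z.1 = x.1) :
    M.evalD (two x z h) = M.toF.bind z E.totS :=
  congrArg (fun w => M.bind (X := M.Ext E.C) (Y := E.C) ⟨z.1, w⟩ (fun _ z => z))
    (funext fun j => funext fun e => evalD_cor (z.2 j e))

/-- The composition of cells. -/
noncomputable def compT {i : I} (x : E.Tot i) (z : M.Ext E.Tot i)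
    (h : M.toF.map E.totT z = E.totS i x) : E.Tot i :=
  E.actT (two x z (congrArg Sigma.fst h)) (E.totT i x) (fun _ c => c) (condD_two x z h)

theorem compT_congr {i : I} {x x' : E.Tot i} {z z' : M.Ext E.Tot i}
    (h : M.toF.map E.totT z = E.totS i x) (hx : x = x') (hz : z = z') :
    compT x z h = compT x' z' (hx ▸ hz ▸ h) := by
  subst hx
  subst hz
  rfl

/-- Grafting is substitution into a tree with two levels: the root node is to be replaced by `T` and
the nodes above it by the trees `f j x`. Associativity for substitution then says that one may first
compose each of these trees and afterwards the two levels, which is `compT`. -/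
theorem actT_graft {i : I} (T : (M.dec E.X).Tree X i) (r : E.C i) (l' : ∀ j, X j → E.C j)
    (h : M.CondD E.t E.s T r l') (f : ∀ j, X j → (M.dec E.X).Tree Y j) (l : ∀ j, Y j → E.C j)
    (hf : ∀ j x, M.CondD E.t E.s (f j x) (l' j x) l)
    (hg : M.CondD E.t E.s (T.graft f) r l)
    (hc : M.toF.map E.totT (M.toF.map (fun j x => E.actT (f j x) (l' j x) l (hf j x)) (M.evalD T))
      = E.totS i (E.actT T r l' h)) :
    E.actT (T.graft f) r l hg = compT (E.actT T r l' h)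
      (M.toF.map (fun j x => E.actT (f j x) (l' j x) l (hf j x)) (M.evalD T)) hc := by
  let R : M.ELab E.t E.s ⟨i, (M.evalD T).1⟩ := ⟨M.tautOp T, r, _, M.condD_taut h⟩
  let K : ∀ j (x : X j), M.ELab E.t E.s ⟨j, (M.evalD (f j x)).1⟩ := fun j x =>
    ⟨M.tautOp (f j x), l' j x, _, M.condD_taut (hf j x)⟩
  -- The tree with two levels whose nodes carry the coloured trees `R` and `K`. Substituting them
  -- gives `T.graft f` (`h1`), and composing them gives the tree that defines `compT`, once its
  -- leaves are relabelled by their colours (`h2`).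
  let S : (M.dec (M.ELab E.t E.s)).Tree Y i :=
    .node (P := M.dec (M.ELab E.t E.s)) (i := i) ⟨_, R⟩ (fun j e =>
      .node (P := M.dec (M.ELab E.t E.s)) (i := j) ⟨_, K j ((M.evalD T).2 j e)⟩
        (fun k e' => .leaf ((M.evalD (f j ((M.evalD T).2 j e))).2 k e')))
  have hS : M.CondD (fun _ d => d.r) (fun _ d => d.l) S r l :=
    ⟨rfl, fun j e => ⟨rfl, fun k e' => rfl⟩⟩
  have h1 : T.graft f = M.bindD (fun _ d => d.op) S := by
    conv_lhs => rw [← M.mapLeaf_taut T]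
    refine (M.mapLeaf_graft _ _ _).trans ?_
    refine congrArg (PolyEnd.Tree.graft (M.taut T)) (funext fun j => funext fun e => ?_)
    exact (M.mapLeaf_taut _).symm
  have h2 : M.mapLeaf l (M.mapDec E.act S) = two (E.actT T r l' h)
      (M.toF.map (fun j x => E.actT (f j x) (l' j x) l (hf j x)) (M.evalD T)) rfl := by
    refine congrArg (PolyEnd.Tree.node (P := M.dec E.X) _) (funext fun j => funext fun e => ?_)
    refine congrArg (PolyEnd.Tree.node (P := M.dec E.X) _) (funext fun k => funext fun e' => ?_)
    exact congrArg PolyEnd.Tree.leaf 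
      (congrFun (congrFun (E.s_act _ (K j ((M.evalD T).2 j e))) k) e').symm
  have hd : M.CondD E.t E.s (M.mapDec E.act S) r l := by
    refine (M.condD_mapLeaf (g := l) (l := fun _ c => c)).1 ?_
    rw [h2]
    have := condD_two _ _ hc
    rwa [show E.totT i (E.actT T r l' h) = r from t_actT T r l' h] at this
  rw [actT_congr hg h1, actT_bindD S r l hS _ hd]
  refine (actT_mapLeaf l (M.mapDec E.act S) r (fun _ c => c) ((M.condD_mapLeaf).2 hd)).symm.trans ?_
  rw [actT_congr _ h2]
  have e := (t_actT T r l' h).symm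
  unfold compT
  congr 1

/-- The same statement with variables for the composed cells, so that it applies to a given
composite. -/
theorem actT_graft' {i : I} (T : (M.dec E.X).Tree X i) (r : E.C i) (l' : ∀ j, X j → E.C j)
    (h : M.CondD E.t E.s T r l') (f : ∀ j, X j → (M.dec E.X).Tree Y j) (l : ∀ j, Y j → E.C j)
    (hf : ∀ j x, M.CondD E.t E.s (f j x) (l' j x) l)
    {x : E.Tot i} {z : M.Ext E.Tot i} (hx : x = E.actT T r l' h)
    (hz : z = M.toF.map (fun j x => E.actT (f j x) (l' j x) l (hf j x)) (M.evalD T))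
    (hc : M.toF.map E.totT z = E.totS i x) :
    compT x z hc = E.actT (T.graft f) r l (h.graft M hf) := by
  subst hx
  subst hz
  exact (actT_graft T r l' h f l hf _ hc).symm

/-- The generalized multicategory of cells. -/
noncomputable def toMultiObj (E : EAlg M) : Multi M.toF where
  C := E.C
  X := E.Tot
  t := E.totT
  s := E.totS
  one j c := E.actT (.leaf c) c (fun _ c => c) rfl
  comp x z h := compT x z h
  t_one c := t_actT _ _ _ _
  s_one c := (s_actT _ _ _ _).trans (M.toF.map_id _)
  t_comp x z h := t_actT _ _ _ _
  s_comp x z h := by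
    refine (s_actT _ _ _ _).trans ?_
    exact (congrArg _ (evalD_two x z _)).trans (M.toF.map_id _)
  one_comp {i} x h := by
    refine (actT_graft' (T := .leaf x) (r := E.totT i x) (l' := E.totT)
      rfl (fun j x => cor x) (fun _ c => c) (fun j x => condD_cor x) ?_ ?_ h).trans (actT_cor x)
    · exact actT_mapLeaf (X := E.Tot) (Y := E.C) E.totT (.leaf x) (E.totT i x) (fun _ c => c) rfl
    · refine Eq.trans ?_ (M.toF.map_pure _ x).symm
      rw [actT_cor]
  comp_one {i} x h := by
    refine (actT_graft' (T := cor x) (r := E.totT i x) (l' := fun _ c => c)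
      (condD_cor x) (fun j c => .leaf c) (fun _ c => c) (fun j c => rfl) (actT_cor x).symm ?_ h).trans ?_
    · rw [evalD_cor]
    · exact (actT_congr _ (PolyEnd.Tree.graft_leaf _)).trans (actT_cor x)
  comp_assoc {i} x ζ h h' h'' := by
    obtain ⟨b, x⟩ := x
    obtain ⟨b', ζ⟩ := ζ
    obtain rfl : b' = b := congrArg Sigma.fst h
    have hx := cond_iff.1 h
    rename' b' => b
    have hp : ∀ j (p : CompPair M.toF E.totT E.totS j), p.1.2.1 = p.1.1.1 := fun j p =>
      congrArg Sigma.fst p.2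
    -- The first cell of a pair with the second component of the pair as leaf labels: replacing
    -- these labels by their targets gives the corolla on the first cell (`hi`), while reducing the
    -- tree gives the second component (`he`).
    let inner : ∀ j (p : CompPair M.toF E.totT E.totS j), (M.dec E.X).Tree E.Tot j := fun j p =>
      .node (P := M.dec E.X) (i := j) ⟨p.1.2.1, castX (hp j p) p.1.1.2⟩
        (fun k e => .leaf (p.1.2.2 k e))
    have hi : ∀ j p, M.mapLeaf E.totT (inner j p) = cor p.1.1 := by
      rintro j ⟨⟨⟨b1, x1⟩, ⟨b2, z2⟩⟩, h⟩
      obtain rfl : b2 = b1 := congrArg Sigma.fst h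
      exact congrArg (PolyEnd.Tree.node (P := M.dec E.X) _) (funext fun k => funext fun e =>
        congrArg PolyEnd.Tree.leaf (cond_iff.1 h k e))
    have he : ∀ j p, M.evalD (inner j p) = p.1.2 := fun j p => M.bind_pure (X := E.Tot) p.1.2
    -- Both bracketings evaluate the same tree with three levels. `D` holds the lower two levels,
    -- with the third one as leaf labels; `D'` is the corolla on `x`, with the composable pairs as
    -- leaf labels. Grafting corollas on `D` and two-level trees on `D'` gives definitionally equal
    -- trees.
    let D : (M.dec E.X).Tree E.Tot i := .node (P := M.dec E.X) (i := i) ⟨b, x⟩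
      (fun j e => inner j (ζ j e))
    let D' : (M.dec E.X).Tree (CompPair M.toF E.totT E.totS) i :=
      .node (P := M.dec E.X) (i := i) ⟨b, x⟩ (fun j e => .leaf (ζ j e))
    have hD : M.mapLeaf E.totT D = two (⟨b, x⟩ : E.Tot i) ⟨b, fun j e => (ζ j e).1.1⟩ rfl :=
      congrArg (PolyEnd.Tree.node (P := M.dec E.X) _) (funext fun j => funext fun e => hi j (ζ j e))
    have hD1 : M.CondD E.t E.s D (E.t _ x) E.totT := by
      refine (M.condD_mapLeaf (g := E.totT) (l := fun _ c => c)).1 ?_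
      rw [hD]
      exact condD_two _ _ h
    refine (actT_graft' (T := D) (r := E.t _ x) (l' := E.totT) hD1 (fun j x => cor x)
      (fun _ c => c) (fun j x => condD_cor x) ?_ ?_ h').trans ?_
    · refine ((actT_mapLeaf (X := E.Tot) (Y := E.C) E.totT D (E.t _ x) (fun _ c => c) ?_).symm.trans
        ?_).symm
      · exact (M.condD_mapLeaf).2 hD1
      · rw [actT_congr _ hD]
        rfl
    · have e1 : (fun j (x : E.Tot j) => E.actT (cor x) (E.totT j x) (fun _ c => c)
          (condD_cor x)) = fun _ x => x := funext fun j => funext fun x => actT_cor x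
      have e2 : M.evalD D = M.bind (X := CompPair M.toF E.totT E.totS) ⟨b, ζ⟩
          (fun _ p => p.1.2) :=
        congrArg (fun w => M.bind (X := M.Ext E.Tot) (Y := E.Tot) ⟨b, w⟩ (fun _ z => z))
          (funext fun j => funext fun e => he j (ζ j e))
      rw [e1]
      exact e2.symm.trans (M.toF.map_id _).symm
    · refine ((actT_graft' (T := D') (r := E.t _ x) (l' := fun j p => E.totT j p.1.1)
        ⟨rfl, fun j e => (hx j e).symm⟩ (fun j p => two p.1.1 p.1.2 (hp j p)) (fun _ c => c)
        (fun j p => condD_two _ _ p.2) ?_ ?_ h'').trans (actT_congr _ ?_)).symm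
      · refine (actT_cor (⟨b, x⟩ : E.Tot i)).symm.trans ?_
        have e3 : cor (⟨b, x⟩ : E.Tot i) = M.mapLeaf (fun j p => E.totT j p.1.1) D' :=
          congrArg (PolyEnd.Tree.node (P := M.dec E.X) _) (funext fun k => funext fun e =>
            congrArg PolyEnd.Tree.leaf (hx k e).symm)
        rw [actT_congr _ e3, actT_mapLeaf]
      · have e4 : M.evalD D' = ⟨b, ζ⟩ := M.bind_pure (X := CompPair M.toF E.totT E.totS) ⟨b, ζ⟩
        rw [e4]
        rfl
      · rfl

end EAlg

/-! ### The functor to generalized multicategories is fully faithful. -/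

namespace EAlg

open PolyMonad

variable {I : Type} {M : PolyMonad I} {X Y W : I → Type}

/-- The action of a morphism on cells. -/
def Hom.tot {E E' : EAlg M} (f : Hom E E') (i : I) (x : E.Tot i) : E'.Tot i := ⟨x.1, f.x _ x.2⟩

/-- A morphism commutes by definition with the composition of trees that are operations; the
tautological labelling extends this to trees with arbitrary leaves. -/
theorem actT_mapDec {E E' : EAlg M} (f : Hom E E') {i : I} (T : (M.dec E.X).Tree Y i) (r : E.C i)
    (l : ∀ j, Y j → E.C j) (h : M.CondD E.t E.s T r l) :
    f.tot i (E.actT T r l h) = E'.actT (M.mapDec f.x T) (f.c _ r) (fun j y => f.c _ (l j y))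
      (h.mapDec M f.t f.s) := by
  have e : M.mapDec f.x T = M.mapLeaf (M.evalD T).2 ((M.tautOp T).map M f.x).1 := by
    conv_lhs => rw [← M.mapLeaf_taut T]
    exact M.mapDec_mapLeaf _ _ _
  rw [actT_congr _ e]
  refine Eq.trans ?_ (actT_mapLeaf_dop (E := E') (a := ⟨i, (M.evalD T).1⟩)
    ((M.tautOp T).map M f.x) (M.evalD T).2 (f.c _ r) (fun j y => f.c _ (l j y)) _).symm
  exact congrArg (Sigma.mk (M.evalD T).1) (f.act _ _)

theorem map_castX {E E' : EAlg M} (f : Hom E E') {i : I} {b b' : M.Op i} (h : b' = b)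
    (x : E.X ⟨i, b⟩) : f.x _ (castX h x) = castX h (f.x _ x) := by
  subst h
  rfl

/-- The passage from coloured algebras to generalized multicategories. -/
noncomputable def toMulti : EAlg M ⥤ Multi M.toF where
  obj E := E.toMultiObj
  map {E E'} f :=
    have f : Hom E E' := f
    { c := f.c
      x := f.tot
      t := fun y => f.t _ _
      s := fun y => congrArg (Sigma.mk y.1) (funext fun k => funext fun e => f.s _ _ _ _)
      one := fun {j} y => (actT_mapDec f (.leaf y) y (fun _ c => c) rfl).trans
        (actT_mapLeaf (X := E.C) (Y := E'.C) f.c (.leaf y) (f.c _ y) (fun _ c => c) rfl).symm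
      comp := fun {i} y z h h' => by
        refine (actT_mapDec f (two y z (congrArg Sigma.fst h)) _ _ (condD_two y z h)).trans ?_
        have e : M.mapLeaf f.c (M.mapDec f.x (two y z (congrArg Sigma.fst h))) =
            two (f.tot i y) (M.toF.map f.tot z) (congrArg Sigma.fst h') := by
          refine (congrArg (fun w => PolyEnd.Tree.node (P := M.dec E'.X) (i := i) ⟨z.1, w⟩ _)
            (map_castX f (congrArg Sigma.fst h) y.2)).trans ?_
          refine congrArg (PolyEnd.Tree.node (P := M.dec E'.X) _)
            (funext fun j => funext fun e => ?_)
          refine congrArg (PolyEnd.Tree.node (P := M.dec E'.X) _)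
            (funext fun k => funext fun e' => ?_)
          exact congrArg PolyEnd.Tree.leaf (f.s _ _ _ _).symm
        have hc := (condD_two y z h).mapDec M f.t f.s
        refine (actT_mapLeaf f.c _ _ (fun _ c => c) ((M.condD_mapLeaf).2 hc)).symm.trans ?_
        rw [actT_congr _ e]
        have e' : f.c i (E.totT i y) = E'.totT i (f.tot i y) := (f.t ⟨i, y.1⟩ y.2).symm
        change _ = compT (E := E') (f.tot i y) (M.toF.map f.tot z) h'
        unfold compT
        congr 1 }

instance : (toMulti (M := M)).Faithful where
  map_injective {E E'} f g h := by
    have hc : Hom.c f = Hom.c g := congrArg (Multi.Hom.c (N := E.toMultiObj) (N' := E'.toMultiObj)) h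
    have hx : Hom.tot f = Hom.tot g :=
      congrArg (Multi.Hom.x (N := E.toMultiObj) (N' := E'.toMultiObj)) h
    refine Hom.ext hc (funext fun a => funext fun y => ?_)
    have := congrFun (congrFun hx a.1) ⟨a.2, y⟩
    exact eq_of_heq (Sigma.mk.inj_iff.1 this).2

/-- The composite of a tree is determined recursively by composites of two levels. This makes
induction on trees possible in the proof of fullness. -/
theorem actT_node {E : EAlg M} {i : I} (b : (M.dec E.X).Op i)
    (c : ∀ j, M.In b.1 j → (M.dec E.X).Tree Y j) (r : E.C i) (l : ∀ j, Y j → E.C j)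
    (h : M.CondD E.t E.s (.node b c) r l) (hc) :
    E.actT (.node b c) r l h = compT (E := E) b
      ⟨b.1, fun j e => E.actT (c j e) (E.s _ b.2 j e) l (h.2 j e)⟩ hc := by
  let f : ∀ j, (Σ' (x : E.C j) (T : (M.dec E.X).Tree Y j), M.CondD E.t E.s T x l) →
    (M.dec E.X).Tree Y j := fun j p => p.2.1
  -- The corolla at the root, its leaves labelled by the subtrees together with their root colours
  -- and colouring proofs; grafting these labels rebuilds the given tree.
  let T : (M.dec E.X).Tree (fun j => Σ' (x : E.C j) (T : (M.dec E.X).Tree Y j),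
      M.CondD E.t E.s T x l) i :=
    .node (P := M.dec E.X) (i := i) b (fun j e => .leaf ⟨_, c j e, h.2 j e⟩)
  have hT : M.CondD E.t E.s T (E.t _ b.2) (fun j p => p.1) := ⟨rfl, fun _ _ => rfl⟩
  have h1 := h.1
  subst h1
  have e : M.evalD T = ⟨b.1, fun j e => ⟨_, c j e, h.2 j e⟩⟩ :=
    M.bind_pure (X := fun j => Σ' (x : E.C j) (T : (M.dec E.X).Tree Y j),
      M.CondD E.t E.s T x l) ⟨b.1, fun j e => ⟨_, c j e, h.2 j e⟩⟩
  refine (actT_graft' (T := T) (r := E.t _ b.2) (l' := fun j p => p.1) hT f l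
    (fun j p => p.2.2) ?_ ?_ hc).symm
  · refine (actT_cor (E := E) b).symm.trans ?_
    exact actT_mapLeaf (fun j p => p.1) T (E.t _ b.2) (fun _ c => c) ((M.condD_mapLeaf).2 hT)
  · rw [e]
    rfl

/-- The source of a cell includes its shape, so a map that preserves sources preserves shapes and
acts fibrewise. -/
theorem exists_of_hom {E E' : EAlg M} (g : Multi.Hom E.toMultiObj E'.toMultiObj)
    (a : Σ i, M.Op i) (y : E.X a) : ∃ y' : E'.X a,
      g.x a.1 (⟨a.2, y⟩ : E.Tot a.1) = (⟨a.2, y'⟩ : E'.Tot a.1) := by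
  have h := congrArg Sigma.fst (g.s (j := a.1) (⟨a.2, y⟩ : E.Tot a.1))
  change (Sigma.fst (g.x a.1 (⟨a.2, y⟩ : E.Tot a.1) : E'.Tot a.1)) = a.2 at h
  generalize g.x a.1 (⟨a.2, y⟩ : E.Tot a.1) = z at h
  obtain ⟨b, z⟩ := z
  change b = _ at h
  subst h
  exact ⟨z, rfl⟩

/-- Preserving units and composites of two levels implies preserving composites of arbitrary trees,
by induction on the tree. -/
instance : (toMulti (M := M)).Full where
  map_surjective {E E'} := fun (g : Multi.Hom E.toMultiObj E'.toMultiObj) => by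
    choose x hx using exists_of_hom g
    have ht : ∀ a (y : E.X a), E'.t a (x a y) = g.c _ (E.t a y) := fun a y => by
      have := g.t (j := a.1) (⟨a.2, y⟩ : E.Tot a.1)
      rw [hx] at this
      exact this
    have hs : ∀ a (y : E.X a) k e, E'.s a (x a y) k e = g.c _ (E.s a y k e) := fun a y k e => by
      have := g.s (j := a.1) (⟨a.2, y⟩ : E.Tot a.1)
      rw [hx] at this
      exact congrFun (congrFun (eq_of_heq (Sigma.mk.inj_iff.1 this).2) k) e
    have key : ∀ {Y : I → Type} {i : I} (T : (M.dec E.X).Tree Y i) (r : E.C i)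
        (l : ∀ j, Y j → E.C j) (h : M.CondD E.t E.s T r l),
        g.x i (E.actT T r l h) = E'.actT (M.mapDec x T) (g.c _ r) (fun j y => g.c _ (l j y))
          (h.mapDec M ht hs) := by
      intro Y i T
      induction T with
      | leaf y =>
        intro r l h
        cases h
        have h1 : E.actT (.leaf y) (l _ y) l rfl = E.toMultiObj.one _ (l _ y) :=
          (actT_mapLeaf (X := Y) (Y := E.C) l (.leaf y) (l _ y) (fun _ c => c) rfl).symm
        refine (congrArg (g.x _) h1).trans ((g.one _).trans ?_)
        exact (actT_mapLeaf (X := Y) (Y := E'.C) (fun j y => g.c _ (l j y)) (.leaf y) _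
          (fun _ c => c) rfl)
      | @node i b c ih =>
        intro r l h
        have hc : M.toF.map E.totT (⟨b.1, fun j e => E.actT (c j e) (E.s _ b.2 j e) l (h.2 j e)⟩ :
            M.Ext E.Tot i) = E.totS i b :=
          cond_iff.2 fun j e => t_actT _ _ _ _
        rw [actT_node b c r l h hc]
        have hc' := Multi.Hom.compat g (i := i) (y := b) hc
        refine (g.comp (i := i) b _ hc hc').trans ?_
        have h' := h.mapDec M ht hs
        have hc2 : M.toF.map E'.totT (⟨b.1, fun j e => E'.actT (M.mapDec x (c j e))
            (E'.s _ (x _ b.2) j e) (fun j y => g.c _ (l j y)) (h'.2 j e)⟩ :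
            M.Ext E'.Tot i) = E'.totS i ⟨b.1, x _ b.2⟩ :=
          cond_iff.2 fun j e => t_actT _ _ _ _
        refine Eq.trans ?_ (actT_node (E := E') ⟨b.1, x _ b.2⟩ (fun j e => M.mapDec x (c j e))
          (g.c _ r) (fun j y => g.c _ (l j y)) h' hc2).symm
        refine compT_congr (E := E') hc' (hx ⟨i, b.1⟩ b.2) ?_
        refine congrArg (Sigma.mk b.1) (funext fun j => funext fun e => ?_)
        refine (ih j e _ _ (h.2 j e)).trans ?_
        have := hs ⟨i, b.1⟩ b.2 j e
        congr 1
        exact this.symm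
    refine ⟨(⟨g.c, x, ht, hs, fun a d => ?_⟩ : Hom E E'), ?_⟩
    -- An operation is its own relabelling along the identity; in this form `key` applies to it, and
    -- `actT_mapLeaf_dop` turns both sides back into actions.
    · have e1 := actT_mapLeaf_dop (E := E) d.op (fun _ e => e) d.r d.l
        ((M.condD_mapLeaf).2 d.cond)
      have e2 := actT_mapLeaf_dop (E := E') (d.op.map M x) (fun _ e => e) (g.c _ d.r)
        (fun j e => g.c _ (d.l j e)) ((M.condD_mapLeaf).2 (d.cond.mapDec M ht hs))
      have e3 := key (M.mapLeaf (fun _ e => e) d.op.1) d.r d.l ((M.condD_mapLeaf).2 d.cond)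
      have e4 : M.mapDec x (M.mapLeaf (fun _ e => e) d.op.1) =
        M.mapLeaf (fun _ e => e) (d.op.map M x).1 := M.mapDec_mapLeaf _ _ _
      have e5 := ((congrArg (g.x a.1) e1).symm.trans e3).trans
        ((actT_congr (E := E') _ e4).trans e2)
      rw [hx] at e5
      exact eq_of_heq (Sigma.mk.inj_iff.1 e5).2
    · refine Multi.Hom.ext rfl (funext fun i => funext fun y => ?_)
      exact (hx ⟨i, y.1⟩ y.2).symm

end EAlg

/-! ### From generalized multicategories to coloured algebras. -/

namespace Multi

open PolyMonad

variable {I : Type} {M : PolyMonad I} (N : Multi M.toF) {X Y W : I → Type}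

/-- The arrows with a given operation as shape, together with their sources. -/
def Fib (a : Σ i, M.Op i) : Type :=
  {p : N.X a.1 × (∀ j, M.In a.2 j → N.C j) // N.s a.1 p.1 = (⟨a.2, p.2⟩ : M.Ext N.C a.1)}

/-- The target of an arrow of given shape. -/
def fibT (a : Σ i, M.Op i) (p : N.Fib a) : N.C a.1 := N.t _ p.1.1

/-- The sources of an arrow of given shape. -/
def fibS (a : Σ i, M.Op i) (p : N.Fib a) : ∀ j, M.In a.2 j → N.C j := p.1.2

/-- The composite of a tree of arrows. -/
def evN : ∀ {i : I} (T : (M.dec N.Fib).Tree Y i) (r : N.C i) (l : ∀ j, Y j → N.C j),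
    M.CondD N.fibT N.fibS T r l →
      {x : N.X i // N.t i x = r ∧ N.s i x = M.toF.map l (M.evalD T)}
  | i, .leaf y, r, l, h => ⟨N.one i r, N.t_one r, by
      refine (N.s_one r).trans ?_
      rw [show r = l _ y from h]
      exact (M.toF.map_pure l y).symm⟩
  | i, .node b c, r, l, h =>
    -- The composites of the subtrees have the targets required by the sources of the root. The
    -- recursion needs this, so the value is bundled with its target and source.
    have hc : M.toF.map N.t (⟨b.1, fun j e => (evN (c j e) _ l (h.2 j e)).1⟩ : M.Ext N.X i) =
        N.s i b.2.1.1 :=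
      (congrArg (Sigma.mk b.1) (funext fun j => funext fun e =>
        (evN (c j e) _ l (h.2 j e)).2.1)).trans b.2.2.symm
    ⟨N.comp b.2.1.1 ⟨b.1, fun j e => (evN (c j e) _ l (h.2 j e)).1⟩ hc,
      (N.t_comp _ _ hc).trans h.1, by
      refine (N.s_comp _ _ hc).trans ?_
      refine Eq.trans ?_ (M.toF.map_bind (fun _ z => z) l
        (⟨b.1, fun j e => M.evalD (c j e)⟩ : M.Ext (M.Ext Y) i)).symm
      exact congrArg (fun w => M.bind (X := M.Ext N.C) (Y := N.C) ⟨b.1, w⟩ (fun _ z => z))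
        (funext fun j => funext fun e => (evN (c j e) _ l (h.2 j e)).2.2)⟩

variable {N}

theorem evN_congr {i : I} {T T' : (M.dec N.Fib).Tree Y i} {r : N.C i} {l : ∀ j, Y j → N.C j}
    (h : M.CondD N.fibT N.fibS T r l) (hT : T = T') :
    (N.evN T r l h).1 = (N.evN T' r l (hT ▸ h)).1 := by
  subst hT
  rfl

theorem evN_graft_cond {i : I} (T : (M.dec N.Fib).Tree X i) (r : N.C i) (l' : ∀ j, X j → N.C j)
    (h : M.CondD N.fibT N.fibS T r l') (F : ∀ j, X j → N.X j) (hF : ∀ j x, N.t j (F j x) = l' j x) :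
    M.toF.map N.t (M.toF.map F (M.evalD T)) = N.s i (N.evN T r l' h).1 := by
  rw [(N.evN T r l' h).2.2]
  refine (M.toF.map_map F N.t (M.evalD T)).trans ?_
  exact congrArg (fun g => M.toF.map g _) (funext fun j => funext fun x => hF j x)

/-- Induction on the base tree: on the trivial tree this is the left unit law, and on a node it is
associativity. -/
theorem evN_graft {i : I} (T : (M.dec N.Fib).Tree X i) (r : N.C i) (l' : ∀ j, X j → N.C j)
    (h : M.CondD N.fibT N.fibS T r l') (f : ∀ j, X j → (M.dec N.Fib).Tree Y j)
    (l : ∀ j, Y j → N.C j) (hf : ∀ j x, M.CondD N.fibT N.fibS (f j x) (l' j x) l)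
    (hg : M.CondD N.fibT N.fibS (T.graft f) r l) :
    (N.evN (T.graft f) r l hg).1 = N.comp (N.evN T r l' h).1
      (M.toF.map (fun j x => (N.evN (f j x) (l' j x) l (hf j x)).1) (M.evalD T))
      (evN_graft_cond T r l' h _ (fun j x => (N.evN (f j x) (l' j x) l (hf j x)).2.1)) := by
  induction T with
  | @leaf i x =>
    cases h
    have e := M.toF.map_pure (fun j x => (N.evN (f j x) (l' j x) l (hf j x)).1) x
    have e1 := (N.evN (f i x) (l' i x) l (hf i x)).2.1
    refine ((N.comp_congr _ (congrArg (N.one i) e1.symm) e).trans (N.one_comp _ ?_)).symm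
    rw [FMonad.map_pure, N.s_one]
  | @node i b c ih =>
    let F : ∀ j, X j → N.X j := fun j x => (N.evN (f j x) (l' j x) l (hf j x)).1
    have hF : ∀ j x, N.t j (F j x) = l' j x := fun j x => (N.evN (f j x) (l' j x) l (hf j x)).2.1
    -- For each input of the root: the composite of the subtree there, paired with the composites of
    -- the trees grafted onto that subtree.
    let ζ : M.Ext (CompPair M.toF N.t N.s) i := ⟨b.1, fun j e =>
      ⟨((N.evN (c j e) _ l' (h.2 j e)).1, M.toF.map F (M.evalD (c j e))),
        evN_graft_cond _ _ _ (h.2 j e) F hF⟩⟩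
    have e2 : (⟨b.1, fun j e => (N.evN ((c j e).graft f) _ l (hg.2 j e)).1⟩ : M.Ext N.X i) =
        M.toF.map (fun _ p => N.comp p.1.1 p.1.2 p.2) ζ :=
      congrArg (Sigma.mk b.1) (funext fun j => funext fun e => ih j e _ (h.2 j e) (hg.2 j e))
    have e3 : M.toF.map F (M.evalD (.node b c)) = M.toF.bind ζ (fun _ p => p.1.2) :=
      M.toF.map_bind (fun _ z => z) F (⟨b.1, fun j e => M.evalD (c j e)⟩ : M.Ext (M.Ext X) i)
    refine (N.comp_congr _ rfl e2).trans ?_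
    refine Eq.trans ?_ (N.comp_congr _ rfl e3).symm
    exact (N.comp_assoc _ ζ _ _ _).symm

theorem evN_mapLeaf (g : ∀ j, X j → Y j) {i : I} (T : (M.dec N.Fib).Tree X i) (r : N.C i)
    (l : ∀ j, Y j → N.C j) (h : M.CondD N.fibT N.fibS (M.mapLeaf g T) r l)
    (h' : M.CondD N.fibT N.fibS T r (fun j x => l j (g j x))) :
    (N.evN (M.mapLeaf g T) r l h).1 = (N.evN T r (fun j x => l j (g j x)) h').1 := by
  induction T with
  | leaf x => rfl
  | @node i b c ih =>
    exact N.comp_congr _ rfl (congrArg (Sigma.mk b.1) (funext fun j => funext fun e =>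
      ih j e _ (h.2 j e) (h'.2 j e)))

variable (N)

/-- The composition of arrows, along trees. -/
def fibAct (a : Σ i, M.Op i) (d : M.ELab N.fibT N.fibS a) : N.Fib a :=
  ⟨((N.evN d.op.1 d.r d.l d.cond).1, d.l), by
    exact (N.evN d.op.1 d.r d.l d.cond).2.2.trans (congrArg (M.toF.map d.l) d.op.2)⟩

/-- Substitution at the root node is a grafting, so `evN_graft` splits off the composite of the
substituted tree and induction treats the rest. Associativity for two levels thus yields
associativity for all substitutions of trees. -/
theorem evN_bindD {i : I} (T : (M.dec (M.ELab N.fibT N.fibS)).Tree Y i) (r : N.C i)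
    (l : ∀ j, Y j → N.C j) (h : M.CondD (fun _ d => d.r) (fun _ d => d.l) T r l)
    (h1 : M.CondD N.fibT N.fibS (M.bindD (fun _ d => d.op) T) r l)
    (h2 : M.CondD N.fibT N.fibS (M.mapDec N.fibAct T) r l) :
    (N.evN (M.bindD (fun _ d => d.op) T) r l h1).1 = (N.evN (M.mapDec N.fibAct T) r l h2).1 := by
  induction T with
  | leaf x => rfl
  | @node i b c ih =>
    obtain ⟨rfl, h⟩ := h
    have hb : ∀ j e, M.CondD N.fibT N.fibS (M.bindD (fun _ d => d.op) (c j e)) (b.2.l j e) l :=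
      fun j e => (h j e).bindD M (fun a d => d.cond)
    refine (evN_graft b.2.op.1 b.2.r b.2.l b.2.cond 
      (fun j e => M.bindD (fun _ (d : M.ELab N.fibT N.fibS _) => d.op) (c j e))
      l hb h1).trans ?_
    refine N.comp_congr _ rfl ?_
    rw [b.2.op.2]
    exact congrArg (Sigma.mk b.1) (funext fun j => funext fun e => ih j e _ (h j e) _ (h2.2 j e))

/-- The coloured algebra of a generalized multicategory. -/
def toEAlg : EAlg M where
  C := N.C
  X := N.Fib
  t := N.fibT
  s := N.fibS
  act := N.fibAct
  t_act a d := (N.evN d.op.1 d.r d.l d.cond).2.1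
  s_act a d := rfl
  act_unit a x := by
    refine Subtype.ext (Prod.ext ?_ rfl)
    refine Eq.trans ?_ (N.comp_one x.1.1 ?_)
    refine N.comp_congr _ rfl ?_
    rw [x.2]
    rfl
  act_bind a ζ r l h h1 h2 := Subtype.ext (Prod.ext (N.evN_bindD ζ.1 r l h h1 h2) rfl)

theorem actT_toEAlg {i : I} (T : (M.dec N.Fib).Tree Y i) (r : N.C i)
    (l : ∀ j, Y j → N.C j) (h : M.CondD N.fibT N.fibS T r l) :
    (N.toEAlg.actT T r l h).2.1.1 = (N.evN T r l h).1 := by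
  refine Eq.trans ?_ (evN_congr (h := (M.mapLeaf_taut T).symm ▸ h) (M.mapLeaf_taut T))
  exact (evN_mapLeaf (N := N) (M.evalD T).2 (M.taut T) r l _ (M.condD_taut h)).symm

end Multi

namespace EAlg

variable {I : Type} {M : PolyMonad I}

/-- The shape and sources recorded in a fibre are the components of `N.s`, so forgetting them is a
bijection onto the arrows of `N`. -/
instance : (toMulti (M := M)).EssSurj where
  mem_essImage N := by
    have hx : ∀ j, Function.Bijective (fun (y : N.toEAlg.Tot j) => y.2.1.1) := by
      intro j
      refine ⟨?_, fun y => ⟨⟨(N.s j y).1, (y, (N.s j y).2), rfl⟩, rfl⟩⟩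
      rintro ⟨b, ⟨⟨y, l⟩, h⟩⟩ ⟨b', ⟨⟨y', l'⟩, h'⟩⟩ hy
      change y = y' at hy
      subst hy
      change N.s j y = ⟨b, l⟩ at h
      change N.s j y = ⟨b', l'⟩ at h'
      have := h.symm.trans h'
      cases this
      rfl
    let f : Multi.Hom N.toEAlg.toMultiObj N :=
      { c := fun _ c => c
        x := fun j y => y.2.1.1
        t := fun _ => rfl
        s := fun y => y.2.2
        one := fun c => N.actT_toEAlg (.leaf c) c (fun _ c => c) rfl
        comp := fun {i} y z h h' => by
          obtain ⟨b, y⟩ := y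
          obtain ⟨b', z⟩ := z
          obtain rfl : b' = b := congrArg Sigma.fst h
          refine (N.actT_toEAlg _ _ _ _).trans ?_
          refine N.comp_congr _ rfl ?_
          refine congrArg (Sigma.mk b') (funext fun j => funext fun e => ?_)
          -- Evaluating a corolla composes its cell with a layer of units on the leaves; the right
          -- unit law removes it.
          refine Eq.trans ?_ (N.comp_one (z j e).2.1.1 ?_)
          refine N.comp_congr _ rfl ?_
          rw [(z j e).2.2]
          rfl }
    have := Multi.isIso_of_bijective (N := N.toEAlg.toMultiObj) (N' := N) f
      (fun _ => Function.bijective_id) hx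
    exact ⟨N.toEAlg, ⟨asIso (C := Multi M.toF) (X := N.toEAlg.toMultiObj) (Y := N) f⟩⟩

end EAlg

/-! ### Decorated trees versus trees with labels at addresses of nodes. -/

theorem PolyEnd.Tree.toDec_ofDec {I : Type} {P : PolyEnd I} {X : I → Type}
    {D : (Σ i, P.Op i) → Type} {i : I} (T : (P.dec D).Tree X i) :
    (ofDec T).1.toDec (ofDec T).2 = T := by
  induction T with
  | leaf x => rfl
  | node b c ih =>
    exact congrArg (PolyEnd.Tree.node (P := P.dec D) b)
      (funext fun j => funext fun e => ih j e)

theorem PolyMonad.decSubst_eq_bindD {I : Type} (M : PolyMonad I) {X : I → Type}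
    {D D' : (Σ i, M.Op i) → Type} (f : ∀ a, D a → M.bdData.Ext D' a) {i : I}
    (T : (M.dec D).Tree X i) :
    M.decSubst f T = M.bindD (fun a d =>
      (⟨(f a d).1.1.toDec (f a d).2, (M.evalD_toDec _ _).trans (f a d).1.2⟩ : M.DOp D' a)) T := by
  induction T with
  | leaf x => rfl
  | node b c ih =>
    exact congrArg (PolyEnd.Tree.graft _) (funext fun j => funext fun e => ih j e)

/-- `EdgeCond`, stated through addresses, unfolds at leaves and nodes in the same way as the
recursion defining `CondD`. -/
theorem PolyMonad.condD_toDec {I : Type} (M : PolyMonad I) {X C : I → Type}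
    {D : (Σ i, M.Op i) → Type} {t : ∀ a, D a → C a.1} {s : ∀ a, D a → ∀ k, M.In a.2 k → C k}
    {i : I} (T : M.Tree X i) (v : ∀ a, T.Node a → D a) (r : C i) (l : ∀ j, X j → C j) :
    M.CondD t s (T.toDec v) r l ↔ EdgeCond t s T v r l := by
  induction T with
  | leaf x => exact (edgeCond_leaf t s).symm
  | node b c ih =>
    refine Iff.trans ?_ (edgeCond_node t s).symm
    exact and_congr Iff.rfl (forall_congr' fun j => forall_congr' fun e => ih j e _ _)

/-! ### Faces in the range of two adjacent dimensions. -/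

section faces

/-- The morphism of the category of opetopes given by a generator. -/
def homOf {o o' : Opt} (e : Face o o') : (⟨o⟩ : OptCat) ⟶ ⟨o'⟩ :=
  (Quotient.functor FaceRel).map ((Paths.of Opt).map e)

/-- The generator of which a path consists, if its length is one. -/
def pathFace : ∀ {a c : Opt}, OptPath a c → Option (Face a c)
  | _, _, .cons .nil e => some e
  | _, _, _ => none

theorem pathFace_eq_none {a c : Opt} (f : OptPath a c) (h : f.length ≠ 1) : pathFace f = none := by
  cases f with
  | nil => rfl
  | cons f e =>
    cases f with
    | nil => exact absurd rfl h
    | cons f e' => rfl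

/-- All relations are between paths of length two, so a path of length one is alone in its class,
and reading off its generator descends to the quotient. -/
theorem homOf_injective {o o' : Opt} : Function.Injective (homOf (o := o) (o' := o')) := by
  intro e e' h
  let F : ((⟨o⟩ : OptCat) ⟶ ⟨o'⟩) → Option (Face o o') := Quot.lift
    (fun f : OptPath o o' => pathFace f) (by
      rintro _ _ ⟨c, d, f, m₁, m₂, g, h⟩
      have hl := length_faceRel h
      have h1 : Quiver.Path.length (f ≫ m₁ ≫ g) ≠ 1 := by
        have : Quiver.Path.length (f ≫ m₁ ≫ g) =
          Quiver.Path.length f + (Quiver.Path.length m₁ + Quiver.Path.length g) :=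
          (Quiver.Path.length_comp _ _).trans (congrArg _ (Quiver.Path.length_comp _ _))
        omega
      have h2 : Quiver.Path.length (f ≫ m₂ ≫ g) ≠ 1 := by
        have : Quiver.Path.length (f ≫ m₂ ≫ g) =
          Quiver.Path.length f + (Quiver.Path.length m₂ + Quiver.Path.length g) :=
          (Quiver.Path.length_comp _ _).trans (congrArg _ (Quiver.Path.length_comp _ _))
        omega
      exact (pathFace_eq_none _ h1).trans (pathFace_eq_none _ h2).symm)
  exact Option.some_injective _ (congrArg F h)

variable {k m : ℕ}

theorem le_dim (hk1 : k ≤ 1) (ω : OptRange k (m + 1)) : m ≤ ω.obj.as.dim := by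
  have := ω.property.1
  omega

theorem exists_lowOb (hk1 : k ≤ 1) (ω : OptRange k (m + 1)) (h : ω.obj.as.dim < m + 1) :
    ∃ (hk : m + 1 ≤ m + k) (j : Opetope m), lowOb hk j = ω := by
  have h1 := le_dim hk1 ω
  obtain ⟨⟨⟨d, i⟩⟩, h2, h3⟩ := ω
  change d < m + 1 at h
  change m ≤ d at h1
  obtain rfl : d = m := by omega
  exact ⟨h2, i, rfl⟩

/-- A proper face has dimension m, as nothing lower is in range. After the last generator is split
off, what remains preserves the dimension and is an identity. -/
theorem exists_face (hk1 : k ≤ 1) {i : Opetope m} (b : (Z m).Op i) (ω : OptRange k (m + 1))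
    (h : ω.obj.as.dim < m + 1) (g : ω.obj ⟶ ob (opetope b)) :
    ∃ e : Face ω.obj.as ⟨m + 1, opetope b⟩, g = homOf e := by
  have h1 := le_dim hk1 ω
  obtain ⟨⟨o⟩, ho⟩ := ω
  change Opt.dim o < m + 1 at h
  change m ≤ Opt.dim o at h1
  rcases hom_cases b (Nat.le_of_lt_succ h) g with ⟨g', rfl⟩ | ⟨j, p, g', rfl⟩
  · obtain ⟨h2, rfl⟩ := eq_of_dim g' h1
    cases h2
    exact ⟨.tgt b, Category.id_comp _⟩
  · obtain ⟨h2, rfl⟩ := eq_of_dim g' h1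
    cases h2
    exact ⟨.src b p, Category.id_comp _⟩

/-- Only dimensions m and m+1 occur, so apart from identities there are only target and source
embeddings. Every naturality square below is checked this way. -/
theorem range_hom_induction (hk1 : k ≤ 1)
    {P : ∀ {ω' ω : OptRange k (m + 1)}, (ω' ⟶ ω) → Prop} (id : ∀ ω, P (𝟙 ω))
    (tgt : ∀ (hk : m + 1 ≤ m + k) (a : Σ i, (Z m).Op i),
      P (ObjectProperty.homMk (X := lowOb hk a.1) (Y := topOb (n := m + 1) k a) (tgtHom a.2)))
    (src : ∀ (hk : m + 1 ≤ m + k) (a : Σ i, (Z m).Op i) (j : Opetope m) (q : (Z m).In a.2 j),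
      P (ObjectProperty.homMk (X := lowOb hk j) (Y := topOb (n := m + 1) k a) (srcHom a.2 q)))
    {ω' ω : OptRange k (m + 1)} (u : ω' ⟶ ω) : P u := by
  by_cases h' : ω'.obj.as.dim < m + 1
  · by_cases h : ω.obj.as.dim < m + 1
    · have h1 : ω.obj.as.dim ≤ ω'.obj.as.dim :=
        (Nat.le_of_lt_succ h).trans (le_dim hk1 ω')
      obtain ⟨e, he⟩ := eq_of_dim u.hom h1
      obtain ⟨o, ho⟩ := ω
      obtain ⟨o', ho'⟩ := ω'
      dsimp only at e
      subst e
      have : u = 𝟙 _ := ObjectProperty.hom_ext _ he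
      rw [this]
      exact id _
    · obtain ⟨⟨i, b⟩, rfl⟩ := exists_topOb ω h
      obtain ⟨g⟩ := u
      obtain ⟨e, he⟩ := exists_face hk1 b ω' h' g
      obtain ⟨⟨o⟩, ho⟩ := ω'
      subst he
      change Face o _ at e
      cases e with
      | tgt => exact tgt ho.1 ⟨i, b⟩
      | src _ p => exact src ho.1 ⟨i, b⟩ _ p
  · obtain ⟨e, rfl⟩ := eq_of_not_lt u h'
    subst e
    exact id _

end faces

/-! ### Top cells of `𝔷ⁿX` as trees of cells with coloured edges. -/

section labels

variable {k m : ℕ} (X : Psh k (m + 1))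

/-- The `m`-dimensional cells of a presheaf on `𝕆_{m+1-k,m+1}`, if `k` is positive, and a family
of singletons otherwise. -/
abbrev LowFam (i : Opetope m) : Type := ∀ hk : m + 1 ≤ m + k, X.obj (.op (lowOb hk i))

/-- The targets of the top-dimensional cells. -/
def lowT (a : Σ i, (Z m).Op i) (x : Top (n := m + 1) X a) : LowFam X a.1 :=
  fun hk => tgtFace hk X a x

/-- The sources of the top-dimensional cells. -/
def lowS (a : Σ i, (Z m).Op i) (x : Top (n := m + 1) X a) (j : Opetope m) (q : (Z m).In a.2 j) :
    LowFam X j :=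
  fun hk => srcFace hk X a x j q

/-- For k = 0 both sides are vacuous, since the colours are then functions on an empty type; this
lets k = 0 and k = 1 share one argument. -/
theorem edgeCond_lowFam {Y : Opetope m → Type} {i : Opetope m} (T : (Z m).Tree Y i)
    (v : ∀ a, T.Node a → Top (n := m + 1) X a) (r : LowFam X i) (l : ∀ j, Y j → LowFam X j) :
    EdgeCond (lowT X) (lowS X) T v r l ↔ ∀ hk : m + 1 ≤ m + k,
      EdgeCond (tgtFace hk X) (srcFace hk X) T v (r hk) (fun j y => l j y hk) := by
  refine ⟨fun h hk => ⟨?_, ?_, ?_, ?_⟩, fun h => ⟨?_, ?_, ?_, ?_⟩⟩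
  · exact fun p _ q _ p' hp => congrFun (h.inner p q p' hp) hk
  · exact fun p hp => congrFun (h.root p hp) hk
  · exact fun p _ q x hp => congrFun (h.leaves p q x hp) hk
  · exact fun x hx => congrFun (h.degen x hx) hk
  · exact fun p _ q _ p' hp => funext fun hk => (h hk).inner p q p' hp
  · exact fun p hp => funext fun hk => (h hk).root p hp
  · exact fun p _ q x hp => funext fun hk => (h hk).leaves p q x hp
  · exact fun x hx => funext fun hk => (h hk).degen x hx

variable {X}

/-- The tree of cells with coloured edges given by a cell of `𝔷ⁿX`. -/
def labOf {a : Σ i, (Z m).Op i} (c : Cell X (topOb (n := m + 1) k a)) :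
    (Z m).ELab (lowT X) (lowS X) a where
  op := ⟨c.ext.1.1.toDec c.ext.2, ((Z m).evalD_toDec _ _).trans c.ext.1.2⟩
  r := fun hk => c.bdry (lowOb hk a.1) (Nat.lt_succ_self m) (tgtHom a.2)
  l := fun j q hk => c.bdry (lowOb hk j) (Nat.lt_succ_self m) (srcHom a.2 q)
  cond := ((Z m).condD_toDec _ _ _ _).2 ((edgeCond_lowFam X _ _ _ _).2 fun hk =>
    edgeCond_of_cell hk c)

theorem elab_ext {I : Type} {M : PolyMonad I} {C : I → Type} {D : (Σ i, M.Op i) → Type}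
    {t : ∀ a, D a → C a.1} {s : ∀ a, D a → ∀ k, M.In a.2 k → C k} {a : Σ i, M.Op i}
    {d d' : M.ELab t s a} (h : d.op.1 = d'.op.1) (hr : d.r = d'.r) (hl : d.l = d'.l) : d = d' := by
  obtain ⟨⟨T, hT⟩, r, l, h1⟩ := d
  obtain ⟨⟨T', hT'⟩, r', l', h1'⟩ := d'
  cases h
  cases hr
  cases hl
  rfl

/-- A cell is determined by its labelled operation and the faces of its target, and for k ≤ 1 these
faces are single generators, recorded by `r` and `l`. -/
theorem labOf_injective (hk1 : k ≤ 1) (a : Σ i, (Z m).Op i) :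
    Function.Injective (labOf (X := X) (a := a)) := by
  intro c c' h
  refine Cell.cell_ext ?_ fun ω hω g => ?_
  · exact (Z m).bd_ext (congrArg (fun d : (Z m).ELab (lowT X) (lowS X) a => d.op.1) h)
  · obtain ⟨e, he⟩ := exists_face hk1 a.2 ω hω g
    obtain ⟨⟨o⟩, ho⟩ := ω
    subst he
    obtain ⟨i, b⟩ := a
    change Face o ⟨m + 1, opetope b⟩ at e
    cases e with
    | tgt => exact congrFun (congrArg PolyMonad.ELab.r h) ho.1
    | src _ p =>
      exact congrFun (congrFun (congrFun (congrArg PolyMonad.ELab.l h) _) p) ho.1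

section cellOf

variable {i : Opetope m} {b : (Z m).Op i}

/-- The face of a boundary that corresponds to a generator. -/
def faceFam (r : LowFam X i) (l : ∀ j, (Z m).In b j → LowFam X j) :
    ∀ {o : Opt} (ho : InRange k (m + 1) ⟨o⟩) (_ : Face o ⟨m + 1, opetope b⟩),
      X.obj (.op ⟨⟨o⟩, ho⟩)
  | _, ho, .tgt _ => r ho.1
  | _, ho, .src _ p => l _ p ho.1

/-- The faces of a boundary. -/
noncomputable def lowVal (hk1 : k ≤ 1) (r : LowFam X i) (l : ∀ j, (Z m).In b j → LowFam X j)
    (ω : OptRange k (m + 1)) (h : ω.obj.as.dim < m + 1) (g : ω.obj ⟶ ob (opetope b)) :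
    X.obj (.op ω) :=
  faceFam r l ω.property (exists_face hk1 b ω h g).choose

/-- The choice of a generator in `lowVal` is harmless because the generator is unique. -/
theorem lowVal_homOf (hk1 : k ≤ 1) (r : LowFam X i) (l : ∀ j, (Z m).In b j → LowFam X j)
    {o : Opt} (ho : InRange k (m + 1) ⟨o⟩) (h : o.dim < m + 1)
    (e : Face o ⟨m + 1, opetope b⟩) :
    lowVal hk1 r l ⟨⟨o⟩, ho⟩ h (homOf e) = faceFam r l ho e := by
  have := (exists_face hk1 b ⟨⟨o⟩, ho⟩ h (homOf e)).choose_spec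
  exact congrArg (faceFam r l ho) (homOf_injective this).symm

theorem map_lowVal (hk1 : k ≤ 1) (r : LowFam X i) (l : ∀ j, (Z m).In b j → LowFam X j)
    (ω ω' : OptRange k (m + 1)) (h : ω.obj.as.dim < m + 1) (h' : ω'.obj.as.dim < m + 1)
    (g : ω.obj ⟶ ob (opetope b)) (u : ω' ⟶ ω) :
    X.map u.op (lowVal hk1 r l ω h g) = lowVal hk1 r l ω' h' (u.hom ≫ g) := by
  revert h h' g
  refine range_hom_induction hk1 (P := fun {ω' ω} u => ∀ (h : ω.obj.as.dim < m + 1)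
    (h' : ω'.obj.as.dim < m + 1) (g : ω.obj ⟶ ob (opetope b)),
    X.map u.op (lowVal hk1 r l ω h g) = lowVal hk1 r l ω' h' (u.hom ≫ g)) ?_ ?_ ?_ u
  · intro ω h h' g
    refine (ConcreteCategory.congr_hom (X.map_id (.op ω)) _).trans ?_
    exact congrArg (lowVal hk1 r l ω h) (Category.id_comp g).symm
  -- Target and source embeddings end in dimension m+1, which `h` excludes; only identities remain.
  · intro hk a h
    exact absurd h (lt_irrefl (m + 1))
  · intro hk a j q h
    exact absurd h (lt_irrefl (m + 1))

end cellOf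

/-- The cell of `𝔷ⁿX` given by a tree of cells with coloured edges. -/
noncomputable def cellOf (hk1 : k ≤ 1) {a : Σ i, (Z m).Op i}
    (d : (Z m).ELab (lowT X) (lowS X) a) : Cell X (topOb (n := m + 1) k a) :=
  .top (n := m + 1) (i := a) (⟨(PolyEnd.Tree.ofDec d.op.1).1, by
      exact ((Z m).evalD_toDec _ _).symm.trans
        ((congrArg (Z m).evalD (PolyEnd.Tree.toDec_ofDec d.op.1)).trans d.op.2)⟩ : (Z m).BDOp a)
    (mkHom (n := m + 1) (i := a) (v := (PolyEnd.Tree.ofDec d.op.1).2)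
      (β := lowVal (b := a.2) hk1 d.r d.l)
      (respects_succ (i := a.1) (b := a.2) _ _ _ (map_lowVal hk1 d.r d.l) (fun hk => by
        have h : EdgeCond (lowT X) (lowS X) (PolyEnd.Tree.ofDec d.op.1).1
            (PolyEnd.Tree.ofDec d.op.1).2 d.r d.l :=
          ((Z m).condD_toDec _ _ _ _).1 ((PolyEnd.Tree.toDec_ofDec d.op.1).symm ▸ d.cond)
        refine ((edgeCond_lowFam X _ _ _ _).1 h hk).congr_edges ?_ ?_
        · exact (lowVal_homOf hk1 d.r d.l ⟨hk, Nat.le_succ m⟩ (Nat.lt_succ_self m) (.tgt a.2)).symm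
        · exact funext fun j => funext fun q =>
            (lowVal_homOf hk1 d.r d.l ⟨hk, Nat.le_succ m⟩ (Nat.lt_succ_self m) (.src a.2 q)).symm))
      (map_lowVal hk1 d.r d.l))

/-- A map out of a spine is freely given by values on the sources and on the faces of the target,
subject to agreement along the edges. So top cells and coloured trees are in bijection, and the
monad can be studied on trees. -/
theorem labOf_cellOf (hk1 : k ≤ 1) {a : Σ i, (Z m).Op i} (d : (Z m).ELab (lowT X) (lowS X) a) :
    labOf (cellOf hk1 d) = d := by
  refine elab_ext ?_ ?_ ?_
  · refine Eq.trans ?_ (PolyEnd.Tree.toDec_ofDec d.op.1)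
    refine congrArg (PolyEnd.Tree.toDec (PolyEnd.Tree.ofDec d.op.1).1) ?_
    exact funext fun _ => funext fun _ => srcVal_mkHom (n := m + 1) (i := a) _ _ _ _
  · funext hk
    refine (Cell.bdry_top (n := m + 1) (i := a) _ _ _ _ _).trans ?_
    refine (tgtVal_mkHom (n := m + 1) (i := a) _ _ _ _).trans ?_
    exact lowVal_homOf hk1 d.r d.l ⟨hk, Nat.le_succ m⟩ (Nat.lt_succ_self m) (.tgt a.2)
  · funext j q hk
    refine (Cell.bdry_top (n := m + 1) (i := a) _ _ _ _ _).trans ?_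
    refine (tgtVal_mkHom (n := m + 1) (i := a) _ _ _ _).trans ?_
    exact lowVal_homOf hk1 d.r d.l ⟨hk, Nat.le_succ m⟩ (Nat.lt_succ_self m) (.src a.2 q)

theorem cellOf_labOf (hk1 : k ≤ 1) {a : Σ i, (Z m).Op i}
    (c : Cell X (topOb (n := m + 1) k a)) : cellOf hk1 (labOf c) = c :=
  labOf_injective hk1 a (labOf_cellOf hk1 _)

/-- In terms of trees the unit is the corolla, with the faces of the cell as colours of its edges.
-/
theorem labOf_eta {a : Σ i, (Z m).Op i} (x : Top (n := m + 1) X a) :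
    labOf (etaTop (n := m + 1) (i := a) x) =
      ⟨(Z m).corD x, lowT X a x, lowS X a x, (Z m).condD_corD x⟩ := by
  refine elab_ext ?_ ?_ ?_
  · have h := ext_etaTop (n := m + 1) (i := a) x
    refine (congrArg (fun z : (Z m).bdData.Ext (Top (n := m + 1) X) a => z.1.1.toDec z.2) h).trans ?_
    rfl
  · funext hk
    exact bdry_etaTop (n := m + 1) (i := a) x _ _ _
  · funext j q hk
    exact bdry_etaTop (n := m + 1) (i := a) x _ _ _

/-- In terms of trees the multiplication is substitution. The two lemmas after this one say that it
keeps the boundary, up to reading a low cell of `𝔷ⁿX` as a cell of X. -/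
theorem op_labOf_mu {a : Σ i, (Z m).Op i}
    (c : Cell ((zFunctor k (m + 1)).obj X) (topOb (n := m + 1) k a)) :
    (labOf (muTop (n := m + 1) (i := a) c)).op.1 =
      (Z m).bindD (fun a (d : Cell X (topOb (n := m + 1) k a)) => (labOf d).op)
        (labOf c).op.1 := by
  have h := ext_muTop (n := m + 1) (i := a) c
  refine (congrArg (fun z : (Z m).bdData.Ext (Top (n := m + 1) X) a => z.1.1.toDec z.2) h).trans ?_
  refine ((Z m).toDec_bind (D := Top (n := m + 1) ((zFunctor k (m + 1)).obj X)) c.ext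
    (fun _ d => Cell.ext d)).trans ?_
  exact (Z m).decSubst_eq_bindD _ _

theorem r_labOf_mu {a : Σ i, (Z m).Op i}
    (c : Cell ((zFunctor k (m + 1)).obj X) (topOb (n := m + 1) k a)) (hk : m + 1 ≤ m + k) :
    (labOf (muTop (n := m + 1) (i := a) c)).r hk =
      Cell.toLow (X := X) (Nat.lt_succ_self m) ((labOf c).r hk) :=
  bdry_muTop (n := m + 1) (i := a) c _ _ _

theorem l_labOf_mu {a : Σ i, (Z m).Op i}
    (c : Cell ((zFunctor k (m + 1)).obj X) (topOb (n := m + 1) k a)) (j : Opetope m)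
    (q : (Z m).In a.2 j) (hk : m + 1 ≤ m + k) :
    (labOf (muTop (n := m + 1) (i := a) c)).l j q hk =
      Cell.toLow (X := X) (Nat.lt_succ_self m) ((labOf c).l j q hk) :=
  bdry_muTop (n := m + 1) (i := a) c _ _ _

variable {Y : Psh k (m + 1)} (α : X ⟶ Y)

theorem op_labOf_map {a : Σ i, (Z m).Op i} (c : Cell X (topOb (n := m + 1) k a)) :
    (labOf (c.map α)).op = (labOf c).op.map (Z m) (fun a x => α.app (.op (topOb k a)) x) := by
  refine Subtype.ext ?_
  have h := Cell.ext_map α c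
  refine (congrArg (fun z : (Z m).bdData.Ext (Top (n := m + 1) Y) a => z.1.1.toDec z.2) h).trans ?_
  exact ((Z m).mapDec_toDec (D := Top (n := m + 1) X) (D' := Top (n := m + 1) Y)
    (fun a x => α.app (.op (topOb k a)) x) c.ext.1.1 c.ext.2).symm

theorem r_labOf_map {a : Σ i, (Z m).Op i} (c : Cell X (topOb (n := m + 1) k a))
    (hk : m + 1 ≤ m + k) : (labOf (c.map α)).r hk = α.app _ ((labOf c).r hk) :=
  Cell.bdry_map (n := m + 1) (i := a) α c _ _ _

theorem l_labOf_map {a : Σ i, (Z m).Op i} (c : Cell X (topOb (n := m + 1) k a)) (j : Opetope m)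
    (q : (Z m).In a.2 j) (hk : m + 1 ≤ m + k) :
    (labOf (c.map α)).l j q hk = α.app _ ((labOf c).l j q hk) :=
  Cell.bdry_map (n := m + 1) (i := a) α c _ _ _

end labels

/-! ### From opetopic algebras to coloured algebras. -/

section algebra

variable {k m : ℕ}

theorem psh_congr_app {n : ℕ} {X Y : Psh k n} {f g : X ⟶ Y} (h : f = g) {ω : OptRange k n}
    (x : X.obj (.op ω)) : f.app (.op ω) x = g.app (.op ω) x := by
  rw [h]

theorem labOf_map_eq {X Y : Psh k (m + 1)} (α : X ⟶ Y) {a : Σ i, (Z m).Op i}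
    {c : Cell X (topOb (n := m + 1) k a)} {d : (Z m).ELab (lowT X) (lowS X) a}
    {d' : (Z m).ELab (lowT Y) (lowS Y) a} (hc : labOf c = d)
    (hop : (d.op.map (Z m) (fun a x => α.app (.op (topOb k a)) x)).1 = d'.op.1)
    (hr : ∀ hk, α.app _ (d.r hk) = d'.r hk) (hl : ∀ j q hk, α.app _ (d.l j q hk) = d'.l j q hk) :
    labOf (c.map α) = d' := by
  subst hc
  refine elab_ext ?_ ?_ ?_
  · exact (congrArg Subtype.val (op_labOf_map α c)).trans hop
  · exact funext fun hk => (r_labOf_map α c hk).trans (hr hk)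
  · exact funext fun j => funext fun q => funext fun hk => (l_labOf_map α c j q hk).trans (hl j q hk)

/-- The structure map of an opetopic algebra. -/
abbrev OAlg.str {n : ℕ} (A : OAlg k n) {ω : OptRange k n} (c : Cell A.A ω) : A.A.obj (.op ω) :=
  A.a.app (.op ω) c

theorem OAlg.str_eta {n : ℕ} (A : OAlg k n) {ω : OptRange k n} (x : A.A.obj (.op ω)) :
    A.str (etaCell A.A ω x) = x :=
  psh_congr_app A.unit x

/-- Below dimension n the unit is the identity on cells, so the unit law leaves no choice for the
structure map. -/
theorem OAlg.str_low {n : ℕ} (A : OAlg k n) {ω : OptRange k n} (h : ω.obj.as.dim < n)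
    (x : A.A.obj (.op ω)) : A.str (.low h x) = x :=
  (congrArg A.str (etaCell_low A.A ω h x)).symm.trans (A.str_eta x)

theorem OAlg.str_mu {n : ℕ} (A : OAlg k n) {ω : OptRange k n}
    (c : Cell ((zFunctor k n).obj A.A) ω) : A.str (muCell A.A c) = A.str (c.map A.a) :=
  psh_congr_app A.assoc c

theorem OAlg.map_str {n : ℕ} (A : OAlg k n) {ω ω' : OptRange k n} (c : Cell A.A ω) (u : ω' ⟶ ω) :
    A.A.map u.op (A.str c) = A.str (c.restrict u) :=
  (ConcreteCategory.congr_hom (A.a.naturality u.op) c).symm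

/-- Naturality of the structure map moves the face inside, where the structure map is trivial. Hence
a composite has the faces prescribed by the tree. -/
theorem OAlg.face_str {n : ℕ} (A : OAlg k n) {i : Opetope n} (c : Cell A.A (topOb k i))
    (ω : OptRange k n) (h : ω.obj.as.dim < n) (g : ω.obj ⟶ ob i) :
    face A.A (ω := topOb k i) (A.str c) g = c.bdry ω h g := by
  refine (A.map_str c _).trans ?_
  refine (congrArg A.str (Cell.low_toLow h _)).symm.trans ?_
  exact A.str_low h _

theorem OAlg.hom_str {n : ℕ} {A B : OAlg k n} (f : A ⟶ B) {ω : OptRange k n} (c : Cell A.A ω) :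
    f.f.app (.op ω) (A.str c) = B.str (c.map f.f) :=
  (psh_congr_app f.h c).symm

variable (hk1 : k ≤ 1) (A : OAlg k (m + 1))

/-- The composite of a tree of cells of an opetopic algebra. -/
noncomputable def OAlg.act (a : Σ i, (Z m).Op i) (d : (Z m).ELab (lowT A.A) (lowS A.A) a) :
    Top (n := m + 1) A.A a := A.str (cellOf hk1 d)

theorem OAlg.act_labOf {a : Σ i, (Z m).Op i} (c : Cell A.A (topOb (n := m + 1) k a)) :
    A.act hk1 a (labOf c) = A.str c := congrArg A.str (cellOf_labOf hk1 c)

theorem lowT_cellOf {X : Psh k (m + 1)} {a : Σ i, (Z m).Op i}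
    (d : (Z m).ELab (lowT X) (lowS X) a) (hk : m + 1 ≤ m + k) :
    lowT ((zFunctor k (m + 1)).obj X) a (cellOf hk1 d) hk =
      Cell.low (Nat.lt_succ_self m) (d.r hk) := by
  refine (Cell.low_toLow (X := X) (Nat.lt_succ_self m) _).symm.trans ?_
  exact congrArg (fun d : (Z m).ELab (lowT X) (lowS X) a =>
    Cell.low (ω := lowOb hk a.1) (Nat.lt_succ_self m) (d.r hk)) (labOf_cellOf hk1 d)

theorem lowS_cellOf {X : Psh k (m + 1)} {a : Σ i, (Z m).Op i}
    (d : (Z m).ELab (lowT X) (lowS X) a) (j : Opetope m) (q : (Z m).In a.2 j)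
    (hk : m + 1 ≤ m + k) :
    lowS ((zFunctor k (m + 1)).obj X) a (cellOf hk1 d) j q hk =
      Cell.low (Nat.lt_succ_self m) (d.l j q hk) := by
  refine (Cell.low_toLow (X := X) (Nat.lt_succ_self m) _).symm.trans ?_
  exact congrArg (fun d : (Z m).ELab (lowT X) (lowS X) a =>
    Cell.low (ω := lowOb hk j) (Nat.lt_succ_self m) (d.l j q hk)) (labOf_cellOf hk1 d)

/-- The cells of dimensions `m` and `m+1` of an opetopic algebra, as a coloured algebra. -/
noncomputable def OAlg.toEAlgObj : EAlg (Z m) where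
  C := LowFam A.A
  X := Top (n := m + 1) A.A
  t := lowT A.A
  s := lowS A.A
  act := A.act hk1
  t_act a d := by
    funext hk
    refine (A.face_str (i := a) (cellOf hk1 d) (lowOb hk a.1) (Nat.lt_succ_self m)
      (tgtHom a.2)).trans ?_
    exact congrFun (congrArg PolyMonad.ELab.r (labOf_cellOf hk1 d)) hk
  s_act a d := by
    funext j q hk
    refine (A.face_str (i := a) (cellOf hk1 d) (lowOb hk j) (Nat.lt_succ_self m)
      (srcHom a.2 q)).trans ?_
    exact congrFun (congrFun (congrFun (congrArg PolyMonad.ELab.l (labOf_cellOf hk1 d)) j) q) hk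
  act_unit a x := by
    refine (congrArg (A.act hk1 a) (labOf_eta x)).symm.trans ?_
    refine (A.act_labOf hk1 _).trans ?_
    refine (congrArg A.str (etaCell_top A.A a x)).symm.trans ?_
    exact A.str_eta (ω := topOb (n := m + 1) k a) x
  act_bind a ζ r l h h1 h2 := by
    -- The cell of `𝔷ⁿ(𝔷ⁿA)` encoding `ζ`: its nodes carry cells of `𝔷ⁿA` instead of coloured trees.
    -- Its multiplication is the substituted tree (`e1`), and its image under the structure map is
    -- the tree of composites (`e2`). Associativity of the algebra compares the two.
    let c : Cell ((zFunctor k (m + 1)).obj A.A) (topOb (n := m + 1) k a) := cellOf hk1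
      ⟨ζ.map (Z m) (fun _ d => cellOf hk1 d), fun hk => Cell.low (Nat.lt_succ_self m) (r hk),
        fun j q hk => Cell.low (Nat.lt_succ_self m) (l j q hk),
        PolyMonad.CondD.mapDec (Z m) (γ := fun j (x : LowFam A.A j) hk =>
          (Cell.low (ω := lowOb hk j) (Nat.lt_succ_self m) (x hk) : Cell A.A (lowOb hk j)))
          (fun a d => funext fun hk => lowT_cellOf hk1 d hk)
          (fun a d j q => funext fun hk => lowS_cellOf hk1 d j q hk) h⟩
    have hc := labOf_cellOf (X := (zFunctor k (m + 1)).obj A.A) hk1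
      ⟨ζ.map (Z m) (fun _ d => cellOf hk1 d), fun hk => Cell.low (Nat.lt_succ_self m) (r hk),
        fun j q hk => Cell.low (Nat.lt_succ_self m) (l j q hk),
        PolyMonad.CondD.mapDec (Z m) (γ := fun j (x : LowFam A.A j) hk =>
          (Cell.low (ω := lowOb hk j) (Nat.lt_succ_self m) (x hk) : Cell A.A (lowOb hk j)))
          (fun a d => funext fun hk => lowT_cellOf hk1 d hk)
          (fun a d j q => funext fun hk => lowS_cellOf hk1 d j q hk) h⟩
    change labOf c = _ at hc
    have e1 : labOf (muTop (n := m + 1) (i := a) c) = ⟨ζ.bind (Z m) (fun _ d => d.op), r, l, h1⟩ := by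
      refine elab_ext ?_ ?_ ?_
      · refine (op_labOf_mu c).trans ?_
        rw [hc]
        refine ((Z m).bindD_mapDec _ _ _).trans ?_
        refine congrArg (fun f => (Z m).bindD f ζ.1) ?_
        exact funext fun b => funext fun d => congrArg PolyMonad.ELab.op (labOf_cellOf hk1 d)
      · funext hk
        refine (r_labOf_mu c hk).trans ?_
        rw [hc]
        rfl
      · funext j q hk
        refine (l_labOf_mu c j q hk).trans ?_
        rw [hc]
        rfl
    have e2 : labOf (c.map A.a) = ⟨ζ.map (Z m) (A.act hk1), r, l, h2⟩ :=
      labOf_map_eq A.a hc ((Z m).mapDec_mapDec _ _ _) (fun hk => A.str_low _ _)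
        (fun j q hk => A.str_low _ _)
    rw [← e1, ← e2]
    refine (A.act_labOf hk1 _).trans (Eq.trans ?_ (A.act_labOf hk1 _).symm)
    refine (congrArg A.str (muCell_top A.A (i := a) c)).symm.trans ?_
    exact A.str_mu c

variable {A}

theorem lowT_map {X Y : Psh k (m + 1)} (α : X ⟶ Y) (a : Σ i, (Z m).Op i)
    (x : Top (n := m + 1) X a) (hk : m + 1 ≤ m + k) :
    lowT Y a (α.app (.op (topOb k a)) x) hk = α.app _ (lowT X a x hk) :=
  (ConcreteCategory.congr_hom (α.naturality _) x).symm

theorem lowS_map {X Y : Psh k (m + 1)} (α : X ⟶ Y) (a : Σ i, (Z m).Op i)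
    (x : Top (n := m + 1) X a) (j : Opetope m) (q : (Z m).In a.2 j) (hk : m + 1 ≤ m + k) :
    lowS Y a (α.app (.op (topOb k a)) x) j q hk = α.app _ (lowS X a x j q hk) :=
  (ConcreteCategory.congr_hom (α.naturality _) x).symm

/-- The functor that takes an opetopic algebra to the coloured algebra of its cells of dimensions
`m` and `m+1`. -/
noncomputable def toEAlg (hk1 : k ≤ 1) : OAlg k (m + 1) ⥤ EAlg (Z m) where
  obj A := A.toEAlgObj hk1
  map {A B} f := EAlg.Hom.mk (E := A.toEAlgObj hk1) (E' := B.toEAlgObj hk1)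
    (fun j x hk => f.f.app (.op (lowOb hk j)) (x hk))
    (fun a x => f.f.app (.op (topOb (n := m + 1) k a)) x)
    (fun a x => funext fun hk => lowT_map f.f a x hk)
    (fun a x j q => funext fun hk => lowS_map f.f a x j q hk)
    (fun a d => by
      refine (OAlg.hom_str f (cellOf hk1 d)).trans ?_
      refine (B.act_labOf hk1 _).symm.trans ?_
      refine congrArg (B.act hk1 a) ?_
      exact labOf_map_eq f.f (labOf_cellOf hk1 d) rfl (fun _ => rfl) (fun _ _ _ => rfl))
  map_id A := rfl
  map_comp f g := rfl

end algebra

theorem topOb_injective {k n : ℕ} {i j : Opetope n} (h : topOb k i = topOb k j) : i = j := by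
  injection h with h
  injection h with h
  injection h

theorem lowOb_injective {k m : ℕ} {hk : m + 1 ≤ m + k} {i j : Opetope m}
    (h : lowOb hk i = lowOb hk j) : i = j := by
  injection h with h
  injection h with h
  injection h

theorem topOb_ne_lowOb {k m : ℕ} (hk : m + 1 ≤ m + k) (i : Opetope (m + 1)) (j : Opetope m) :
    topOb k i ≠ lowOb hk j := by
  intro h
  have : m + 1 = m := congrArg (fun ω : OptRange k (m + 1) => ω.obj.as.dim) h
  omega

/-! ### Opetopic algebras embed fully faithfully into coloured algebras. -/

section faithful

variable {k m : ℕ} (hk1 : k ≤ 1)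

instance : (toEAlg (m := m) hk1).Faithful where
  map_injective {A B} f g h := by
    apply Monad.Algebra.Hom.ext
    ext ⟨ω⟩ x
    have hx := congrArg EAlg.Hom.x h
    have hc := congrArg EAlg.Hom.c h
    by_cases hω : ω.obj.as.dim < m + 1
    · obtain ⟨hk, j, rfl⟩ := exists_lowOb hk1 ω hω
      exact congrFun (congrFun (congrFun hc j) (fun _ => x)) hk
    · obtain ⟨i, rfl⟩ := exists_topOb ω hω
      exact congrFun (congrFun hx i) x

/-- An object in range is a top or a low one only up to an equality, so the components are found by
existence and described by heterogeneous equalities. After a choice these become honest equations.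
-/
theorem exists_app {A B : OAlg k (m + 1)}
    (g : EAlg.Hom (A.toEAlgObj hk1) (B.toEAlgObj hk1)) (ω : OptRange k (m + 1)) :
    ∃ F : A.A.obj (.op ω) → B.A.obj (.op ω),
      (∀ (a : Opetope (m + 1)) (_ : ω = topOb k a), HEq F (g.x a)) ∧
      ∀ (hk : m + 1 ≤ m + k) (j : Opetope m) (_ : ω = lowOb hk j),
        HEq F (fun x : A.A.obj (.op (lowOb hk j)) => g.c j (fun _ => x) hk) := by
  by_cases hω : ω.obj.as.dim < m + 1
  · obtain ⟨hk, j, rfl⟩ := exists_lowOb hk1 ω hω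
    refine ⟨fun x => g.c j (fun _ => x) hk, fun a h => absurd h.symm (topOb_ne_lowOb hk a j),
      fun hk' j' h => ?_⟩
    obtain rfl := lowOb_injective h
    rfl
  · obtain ⟨i, rfl⟩ := exists_topOb ω hω
    refine ⟨g.x i, fun a h => ?_, fun hk j h => absurd h (topOb_ne_lowOb hk i j)⟩
    obtain rfl := topOb_injective h
    rfl

instance : (toEAlg (m := m) hk1).Full where
  map_surjective {A B} := fun (g : EAlg.Hom (A.toEAlgObj hk1) (B.toEAlgObj hk1)) => by
    choose F htop hlow using exists_app hk1 g
    replace htop : ∀ a, F (topOb k a) = g.x a := fun a => eq_of_heq (htop _ a rfl)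
    replace hlow : ∀ hk j, F (lowOb hk j) = fun x => g.c j (fun _ => x) hk :=
      fun hk j => eq_of_heq (hlow _ hk j rfl)
    let α : A.A ⟶ B.A :=
      { app := fun ω => ↾(F ω.unop)
        naturality := fun ω ω' u => by
          ext x
          revert x
          refine range_hom_induction hk1 (P := fun {ω' ω} u => ∀ x : A.A.obj (.op ω),
            F ω' (A.A.map u.op x) = B.A.map u.op (F ω x)) ?_ ?_ ?_ u.unop
          · intro ω x
            refine (congrArg (F ω) (ConcreteCategory.congr_hom (A.A.map_id (.op ω)) x)).trans ?_
            exact (ConcreteCategory.congr_hom (B.A.map_id (.op ω)) (F ω x)).symm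
          · intro hk a x
            refine (congrFun (hlow hk _) _).trans (Eq.trans ?_
              (congrArg (B.A.map _) (congrFun (htop a) x)).symm)
            exact (congrFun (g.t a x) hk).symm
          · intro hk a j q x
            refine (congrFun (hlow hk _) _).trans (Eq.trans ?_
              (congrArg (B.A.map _) (congrFun (htop a) x)).symm)
            exact (congrFun (g.s a x j q) hk).symm }
    have hα : ∀ a (x : Top (n := m + 1) A.A a), α.app (.op (topOb k a)) x = g.x a x :=
      fun a x => congrFun (htop a) x
    have hα' : ∀ hk j (w : LowFam A.A j), α.app (.op (lowOb hk j)) (w hk) = g.c j w hk :=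
      fun hk j w => congrFun (hlow hk j) (w hk)
    refine ⟨{ f := α, h := ?_ }, ?_⟩
    · ext ⟨ω⟩ c
      change Cell A.A ω at c
      change B.str (c.map α) = α.app (.op ω) (A.str c)
      by_cases hω : ω.obj.as.dim < m + 1
      · rw [← Cell.low_toLow hω c]
        refine (B.str_low hω _).trans ?_
        exact congrArg (α.app (.op ω)) (A.str_low hω _).symm
      · obtain ⟨a, rfl⟩ := exists_topOb ω hω
        refine Eq.trans ?_ (hα a _).symm
        refine Eq.trans ?_ (congrArg (g.x a) (A.act_labOf hk1 c))
        refine Eq.trans ?_ (g.act a (labOf c)).symm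
        -- Both structure maps are expressed through actions on trees, where compatibility is the
        -- law `act` of `g`; what remains is that `α` acts on nodes and colours as `g` does.
        refine (B.act_labOf hk1 (a := a) (c.map α)).symm.trans ?_
        refine congrArg (B.act hk1 a) (labOf_map_eq α (a := a) rfl ?_ ?_ ?_)
        · exact congrArg (fun f => (Z m).mapDec f (labOf c).op.1)
            (funext fun a => funext fun x => hα a x)
        · exact fun hk => hα' hk _ (labOf c).r
        · exact fun j q hk => hα' hk _ ((labOf c).l j q)
    · refine EAlg.Hom.ext ?_ ?_
      · exact funext fun j => funext fun w => funext fun hk => hα' hk j w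
      · exact funext fun a => funext fun x => hα a x

end faithful

theorem EAlg.isIso_of_bijective {I : Type} {M : PolyMonad I} {E E' : EAlg M} (f : E ⟶ E')
    (hc : ∀ j, Function.Bijective (EAlg.Hom.c f j))
    (hx : ∀ a, Function.Bijective (EAlg.Hom.x f a)) : IsIso f := by
  choose gc hgc using fun j => (hc j).2
  choose gx hgx using fun a => (hx a).2
  have hc1 : ∀ j c, gc j (EAlg.Hom.c f j c) = c := fun j c => (hc j).1 (hgc j _)
  have hx1 : ∀ a x, gx a (EAlg.Hom.x f a x) = x := fun a x => (hx a).1 (hgx a _)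
  have ht : ∀ a y, E.t a (gx a y) = gc _ (E'.t a y) := fun a y => by
    rw [← hc1 _ (E.t a (gx a y)), ← EAlg.Hom.t, hgx]
  have hs : ∀ a y k e, E.s a (gx a y) k e = gc _ (E'.s a y k e) := fun a y k e => by
    rw [← hc1 _ (E.s a (gx a y) k e), ← EAlg.Hom.s, hgx]
  let g : EAlg.Hom E' E :=
    { c := gc
      x := gx
      t := ht
      s := hs
      act := fun a d => by
        apply (hx a).1
        rw [hgx]
        refine Eq.trans ?_ (EAlg.Hom.act f a _).symm
        refine E'.act_congr ?_ (hgc _ _).symm (funext fun j => funext fun e => (hgc _ _).symm)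
        refine Eq.trans ?_ (M.mapDec_mapDec _ _ _).symm
        simp only [hgx]
        exact (M.mapDec_id _).symm }
  refine ⟨g, EAlg.Hom.ext ?_ ?_, EAlg.Hom.ext ?_ ?_⟩
  · exact funext fun j => funext fun c => hc1 j c
  · exact funext fun j => funext fun c => hx1 j c
  · exact funext fun j => funext fun c => hgc j c
  · exact funext fun j => funext fun c => hgx j c

/-! ### The opetopic algebra of a coloured algebra. -/

namespace EAlg

variable {m : ℕ} (E : EAlg (Z m))

/-- The values at opetopes of dimensions `m` and `m+1` of a coloured algebra, extended to all
opetopes. -/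
@[ext]
structure Val (o : Opt) where
  c : ∀ j, o = ⟨m, j⟩ → E.C j
  x : ∀ a, o = ⟨m + 1, a⟩ → E.X a
  -- Above dimension m+1 there are no values and below dimension m exactly one, so restriction makes
  -- sense along every generator of `𝕆`, and the presheaf can be defined on all opetopes before it
  -- is cut down to the range.
  le : o.dim ≤ m + 1

variable {E}

theorem Val.eq_of_dim_lt {o : Opt} (h : o.dim < m) (v w : E.Val o) : v = w := by
  refine Val.ext ?_ ?_
  · funext j e
    have := congrArg Opt.dim e
    exact absurd this (by dsimp only; omega)
  · funext j e
    have := congrArg Opt.dim e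
    exact absurd this (by dsimp only; omega)

theorem Val.ext_low {j : Opetope m} {v w : E.Val ⟨m, j⟩} (h : v.c j rfl = w.c j rfl) : v = w := by
  refine Val.ext ?_ ?_
  · funext j e
    cases e
    exact h
  · funext j e
    have : m = m + 1 := congrArg Opt.dim e
    omega

theorem Val.ext_top {a : Opetope (m + 1)} {v w : E.Val ⟨m + 1, a⟩} (h : v.x a rfl = w.x a rfl) :
    v = w := by
  refine Val.ext ?_ ?_
  · funext j e
    have : m + 1 = m := congrArg Opt.dim e
    omega
  · funext j e
    cases e
    exact h

/-- The value at an `m`-opetope given by a colour. -/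
def Val.low {j : Opetope m} (c : E.C j) : E.Val ⟨m, j⟩ where
  c j' e := by
    cases e
    exact c
  x j' e := absurd (congrArg Opt.dim e : m = m + 1) (Nat.succ_ne_self m).symm
  le := Nat.le_succ m

/-- The value at an `(m+1)`-opetope given by a cell. -/
def Val.top {a : Opetope (m + 1)} (x : E.X a) : E.Val ⟨m + 1, a⟩ where
  c j e := absurd (congrArg Opt.dim e : m + 1 = m) (Nat.succ_ne_self m)
  x a' e := by
    cases e
    exact x
  le := le_rfl

/-- The restriction of values along generators. -/
def Val.restrict {o o' : Opt} (e : Face o o') (v : E.Val o') : E.Val o where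
  c j h := by
    cases e with
    | tgt b =>
      cases h
      exact E.t _ (v.x _ rfl)
    | src b p =>
      cases h
      exact E.s _ (v.x _ rfl) _ p
  x a h := by
    have := v.le
    have h' := congrArg Opt.dim h
    exact absurd v.le (by cases e <;> (dsimp only at h' ⊢; omega))
  le := by
    have := v.le
    cases e <;> (dsimp only at this ⊢; omega)

variable (E)

/-- The values at opetopes as a contravariant functor. -/
def valFunctor : OptCat ⥤ Typeᵒᵖ :=
  CategoryTheory.Quotient.lift FaceRel (Paths.lift
    { obj := fun o => Opposite.op (E.Val o)
      map := fun e => Quiver.Hom.op (↾(Val.restrict e)) }) (by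
    intro a c f g h
    apply Quiver.Hom.unop_inj
    ext v
    change E.Val c at v
    have h1 := dim_eq (a := a) (c := c) f
    have h2 := (length_faceRel h).1
    have h3 := v.le
    -- The relations compare paths of length two, and a value exists only up to dimension m+1. The
    -- restricted values therefore lie below dimension m, where they are unique: all relations hold
    -- trivially.
    refine Val.eq_of_dim_lt (E := E) (o := a) ?_ _ _
    omega)

/-- The presheaf given by the cells of a coloured algebra. -/
def valPsh (k : ℕ) : Psh k (m + 1) := (InRange k (m + 1)).ι.op ⋙ E.valFunctor.leftOp

end EAlg

namespace EAlg

variable {m k : ℕ} {E : EAlg (Z m)}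

/-- The cells of the presheaf of a coloured algebra. -/
def valX (a : Opetope (m + 1)) (v : Top (n := m + 1) (E.valPsh k) a) : E.X a :=
  Val.x (show E.Val ⟨m + 1, a⟩ from v) a rfl

/-- The cell of the presheaf of a coloured algebra given by a cell of the latter. -/
def valTop {a : Opetope (m + 1)} (x : E.X a) : Top (n := m + 1) (E.valPsh k) a :=
  (Val.top x : E.Val ⟨m + 1, a⟩)

theorem valTop_valX {a : Opetope (m + 1)} (v : Top (n := m + 1) (E.valPsh k) a) :
    valTop (valX a v) = v := Val.ext_top rfl

theorem valX_bijective (a : Opetope (m + 1)) : Function.Bijective (valX (E := E) (k := k) a) :=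
  ⟨fun _ _ h => Val.ext_top h, fun x => ⟨valTop x, rfl⟩⟩

/-- The colour given by a family of low-dimensional cells of the presheaf of a coloured
algebra. -/
noncomputable def valC (hE : ¬ m + 1 ≤ m + k → ∀ i, Nonempty (Unique (E.C i))) (i : Opetope m)
    (w : LowFam (E.valPsh k) i) : E.C i :=
  open Classical in
  if hk : m + 1 ≤ m + k then Val.c (show E.Val ⟨m, i⟩ from w hk) i rfl
  else (hE hk i).some.default

variable (hE : ¬ m + 1 ≤ m + k → ∀ i, Nonempty (Unique (E.C i)))

theorem valC_eq {i : Opetope m} (w : LowFam (E.valPsh k) i) (hk : m + 1 ≤ m + k) :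
    valC hE i w = Val.c (show E.Val ⟨m, i⟩ from w hk) i rfl := dif_pos hk

theorem eq_valC {i : Opetope m} {w : LowFam (E.valPsh k) i} {c : E.C i}
    (h : ∀ hk, Val.c (show E.Val ⟨m, i⟩ from w hk) i rfl = c) : valC hE i w = c := by
  by_cases hk : m + 1 ≤ m + k
  · exact (valC_eq hE w hk).trans (h hk)
  · obtain ⟨u⟩ := hE hk i
    exact Subsingleton.elim _ _

/-- For k = 1 the colour is read off the presheaf; for k = 0 both sides are singletons, the
right-hand one by `hE`. -/
theorem valC_bijective (i : Opetope m) : Function.Bijective (valC (E := E) (k := k) hE i) := by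
  constructor
  · intro w w' h
    funext hk
    rw [valC_eq hE w hk, valC_eq hE w' hk] at h
    exact Val.ext_low h
  · intro c
    exact ⟨fun hk => (Val.low c : E.Val ⟨m, i⟩), eq_valC hE fun hk => rfl⟩

theorem valC_lowT (a : Σ i, (Z m).Op i) (v : Top (n := m + 1) (E.valPsh k) a) :
    valC hE a.1 (lowT (E.valPsh k) a v) = E.t a (valX a v) :=
  eq_valC hE fun _ => rfl

theorem valC_lowS (a : Σ i, (Z m).Op i) (v : Top (n := m + 1) (E.valPsh k) a) (j : Opetope m)
    (q : (Z m).In a.2 j) :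
    valC hE j (lowS (E.valPsh k) a v j q) = E.s a (valX a v) j q :=
  eq_valC hE fun _ => rfl

/-- The tree of cells of a coloured algebra given by a tree of cells of its presheaf. -/
noncomputable def valLab {a : Σ i, (Z m).Op i}
    (d : (Z m).ELab (lowT (E.valPsh k)) (lowS (E.valPsh k)) a) : (Z m).ELab E.t E.s a where
  op := d.op.map (Z m) valX
  r := valC hE a.1 d.r
  l := fun j q => valC hE j (d.l j q)
  cond := d.cond.mapDec (Z m) (fun a v => (valC_lowT hE a v).symm)
    (fun a v j q => (valC_lowS hE a v j q).symm)

/-- The structure map of the opetopic algebra given by a coloured algebra. -/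
noncomputable def valStr : ∀ {ω : OptRange k (m + 1)}, Cell (E.valPsh k) ω →
    (E.valPsh k).obj (.op ω)
  | _, .low _ x => x
  | _, .top (i := a) b y =>
    valTop (E.act a (valLab hE (labOf (a := a) (.top (n := m + 1) b y))))

theorem valStr_low {ω : OptRange k (m + 1)} (h : ω.obj.as.dim < m + 1) (c : Cell (E.valPsh k) ω) :
    valStr hE c = c.toLow h := by
  cases c with
  | low _ _ => rfl
  | top _ _ => exact absurd h (lt_irrefl (m + 1))

theorem valStr_top {a : Σ i, (Z m).Op i} (c : Cell (E.valPsh k) (topOb (n := m + 1) k a)) :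
    valStr hE c = valTop (E.act a (valLab hE (labOf c))) := by
  obtain ⟨b, y, rfl⟩ := c.top_cases
  rfl

/-- On target and source embeddings, naturality is the statement that the composite of a tree has
the boundary of that tree (`t_act`, `s_act`). -/
theorem valStr_map (hk1 : k ≤ 1) {ω' ω : OptRange k (m + 1)} (c : Cell (E.valPsh k) ω)
    (u : ω' ⟶ ω) :
    valStr hE (c.restrict u) = (E.valPsh k).map u.op (valStr hE c) := by
  revert c
  refine range_hom_induction hk1 (P := fun {ω' ω} u => ∀ c : Cell (E.valPsh k) ω,
    valStr hE (c.restrict u) = (E.valPsh k).map u.op (valStr hE c)) ?_ ?_ ?_ u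
  · intro ω c
    refine (congrArg (valStr hE) c.restrict_id).trans ?_
    exact (ConcreteCategory.congr_hom ((E.valPsh k).map_id (.op ω)) _).symm
  · intro hk a c
    refine (valStr_low hE (Nat.lt_succ_self m) _).trans ?_
    refine Eq.trans ?_ (congrArg _ (valStr_top hE c)).symm
    refine Val.ext_low ?_
    refine (valC_eq hE (labOf c).r hk).symm.trans ?_
    exact (E.t_act a (valLab hE (labOf c))).symm
  · intro hk a j q c
    refine (valStr_low hE (Nat.lt_succ_self m) _).trans ?_
    refine Eq.trans ?_ (congrArg _ (valStr_top hE c)).symm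
    refine Val.ext_low ?_
    refine (valC_eq hE ((labOf c).l j q) hk).symm.trans ?_
    exact (congrFun (congrFun (E.s_act a (valLab hE (labOf c))) j) q).symm

theorem valStr_eta {ω : OptRange k (m + 1)} (x : (E.valPsh k).obj (.op ω)) :
    valStr hE (etaCell (E.valPsh k) ω x) = x := by
  by_cases hω : ω.obj.as.dim < m + 1
  · rw [etaCell_low _ ω hω]
    rfl
  · obtain ⟨a, rfl⟩ := exists_topOb ω hω
    refine (congrArg (valStr hE) (etaCell_top (E.valPsh k) a x)).trans ?_
    refine (valStr_top hE _).trans ?_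
    refine Eq.trans (congrArg valTop ?_) (valTop_valX x)
    refine Eq.trans ?_ (E.act_unit a (valX a x))
    refine (congrArg (fun d => E.act a (valLab hE d)) (labOf_eta (a := a) x)).trans ?_
    exact E.act_congr rfl (valC_lowT hE a x)
      (funext fun j => funext fun q => valC_lowS hE a x j q)

variable (E) in
/-- The structure map of the opetopic algebra given by a coloured algebra, as a morphism of
presheaves. -/
noncomputable def valHom (hk1 : k ≤ 1) : (zFunctor k (m + 1)).obj (E.valPsh k) ⟶ E.valPsh k where
  app ω := ↾fun c => valStr hE (ω := ω.unop) c
  naturality ω ω' u := by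
    ext c
    exact valStr_map hE hk1 c u.unop

/-- On top cells both sides are actions of `E`: on a substituted tree and on the tree of composites.
This is exactly `act_bind`. -/
theorem valStr_mu (hk1 : k ≤ 1) {ω : OptRange k (m + 1)}
    (c : Cell ((zFunctor k (m + 1)).obj (E.valPsh k)) ω) :
    valStr hE (muCell (E.valPsh k) c) = valStr hE (c.map (E.valHom hE hk1)) := by
  by_cases hω : ω.obj.as.dim < m + 1
  · cases c with
    | low h x => rfl
    | top b y => exact absurd hω (lt_irrefl (m + 1))
  · obtain ⟨a, rfl⟩ := exists_topOb ω hω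
    refine (congrArg (valStr hE) (muCell_top (E.valPsh k) (i := a) c)).trans ?_
    refine (valStr_top hE (a := a) _).trans (Eq.trans (congrArg valTop ?_)
      (valStr_top hE (a := a) _).symm)
    -- The tree underlying `c`, each node decorated by the coloured tree of `E` that its label
    -- describes; `g` below reads the colours of its edges in `E`.
    let ζ : (Z m).DOp ((Z m).ELab E.t E.s) a :=
      (labOf (a := a) c).op.map (Z m) (fun b d => valLab hE (labOf (a := b) d))
    let g : ∀ j, LowFam ((zFunctor k (m + 1)).obj (E.valPsh k)) j → E.C j := fun j w =>
      valC hE j (fun hk => Cell.toLow (X := E.valPsh k) (ω := lowOb hk j) (Nat.lt_succ_self m) (w hk))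
    have hζ : (Z m).CondD (fun _ d => d.r) (fun _ d => d.l) ζ.1 (g _ (labOf (a := a) c).r)
        (fun j q => g j ((labOf (a := a) c).l j q)) :=
      (labOf (a := a) c).cond.mapDec (Z m) (α := fun b d => valLab hE (labOf (a := b) d)) (γ := g)
        (tB := fun _ d => d.r) (sB := fun _ d => d.l) (fun _ _ => rfl) (fun _ _ _ _ => rfl)
    have e1 : (ζ.bind (Z m) (fun _ d => d.op)).1 =
        (valLab hE (labOf (muTop (n := m + 1) (i := a) c))).op.1 := by
      refine ((Z m).bindD_mapDec _ _ _).trans (Eq.trans ?_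
        (congrArg ((Z m).mapDec valX) (op_labOf_mu (a := a) c)).symm)
      exact ((Z m).mapDec_bindD _ _ _).symm
    have e2 : (ζ.map (Z m) E.act).1 =
        (valLab hE (labOf (a := a) (c.map (E.valHom hE hk1)))).op.1 := by
      refine ((Z m).mapDec_mapDec _ _ _).trans (Eq.trans ?_
        (congrArg (fun T => (Z m).mapDec valX T.1)
          (op_labOf_map (E.valHom hE hk1) (a := a) c)).symm)
      refine Eq.trans ?_ ((Z m).mapDec_mapDec _ _ _).symm
      refine congrArg (fun f => (Z m).mapDec f (labOf (a := a) c).op.1) ?_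
      funext b d
      exact (congrArg (valX b) (valStr_top hE (a := b) d)).symm
    have hr1 : g _ (labOf (a := a) c).r =
        (valLab hE (labOf (muTop (n := m + 1) (i := a) c))).r :=
      congrArg (valC hE _) (funext fun hk => (r_labOf_mu (a := a) c hk).symm)
    have hl1 : (fun j q => g j ((labOf (a := a) c).l j q)) =
        (valLab hE (labOf (muTop (n := m + 1) (i := a) c))).l :=
      funext fun j => funext fun q =>
        congrArg (valC hE _) (funext fun hk => (l_labOf_mu (a := a) c j q hk).symm)
    have hr2 : g _ (labOf (a := a) c).r =
        (valLab hE (labOf (a := a) (c.map (E.valHom hE hk1)))).r :=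
      congrArg (valC hE _) (funext fun hk =>
        ((r_labOf_map (E.valHom hE hk1) (a := a) c hk).trans
          (valStr_low hE (Nat.lt_succ_self m) _)).symm)
    have hl2 : (fun j q => g j ((labOf (a := a) c).l j q)) =
        (valLab hE (labOf (a := a) (c.map (E.valHom hE hk1)))).l :=
      funext fun j => funext fun q => congrArg (valC hE _) (funext fun hk =>
        ((l_labOf_map (E.valHom hE hk1) (a := a) c j q hk).trans
          (valStr_low hE (Nat.lt_succ_self m) _)).symm)
    have h1 : (Z m).CondD E.t E.s (ζ.bind (Z m) (fun _ d => d.op)).1 (g _ (labOf (a := a) c).r)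
        (fun j q => g j ((labOf (a := a) c).l j q)) := by
      rw [e1, hr1, hl1]
      exact (valLab hE _).cond
    have h2 : (Z m).CondD E.t E.s (ζ.map (Z m) E.act).1 (g _ (labOf (a := a) c).r)
        (fun j q => g j ((labOf (a := a) c).l j q)) := by
      rw [e2, hr2, hl2]
      exact (valLab hE _).cond
    refine Eq.trans ?_ ((E.act_bind a ζ _ _ hζ h1 h2).trans ?_)
    · exact E.act_congr e1.symm hr1.symm hl1.symm
    · exact E.act_congr e2 hr2 hl2

variable (E) in
/-- The opetopic algebra given by a coloured algebra. -/
noncomputable def toOAlg (hk1 : k ≤ 1) : OAlg k (m + 1) where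
  A := E.valPsh k
  a := E.valHom hE hk1
  unit := by
    ext ⟨ω⟩ x
    exact valStr_eta hE x
  assoc := by
    ext ⟨ω⟩ c
    exact valStr_mu hE hk1 c

variable (E) in
/-- The comparison of a coloured algebra with the one given by its opetopic algebra. -/
noncomputable def valComp (hk1 : k ≤ 1) : (toEAlg hk1).obj (E.toOAlg hE hk1) ⟶ E :=
  EAlg.Hom.mk (E := (E.toOAlg hE hk1).toEAlgObj hk1) (E' := E)
    (valC hE) valX (fun a y => (valC_lowT hE a y).symm) (fun a y j q => (valC_lowS hE a y j q).symm)
    (fun a d => by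
      refine (congrArg (valX a) (valStr_top hE (cellOf hk1 d))).trans ?_
      exact congrArg (fun d => E.act a (valLab hE d)) (labOf_cellOf (X := E.valPsh k) hk1 d))

end EAlg

/-- For k = 0 the colours of an opetopic algebra are functions on an empty type, so they form
singletons, and this is invariant under isomorphism. Conversely the algebra built from presheaf
values is isomorphic to `E` as soon as its colours can be recovered. -/
theorem toEAlg_essImage {k m : ℕ} (hk1 : k ≤ 1) (E : EAlg (Z m)) :
    (toEAlg hk1).essImage E ↔ k = 1 ∨ ∀ i, Nonempty (Unique (E.C i)) := by
  constructor
  · rintro ⟨A, ⟨e⟩⟩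
    by_cases hk : k = 1
    · exact Or.inl hk
    · right
      intro i
      have hk' : ¬ m + 1 ≤ m + k := by omega
      have h1 : ∀ c, EAlg.Hom.c e.hom i (EAlg.Hom.c e.inv i c) = c := fun c =>
        congrFun (congrFun (congrArg EAlg.Hom.c e.inv_hom_id) i) c
      refine ⟨⟨⟨EAlg.Hom.c e.hom i (fun h => absurd h hk')⟩, fun c => ?_⟩⟩
      rw [← h1 c]
      exact congrArg _ (funext fun h => absurd h hk')
  · intro h
    have hE : ¬ m + 1 ≤ m + k → ∀ i, Nonempty (Unique (E.C i)) := fun hk =>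
      h.resolve_left (by omega)
    have := EAlg.isIso_of_bijective (E.valComp hE hk1) (EAlg.valC_bijective hE)
      EAlg.valX_bijective
    exact ⟨E.toOAlg hE hk1, ⟨asIso (E.valComp hE hk1)⟩⟩

/-! ### Opetopic algebras inside generalized multicategories. -/

/-- The functor that takes an opetopic algebra to a generalized multicategory. -/
noncomputable def toMultiFunctor {k m : ℕ} (hk1 : k ≤ 1) : OAlg k (m + 1) ⥤ Multi (Z m).toF :=
  toEAlg hk1 ⋙ EAlg.toMulti

instance {k m : ℕ} (hk1 : k ≤ 1) : (toMultiFunctor (m := m) hk1).Faithful :=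
  inferInstanceAs (toEAlg hk1 ⋙ EAlg.toMulti).Faithful

instance {k m : ℕ} (hk1 : k ≤ 1) : (toMultiFunctor (m := m) hk1).Full :=
  inferInstanceAs (toEAlg hk1 ⋙ EAlg.toMulti).Full

theorem toMultiFunctor_essImage {k m : ℕ} (hk1 : k ≤ 1) (N : Multi (Z m).toF) :
    (toMultiFunctor hk1).essImage N ↔ k = 1 ∨ Multi.OneObj _ N := by
  constructor
  · rintro ⟨A, ⟨e⟩⟩
    refine ((toEAlg_essImage hk1 _).1 (Functor.obj_mem_essImage _ A)).imp id fun h => ?_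
    exact Multi.OneObj.of_iso e h
  · intro h
    obtain ⟨E, ⟨e⟩⟩ := Functor.EssSurj.mem_essImage (F := EAlg.toMulti) N
    have hE : (toEAlg hk1).essImage E := (toEAlg_essImage hk1 E).2 (h.imp id fun h =>
      Multi.OneObj.of_iso e.symm h)
    obtain ⟨A, ⟨e'⟩⟩ := hE
    exact ⟨A, ⟨EAlg.toMulti.mapIso e' ≪≫ e⟩⟩

/-! ### The identity monad: categories and monoids. -/

/-- The identity monad on families of sets. -/
def FMonad.ident (I : Type) : FMonad I where
  F X i := X i
  map f _ x := f _ x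
  pure x := x
  bind x f := f _ x
  pure_bind _ _ := rfl
  bind_pure _ := rfl
  bind_assoc _ _ _ := rfl
  map_eq _ _ _ := rfl

/-- The monad `𝔷⁰` is the identity monad. -/
def zZeroIso : FMonad.Iso (Z 0).toF (FMonad.ident (Opetope 0)) where
  e _ _ := ⟨fun z => z.2 () (), fun x => ⟨(), fun _ _ => x⟩, fun _ => rfl, fun _ => rfl⟩
  pure _ := rfl
  bind _ _ := rfl

/-- The transport of generalized multicategories along the isomorphism of `𝔷⁰` with the identity
monad. -/
def zZeroTransport : Multi (FMonad.ident Unit) ⥤ Multi (Z 0).toF := zZeroIso.transport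

instance : zZeroTransport.Full := by
  have h : zZeroIso.transport.Full := inferInstance
  exact h

instance : zZeroTransport.Faithful := by
  have h : zZeroIso.transport.Faithful := inferInstance
  exact h

instance : zZeroTransport.EssSurj := by
  have h : zZeroIso.transport.EssSurj := inferInstance
  exact h

theorem arrow_mk_congr {C : Type*} [Category C] {X Y : C} {f g : X ⟶ Y} (h : f = g) :
    Arrow.mk f = Arrow.mk g := by
  rw [h]

theorem arrow_mk_injective {C : Type*} [Category C] {X Y : C} {f g : X ⟶ Y}
    (h : Arrow.mk f = Arrow.mk g) : f = g := by
  obtain ⟨_, _, h⟩ := (Arrow.mk_eq_mk_iff f g).1 h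
  simpa using h

/-- A category as a generalized multicategory for the identity monad. -/
def catToMultiObj (C : Type) [Category.{0} C] : Multi (FMonad.ident Unit) where
  C _ := C
  X _ := Arrow C
  t _ f := f.right
  s _ f := f.left
  one _ c := Arrow.mk (𝟙 c)
  -- Here `g` is the arrow plugged into the input of `f`, so it comes first in diagrammatic order;
  -- `eqToHom` bridges the propositional equality of the middle objects.
  comp (f : Arrow C) (g : Arrow C) (h : g.right = f.left) :=
    Arrow.mk (g.hom ≫ eqToHom h ≫ f.hom)
  t_one _ := rfl
  s_one _ := rfl
  t_comp _ _ _ := rfl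
  s_comp _ _ _ := rfl
  one_comp (f : Arrow C) h := arrow_mk_congr (g := f.hom)
    (show f.hom ≫ eqToHom rfl ≫ 𝟙 f.right = f.hom by simp)
  comp_one (f : Arrow C) h := arrow_mk_congr (g := f.hom)
    (show 𝟙 f.left ≫ eqToHom rfl ≫ f.hom = f.hom by simp)
  comp_assoc (f : Arrow C) ζ h h' h'' := by
    obtain ⟨⟨g, e⟩, h1⟩ := ζ
    change Arrow C at g e
    change e.right = g.left at h1
    change g.right = f.left at h
    exact arrow_mk_congr
      (show e.hom ≫ eqToHom h1 ≫ g.hom ≫ eqToHom h ≫ f.hom =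
        (e.hom ≫ eqToHom h1 ≫ g.hom) ≫ eqToHom h ≫ f.hom by simp only [Category.assoc])

/-- The functor that takes a category to a generalized multicategory for the identity monad. -/
def catToMulti : Cat.{0, 0} ⥤ Multi (FMonad.ident Unit) where
  obj C := catToMultiObj C
  map {C D} F := Multi.Hom.mk (N := catToMultiObj C) (N' := catToMultiObj D)
    (fun _ c => F.toFunctor.obj c) (fun _ (f : Arrow C) => Arrow.mk (F.toFunctor.map f.hom))
    (fun _ => rfl) (fun _ => rfl)
    (fun (c : C) => arrow_mk_congr (F.toFunctor.map_id c))
    (fun {_} (f : Arrow C) (g : Arrow C) (h : g.right = f.left) h' => arrow_mk_congr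
      (show F.toFunctor.map (g.hom ≫ eqToHom h ≫ f.hom) =
        F.toFunctor.map g.hom ≫ eqToHom (congrArg F.toFunctor.obj h) ≫ F.toFunctor.map f.hom by
        simp [eqToHom_map]))
  map_id C := rfl
  map_comp F G := rfl

instance : catToMulti.Faithful where
  map_injective {C D} F G h := by
    have hx := congrArg Multi.Hom.x h
    have hc := congrArg Multi.Hom.c h
    refine Cat.Hom.ext (CategoryTheory.Functor.ext (fun c => congrFun (congrFun hc ()) c) fun a b f => ?_)
    obtain ⟨_, _, h⟩ := (Arrow.mk_eq_mk_iff (F.toFunctor.map f) (G.toFunctor.map f)).1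
      (congrFun (congrFun hx ()) (Arrow.mk f))
    exact h

instance : catToMulti.Full where
  map_surjective {C D} := fun (g : Multi.Hom (catToMultiObj C) (catToMultiObj D)) => by
    let gc : C → D := g.c ()
    let gx : Arrow C → Arrow D := g.x ()
    -- The image of an arrow has the right endpoints only up to equality; it is conjugated by
    -- `eqToHom` to obtain a morphism in the required hom-set.
    have key : ∀ (a b : C) (f : a ⟶ b), ∃ f' : gc a ⟶ gc b, gx (Arrow.mk f) = Arrow.mk f' := by
      intro a b f
      have ht : (gx (Arrow.mk f)).right = gc b := g.t (j := ()) (Arrow.mk f)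
      have hs : (gx (Arrow.mk f)).left = gc a := g.s (j := ()) (Arrow.mk f)
      exact ⟨eqToHom hs.symm ≫ (gx (Arrow.mk f)).hom ≫ eqToHom ht,
        (Arrow.mk_eq_mk_iff (gx (Arrow.mk f)).hom _).2 ⟨hs, ht, by simp⟩⟩
    choose φ hφ using key
    let F : C ⥤ D :=
      { obj := gc
        map := fun f => φ _ _ f
        map_id := fun c => arrow_mk_injective ((hφ _ _ (𝟙 c)).symm.trans (g.one (j := ()) c))
        map_comp := fun {a b c} f f' => by
          apply arrow_mk_injective
          have h1 : Arrow.mk (f ≫ f') = Arrow.mk (f ≫ eqToHom rfl ≫ f') := by simp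
          have h2 : Arrow.mk (φ _ _ f ≫ φ _ _ f') =
            Arrow.mk (φ _ _ f ≫ eqToHom rfl ≫ φ _ _ f') := by simp
          refine (hφ _ _ _).symm.trans ((congrArg gx h1).trans (Eq.trans ?_ h2.symm))
          have h := g.comp (i := ()) (Arrow.mk f') (Arrow.mk f) rfl
            (g.compat (i := ()) (y := Arrow.mk f') (z := Arrow.mk f) rfl)
          exact h.trans ((catToMultiObj D).comp_congr _ (hφ _ _ f') (hφ _ _ f)) }
    refine ⟨F.toCatHom, Multi.Hom.ext rfl ?_⟩
    funext _ f
    exact (hφ _ _ (Arrow.hom f)).symm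

section

variable (N : Multi (FMonad.ident Unit))

/-- The objects of the category given by a generalized multicategory for the identity monad. -/
def Multi.Ob : Type := N.C ()

instance : Category.{0} N.Ob where
  Hom a b := {x : N.X () // N.s () x = a ∧ N.t () x = b}
  id c := ⟨N.one () c, N.s_one (i := ()) c, N.t_one (i := ()) c⟩
  comp f g := ⟨N.comp (i := ()) g.1 f.1 (f.2.2.trans g.2.1.symm),
    (N.s_comp (i := ()) _ _ _).trans f.2.1, (N.t_comp (i := ()) _ _ _).trans g.2.2⟩
  id_comp {a b} f := by
    obtain ⟨f, rfl, rfl⟩ := f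
    exact Subtype.ext (N.comp_one (i := ()) f _)
  comp_id {a b} f := by
    obtain ⟨f, rfl, rfl⟩ := f
    exact Subtype.ext (N.one_comp (i := ()) f _)
  assoc f g h := Subtype.ext (N.comp_assoc (i := ()) h.1
    ⟨(g.1, f.1), f.2.2.trans g.2.1.symm⟩ (g.2.2.trans h.2.1.symm) _ _).symm

end

instance : catToMulti.EssSurj where
  mem_essImage N := by
    let f : Multi.Hom (catToMultiObj N.Ob) N :=
      { c := fun _ c => c
        x := fun _ f => (Arrow.hom f).1
        t := fun f => (Arrow.hom f).2.2
        s := fun f => (Arrow.hom f).2.1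
        one := fun _ => rfl
        comp := fun f g h h' => by
          obtain ⟨a, b, f⟩ := f
          obtain ⟨a', b', g⟩ := g
          obtain rfl : b' = a := h
          exact congrArg Subtype.val (show g ≫ eqToHom rfl ≫ f = g ≫ f by simp) }
    have := Multi.isIso_of_bijective f (fun _ => Function.bijective_id) (fun _ => by
      refine ⟨fun f g h => ?_, fun x => ⟨Arrow.mk (X := (N.s () x : N.Ob)) (Y := (N.t () x : N.Ob))
        ⟨x, rfl, rfl⟩, rfl⟩⟩
      obtain ⟨a, b, f⟩ := f
      obtain ⟨a', b', g⟩ := g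
      change {x : N.X () // N.s () x = a ∧ N.t () x = b} at f
      change {x : N.X () // N.s () x = a' ∧ N.t () x = b'} at g
      obtain ⟨f, rfl, rfl⟩ := f
      obtain ⟨g, rfl, rfl⟩ := g
      obtain rfl : f = g := h
      rfl)
    exact ⟨Cat.of N.Ob, ⟨@asIso (Multi (FMonad.ident Unit)) _ _ _ f this⟩⟩

/-- When there is one object every pair of arrows is composable, so all arrows form a monoid, and
the category with one object on this monoid is `N` again. -/
theorem monCat_essImage (N : Multi (FMonad.ident Unit)) :
    (MonCat.toCat.{0} ⋙ catToMulti).essImage N ↔ Multi.OneObj _ N := by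
  constructor
  · rintro ⟨M, ⟨e⟩⟩
    exact Multi.OneObj.of_iso e fun _ => ⟨inferInstanceAs (Unique (SingleObj M))⟩
  · intro h
    have hs : ∀ c c' : N.C (), c = c' := fun c c' => by
      obtain ⟨u⟩ := h ()
      exact Subsingleton.elim c c'
    let inst : Monoid (N.X ()) :=
      { one := N.one () (h ()).some.default
        mul := fun x y => N.comp (i := ()) x y (hs _ _)
        one_mul := fun x => by
          have := N.one_comp (i := ()) x (hs _ _)
          rwa [hs (N.t () x) (h ()).some.default] at this
        mul_one := fun x => by
          refine Eq.trans ?_ (N.comp_one (i := ()) x (hs _ _))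
          exact N.comp_congr _ rfl (congrArg (N.one ()) (hs _ _))
        mul_assoc := fun x y z => N.comp_assoc (i := ()) x ⟨(y, z), hs _ _⟩ (hs _ _) (hs _ _)
          (hs _ _) }
    let f : Multi.Hom (catToMultiObj (SingleObj (N.X ()))) N :=
      { c := fun _ _ => (h ()).some.default
        x := fun _ f => Arrow.hom f
        t := fun _ => hs _ _
        s := fun _ => hs _ _
        one := fun c => congrArg (N.one ()) (hs _ _)
        -- Composition in `SingleObj` reverses multiplication, so `g ≫ f` is `f * g`, which is the
        -- composite in `N`.
        comp := fun f g h' h'' => by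
          obtain ⟨a, b, f⟩ := f
          obtain ⟨a', b', g⟩ := g
          obtain rfl : b' = a := h'
          exact (show g ≫ eqToHom rfl ≫ f = g ≫ f by simp) }
    have := Multi.isIso_of_bijective f (fun _ => ⟨fun _ _ _ => rfl, fun c => ⟨(), hs _ _⟩⟩)
      (fun _ => by
      refine ⟨fun f g h => ?_, fun x => ⟨Arrow.mk (X := SingleObj.star (N.X ()))
        (Y := SingleObj.star (N.X ())) x, rfl⟩⟩
      obtain ⟨a, b, f⟩ := f
      obtain ⟨a', b', g⟩ := g
      obtain rfl : f = g := h
      rfl)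
    exact ⟨MonCat.of (N.X ()), ⟨@asIso (Multi (FMonad.ident Unit)) _ _ _ f this⟩⟩

theorem oalg_one_one : Nonempty (OAlg 1 1 ≌ Cat.{0, 0}) :=
  nonempty_equivalence_of_essImage (toMultiFunctor (k := 1) (m := 0) le_rfl)
    (catToMulti ⋙ zZeroTransport) fun N => iff_of_true
      ((toMultiFunctor_essImage (m := 0) le_rfl N).2 (Or.inl rfl))
      (Functor.EssSurj.mem_essImage (F := catToMulti ⋙ zZeroTransport) N)

/-- Transport does not touch the objects, so having one object of each sort is preserved and
reflected. -/
theorem FMonad.Iso.transport_essImage {I : Type} {T T' : FMonad I} (φ : T.Iso T') {A : Type*}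
    [Category A] (F : A ⥤ Multi T') (h : ∀ N, F.essImage N ↔ Multi.OneObj T' N) (N : Multi T) :
    (F ⋙ φ.transport).essImage N ↔ Multi.OneObj T N := by
  constructor
  · rintro ⟨a, ⟨e⟩⟩
    exact Multi.OneObj.of_iso e ((h (F.obj a)).1 (F.obj_mem_essImage a))
  · intro hN
    obtain ⟨N', ⟨e⟩⟩ := Functor.EssSurj.mem_essImage (F := φ.transport) N
    obtain ⟨a, ⟨e'⟩⟩ := (h N').2
      (show Multi.OneObj T (φ.transport.obj N') from Multi.OneObj.of_iso e.symm hN)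
    exact ⟨a, ⟨φ.transport.mapIso e' ≪≫ e⟩⟩

theorem oalg_zero_one : Nonempty (OAlg 0 1 ≌ MonCat.{0}) :=
  nonempty_equivalence_of_essImage (toMultiFunctor (k := 0) (m := 0) zero_le_one)
    ((MonCat.toCat.{0} ⋙ catToMulti) ⋙ zZeroTransport) fun N =>
      ((toMultiFunctor_essImage (m := 0) zero_le_one N).trans (by simp)).trans
        (zZeroIso.transport_essImage _ monCat_essImage N).symm

/-! ### The monad of finite sequences. -/

theorem finSigmaFinEquiv_zero {n : ℕ} (m : Fin (n + 1) → ℕ) (j : Fin (m 0)) :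
    (finSigmaFinEquiv (n := m) ⟨0, j⟩ : ℕ) = j := by
  rw [finSigmaFinEquiv_apply]
  simp

theorem finSigmaFinEquiv_succ {n : ℕ} (m : Fin (n + 1) → ℕ) (i : Fin n) (j : Fin (m i.succ)) :
    (finSigmaFinEquiv (n := m) ⟨i.succ, j⟩ : ℕ) =
      m 0 + finSigmaFinEquiv (n := fun i => m i.succ) ⟨i, j⟩ := by
  rw [finSigmaFinEquiv_apply, finSigmaFinEquiv_apply, ← add_assoc]
  congr 1
  exact Fin.sum_univ_succ (n := i) (fun x => m (Fin.castLE i.succ.2.le x))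

/-- `finSigmaFinEquiv` enumerates lexicographically; induction on the number of blocks splits off
the first one. This translates the indexing by sums in operads into concatenation of lists. -/
theorem ofFn_sigma {α : Type*} : ∀ {n : ℕ} (m : Fin n → ℕ) (g : ∀ i, Fin (m i) → α),
    List.ofFn (fun y : Fin (∑ i, m i) =>
      g (finSigmaFinEquiv.symm y).1 (finSigmaFinEquiv.symm y).2) =
    (List.ofFn fun i => List.ofFn (g i)).flatten
  | 0, m, g => by simp
  | n + 1, m, g => by
    rw [List.ofFn_succ, List.flatten_cons, ← ofFn_sigma (fun i => m i.succ) (fun i => g i.succ)]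
    have key : ∀ (y : Fin (∑ i, m i)) (s : Σ i, Fin (m i)), (finSigmaFinEquiv s : ℕ) = y →
        g (finSigmaFinEquiv.symm y).1 (finSigmaFinEquiv.symm y).2 = g s.1 s.2 := by
      intro y s h
      have : finSigmaFinEquiv.symm y = s := by
        rw [Equiv.symm_apply_eq]
        exact Fin.ext h.symm
      rw [this]
    refine List.ext_getElem ?_ fun p h1 h2 => ?_
    · simp [Fin.sum_univ_succ]
    · rw [List.getElem_ofFn, List.getElem_append]
      split_ifs with h
      · rw [List.length_ofFn] at h
        rw [List.getElem_ofFn]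
        exact key _ ⟨0, ⟨p, h⟩⟩ (finSigmaFinEquiv_zero m _)
      · rw [List.getElem_ofFn]
        refine key _ ⟨_, _⟩ ?_
        · refine (finSigmaFinEquiv_succ m _ _).trans ?_
          simp only [Sigma.eta, Equiv.apply_symm_apply, List.length_ofFn] at h ⊢
          omega

/-- The concatenation of finite sequences. -/
def tupleBind {α β : Type} (x : Σ n, Fin n → α) (f : α → Σ n, Fin n → β) : Σ n, Fin n → β :=
  ⟨∑ i, (f (x.2 i)).1, fun y =>
    (f (x.2 (finSigmaFinEquiv.symm y).1)).2 (finSigmaFinEquiv.symm y).2⟩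

theorem ofFn_tupleBind {α β : Type} (x : Σ n, Fin n → α) (f : α → Σ n, Fin n → β) :
    List.ofFn (tupleBind x f).2 = (List.ofFn x.2).flatMap (fun y => List.ofFn (f y).2) := by
  refine (ofFn_sigma _ fun i => (f (x.2 i)).2).trans ?_
  rw [List.flatMap_def, List.map_ofFn]
  rfl

/-- Sequences of varying length are compared as lists, which removes the dependence of the index
type on the length; the monad laws become list identities. -/
theorem tuple_ext {α : Type} {x y : Σ n, Fin n → α} (h : List.ofFn x.2 = List.ofFn y.2) : x = y :=
  List.equivSigmaTuple.symm.injective h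

/-- The monad of finite sequences on families of sets. -/
def FMonad.tuple (I : Type) : FMonad I where
  F X i := Σ n, Fin n → X i
  map f _ x := ⟨x.1, fun y => f _ (x.2 y)⟩
  pure x := ⟨1, fun _ => x⟩
  bind x f := tupleBind x (f _)
  pure_bind x f := tuple_ext (by
    rw [ofFn_tupleBind]
    simp)
  bind_pure z := tuple_ext (by
    rw [ofFn_tupleBind]
    simp)
  bind_assoc z f g := tuple_ext (by
    rw [ofFn_tupleBind, ofFn_tupleBind, ofFn_tupleBind, List.flatMap_assoc]
    simp only [ofFn_tupleBind])
  map_eq f _ z := tuple_ext (by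
    rw [ofFn_tupleBind]
    have := List.map_eq_flatMap (f := f _) (l := List.ofFn z.2)
    rw [List.map_ofFn] at this
    change List.ofFn (fun y => f _ (z.2 y)) = _ at this
    simpa using this)

/-! ### `𝔷¹` as the monad of finite sequences. -/

section linear

variable {D D' : (Σ i, idMonad.Op i) → Type}

/-- The list of decorations of a linear tree. -/
def treeList {Y : Unit → Type} : ∀ {i : Unit}, (idMonad.dec D).Tree Y i → List (D ⟨(), ()⟩)
  | _, .leaf _ => []
  | _, .node b c => b.2 :: treeList (c () ())

theorem treeList_graft {X Y : Unit → Type} {i : Unit} (T : (idMonad.dec D).Tree X i)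
    (f : ∀ j, X j → (idMonad.dec D).Tree Y j) (l : List (D ⟨(), ()⟩))
    (hf : ∀ j x, treeList (f j x) = l) : treeList (T.graft f) = treeList T ++ l := by
  induction T with
  | leaf x => exact hf _ x
  | node b c ih => exact congrArg (b.2 :: ·) (ih () ())

theorem treeList_decSubst {Y : Unit → Type} (f : ∀ a, D a → idMonad.bdData.Ext D' a) {i : Unit}
    (T : (idMonad.dec D).Tree Y i) :
    treeList (idMonad.decSubst f T) =
      (treeList T).flatMap (fun d => treeList ((f ⟨(), ()⟩ d).1.1.toDec (f ⟨(), ()⟩ d).2)) := by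
  induction T with
  | leaf x => rfl
  | node b c ih =>
    refine Eq.trans ?_ (congrArg (_ ++ ·) (ih () ()))
    exact treeList_graft _ _ _ fun _ _ => rfl

/-- The linear tree given by a list of decorations. -/
def listTree : List (D ⟨(), ()⟩) → (idMonad.dec D).Tree (fun _ => Unit) ()
  | [] => .leaf ()
  | d :: l => .node (P := idMonad.dec D) (i := ()) ⟨(), d⟩ (fun _ _ => listTree l)

theorem treeList_listTree (l : List (D ⟨(), ()⟩)) : treeList (listTree l) = l := by
  induction l with
  | nil => rfl
  | cons d l ih => exact congrArg (d :: ·) ih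

theorem listTree_treeList {i : Unit} (T : (idMonad.dec D).Tree (fun _ => Unit) i) :
    listTree (treeList T) = T := by
  induction T with
  | leaf x => rfl
  | node b c ih =>
    exact congrArg (PolyEnd.Tree.node (P := idMonad.dec D) b)
      (funext fun j => funext fun e => ih () ())

/-- The labelled inputs of an operation of `𝔷¹`, as a sequence. -/
def extTuple {a : Σ i, idMonad.Op i} (z : idMonad.bdData.Ext D a) : Σ n, Fin n → D a :=
  List.equivSigmaTuple (treeList (z.1.1.toDec z.2))

theorem ofFn_extTuple {a : Σ i, idMonad.Op i} (z : idMonad.bdData.Ext D a) :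
    List.ofFn (extTuple z).2 = treeList (z.1.1.toDec z.2) :=
  List.equivSigmaTuple.symm_apply_apply _

/-- The identity monad has one operation, with one input, so its trees are linear and a decorated
tree is the list of its decorations. The condition on the reduction is empty. -/
theorem extTuple_bijective (a : Σ i, idMonad.Op i) :
    Function.Bijective (extTuple (D := D) (a := a)) := by
  refine List.equivSigmaTuple.bijective.comp ⟨fun z z' h => ?_, fun l => ?_⟩
  · apply idMonad.bd_ext
    exact (listTree_treeList _).symm.trans ((congrArg listTree h).trans (listTree_treeList _))
  · refine ⟨⟨⟨(PolyEnd.Tree.ofDec (listTree l)).1, rfl⟩, (PolyEnd.Tree.ofDec (listTree l)).2⟩, ?_⟩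
    exact (congrArg treeList (PolyEnd.Tree.toDec_ofDec _)).trans (treeList_listTree l)

/-- The monad `𝔷¹` is the monad of finite sequences. -/
noncomputable def zOneIso : FMonad.Iso (Z 1).toF (FMonad.tuple (Opetope 1)) where
  e X i := Equiv.ofBijective _ (extTuple_bijective (D := X) i)
  pure x := tuple_ext ((ofFn_extTuple _).trans (List.ofFn_succ (f := fun _ : Fin 1 => x)).symm)
  bind {X Y i} z f := by
    apply tuple_ext
    refine (ofFn_extTuple _).trans ?_
    refine Eq.trans ?_ (ofFn_tupleBind _ _).symm
    refine (congrArg treeList (idMonad.toDec_bind z f)).trans ?_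
    refine (treeList_decSubst _ _).trans ?_
    refine Eq.trans ?_ (congrArg (fun l => List.flatMap _ l) (ofFn_extTuple z)).symm
    refine congrArg (fun g => List.flatMap g (treeList (z.1.1.toDec z.2))) ?_
    funext d
    exact (ofFn_extTuple (f _ d)).symm

end linear

/-! ### Coloured planar operads as multicategories for finite sequences. -/

namespace ColPlanarOperad

/-- The operations of a coloured operad. -/
structure Arr (P : ColPlanarOperad) where
  k : ℕ
  a : Fin k → P.Col
  c : P.Col
  p : P.Op a c

variable {P Q : ColPlanarOperad}

/-- The inputs of an operation. -/
def Arr.inp (x : P.Arr) : Σ k, Fin k → P.Col := ⟨x.k, x.a⟩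

/-- The operation given by an element of the total space of operations with a given output. -/
def Arr.of {c : P.Col} (x : Σ k, Σ a : Fin k → P.Col, P.Op a c) : P.Arr := ⟨x.1, x.2.1, c, x.2.2⟩

theorem Arr.exists_eq {x : P.Arr} {k : ℕ} {a : Fin k → P.Col} {c : P.Col} (h : x.inp = ⟨k, a⟩)
    (hc : x.c = c) : ∃ p : P.Op a c, x = ⟨k, a, c, p⟩ := by
  obtain ⟨k', a', c', p⟩ := x
  cases h
  cases hc
  exact ⟨p, rfl⟩

theorem Arr.mk_injective {k : ℕ} {a : Fin k → P.Col} {c : P.Col} {p p' : P.Op a c}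
    (h : (⟨k, a, c, p⟩ : P.Arr) = ⟨k, a, c, p'⟩) : p = p' := by
  cases h
  rfl

/-- Transport of operations along an equality of inputs. -/
def castOp {c : P.Col} {s s' : Σ k, Fin k → P.Col} (h : s = s') (p : P.Op s.2 c) : P.Op s'.2 c :=
  h ▸ p

/-- The composition of operations. -/
def Arr.comp (x : P.Arr) (z : Σ n, Fin n → P.Arr)
    (h : (⟨z.1, fun i => (z.2 i).c⟩ : Σ n, Fin n → P.Col) = x.inp) : P.Arr :=
  ⟨_, _, x.c, P.comp (castOp (s := x.inp) h.symm x.p) (fun i => (z.2 i).k) (fun i => (z.2 i).a)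
    (fun i => (z.2 i).p)⟩

/-- A coloured operad as a generalized multicategory for the monad of finite sequences. -/
def toMultiObj (P : ColPlanarOperad) : Multi (FMonad.tuple (Opetope 1)) where
  C _ := P.Col
  X _ := P.Arr
  t _ x := x.c
  s _ x := x.inp
  one _ c := ⟨1, _, c, P.one c⟩
  comp x z h := Arr.comp x z h
  t_one _ := rfl
  s_one _ := rfl
  t_comp _ _ _ := rfl
  s_comp _ _ _ := rfl
  one_comp x h := congrArg Arr.of (P.one_comp x.p)
  comp_one x h := congrArg Arr.of (P.comp_one x.p)
  comp_assoc x ζ h h' h'' := by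
    obtain ⟨n, ζ⟩ := ζ
    -- Each composable pair is put in the form where the inputs of the first operation are literally
    -- the outputs of the second component. The casts disappear and the associativity of the operad
    -- applies as it stands.
    have key : ∀ i, ∃ (c : P.Col) (r : Σ n, Fin n → P.Arr)
        (p : P.Op (fun i => (r.2 i).c) c), ζ i = ⟨(⟨_, _, c, p⟩, r), rfl⟩ := by
      intro i
      obtain ⟨⟨⟨k, a, c, p⟩, r⟩, h⟩ := ζ i
      change (⟨r.1, fun j => (r.2 j).c⟩ : Σ k, Fin k → P.Col) = ⟨k, a⟩ at h
      cases h
      exact ⟨c, r, p, rfl⟩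
    choose c r p hζ using key
    obtain rfl : ζ = fun i => ⟨(⟨_, _, c i, p i⟩, r i), rfl⟩ := funext hζ
    obtain ⟨k, a, d, q⟩ := x
    cases h
    exact congrArg Arr.of (P.comp_assoc q (fun i => (r i).1) _ p (fun i j => ((r i).2 j).k)
      (fun i j => ((r i).2 j).a) (fun i j => ((r i).2 j).p))

/-- The functor that takes a coloured operad to a generalized multicategory for the monad of finite
sequences. -/
def toMulti : ColPlanarOperad ⥤ Multi (FMonad.tuple (Opetope 1)) where
  obj P := P.toMultiObj
  map {P Q} f := Multi.Hom.mk (N := P.toMultiObj) (N' := Q.toMultiObj)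
    (fun _ c => Hom.col f c) (fun _ (x : P.Arr) => (⟨x.k, _, _, Hom.map f x.p⟩ : Q.Arr))
    (fun _ => rfl) (fun _ => rfl) (fun (c : P.Col) => congrArg (fun p => (⟨1, _, _, p⟩ : Q.Arr)) (Hom.map_one f c))
    (fun {_} x z h h' => by
      obtain ⟨k, a, c, p⟩ := x
      obtain ⟨n, z⟩ := z
      cases h
      exact congrArg (fun p => (⟨_, _, _, p⟩ : Q.Arr)) (Hom.map_comp f p (fun i => (z i).k)
        (fun i => (z i).a) (fun i => (z i).p)))
  map_id P := rfl
  map_comp f g := rfl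

instance : toMulti.Faithful where
  map_injective {P Q} f g h := by
    have hx := congrArg Multi.Hom.x h
    have hc := congrArg Multi.Hom.c h
    obtain ⟨c, m, h1, h2⟩ := f
    obtain ⟨c', m', h1', h2'⟩ := g
    obtain rfl : c = c' := congrFun hc ⟨(), ()⟩
    have : @m = @m' := by
      funext k a d p
      exact Arr.mk_injective (congrFun (congrFun hx ⟨(), ()⟩) (⟨k, a, d, p⟩ : P.Arr))
    subst this
    rfl

instance : toMulti.Full where
  map_surjective {P Q} := fun (g : Multi.Hom P.toMultiObj Q.toMultiObj) => by
    let i₀ : Opetope 1 := ⟨(), ()⟩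
    let gc : P.Col → Q.Col := g.c i₀
    let gx : P.Arr → Q.Arr := g.x i₀
    have key : ∀ {k : ℕ} {a : Fin k → P.Col} {c : P.Col} (p : P.Op a c),
        ∃ q : Q.Op (fun i => gc (a i)) (gc c), gx ⟨k, a, c, p⟩ = ⟨k, _, _, q⟩ := fun {k a c} p =>
      Arr.exists_eq (x := gx ⟨k, a, c, p⟩) (g.s (j := i₀) (⟨k, a, c, p⟩ : P.Arr))
        (g.t (j := i₀) (⟨k, a, c, p⟩ : P.Arr))
    choose φ hφ using @key
    refine ⟨Hom.mk gc (fun p => φ p) (fun c => ?_) (fun {k a c} p m b q => ?_),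
      Multi.Hom.ext rfl ?_⟩
    · exact Arr.mk_injective ((hφ (P.one c)).symm.trans (g.one (j := i₀) c))
    · apply Arr.mk_injective
      refine (hφ _).symm.trans ?_
      have h := g.comp (i := i₀) (⟨k, a, c, p⟩ : P.Arr)
        (⟨k, fun i => ⟨m i, b i, a i, q i⟩⟩ : Σ n, Fin n → P.Arr) rfl
        (g.compat (i := i₀) (y := (⟨k, a, c, p⟩ : P.Arr))
          (z := (⟨k, fun i => ⟨m i, b i, a i, q i⟩⟩ : Σ n, Fin n → P.Arr)) rfl)
      refine h.trans (Q.toMultiObj.comp_congr (i := i₀)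
        (z' := (⟨k, fun i => ⟨m i, _, _, φ (q i)⟩⟩ : Σ n, Fin n → Q.Arr)) _ (hφ p) ?_)
      exact congrArg (fun z => (⟨k, z⟩ : Σ n, Fin n → Q.Arr)) (funext fun i => hφ (q i))
    · funext _ x
      exact (hφ (Arr.p x)).symm

section

variable (N : Multi (FMonad.tuple (Opetope 1)))

/-- Arity and input colours are part of the source of an arrow, so an operation is determined by its
underlying arrow; the operad laws reduce to equations between arrows. -/
theorem sigma_ext {i : Opetope 1} {c : N.C i} {k k' : ℕ} {a : Fin k → N.C i} {a' : Fin k' → N.C i}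
    {x : {x : N.X i // N.s i x = ⟨k, a⟩ ∧ N.t i x = c}}
    {x' : {x : N.X i // N.s i x = ⟨k', a'⟩ ∧ N.t i x = c}} (h : x.1 = x'.1) :
    (⟨k, a, x⟩ : Σ k, Σ a : Fin k → N.C i, {x : N.X i // N.s i x = ⟨k, a⟩ ∧ N.t i x = c}) =
      ⟨k', a', x'⟩ := by
  obtain ⟨x, h1, h2⟩ := x
  obtain ⟨x', h1', h2'⟩ := x'
  obtain rfl : x = x' := h
  cases h1.symm.trans h1'
  rfl

/-- The coloured operad given by a generalized multicategory for the monad of finite sequences. -/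
def ofMulti : ColPlanarOperad where
  Col := N.C ⟨(), ()⟩
  Op {k} a c := {x : N.X ⟨(), ()⟩ // N.s _ x = ⟨k, a⟩ ∧ N.t _ x = c}
  one c := ⟨N.one _ c, N.s_one c, N.t_one c⟩
  comp {k a c} p m b q := ⟨N.comp p.1 ⟨k, fun i => (q i).1⟩
    ((congrArg (fun f => (⟨k, f⟩ : Σ k, Fin k → _)) (funext fun i => (q i).2.2)).trans p.2.1.symm),
    (N.s_comp _ _ _).trans (congrArg (fun w : Fin k → Σ n, Fin n → N.C ⟨(), ()⟩ =>
      (⟨∑ i, (w i).1, fun y => (w (finSigmaFinEquiv.symm y).1).2 (finSigmaFinEquiv.symm y).2⟩ :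
        Σ n, Fin n → N.C ⟨(), ()⟩)) (funext fun i => (q i).2.1)),
    (N.t_comp _ _ _).trans p.2.2⟩
  one_comp q := sigma_ext N (by
    obtain ⟨x, h, rfl⟩ := q
    exact N.one_comp x _)
  comp_one {k a c} p := sigma_ext N (by
    obtain ⟨x, h, rfl⟩ := p
    refine Eq.trans (N.comp_congr _ rfl ?_) (N.comp_one x ?_)
    · rw [h]
      rfl
    · rw [h]
      exact (congrArg (fun f => (⟨k, f⟩ : Σ k, Fin k → _)) (funext fun i => N.t_one (a i))))
  comp_assoc {k a c} p m b q l d r := sigma_ext N (by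
    refine N.comp_assoc p.1 (⟨k, fun i => ⟨((q i).1, ⟨m i, fun j => (r i j).1⟩),
      (congrArg (fun f => (⟨m i, f⟩ : Σ k, Fin k → _)) (funext fun j => (r i j).2.2)).trans
        (q i).2.1.symm⟩⟩ : Σ n, Fin n → CompPair (FMonad.tuple (Opetope 1)) N.t N.s ⟨(), ()⟩) _ _ _)

end

instance : toMulti.EssSurj where
  mem_essImage N := by
    let f : Multi.Hom (ofMulti N).toMultiObj N :=
      { c := fun _ c => c
        x := fun _ x => (Arr.p x).1
        t := fun x => (Arr.p x).2.2
        s := fun x => (Arr.p x).2.1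
        one := fun _ => rfl
        comp := fun x z h h' => by
          obtain ⟨k, a, c, p⟩ := x
          obtain ⟨n, z⟩ := z
          cases h
          rfl }
    have := Multi.isIso_of_bijective f (fun _ => Function.bijective_id) (fun _ => by
      refine ⟨fun x x' h => ?_, fun x => ⟨(⟨_, _, _, ⟨x, rfl, rfl⟩⟩ : (ofMulti N).Arr), rfl⟩⟩
      obtain ⟨k, a, c, x, h1, h2⟩ := x
      obtain ⟨k', a', c', x', h1', h2'⟩ := x'
      obtain rfl : x = x' := h
      cases h1.symm.trans h1'
      cases h2.symm.trans h2'
      rfl)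
    exact ⟨ofMulti N, ⟨@asIso (Multi (FMonad.tuple (Opetope 1))) _ _ _ f this⟩⟩

end ColPlanarOperad

/-! ### Planar operads as the case of one colour. -/

namespace PlanarOperad

/-- An operad as a coloured operad with one colour. -/
def toColObj (P : PlanarOperad) : ColPlanarOperad where
  Col := Unit
  Op {k} _ _ := P.Op k
  one _ := P.one
  comp p m _ q := P.comp p m q
  one_comp q := congrArg (fun s : Σ n, P.Op n =>
    (⟨s.1, fun _ => (), s.2⟩ : Σ n, Σ _ : Fin n → Unit, P.Op n)) (P.one_comp q)
  comp_one q := congrArg (fun s : Σ n, P.Op n =>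
    (⟨s.1, fun _ => (), s.2⟩ : Σ n, Σ _ : Fin n → Unit, P.Op n)) (P.comp_one q)
  comp_assoc p m _ q l _ r := congrArg (fun s : Σ n, P.Op n =>
    (⟨s.1, fun _ => (), s.2⟩ : Σ n, Σ _ : Fin n → Unit, P.Op n)) (P.comp_assoc p m q l r)

/-- The functor that takes an operad to a coloured operad with one colour. -/
def toCol : PlanarOperad ⥤ ColPlanarOperad where
  obj P := P.toColObj
  map {P Q} f := ColPlanarOperad.Hom.mk (P := P.toColObj) (Q := Q.toColObj) (fun _ => ())
    (fun p => Hom.map f p) (fun _ => Hom.map_one f) (fun p m _ q => Hom.map_comp f p m q)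
  map_id _ := rfl
  map_comp _ _ := rfl

instance : toCol.Faithful where
  map_injective {P Q} f g h := by
    refine Hom.ext ?_
    funext k p
    have : ∀ {k : ℕ} (a : Fin k → Unit) (c : Unit) (p : P.Op k),
        (ColPlanarOperad.Hom.map (toCol.map f) (k := k) (a := a) (c := c) p : Q.Op k) =
          ColPlanarOperad.Hom.map (toCol.map g) (k := k) (a := a) (c := c) p := by
      rw [h]
      intros
      rfl
    exact this (fun _ => ()) () p

instance : toCol.Full where
  map_surjective {P Q} := fun (g : ColPlanarOperad.Hom P.toColObj Q.toColObj) =>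
    ⟨Hom.mk (fun {k} p => g.map (k := k) (a := fun _ => ()) (c := ()) p) (g.map_one ())
      (fun {k} p m q => g.map_comp (k := k) (a := fun _ => ()) (c := ()) p m (fun _ _ => ()) q), rfl⟩

section

variable {N : Multi (FMonad.tuple (Opetope 1))} (h : Multi.OneObj _ N)

theorem sigma_ext {i : Opetope 1} {k k' : ℕ} {x : {x : N.X i // (N.s i x).1 = k}}
    {x' : {x : N.X i // (N.s i x).1 = k'}} (h : x.1 = x'.1) :
    (⟨k, x⟩ : Σ k, {x : N.X i // (N.s i x).1 = k}) = ⟨k', x'⟩ := by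
  obtain ⟨x, rfl⟩ := x
  obtain ⟨x', rfl⟩ := x'
  obtain rfl : x = x' := h
  rfl

/-- With one object a sequence of objects is its length, so composability is a matter of arities
only. -/
theorem tuple_eq (h : Multi.OneObj _ N) {i : Opetope 1} {s s' : Σ k, Fin k → N.C i} (hs : s.1 = s'.1) : s = s' := by
  obtain ⟨k, a⟩ := s
  obtain ⟨k', a'⟩ := s'
  obtain rfl : k = k' := hs
  obtain ⟨u⟩ := h i
  exact congrArg (Sigma.mk k) (Subsingleton.elim _ _)

/-- The operad given by a generalized multicategory with one object for the monad of finite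
sequences. -/
noncomputable def ofMulti : PlanarOperad where
  Op k := {x : N.X ⟨(), ()⟩ // (N.s _ x).1 = k}
  one := ⟨N.one _ (h _).some.default, congrArg Sigma.fst (N.s_one _)⟩
  comp {k} p m q := ⟨N.comp p.1 ⟨k, fun i => (q i).1⟩ (tuple_eq h p.2.symm),
    (congrArg Sigma.fst (N.s_comp _ _ _)).trans
      (congrArg (fun w : Fin k → ℕ => ∑ i, w i) (funext fun i => (q i).2))⟩
  one_comp q := sigma_ext (by
    refine Eq.trans (N.comp_congr _ (congrArg (N.one _) ?_) rfl) (N.one_comp q.1 ?_)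
    · exact ((h _).some.uniq _).symm
    · exact tuple_eq h (congrArg Sigma.fst (N.s_one _)).symm)
  comp_one {k} p := sigma_ext (by
    refine Eq.trans (N.comp_congr _ rfl ?_) (N.comp_one p.1 (tuple_eq h rfl))
    have : N.s _ p.1 = ⟨k, fun _ => (h _).some.default⟩ := tuple_eq h p.2
    rw [this]
    rfl)
  comp_assoc {k} p m q l r := sigma_ext
    (N.comp_assoc p.1 (⟨k, fun i => ⟨((q i).1, ⟨m i, fun j => (r i j).1⟩),
      tuple_eq h (q i).2.symm⟩⟩ : Σ n, Fin n → CompPair (FMonad.tuple (Opetope 1)) N.t N.s ⟨(), ()⟩)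
      _ _ (tuple_eq h p.2.symm))

end

theorem toMulti_essImage (N : Multi (FMonad.tuple (Opetope 1))) :
    (toCol ⋙ ColPlanarOperad.toMulti).essImage N ↔ Multi.OneObj _ N := by
  constructor
  · rintro ⟨P, ⟨e⟩⟩
    exact Multi.OneObj.of_iso e fun _ => ⟨inferInstanceAs (Unique Unit)⟩
  · intro h
    have hs : ∀ {i : Opetope 1} (c c' : N.C i), c = c' := fun {i} c c' => by
      obtain ⟨u⟩ := h i
      exact Subsingleton.elim c c'
    let f : Multi.Hom (ofMulti h).toColObj.toMultiObj N :=
      { c := fun i _ => (h i).some.default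
        x := fun _ x => (ColPlanarOperad.Arr.p x).1
        t := fun x => hs _ _
        s := fun x => tuple_eq h (ColPlanarOperad.Arr.p x).2
        one := fun _ => rfl
        comp := fun x z h h' => by
          obtain ⟨k, a, c, p⟩ := x
          obtain ⟨n, z⟩ := z
          cases h
          rfl }
    have := Multi.isIso_of_bijective f
      (fun _ => ⟨fun _ _ _ => rfl, fun c => ⟨(), hs _ _⟩⟩) (fun _ => by
      refine ⟨fun x x' h' => ?_, fun x => ⟨(⟨_, fun _ => (), (), ⟨x, rfl⟩⟩ :
        (ofMulti h).toColObj.Arr), rfl⟩⟩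
      obtain ⟨k, a, c, x, rfl⟩ := x
      obtain ⟨k', a', c', x', rfl⟩ := x'
      obtain rfl : x = x' := h'
      change Unit at c c'
      change Fin _ → Unit at a a'
      obtain rfl : c = c' := rfl
      obtain rfl : a = a' := funext fun _ => rfl
      rfl)
    exact ⟨ofMulti h, ⟨@asIso (Multi (FMonad.tuple (Opetope 1))) _ _ _ f this⟩⟩

end PlanarOperad

theorem oalg_one_two : Nonempty (OAlg 1 2 ≌ ColPlanarOperad) :=
  nonempty_equivalence_of_essImage (toMultiFunctor (k := 1) (m := 1) le_rfl)
    (ColPlanarOperad.toMulti ⋙ zOneIso.transport) fun N => iff_of_true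
      ((toMultiFunctor_essImage (m := 1) le_rfl N).2 (Or.inl rfl))
      (Functor.EssSurj.mem_essImage (F := ColPlanarOperad.toMulti ⋙ zOneIso.transport) N)

theorem oalg_zero_two : Nonempty (OAlg 0 2 ≌ PlanarOperad) :=
  nonempty_equivalence_of_essImage (toMultiFunctor (k := 0) (m := 1) zero_le_one)
    ((PlanarOperad.toCol ⋙ ColPlanarOperad.toMulti) ⋙ zOneIso.transport) fun N =>
      ((toMultiFunctor_essImage (m := 1) zero_le_one N).trans (by simp)).trans
        (zOneIso.transport_essImage _ PlanarOperad.toMulti_essImage N).symm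

/-! ### Dimension zero: algebras are sets. -/

section zero

/-- The `0`-opetope. -/
def pointOpetope : Opetope 0 := ()

theorem eq_topOb_zero (ω : OptRange 0 0) : topOb 0 pointOpetope = ω := by
  obtain ⟨i, h⟩ := exists_topOb ω (Nat.not_lt_zero _)
  exact h

/-- `𝔷⁰` has only the unit operation, and there are no faces below dimension 0, so a cell is nothing
but the label of its single source. -/
theorem exists_eta_zero {X : Psh 0 0} {i : Opetope 0} (c : Cell X (topOb 0 i)) :
    ∃ x, c = etaTop x :=
  ⟨c.ext.2 () (), Cell.cell_ext (Eq.trans (b := (Z 0).pure (X := Top X) (c.ext.2 () ())) rfl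
    (ext_etaTop (n := 0) (X := X) (i := i) (c.ext.2 () ())).symm) fun _ h => absurd h (Nat.not_lt_zero _)⟩

theorem etaCell_zero_bijective (X : Psh 0 0) (ω : OptRange 0 0) :
    Function.Bijective (etaCell X ω) := by
  obtain rfl := eq_topOb_zero ω
  constructor
  · intro x y h
    rw [etaCell_top, etaCell_top] at h
    have h' := (ext_etaTop x).symm.trans ((congrArg Cell.ext h).trans (ext_etaTop y))
    exact congrArg (fun z : (Z 0).Ext (Top X) pointOpetope => z.2 () ()) h'
  · intro c
    obtain ⟨x, rfl⟩ := exists_eta_zero c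
    exact ⟨x, etaCell_top X _ x⟩

/-- The functor that takes a `(0,0)`-opetopic algebra to its underlying set. -/
def oalgZeroFunctor : OAlg 0 0 ⥤ Type where
  obj A := A.A.obj (.op (topOb 0 pointOpetope))
  map f := f.f.app _

instance : oalgZeroFunctor.Faithful where
  map_injective {A B} f g h := by
    apply Monad.Algebra.Hom.ext
    ext ⟨ω⟩ x
    obtain rfl := eq_topOb_zero ω
    exact ConcreteCategory.congr_hom h x

instance : oalgZeroFunctor.Full where
  map_surjective {A B} g := by
    -- There is one object, but only up to propositional equality; the given map is transported
    -- along it.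
    let F : ∀ ω : OptRange 0 0, A.A.obj (.op ω) → B.A.obj (.op ω) := fun ω =>
      Eq.rec (motive := fun ω _ => A.A.obj (.op ω) → B.A.obj (.op ω))
        (fun x => (ConcreteCategory.hom g) x) (eq_topOb_zero ω)
    have hF : ∀ {ω' ω : OptRange 0 0} (u : ω' ⟶ ω) (x : A.A.obj (.op ω)),
        F ω' (A.A.map u.op x) = B.A.map u.op (F ω x) := by
      intro ω' ω u x
      obtain ⟨rfl, rfl⟩ := eq_of_not_lt u (Nat.not_lt_zero _)
      refine (congrArg (F _) (ConcreteCategory.congr_hom (A.A.map_id _) x)).trans ?_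
      exact (ConcreteCategory.congr_hom (B.A.map_id _) (F _ x)).symm
    let α : A.A ⟶ B.A :=
      { app := fun ω => ↾(F ω.unop)
        naturality := fun ω ω' u => by
          ext x
          exact hF u.unop x }
    refine ⟨{ f := α, h := ?_ }, rfl⟩
    ext ⟨ω⟩ c
    change B.str (Cell.map α c) = α.app (.op ω) (A.str c)
    obtain ⟨x, rfl⟩ := (etaCell_zero_bijective A.A ω).2 c
    rw [A.str_eta, ← etaCell_map, B.str_eta]

theorem isIso_zUnit_zero (X : Psh 0 0) : IsIso ((zUnit 0 0).app X) := by
  have : ∀ ω, IsIso (((zUnit 0 0).app X).app ω) :=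
    fun ω => (isIso_iff_bijective _).2 (etaCell_zero_bijective _ ω.unop)
  exact NatIso.isIso_of_isIso_app _

/-- The `(0,0)`-opetopic algebra on a presheaf. -/
noncomputable def oalgZeroOf (X : Psh 0 0) : OAlg 0 0 where
  A := X
  a := @inv _ _ _ _ ((zUnit 0 0).app X) (isIso_zUnit_zero X)
  unit := @IsIso.hom_inv_id _ _ _ _ ((zUnit 0 0).app X) (isIso_zUnit_zero X)
  assoc := by
    have := isIso_zUnit_zero X
    have h : ∀ ω x, (inv ((zUnit 0 0).app X)).app (.op ω) (etaCell X ω x) = x :=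
      fun ω x => psh_congr_app (IsIso.hom_inv_id ((zUnit 0 0).app X)) x
    ext ⟨ω⟩ c
    -- The unit is bijective on cells of `𝔷⁰X` as well as of X, so associativity need only be
    -- checked on a unit of a unit, where it follows from the unit laws.
    obtain ⟨c, rfl⟩ := (etaCell_zero_bijective ((zFunctor 0 0).obj X) ω).2 c
    obtain ⟨x, rfl⟩ := (etaCell_zero_bijective X ω).2 c
    refine (congrArg _ (mu_eta X ω _)).trans ((h ω x).trans ?_)
    refine Eq.trans ?_ (congrArg ((inv ((zUnit 0 0).app X)).app (.op ω))
      (etaCell_map (inv ((zUnit 0 0).app X)) ω _))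
    exact ((h ω _).trans (h ω x)).symm

instance : oalgZeroFunctor.EssSurj where
  mem_essImage S := ⟨oalgZeroOf ((Functor.const (OptRange 0 0)ᵒᵖ).obj S), ⟨Iso.refl S⟩⟩

theorem oalg_zero_zero : Nonempty (OAlg 0 0 ≌ Type) :=
  have : oalgZeroFunctor.IsEquivalence := {}
  ⟨oalgZeroFunctor.asEquivalence⟩

end zero

/-! ### Independence of k for k ≥ n. -/

section reindex

variable {k k' n : ℕ}

/-- The comparison of categories of opetopes of dimension at most `n`. -/
def rangeMap (h' : n ≤ k') : OptRange k n ⥤ OptRange k' n where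
  obj ω := ⟨ω.obj, h'.trans (Nat.le_add_left _ _), ω.property.2⟩
  map f := ObjectProperty.homMk f.hom

/-- The comparison of categories of presheaves on opetopes of dimension at most `n`. -/
def pshMap (h' : n ≤ k') : Psh k' n ⥤ Psh k n where
  obj X := (rangeMap h').op ⋙ X
  map α := Functor.whiskerLeft (rangeMap h').op α

variable (h : n ≤ k) (h' : n ≤ k')

/-- The comparison of spines. -/
def spineMap {X : Psh k' n} {i : Opetope n} {b : (Z n).Op i}
    (y : spinePsh k b ⟶ (pshMap h').obj X) : spinePsh k' b ⟶ X where
  app ω := y.app (.op ((rangeMap h).obj ω.unop))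
  naturality _ _ u := y.naturality ((rangeMap h).map u.unop).op

/-- The comparison of cells. -/
def cellMap {X : Psh k' n} : ∀ {ω : OptRange k n}, Cell ((pshMap h').obj X) ω →
    Cell X ((rangeMap h').obj ω)
  | _, .low hω x => .low hω x
  | _, .top b y => .top b (spineMap h h' y)

theorem cellMap_restrict {X : Psh k' n} {ω ω' : OptRange k n} (c : Cell ((pshMap h').obj X) ω)
    (u : ω' ⟶ ω) :
    cellMap h h' (c.restrict u) = (cellMap h h' c).restrict ((rangeMap h').map u) := by
  by_cases hω : ω'.obj.as.dim < n
  · cases c with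
    | low _ x => rfl
    | top b y =>
      refine (congrArg (cellMap h h') (Cell.restrict_top b y u hω)).trans ?_
      exact (Cell.restrict_top b (spineMap h h' y) ((rangeMap h').map u) hω).symm
  · obtain ⟨rfl, rfl⟩ := eq_of_not_lt u hω
    rw [eqToHom_refl, Cell.restrict_id, CategoryTheory.Functor.map_id, Cell.restrict_id]

theorem cellMap_map {X Y : Psh k' n} (α : X ⟶ Y) {ω : OptRange k n}
    (c : Cell ((pshMap h').obj X) ω) :
    cellMap h h' (c.map ((pshMap h').map α)) = (cellMap h h' c).map α := by
  cases c <;> rfl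

/-- The comparison of cells, as a morphism of presheaves. -/
def cellHom (X : Psh k' n) :
    (zFunctor k n).obj ((pshMap h').obj X) ⟶ (pshMap h').obj ((zFunctor k' n).obj X) where
  app ω := ↾fun c => cellMap h h' (ω := ω.unop) c
  naturality ω ω' u := by
    ext c
    exact cellMap_restrict h h' c u.unop

theorem ext_cellMap {X : Psh k' n} {i : Opetope n} (c : Cell ((pshMap h').obj X) (topOb k i)) :
    (show Cell X (topOb k' i) from cellMap h h' c).ext = c.ext := by
  obtain ⟨b, y, rfl⟩ := c.top_cases
  rfl

theorem bdry_cellMap {X : Psh k' n} {i : Opetope n} (c : Cell ((pshMap h').obj X) (topOb k i))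
    (ω : OptRange k' n) (hω : ω.obj.as.dim < n) (g : ω.obj ⟶ ob i) :
    (show Cell X (topOb k' i) from cellMap h h' c).bdry ω hω g =
      c.bdry ((rangeMap h).obj ω) hω g := by
  obtain ⟨b, y, rfl⟩ := c.top_cases
  refine (Cell.bdry_top b (spineMap h h' y) ω hω g).trans ?_
  exact (Cell.bdry_top b y ((rangeMap h).obj ω) hω g).symm

theorem toLow_cellMap {X : Psh k' n} {ω : OptRange k n} (hω : ω.obj.as.dim < n)
    (c : Cell ((pshMap h').obj X) ω) :
    Cell.toLow (X := X) (ω := (rangeMap h').obj ω) hω (cellMap h h' c) = c.toLow hω := by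
  cases c with
  | low _ _ => rfl
  | top _ _ => exact absurd hω (lt_irrefl n)

theorem cellMap_eta (X : Psh k' n) (ω : OptRange k n) (x : X.obj (.op ((rangeMap h').obj ω))) :
    cellMap h h' (etaCell ((pshMap h').obj X) ω x) = etaCell X ((rangeMap h').obj ω) x := by
  by_cases hω : ω.obj.as.dim < n
  · refine (congrArg (cellMap h h') (etaCell_low ((pshMap h').obj X) ω hω x)).trans ?_
    exact (etaCell_low X ((rangeMap h').obj ω) hω x).symm
  · obtain ⟨i, rfl⟩ := exists_topOb ω hω
    refine (congrArg (cellMap h h') (etaCell_top (k := k) ((pshMap h').obj X) i x)).trans ?_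
    refine Eq.trans ?_ (etaCell_top X i x).symm
    refine Cell.cell_ext (i := i) ?_ fun ω' hω' g => ?_
    · exact (ext_cellMap h h' _).trans ((ext_etaTop _).trans (ext_etaTop _).symm)
    · exact (bdry_cellMap h h' _ ω' hω' g).trans
        ((bdry_etaTop (k := k) (X := (pshMap h').obj X) x _ _ _).trans (bdry_etaTop (X := X) x _ _ _).symm)

/-- Cells are compared through their labelled operations and their boundaries; both are computed by
formulas in which k does not occur. -/
theorem cellMap_mu (X : Psh k' n) {ω : OptRange k n}
    (c : Cell ((zFunctor k n).obj ((pshMap h').obj X)) ω) :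
    cellMap h h' (muCell ((pshMap h').obj X) c) = muCell X (cellMap h h' (c.map (cellHom h h' X))) := by
  by_cases hω : ω.obj.as.dim < n
  · cases c with
    | low _ x => rfl
    | top b y => exact absurd hω (lt_irrefl n)
  · obtain ⟨i, rfl⟩ := exists_topOb ω hω
    refine (congrArg (cellMap h h') (muCell_top ((pshMap h').obj X) (i := i) c)).trans ?_
    refine Eq.trans ?_ (muCell_top X (i := i) (cellMap h h' (c.map (cellHom h h' X)))).symm
    refine Cell.cell_ext (i := i) ?_ fun ω' hω' g => ?_
    · refine (ext_cellMap h h' _).trans ((ext_muTop (X := (pshMap h').obj X) c).trans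
        (Eq.trans ?_ (ext_muTop (X := X) _).symm))
      unfold muExt
      have h1 := (ext_cellMap h h' (X := (zFunctor k' n).obj X) (c.map (cellHom h h' X))).trans
        (Cell.ext_map (cellHom h h' X) c)
      refine Eq.trans ?_ (congrArg (fun z : (Z n).Ext (Top ((zFunctor k' n).obj X)) i =>
        (Z n).bind (Y := Top X) z (fun _ d => Cell.ext d)) h1).symm
      have e : (fun j p => Cell.ext (c.ext.2 j p)) = fun j (p : (Z n).In c.ext.1 j) =>
          Cell.ext (show Cell X (topOb k' j) from cellMap h h' (c.ext.2 j p)) := by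
        funext j p
        exact (ext_cellMap h h' _).symm
      exact congrArg (fun w => (Z n).bind (X := (Z n).Ext (Top X)) (Y := Top X) ⟨c.ext.1, w⟩
        (fun _ z => z)) e
    · refine (bdry_cellMap h h' _ ω' hω' g).trans
        ((bdry_muTop (X := (pshMap h').obj X) c _ _ _).trans (Eq.trans ?_ (bdry_muTop (X := X) _ _ _ _).symm))
      unfold muBdry
      have h1 := (bdry_cellMap h h' (X := (zFunctor k' n).obj X) (c.map (cellHom h h' X)) ω' hω' g).trans
        (Cell.bdry_map (cellHom h h' X) c _ _ _)
      refine Eq.trans ?_ (congrArg (fun d : Cell X ω' => d.toLow hω') h1).symm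
      exact (toLow_cellMap h h' (X := X) (ω := (rangeMap h).obj ω') hω' _).symm

/-- The comparison of categories of opetopic algebras. -/
def oalgMap : OAlg k' n ⥤ OAlg k n where
  obj A :=
    { A := (pshMap h').obj A.A
      a := cellHom h h' A.A ≫ (pshMap h').map A.a
      unit := by
        ext ⟨ω⟩ x
        exact (congrArg A.str (cellMap_eta h h' A.A ω x)).trans (A.str_eta _)
      assoc := by
        ext ⟨ω⟩ c
        change Cell ((zFunctor k n).obj ((pshMap h').obj A.A)) ω at c
        refine (congrArg A.str (cellMap_mu h h' A.A c)).trans ((A.str_mu _).trans ?_)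
        refine congrArg A.str ((cellMap_map h h' A.a (c.map (cellHom h h' A.A))).symm.trans ?_)
        exact congrArg (cellMap h h') (Cell.map_comp c _ _).symm }
  map {A B} f :=
    { f := (pshMap h').map f.f
      h := by
        ext ⟨ω⟩ c
        refine (congrArg B.str (cellMap_map h h' f.f c)).trans ?_
        exact (OAlg.hom_str f _).symm }

theorem algebra_mk_eq {C : Type*} [Category C] {T : Monad C} (A : T.Algebra) {a : T.obj A.A ⟶ A.A}
    (ha : a = A.a) (hu : T.η.app A.A ≫ a = 𝟙 A.A)
    (hs : T.μ.app A.A ≫ a = T.map a ≫ a) : (⟨A.A, a, hu, hs⟩ : T.Algebra) = A := by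
  subst ha
  rfl

theorem algebra_hom_heq {C : Type*} [Category C] {T : Monad C} {A A' B B' : T.Algebra}
    (hA : A = A') (hB : B = B') {f : A ⟶ B} {f' : A' ⟶ B'} (hf : HEq f.f f'.f) : HEq f f' := by
  subst hA
  subst hB
  exact heq_of_eq (Monad.Algebra.Hom.ext (eq_of_heq hf))

theorem cellMap_cellMap {X : Psh k n} {ω : OptRange k n} (c : Cell X ω) :
    cellMap h' h (cellMap (X := (pshMap h).obj X) h h' c) = c := by
  cases c <;> rfl

/-- Reindexing presheaves back and forth is definitionally the identity, so only the structure maps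
have to be compared. The equality of functors is strict, which gives an isomorphism and not just an
equivalence. -/
theorem oalgMap_comp : oalgMap h' h ⋙ oalgMap h h' = 𝟭 (OAlg k n) := by
  have hobj : ∀ A : OAlg k n, (oalgMap h h').obj ((oalgMap h' h).obj A) = A := fun A =>
    algebra_mk_eq A (by
      ext ⟨ω⟩ c
      exact congrArg A.str (cellMap_cellMap h h' c)) _ _
  exact CategoryTheory.Functor.hext hobj fun A B f => algebra_hom_heq (hobj A) (hobj B) HEq.rfl

theorem oalg_iso (h : n ≤ k) (h' : n ≤ k') : Nonempty (Cat.of (OAlg k n) ≅ Cat.of (OAlg k' n)) :=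
  ⟨{ hom := (oalgMap h' h).toCatHom
     inv := (oalgMap h h').toCatHom
     hom_inv_id := Cat.Hom.ext (oalgMap_comp h h')
     inv_hom_id := Cat.Hom.ext (oalgMap_comp h' h) }⟩

end reindex

/-! ### Planar trees with labelled vertices and leaves. -/

/-- Planar trees with vertices labelled in `V` and leaves labelled in `W`, where the number of
inputs of a vertex is determined by its label. -/
inductive LTree {V : Type} (ar : V → ℕ) (W : Type) : Type
  | leaf (w : W) : LTree ar W
  | node (v : V) (c : Fin (ar v) → LTree ar W) : LTree ar W

namespace LTree

variable {V V' : Type} {ar : V → ℕ} {ar' : V' → ℕ} {W W' W'' : Type}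

/-- Grafting of labelled trees. -/
def graft : LTree ar W → (W → LTree ar W') → LTree ar W'
  | leaf w, f => f w
  | node v c, f => node v (fun i => (c i).graft f)

theorem graft_graft (t : LTree ar W) (f : W → LTree ar W') (g : W' → LTree ar W'') :
    (t.graft f).graft g = t.graft (fun w => (f w).graft g) := by
  induction t with
  | leaf w => rfl
  | node v c ih => exact congrArg (node v) (funext ih)

theorem graft_leaf (t : LTree ar W) : t.graft leaf = t := by
  induction t with
  | leaf w => rfl
  | node v c ih => exact congrArg (node v) (funext ih)

/-- The list of the labels of the leaves. -/
def leafList : LTree ar W → List W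
  | leaf w => [w]
  | node _ c => (List.ofFn fun i => (c i).leafList).flatten

theorem leafList_relabel (t : LTree ar W) (g : W → W') :
    (t.graft (fun w => leaf (g w))).leafList = t.leafList.map g := by
  induction t with
  | leaf w => rfl
  | node v c ih =>
    simp only [graft, leafList, ih, List.map_flatten, List.map_ofFn]
    rfl

/-- Substitution of labelled trees into the vertices of a labelled tree. -/
def subst (f : ∀ v, LTree ar' (Fin (ar v))) : LTree ar W → LTree ar' W
  | leaf w => leaf w
  | node v c => (f v).graft (fun i => (c i).subst f)

theorem subst_relabel (f : ∀ v, LTree ar' (Fin (ar v))) (t : LTree ar W) (g : W → W') :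
    (t.graft (fun w => leaf (g w))).subst f = (t.subst f).graft (fun w => leaf (g w)) := by
  induction t with
  | leaf w => rfl
  | node v c ih =>
    simp only [graft, subst, ih, graft_graft]

instance : IsEmpty PTree.leaf.Vert := ⟨fun v => nomatch v⟩

/-- The labelled tree given by a planar tree and labels. -/
def build : ∀ (P : PTree) (l : P.Vert → V) (_ : ∀ v, ar (l v) = v.arity)
    (_ : Fin P.leaves → W), LTree ar W
  | .leaf, _, _, m => leaf (m (0 : Fin 1))
  | .node _ c, l, h, m => node (l .root) (fun i =>
      build (c (Fin.cast (h .root) i)) (fun v => l (.child _ v)) (fun v => h (.child _ v))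
        (fun y => m (finSigmaFinEquiv ⟨Fin.cast (h .root) i, y⟩)))

theorem exists_eq_build (t : LTree ar W) : ∃ P l h m, t = build P l h m := by
  induction t with
  | leaf w => exact ⟨.leaf, isEmptyElim, isEmptyElim, fun _ => w, rfl⟩
  | node v c ih =>
    choose P l h m e using ih
    refine ⟨.node (ar v) P, fun u => match u with
      | .root => v
      | .child i u => l i u, fun u => match u with
      | .root => rfl
      | .child i u => h i u,
      fun x => m (finSigmaFinEquiv.symm x).1 (finSigmaFinEquiv.symm x).2, ?_⟩
    refine congrArg (node v) (funext fun i => (e i).trans ?_)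
    refine congrArg (build (P i) (l i) (h i)) (funext fun y => ?_)
    have key : ∀ r s : Σ i, Fin (P i).leaves, r = s → m r.1 r.2 = m s.1 s.2 := by
      rintro r _ rfl
      rfl
    exact key ⟨i, y⟩ _ (Equiv.symm_apply_apply finSigmaFinEquiv _).symm

theorem ofFn_cast {α : Type} {n k : ℕ} (h : n = k) (g : Fin k → α) :
    List.ofFn (fun i => g (Fin.cast h i)) = List.ofFn g := by
  subst h
  rfl

/-- The leaves of a planar tree are numbered lexicographically, so listing their labels is the
flattening of `ofFn_sigma`. -/
theorem leafList_build : ∀ (P : PTree) (l : P.Vert → V) (h : ∀ v, ar (l v) = v.arity)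
    (m : Fin P.leaves → W), (build P l h m).leafList = List.ofFn m
  | .leaf, _, _, m => (List.ofFn_succ (f := fun x : Fin 1 => m x)).symm
  | .node k c, l, h, m => by
    refine (congrArg (fun g => (List.ofFn g).flatten) (funext fun i =>
      leafList_build (c (Fin.cast (h .root) i)) (fun v => l (.child _ v)) _ _)).trans ?_
    refine (congrArg List.flatten (ofFn_cast (h .root) (fun i =>
      List.ofFn fun y => m (finSigmaFinEquiv ⟨i, y⟩)))).trans ?_
    refine (ofFn_sigma _ _).symm.trans ?_
    refine congrArg List.ofFn (funext fun y => ?_)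
    exact congrArg m (finSigmaFinEquiv.apply_symm_apply y)

/-- A vertex with a planar tree with labelled vertices on every input. -/
def pnode (k : ℕ) (v : V) (g : Fin k → Σ P : PTree, P.Vert → V) : Σ P : PTree, P.Vert → V :=
  ⟨.node k (fun i => (g i).1), fun u => match u with
    | .root => v
    | .child i u => (g i).2 u⟩

theorem pnode_cast {n k : ℕ} (h : n = k) (v : V) (g : Fin k → Σ P : PTree, P.Vert → V) :
    pnode n v (fun i => g (Fin.cast h i)) = pnode k v g := by
  subst h
  rfl

/-- The planar tree of a labelled tree, with the labels of its vertices. -/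
def planar : LTree ar W → Σ P : PTree, P.Vert → V
  | leaf _ => ⟨.leaf, fun v => nomatch v⟩
  | node v c => pnode (ar v) v (fun i => (c i).planar)

theorem planar_build : ∀ (P : PTree) (l : P.Vert → V) (h : ∀ v, ar (l v) = v.arity)
    (m : Fin P.leaves → W), (build P l h m).planar = ⟨P, l⟩
  | .leaf, _, _, _ => 
    congrArg (Sigma.mk PTree.leaf) (Subsingleton.elim (α := PTree.leaf.Vert → V) _ _)
  | .node k c, l, h, m => by
    refine (congrArg (pnode _ _) (funext fun i =>
      planar_build (c (Fin.cast (h .root) i)) (fun v => l (.child _ v)) _ _)).trans ?_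
    refine (pnode_cast (h .root) (l .root) (fun i => ⟨c i, fun v => l (.child i v)⟩)).trans ?_
    refine Sigma.ext rfl (heq_of_eq (funext fun v => ?_))
    cases v <;> rfl

/-- Substituting corollas only relabels the vertices; this gives the action of maps on labels from
that of substitution. -/
theorem subst_corolla (g : V → V') (hg : ∀ v, ar' (g v) = ar v) :
    ∀ (P : PTree) (l : P.Vert → V) (h : ∀ v, ar (l v) = v.arity) (m : Fin P.leaves → W),
    (build P l h m).subst (fun v => node (ar := ar') (g v) (fun i => leaf (Fin.cast (hg v) i))) =
      build P (fun v => g (l v)) (fun v => (hg _).trans (h v)) m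
  | .leaf, _, _, _ => rfl
  | .node _ c, l, h, _ => congrArg (node (g (l .root))) (funext fun i =>
      subst_corolla g hg (c (Fin.cast (h .root) (Fin.cast (hg _) i))) _ _ _)

/-- `vertGraft` decodes the index of a leaf and casts along the decoding. For an index given as a
pair the cast is invisible. -/
theorem vertGraft_apply {k : ℕ} {c : Fin k → PTree} (f : Fin (PTree.node k c).leaves → PTree)
    (i : Fin k) (y : Fin (c i).leaves) (v : (f (finSigmaFinEquiv ⟨i, y⟩)).Vert) :
    PTree.vertGraft f (finSigmaFinEquiv ⟨i, y⟩) v =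
      .child i (PTree.vertGraft (fun z => f (finSigmaFinEquiv ⟨i, z⟩)) y v) := by
  have key : ∀ (r s : Σ i, Fin (c i).leaves) (hr : r = s) (v : (f (finSigmaFinEquiv s)).Vert),
      (.child r.1 (PTree.vertGraft (fun z => f (finSigmaFinEquiv ⟨r.1, z⟩)) r.2
        (cast (congrArg (fun z => (f (finSigmaFinEquiv z)).Vert) hr.symm) v)) :
        ((PTree.node k c).graft f).Vert) =
      .child s.1 (PTree.vertGraft (fun z => f (finSigmaFinEquiv ⟨s.1, z⟩)) s.2 v) := by
    rintro r s rfl v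
    rfl
  exact key _ ⟨i, y⟩ (Equiv.symm_apply_apply _ _) v

/-- The shape of a grafting is the grafting of the shapes. The labels of its vertices are fixed only
along `vertBase` and `vertGraft`; stating their existence avoids an explicit inverse of these maps.
-/
theorem exists_graft_build (Q : W → PTree) (l' : ∀ w, (Q w).Vert → V)
    (h' : ∀ w v, ar (l' w v) = v.arity) : ∀ (P : PTree) (l : P.Vert → V)
    (h : ∀ v, ar (l v) = v.arity) (m : Fin P.leaves → W) (k : W → LTree ar W')
    (_ : ∀ w, ∃ n, k w = build (Q w) (l' w) (h' w) n),
    ∃ (L : (P.graft (fun x => Q (m x))).Vert → V) (H : ∀ v, ar (L v) = v.arity)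
      (n : Fin (P.graft (fun x => Q (m x))).leaves → W'),
      (build P l h m).graft k = build _ L H n ∧
      (∀ v, L (PTree.vertBase _ v) = l v) ∧
      ∀ x v, L (PTree.vertGraft (fun x => Q (m x)) x v) = l' (m x) v
  | .leaf, l, h, m, k, hk => by
    obtain ⟨n, hn⟩ := hk (m (0 : Fin 1))
    refine ⟨l' _, h' _, n, hn, isEmptyElim, fun x v => ?_⟩
    obtain rfl : x = (0 : Fin 1) := Subsingleton.elim (α := Fin 1) _ _
    rfl
  | .node p c, l, h, m, k, hk => by
    have ih := fun i : Fin p => exists_graft_build Q l' h' (c i) (fun v => l (.child i v))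
      (fun v => h (.child i v)) (fun y => m (finSigmaFinEquiv ⟨i, y⟩)) k hk
    choose L H n e hb hg using ih
    refine ⟨fun v => match v with
      | .root => l .root
      | .child i v => L i v, fun v => match v with
      | .root => h .root
      | .child i v => H i v,
      fun x => n (finSigmaFinEquiv.symm x).1 (finSigmaFinEquiv.symm x).2, ?_, fun v => ?_,
      fun x v => ?_⟩
    · refine congrArg (node (l .root)) (funext fun i => (e _).trans ?_)
      refine congrArg (build _ (L _) (H _)) (funext fun y => ?_)
      have key : ∀ r s : Σ i, Fin ((c i).graft (fun y => Q (m (finSigmaFinEquiv ⟨i, y⟩)))).leaves,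
        r = s → n r.1 r.2 = n s.1 s.2 := by
          rintro r _ rfl
          rfl
      exact key ⟨_, y⟩ _ (Equiv.symm_apply_apply finSigmaFinEquiv _).symm
    · cases v with
      | root => rfl
      | child i v => exact hb i v
    · obtain ⟨⟨i, y⟩, rfl⟩ := (finSigmaFinEquiv (n := fun i => (c i).leaves)).surjective x
      rw [vertGraft_apply]
      exact hg i y v

/-- Induction on the shape, as substitution at the root is a grafting. The trees substituted in must
have their leaves numbered from left to right, so that numbers of leaves match inputs of vertices.
-/
theorem exists_subst_build (f : ∀ v, LTree ar' (Fin (ar v))) : ∀ (P : PTree) (l : P.Vert → V)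
    (h : ∀ v, ar (l v) = v.arity) (m : Fin P.leaves → W) (U : P.Vert → PTree)
    (hU : ∀ v, (U v).leaves = v.arity) (l' : ∀ v, (U v).Vert → V')
    (h' : ∀ v u, ar' (l' v u) = u.arity)
    (_ : ∀ v, f (l v) = build (U v) (l' v) (h' v) (Fin.cast ((hU v).trans (h v).symm))),
    ∃ (L : (P.subst U hU).Vert → V') (H : ∀ v, ar' (L v) = v.arity)
      (n : Fin (P.subst U hU).leaves → W),
      (build P l h m).subst f = build _ L H n ∧ ∀ v u, L (PTree.vertSubst U hU v u) = l' v u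
  | .leaf, _, _, m, _, _, _, _, _ =>
    ⟨(isEmptyElim : PTree.leaf.Vert → V'), (isEmptyElim : ∀ _ : PTree.leaf.Vert, _), m, rfl,
      (isEmptyElim : ∀ _ : PTree.leaf.Vert, _)⟩
  | .node p c, l, h, m, U, hU, l', h', hf => by
    have ih := fun i : Fin (ar (l .root)) => exists_subst_build f (c (Fin.cast (h .root) i))
      (fun v => l (.child _ v)) (fun v => h (.child _ v))
      (fun y => m (finSigmaFinEquiv ⟨Fin.cast (h .root) i, y⟩)) (fun v => U (.child _ v))
      (fun v => hU (.child _ v)) (fun v => l' (.child _ v)) (fun v => h' (.child _ v))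
      (fun v => hf (.child _ v))
    choose L' H' n' e' hL' using ih
    obtain ⟨L, H, n, e, hb, hg⟩ := exists_graft_build (fun i : Fin (ar (l .root)) =>
      (c (Fin.cast (h .root) i)).subst (fun v => U (.child _ v)) (fun v => hU (.child _ v)))
      L' H' (U .root) (l' .root) (h' .root) (Fin.cast ((hU .root).trans (h .root).symm))
      (fun i => (build (c (Fin.cast (h .root) i)) (fun v => l (.child _ v))
        (fun v => h (.child _ v))
        (fun y => m (finSigmaFinEquiv ⟨Fin.cast (h .root) i, y⟩))).subst f)
      (fun i => ⟨n' i, e' i⟩)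
    refine ⟨L, H, n, (congrArg (fun t => LTree.graft t _) (hf .root)).trans e, fun v u => ?_⟩
    cases v with
    | root => exact hb u
    | child i v =>
      exact (hg (Fin.cast (hU .root).symm i) _).trans
        (hL' (Fin.cast (h .root).symm i) v u)

end LTree

/-! ### Operations of `𝔷¹` and the linear order of their inputs. -/

/-- The arrow, i.e. the `1`-dimensional opetope. -/
def arrow : Opetope 1 := ⟨(), ()⟩

section tupOne

variable {X Y : Opetope 1 → Type} {i : Opetope 1}

/-- The labels of the inputs of an operation of `𝔷¹`, in their linear order. -/
noncomputable def tupOne (z : (Z 1).Ext X i) : Σ n, Fin n → X arrow := zOneIso.e X i z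

theorem tupOne_bijective : Function.Bijective (tupOne (X := X) (i := i)) :=
  (zOneIso.e X i).bijective

theorem tupOne_pure (x : X i) : tupOne ((Z 1).pure x) = ⟨1, fun _ => x⟩ := zOneIso.pure x

theorem tupOne_bind (z : (Z 1).Ext X i) (f : ∀ j, X j → (Z 1).Ext Y j) :
    tupOne ((Z 1).bind z f) = tupleBind (tupOne z) (fun x => tupOne (f arrow x)) :=
  zOneIso.bind z f

/-- The number of inputs of an operation of `𝔷¹`. -/
noncomputable def arityOne (a : Σ i, (Z 1).Op i) : ℕ :=
  (tupOne (X := (Z 1).In a.2) (i := a.1) ⟨a.2, fun _ e => e⟩).1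

/-- The inputs of an operation of `𝔷¹`, in their linear order. -/
noncomputable def inputOne (a : Σ i, (Z 1).Op i) : Fin (arityOne a) → (Z 1).In a.2 arrow :=
  (tupOne (X := (Z 1).In a.2) (i := a.1) ⟨a.2, fun _ e => e⟩).2

theorem tupOne_mk (b : (Z 1).Op i) (g : ∀ j, (Z 1).In b j → X j) :
    tupOne (⟨b, g⟩ : (Z 1).Ext X i) =
      ⟨arityOne ⟨i, b⟩, fun y => g arrow (inputOne ⟨i, b⟩ y)⟩ :=
  zOneIso.map g (⟨b, fun _ e => e⟩ : (Z 1).Ext ((Z 1).In b) i)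

end tupOne

/-- With trivial labels an operation becomes a sequence of points, determined by its length, and
passing to sequences is injective. -/
theorem arityOne_injective : Function.Injective arityOne := by
  have key : ∀ b b' : (Z 1).Op arrow,
      arityOne ⟨arrow, b⟩ = arityOne ⟨arrow, b'⟩ → b = b' := fun b b' h => by
    have : (⟨b, fun _ _ => ()⟩ : (Z 1).Ext (fun _ => Unit) arrow) = ⟨b', fun _ _ => ()⟩ := by
      apply tupOne_bijective.1
      rw [tupOne_mk, tupOne_mk]
      exact Sigma.ext h (Function.hfunext (congrArg Fin h) fun _ _ _ => HEq.rfl)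
    exact congrArg Sigma.fst this
  rintro ⟨i, b⟩ ⟨i', b'⟩ h
  exact congrArg (Sigma.mk arrow) (key b b' h)

theorem arityOne_surjective : Function.Surjective arityOne := fun n => by
  obtain ⟨z, hz⟩ := (tupOne_bijective (X := fun _ => Unit) (i := arrow)).2 ⟨n, fun _ => ()⟩
  obtain ⟨b, g⟩ := z
  rw [tupOne_mk] at hz
  exact ⟨⟨_, b⟩, congrArg Sigma.fst hz⟩

/-- Only the bijection with sequences is used, for well-chosen labels. Labelling the inputs by
positions gives a left inverse. An input missed by the enumeration could be labelled differently
without changing the sequence. -/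
theorem inputOne_bijective (a : Σ i, (Z 1).Op i) : Function.Bijective (inputOne a) := by
  obtain ⟨i, b⟩ := a
  constructor
  · obtain ⟨⟨b', g⟩, hz⟩ := (tupOne_bijective (X := fun _ => Fin (arityOne ⟨i, b⟩)) (i := i)).2
      ⟨arityOne ⟨i, b⟩, fun y => y⟩
    rw [tupOne_mk] at hz
    have h : (⟨i, b'⟩ : Σ i, (Z 1).Op i) = ⟨i, b⟩ := arityOne_injective (congrArg Sigma.fst hz)
    cases h
    have h' := eq_of_heq (Sigma.mk.inj_iff.1 hz).2
    exact fun x y hxy => (congrFun h' x).symm.trans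
      ((congrArg (g arrow) hxy).trans (congrFun h' y))
  · intro e
    by_contra hne
    -- Two labellings that differ exactly at `e`; if `e` is not enumerated they yield the same
    -- sequence.
    have h : (⟨b, fun _ _ => ULift.up False⟩ : (Z 1).Ext (fun _ => ULift Prop) i) =
        ⟨b, fun j (e' : (Z 1).In b j) => ULift.up ((e' : (Z 1).In b arrow) = e)⟩ := by
      apply tupOne_bijective.1
      rw [tupOne_mk, tupOne_mk]
      refine congrArg (Sigma.mk (arityOne ⟨i, b⟩)) (funext fun y => ?_)
      exact congrArg ULift.up (eq_false fun h => hne ⟨y, h⟩).symm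
    have h' := congrFun (congrFun (eq_of_heq (Sigma.mk.inj_iff.1 h).2) arrow) e
    exact (congrArg ULift.down h').mpr rfl

/-- The inputs of an operation of `𝔷¹` correspond to their positions in the linear order. -/
noncomputable def inputEquiv (a : Σ i, (Z 1).Op i) : Fin (arityOne a) ≃ (Z 1).In a.2 arrow :=
  Equiv.ofBijective _ (inputOne_bijective a)

/-- The number of inputs of a labelled operation of `𝔷¹`. -/
noncomputable def arityLab (D : (Σ i, (Z 1).Op i) → Type) (v : Σ a, D a) : ℕ := arityOne v.1

/-! ### Trees over `𝔷¹` as labelled planar trees. -/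

section

variable {D D' : (Σ i, (Z 1).Op i) → Type} {X Y : Opetope 1 → Type}

/-- The labelled planar tree given by a tree of labelled operations of `𝔷¹`. -/
noncomputable def toLTree : ∀ {i : Opetope 1}, ((Z 1).dec D).Tree Y i →
    LTree (arityLab D) (Y arrow)
  | _, .leaf y => .leaf y
  | i, .node b c => .node (ar := arityLab D) ⟨⟨i, b.1⟩, b.2⟩
      (fun k => toLTree (c arrow (inputOne ⟨i, b.1⟩ k)))

theorem toLTree_graft {i : Opetope 1} (T : ((Z 1).dec D).Tree X i)
    (f : ∀ j, X j → ((Z 1).dec D).Tree Y j) :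
    toLTree (T.graft f) = (toLTree T).graft (fun x => toLTree (f arrow x)) := by
  induction T with
  | leaf x => rfl
  | node b c ih => exact congrArg (LTree.node _) (funext fun k => ih arrow _)

/-- Reading leaves from left to right is reducing the tree: both concatenate along the order of the
inputs of each node. -/
theorem leafList_toLTree {i : Opetope 1} (T : ((Z 1).dec D).Tree Y i) :
    (toLTree T).leafList = List.ofFn (tupOne ((Z 1).evalD T)).2 := by
  induction T with
  | leaf x =>
    refine Eq.trans ?_ (congrArg (fun s : Σ n, Fin n → Y arrow => List.ofFn s.2)
      (tupOne_pure _)).symm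
    exact (List.ofFn_succ (f := fun _ : Fin 1 => _)).symm
  | @node i b c ih =>
    refine Eq.trans ?_ (congrArg (fun s : Σ n, Fin n → Y arrow => List.ofFn s.2)
      ((tupOne_bind (X := (Z 1).Ext Y) ⟨b.1, fun j e => (Z 1).evalD (c j e)⟩
        (fun _ z => z)).trans (congrArg (fun s => tupleBind s _) (tupOne_mk _ _)))).symm
    refine Eq.trans ?_ (ofFn_tupleBind _ _).symm
    rw [List.flatMap_def, List.map_ofFn]
    exact congrArg (fun g => (List.ofFn g).flatten) (funext fun k => ih arrow _)

/-- The tree of labelled operations of `𝔷¹` given by a labelled planar tree. -/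
noncomputable def ofLTree : LTree (arityLab D) (Y arrow) → ((Z 1).dec D).Tree Y arrow
  | .leaf y => .leaf y
  | .node v c => .node (P := (Z 1).dec D) (i := arrow) ⟨v.1.2, v.2⟩
      (fun _ e => ofLTree (c ((inputEquiv v.1).symm e)))

theorem ofLTree_toLTree {i : Opetope 1} (T : ((Z 1).dec D).Tree Y i) :
    ofLTree (toLTree T) = T := by
  induction T with
  | leaf x => rfl
  | @node i b c ih =>
    refine congrArg (PolyEnd.Tree.node (P := (Z 1).dec D) b) (funext fun j => funext fun e => ?_)
    refine (ih arrow _).trans ?_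
    exact congrArg (c arrow) ((inputEquiv ⟨i, b.1⟩).apply_symm_apply e)

theorem toLTree_ofLTree (t : LTree (arityLab D) (Y arrow)) : toLTree (ofLTree t) = t := by
  induction t with
  | leaf x => rfl
  | node v c ih =>
    refine congrArg (LTree.node v) (funext fun k => ?_)
    refine (ih _).trans ?_
    exact congrArg c ((inputEquiv v.1).symm_apply_apply k)

end

/-- A tree whose leaves are numbered consecutively has no freedom in its leaf labels; shape and
vertex labels determine it. -/
theorem LTree.exists_build_of_leafList {V : Type} {ar : V → ℕ} {n : ℕ} {t : LTree ar (Fin n)}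
    (ht : t.leafList = List.ofFn (fun x : Fin n => x)) :
    ∃ (h : ∀ v, ar (t.planar.2 v) = v.arity) (hP : t.planar.1.leaves = n),
      t = build t.planar.1 t.planar.2 h (Fin.cast hP) := by
  obtain ⟨P, l, h, m, rfl⟩ := t.exists_eq_build
  rw [leafList_build] at ht
  obtain rfl : P.leaves = n := congrArg Sigma.fst
    (tuple_ext (x := ⟨_, m⟩) (y := ⟨_, fun x => x⟩) ht)
  obtain rfl : m = fun x => x := List.ofFn_injective ht
  have := planar_build P l h (fun x => x)
  generalize (build P l h (fun x => x)).planar = p at this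
  subst this
  exact ⟨h, rfl, rfl⟩

/-! ### Presenting `𝔷²` by planar trees with labelled vertices. -/

/-- A presentation of a monad by planar trees with labelled vertices. -/
structure TreeRep {I : Type} (T : FMonad I) where
  -- The sorts are identified with arities; for `𝔷²` a colour is an operation of `𝔷¹`, determined by
  -- its number of inputs.
  len : I ≃ ℕ
  e : ∀ {X : I → Type} {a : I}, T.F X a → Σ P : PTree, P.Vert → Σ j, X j
  leaves : ∀ {X : I → Type} {a : I} (z : T.F X a), (e z).1.leaves = len a
  arity : ∀ {X : I → Type} {a : I} (z : T.F X a) (v : (e z).1.Vert),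
    len ((e z).2 v).1 = v.arity
  e_injective : ∀ {X : I → Type} {a : I} {z z' : T.F X a}, e z = e z' → z = z'
  exists_eq : ∀ {X : I → Type} {a : I} (P : PTree) (l : P.Vert → Σ j, X j),
    P.leaves = len a → (∀ v, len (l v).1 = v.arity) → ∃ z : T.F X a, e z = ⟨P, l⟩
  map : ∀ {X Y : I → Type} {a : I} (f : ∀ j, X j → Y j) (z : T.F X a),
    e (T.map f z) = ⟨(e z).1, fun v => ⟨((e z).2 v).1, f _ ((e z).2 v).2⟩⟩
  pure : ∀ {X : I → Type} {a : I} (x : X a),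
    e (T.pure x) = ⟨PTree.corolla (len a), fun _ => ⟨a, x⟩⟩
  -- The labels are prescribed along `vertSubst` only, which determines them because every vertex of
  -- a substitution arises in this way.
  bind : ∀ {X Y : I → Type} {a : I} (z : T.F X a) (f : ∀ j, X j → T.F Y j),
    ∃ (h : ∀ v, (e (f _ ((e z).2 v).2)).1.leaves = v.arity)
      (L : ((e z).1.subst (fun v => (e (f _ ((e z).2 v).2)).1) h).Vert → Σ j, Y j),
      e (T.bind z f) = ⟨_, L⟩ ∧
      ∀ v u, L (PTree.vertSubst _ h v u) = (e (f _ ((e z).2 v).2)).2 u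

section

variable {D D' : (Σ i, (Z 1).Op i) → Type} {a : Σ i, (Z 1).Op i}

/-- The labelled planar tree given by a labelled operation of `𝔷²`, with its leaves numbered from
left to right. -/
noncomputable def normTree (z : (Z 1).bdData.Ext D a) :
    LTree (arityLab D) (Fin (arityOne a)) :=
  (toLTree (z.1.1.toDec z.2)).graft (fun e => .leaf ((inputEquiv a).symm e))

/-- The labelled planar trees given by labelled operations of `𝔷²`. -/
noncomputable def normFun (f : ∀ a, D a → (Z 1).bdData.Ext D' a) (v : Σ a, D a) :
    LTree (arityLab D') (Fin (arityLab D v)) :=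
  normTree (f v.1 v.2)

/-- The leaves of an operation are labelled by the inputs of its reduction, each in its place; once
numbered by position, they read 0, 1, 2 and so on. -/
theorem leafList_normTree (z : (Z 1).bdData.Ext D a) :
    (normTree z).leafList = List.ofFn (fun x : Fin (arityOne a) => x) := by
  refine (LTree.leafList_relabel _ _).trans ?_
  rw [leafList_toLTree]
  have h := ((Z 1).evalD_toDec z.1.1 z.2).trans z.1.2
  rw [h, tupOne_mk, List.map_ofFn]
  exact congrArg List.ofFn (funext fun y => (inputEquiv a).symm_apply_apply y)

theorem normTree_injective {z z' : (Z 1).bdData.Ext D a} (h : normTree z = normTree z') :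
    z = z' := by
  apply (Z 1).bd_ext
  have h' := congrArg (fun t => LTree.graft t (fun k => .leaf (inputEquiv a k))) h
  simp only [normTree, LTree.graft_graft, LTree.graft, Equiv.apply_symm_apply,
    LTree.graft_leaf] at h'
  exact (ofLTree_toLTree _).symm.trans ((congrArg ofLTree h').trans (ofLTree_toLTree _))

/-- Conversely, consecutive numbering of the leaves forces the tree over `𝔷¹` to reduce to `b` with
its tautological labels, since sequences determine labelled operations. -/
theorem exists_normTree_eq (t : LTree (arityLab D) (Fin (arityOne a)))
    (ht : t.leafList = List.ofFn (fun x : Fin (arityOne a) => x)) :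
    ∃ z : (Z 1).bdData.Ext D a, normTree z = t := by
  obtain ⟨i, b⟩ := a
  let T : ((Z 1).dec D).Tree ((Z 1).In b) arrow :=
    ofLTree (Y := (Z 1).In b) (t.graft (fun k => .leaf (inputEquiv ⟨i, b⟩ k)))
  have hT : (Z 1).evalD T = ⟨b, fun _ e => e⟩ := by
    apply tupOne_bijective.1
    apply tuple_ext
    rw [← leafList_toLTree, toLTree_ofLTree, LTree.leafList_relabel, ht, List.map_ofFn]
    exact (congrArg (fun s : Σ n, Fin n → (Z 1).In b arrow => List.ofFn s.2)
      (tupOne_mk (X := (Z 1).In b) (i := arrow) b (fun _ e => e))).symm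
  have h1 := PolyEnd.Tree.toDec_ofDec T
  refine ⟨⟨⟨(PolyEnd.Tree.ofDec T).1, ((Z 1).evalD_toDec _ (PolyEnd.Tree.ofDec T).2).symm.trans
    ((congrArg (Z 1).evalD h1).trans hT)⟩, (PolyEnd.Tree.ofDec T).2⟩, ?_⟩
  unfold normTree
  refine (congrArg (fun T' : ((Z 1).dec D).Tree ((Z 1).In b) arrow => (toLTree T').graft
    (fun e => .leaf ((inputEquiv ⟨i, b⟩).symm e))) h1).trans ?_
  rw [toLTree_ofLTree, LTree.graft_graft]
  simp only [LTree.graft, Equiv.symm_apply_apply]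
  exact LTree.graft_leaf t

theorem normTree_pure (x : D a) :
    normTree ((Z 1).bdData.pure x) = .node (ar := arityLab D) ⟨a, x⟩ (fun k => .leaf k) :=
  congrArg (LTree.node (ar := arityLab D) ⟨a, x⟩) (funext fun k =>
    congrArg LTree.leaf ((inputEquiv a).symm_apply_apply k))

/-- Substituted trees have leaves labelled by inputs on one side and by positions on the other; the
two conversions cancel. -/
theorem toLTree_decSubst {Y : Opetope 1 → Type} (f : ∀ a, D a → (Z 1).bdData.Ext D' a)
    {i : Opetope 1} (T : ((Z 1).dec D).Tree Y i) :
    toLTree ((Z 1).decSubst f T) = (toLTree T).subst (normFun f) := by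
  induction T with
  | leaf x => rfl
  | @node i b c ih =>
    refine (toLTree_graft _ _).trans ?_
    refine Eq.trans ?_ (LTree.graft_graft _ _ _).symm
    refine congrArg (LTree.graft _) (funext fun e => (ih arrow e).trans ?_)
    exact congrArg (fun e => (toLTree (c arrow e)).subst (normFun f))
      ((inputEquiv ⟨i, b.1⟩).apply_symm_apply e).symm

theorem normTree_bind (z : (Z 1).bdData.Ext D a) (f : ∀ a, D a → (Z 1).bdData.Ext D' a) :
    normTree ((Z 1).bdData.bind z f) =
      (normTree z).subst (normFun f) := by
  unfold normTree
  rw [(Z 1).toDec_bind, toLTree_decSubst, LTree.subst_relabel]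

theorem normTree_eq_build (z : (Z 1).bdData.Ext D a) :
    ∃ (h : ∀ v, arityLab D ((normTree z).planar.2 v) = v.arity)
      (hP : (normTree z).planar.1.leaves = arityOne a),
      normTree z = .build (normTree z).planar.1 (normTree z).planar.2 h (Fin.cast hP) :=
  LTree.exists_build_of_leafList (leafList_normTree z)

theorem planar_normTree_map (f : ∀ a, D a → D' a) (z : (Z 1).bdData.Ext D a) :
    (normTree ((Z 1).bd.toF.map f z)).planar = ⟨(normTree z).planar.1, fun v =>
      ⟨((normTree z).planar.2 v).1, f _ ((normTree z).planar.2 v).2⟩⟩ := by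
  obtain ⟨h, hP, e⟩ := normTree_eq_build z
  have h1 : normTree ((Z 1).bd.toF.map f z) =
      (normTree z).subst (fun v : Σ a, D a =>
        .node (ar := arityLab D') ⟨v.1, f _ v.2⟩ (fun k => .leaf k)) := by
    refine (congrArg normTree ((Z 1).bd.toF.map_eq f z)).trans ((normTree_bind z _).trans ?_)
    exact congrArg (fun g => LTree.subst g (normTree z)) (funext fun v => normTree_pure _)
  rw [h1]
  refine (congrArg (fun t => (LTree.subst _ t).planar) e).trans ?_
  refine (congrArg LTree.planar (LTree.subst_corolla (ar := arityLab D) (ar' := arityLab D')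
    (fun v => ⟨v.1, f _ v.2⟩) (fun _ => rfl) _ _ h _)).trans ?_
  exact LTree.planar_build _ _ _ _

theorem planar_normTree_bind (z : (Z 1).bdData.Ext D a)
    (f : ∀ a, D a → (Z 1).bdData.Ext D' a) :
    ∃ (h : ∀ v, (normTree (f _ ((normTree z).planar.2 v).2)).planar.1.leaves = v.arity)
      (L : ((normTree z).planar.1.subst
        (fun v => (normTree (f _ ((normTree z).planar.2 v).2)).planar.1) h).Vert → Σ j, D' j),
      (normTree ((Z 1).bdData.bind z f)).planar = ⟨_, L⟩ ∧
      ∀ v u, L (PTree.vertSubst _ h v u) =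
        (normTree (f _ ((normTree z).planar.2 v).2)).planar.2 u := by
  obtain ⟨h, hP, e⟩ := normTree_eq_build z
  choose h' hP' e' using fun v => normTree_eq_build (f _ ((normTree z).planar.2 v).2)
  obtain ⟨L, H, n, e2, hL⟩ := LTree.exists_subst_build (normFun f)
    (normTree z).planar.1 (normTree z).planar.2 h (Fin.cast hP) _
    (fun v => (hP' v).trans (h v)) _ h' e'
  refine ⟨_, L, ?_, hL⟩
  rw [normTree_bind]
  refine (congrArg (fun t => (LTree.subst _ t).planar) e).trans ?_
  exact (congrArg LTree.planar e2).trans (LTree.planar_build _ _ _ _)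

end

/-- The presentation of the monad `𝔷²` by planar trees with labelled vertices. -/
noncomputable def zTwoRep : TreeRep (Z 2).toF where
  len := Equiv.ofBijective _ ⟨arityOne_injective, arityOne_surjective⟩
  e z := (normTree z).planar
  leaves z := (normTree_eq_build z).choose_spec.choose
  arity z := (normTree_eq_build z).choose
  e_injective {X a z z'} h := by
    apply normTree_injective
    obtain ⟨h1, hP1, e1⟩ := normTree_eq_build z
    obtain ⟨h2, hP2, e2⟩ := normTree_eq_build z'
    refine e1.trans (Eq.trans ?_ e2.symm)
    change (normTree z).planar = (normTree z').planar at h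
    generalize (normTree z).planar = p at *
    generalize (normTree z').planar = p' at *
    subst h
    rfl
  exists_eq {X a} P l hP h := by
    obtain ⟨z, hz⟩ := exists_normTree_eq (D := X) (a := a)
      (.build P l h (Fin.cast hP)) 
      ((LTree.leafList_build _ _ _ _).trans (LTree.ofFn_cast hP fun x => x))
    exact ⟨z, (congrArg LTree.planar hz).trans (LTree.planar_build _ _ _ _)⟩
  map f z := planar_normTree_map f z
  pure {X a} x := by
    refine (congrArg LTree.planar (normTree_pure (D := X) x)).trans ?_
    refine Sigma.ext rfl (heq_of_eq (funext fun v => ?_))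
    cases v with
    | root => rfl
    | child i v => cases v
  bind z f := planar_normTree_bind z f

theorem exists_eq_sigma_mk {A : Type*} {B : A → Type*} {w : Σ a, B a} {a : A} (h : w.1 = a) :
    ∃ b, w = ⟨a, b⟩ := by
  subst h
  exact ⟨_, rfl⟩

theorem PTree.subst_congr {S : PTree} {U U' : S.Vert → PTree} (h : ∀ v, (U v).leaves = v.arity)
    (e : U = U') : S.subst U h = S.subst U' (e ▸ h) := by
  subst e
  rfl

/-! ### Calculus with tree presentations. -/

namespace TreeRep

variable {I : Type} {T : FMonad I} (R : TreeRep T)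

/-- With trivial labels a vertex carries only a sort, and its arity fixes the sort. So sources and
composability conditions are equalities of planar trees. -/
theorem eq_of_shape {C : I → Type} (hC : ∀ i, Subsingleton (C i)) {a : I} {z z' : T.F C a}
    (h : (R.e z).1 = (R.e z').1) : z = z' := by
  apply R.e_injective
  have h1 := R.arity z
  have h2 := R.arity z'
  generalize R.e z = w at *
  generalize R.e z' = w' at *
  obtain ⟨S, l⟩ := w
  obtain ⟨S', l'⟩ := w'
  obtain rfl : S = S' := h
  refine congrArg (Sigma.mk S) (funext fun v => ?_)
  have h3 := R.len.injective ((h1 v).trans (h2 v).symm)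
  dsimp only at h3
  generalize l v = y at *
  generalize l' v = y' at *
  obtain ⟨j, y⟩ := y
  obtain ⟨j', y'⟩ := y'
  obtain rfl : j = j' := h3
  exact congrArg (Sigma.mk j) (Subsingleton.elim _ _)

/-- The element of the monad given by a planar tree whose vertices have trivial labels. -/
noncomputable def tree {a : I} (S : PTree) (h : S.leaves = R.len a) :
    T.F (fun _ => Unit) a :=
  (R.exists_eq S (fun v => ⟨R.len.symm v.arity, ()⟩) h
    (fun _ => R.len.apply_symm_apply _)).choose

theorem e_tree {a : I} {S : PTree} (h : S.leaves = R.len a) : (R.e (R.tree S h)).1 = S :=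
  congrArg Sigma.fst (R.exists_eq (X := fun _ => Unit) S (fun v => ⟨R.len.symm v.arity, ()⟩) h
    (fun _ => R.len.apply_symm_apply _)).choose_spec

theorem shape_map {X Y : I → Type} {a : I} (f : ∀ j, X j → Y j) (z : T.F X a) :
    (R.e (T.map f z)).1 = (R.e z).1 := congrArg Sigma.fst (R.map f z)

theorem e_map {X Y : I → Type} {a : I} (f : ∀ j, X j → Y j) {z : T.F X a} {S : PTree}
    {l : S.Vert → Σ j, X j} (h : R.e z = ⟨S, l⟩) :
    R.e (T.map f z) = ⟨S, fun v => ⟨(l v).1, f _ (l v).2⟩⟩ := by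
  refine (R.map f z).trans ?_
  generalize R.e z = w at *
  subst h
  rfl

theorem arity_of_eq {X : I → Type} {a : I} {z : T.F X a} {S : PTree} {l : S.Vert → Σ j, X j}
    (h : R.e z = ⟨S, l⟩) (v : S.Vert) : R.len (l v).1 = v.arity := by
  have := R.arity z
  generalize R.e z = w at *
  subst h
  exact this v

/-- The law `bind` with shapes and labels replaced by variables, so that known values can be
inserted without casts. -/
theorem e_bind {X Y : I → Type} {a : I} {z : T.F X a} (f : ∀ j, X j → T.F Y j) {S : PTree}
    {l : S.Vert → Σ j, X j} (h : R.e z = ⟨S, l⟩) {U : S.Vert → PTree}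
    {m : ∀ v, (U v).Vert → Σ j, Y j} (hm : ∀ v, R.e (f _ (l v).2) = ⟨U v, m v⟩) :
    ∃ (hU : ∀ v, (U v).leaves = v.arity) (L : (S.subst U hU).Vert → Σ j, Y j),
      R.e (T.bind z f) = ⟨_, L⟩ ∧ ∀ v u, L (PTree.vertSubst U hU v u) = m v u := by
  have := R.bind z f
  generalize R.e z = w at *
  subst h
  obtain rfl : U = fun v => (R.e (f _ (l v).2)).1 :=
    funext fun v => (congrArg Sigma.fst (hm v)).symm
  obtain rfl : m = fun v => (R.e (f _ (l v).2)).2 :=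
    funext fun v => (eq_of_heq (Sigma.mk.inj_iff.1 (hm v)).2).symm
  exact this

end TreeRep

/-! ### Combinads as generalized multicategories. -/

namespace Combinad

/-- The operations of a combinad. -/
def Tot (P : Combinad) : Type := Σ S, P.Op S

/-- Transport of operations along an equality of trees. -/
def castOp (P : Combinad) {S S' : PTree} (h : S = S') (p : P.Op S) : P.Op S' := h ▸ p

section

variable {I : Type} {T : FMonad I} (R : TreeRep T) (P : Combinad)

/-- The operations of a combinad whose tree has a given number of leaves. -/
def Cell (a : I) : Type := {q : P.Tot // q.1.leaves = R.len a}

/-- The source of an operation. -/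
noncomputable def Cell.s {a : I} (q : P.Cell R a) : T.F (fun _ => Unit) a := R.tree q.1.1 q.2

variable {R P}

theorem Cell.shape_eq {a : I} {x : P.Cell R a} {z : T.F (P.Cell R) a}
    (h : T.map (fun _ _ => ()) z = x.s) : x.1.1 = (R.e z).1 :=
  (R.e_tree x.2).symm.trans ((congrArg (fun w => (R.e w).1) h.symm).trans (R.shape_map _ z))

/-- The composition of operations. -/
def Cell.comp {a : I} (x : P.Cell R a) (z : T.F (P.Cell R) a)
    (h : T.map (fun _ _ => ()) z = x.s) : P.Cell R a :=
  ⟨⟨_, P.comp (P.castOp (Cell.shape_eq h) x.1.2) (fun v => ((R.e z).2 v).2.1.1)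
    (fun v => ((R.e z).2 v).2.2.trans (R.arity z v)) (fun v => ((R.e z).2 v).2.1.2)⟩,
    (PTree.leaves_subst _ _ _).trans (R.leaves z)⟩

theorem Cell.exists_eq {a : I} {x : P.Cell R a} {z : T.F (P.Cell R) a}
    (h : T.map (fun _ _ => ()) z = x.s) :
    ∃ (S : PTree) (p : P.Op S) (l : S.Vert → Σ j, P.Cell R j), x.1 = ⟨S, p⟩ ∧ R.e z = ⟨S, l⟩ := by
  have := Cell.shape_eq h
  generalize R.e z = w at *
  obtain ⟨⟨S, p⟩, hx⟩ := x
  obtain ⟨S', l⟩ := w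
  obtain rfl : S = S' := this
  exact ⟨S, p, l, rfl, rfl⟩

/-- Composition is defined with a cast of the outer operation; when both arguments are presented
over one tree `S`, it is the composition of the combinad itself. -/
theorem Cell.comp_eq {a : I} {x : P.Cell R a} {z : T.F (P.Cell R) a}
    (h : T.map (fun _ _ => ()) z = x.s) {S : PTree} {p : P.Op S} {l : S.Vert → Σ j, P.Cell R j}
    (hx : x.1 = ⟨S, p⟩) (hz : R.e z = ⟨S, l⟩) {U : S.Vert → PTree} {y : ∀ v, P.Op (U v)}
    (hl : ∀ v, (l v).2.1 = ⟨U v, y v⟩) :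
    ∃ hU, (x.comp z h).1 = ⟨_, P.comp p U hU y⟩ := by
  unfold Cell.comp
  have h1 := Cell.shape_eq h
  have h2 := fun v => ((R.e z).2 v).2.2.trans (R.arity z v)
  change ∃ hU, (⟨_, P.comp (P.castOp h1 x.1.2) (fun v => ((R.e z).2 v).2.1.1) h2
    (fun v => ((R.e z).2 v).2.1.2)⟩ : P.Tot) = _
  clear h
  generalize R.e z = w at *
  subst hz
  obtain ⟨x, hx'⟩ := x
  obtain rfl : x = ⟨S, p⟩ := hx
  obtain rfl : U = fun v => (l v).2.1.1 := funext fun v => (congrArg Sigma.fst (hl v)).symm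
  obtain rfl : y = fun v => (l v).2.1.2 :=
    funext fun v => (eq_of_heq (Sigma.mk.inj_iff.1 (hl v)).2).symm
  exact ⟨h2, rfl⟩

theorem one_comp_of_leaves {n : ℕ} (q : P.Tot) (hq : q.1.leaves = n)
    (h : ∀ v : (PTree.corolla n).Vert, q.1.leaves = v.arity) :
    (⟨_, P.comp (P.one n) (fun _ => q.1) h (fun _ => q.2)⟩ : P.Tot) = q := by
  subst hq
  exact P.one_comp q.2

theorem comp_one_of_arity {S : PTree} (p : P.Op S) {w : S.Vert → ℕ} (hw : ∀ v, w v = v.arity)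
    (h : ∀ v, (PTree.corolla (w v)).leaves = v.arity) :
    (⟨_, P.comp p (fun v => PTree.corolla (w v)) h (fun v => P.one (w v))⟩ : P.Tot) = ⟨S, p⟩ := by
  obtain rfl : w = fun v => v.arity := funext hw
  exact P.comp_one p

variable (R P)

/-- The generalized multicategory of a combinad. -/
noncomputable def toMultiObj : Multi T where
  C _ := Unit
  X := P.Cell R
  t _ _ := ()
  s _ x := x.s
  one a _ := ⟨⟨_, P.one (R.len a)⟩, PTree.leaves_corolla _⟩
  comp x z h := x.comp z h
  t_one _ := rfl
  s_one {a} _ := R.eq_of_shape (fun _ => inferInstanceAs (Subsingleton Unit))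
    ((R.e_tree (a := a) (PTree.leaves_corolla _)).trans 
      (congrArg Sigma.fst (R.pure (X := fun _ => Unit) (a := a) ())).symm)
  t_comp _ _ _ := rfl
  s_comp {a} x z h := R.eq_of_shape (fun _ => inferInstanceAs (Subsingleton Unit)) (by
    refine (R.e_tree (x.comp z h).2).trans ?_
    obtain ⟨h', L, hL, -⟩ := R.bind z (fun _ (x : P.Cell R _) => x.s)
    refine Eq.trans ?_ (congrArg Sigma.fst hL).symm
    exact PTree.subst_congr _ (funext fun v => (R.e_tree ((R.e z).2 v).2.2).symm))
  one_comp {a} x h := by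
    apply Subtype.ext
    obtain ⟨hU, e⟩ := Cell.comp_eq h rfl (R.pure x) (fun _ => rfl)
    exact e.trans (one_comp_of_leaves x.1 x.2 hU)
  comp_one {a} x h := by
    apply Subtype.ext
    obtain ⟨S, p, l, hx, hz⟩ := Cell.exists_eq h
    obtain ⟨l', hl'⟩ := exists_eq_sigma_mk (w := R.e x.s)
      ((R.shape_map _ _).symm.trans (congrArg Sigma.fst hz))
    obtain ⟨hU, e⟩ := Cell.comp_eq h hx (R.e_map _ hl') (fun _ => rfl)
    exact e.trans ((comp_one_of_arity p (R.arity_of_eq hl') hU).trans hx.symm)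
  comp_assoc {a} x ζ h h' h'' := by
    apply Subtype.ext
    obtain ⟨S, p, l, hx, hz⟩ := Cell.exists_eq h
    obtain ⟨w, hw⟩ := exists_eq_sigma_mk (w := R.e ζ)
      ((R.shape_map _ _).symm.trans (congrArg Sigma.fst hz))
    choose U y m hy hm using fun v => Cell.exists_eq (w v).2.2
    obtain ⟨hU, e1⟩ := Cell.comp_eq h hx (R.e_map _ hw) hy
    obtain ⟨hU', L, hL, hLm⟩ := R.e_bind (fun _ p => p.1.2) hw hm
    -- The labels of the inner trees are those of the substituted tree, restricted along
    -- `vertSubst`; this is the indexing used in the associativity law of a combinad.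
    obtain rfl : m = fun v u => L (PTree.vertSubst U hU' v u) :=
      funext fun v => funext fun u => (hLm v u).symm
    choose hV e2 using fun v => Cell.comp_eq (w v).2.2 (hy v) (hm v) (fun _ => rfl)
    obtain ⟨hU2, e3⟩ := Cell.comp_eq h'' hx (R.e_map _ hw) e2
    obtain ⟨hU3, e4⟩ := Cell.comp_eq h' e1 hL (fun _ => rfl)
    exact e4.trans ((P.comp_assoc p U hU y _ hU3 _).trans e3.symm)

end

end Combinad

namespace Combinad

variable {I : Type} {T : FMonad I} (R : TreeRep T)

/-- The functor that takes a combinad to a generalized multicategory. -/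
noncomputable def toMulti : Combinad ⥤ Multi T where
  obj P := P.toMultiObj R
  map {P Q} f := Multi.Hom.mk (N := P.toMultiObj R) (N' := Q.toMultiObj R) (fun _ c => c)
    (fun _ (x : P.Cell R _) => (⟨⟨x.1.1, Hom.map f x.1.2⟩, x.2⟩ : Q.Cell R _))
    (fun _ => rfl) (fun _ => (T.map_id _).symm)
    (fun {a} _ => Subtype.ext (congrArg (fun p => (⟨_, p⟩ : Q.Tot)) (Hom.map_one f (R.len a))))
    (fun {a} (x : P.Cell R a) z h h' => by
      apply Subtype.ext
      obtain ⟨S, p, l, hx, hz⟩ := Cell.exists_eq h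
      obtain ⟨hU, e1⟩ := Cell.comp_eq h hx hz (fun _ => rfl)
      obtain ⟨hU', e2⟩ := Cell.comp_eq (P := Q) h'
        (congrArg (fun q : P.Tot => (⟨q.1, Hom.map f q.2⟩ : Q.Tot)) hx)
        (R.e_map (Y := Q.Cell R) _ hz) (fun _ => rfl)
      refine (congrArg (fun q : P.Tot => (⟨q.1, Hom.map f q.2⟩ : Q.Tot)) e1).trans
        (Eq.trans ?_ e2.symm)
      exact congrArg (fun p => (⟨_, p⟩ : Q.Tot)) (Hom.map_comp f p _ hU _))
  map_id P := rfl
  map_comp f g := rfl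

instance : (toMulti R).Faithful where
  map_injective {P Q} f g h := by
    refine Hom.ext ?_
    funext S p
    have := congrFun (congrFun (congrArg Multi.Hom.x h) (R.len.symm S.leaves))
      (⟨⟨S, p⟩, (R.len.apply_symm_apply _).symm⟩ : P.Cell R _)
    exact eq_of_heq (Sigma.mk.inj_iff.1 (congrArg Subtype.val this)).2

instance : (toMulti R).Full where
  map_surjective {P Q} := fun (g : Multi.Hom (P.toMultiObj R) (Q.toMultiObj R)) => by
    let gx : ∀ {a : I}, P.Cell R a → Q.Cell R a := fun {a} => g.x a
    have hs : ∀ {a : I} (x : P.Cell R a), (gx x).1.1 = x.1.1 := fun {a} x =>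
      (R.e_tree (gx x).2).symm.trans ((congrArg (fun z => (R.e z).1) (g.s (j := a) x)).trans
        ((R.shape_map _ _).trans (R.e_tree x.2)))
    -- A tree with a given number of leaves belongs to exactly one sort, so the image of `p` does
    -- not depend on how that sort is named.
    have key : ∀ {S : PTree} (p : P.Op S), ∃ q : Q.Op S, ∀ {a : I} (h : S.leaves = R.len a),
        (gx (⟨⟨S, p⟩, h⟩ : P.Cell R a)).1 = ⟨S, q⟩ := fun {S} p => by
      obtain ⟨q, hq⟩ := exists_eq_sigma_mk
        (hs (⟨⟨S, p⟩, (R.len.apply_symm_apply _).symm⟩ : P.Cell R (R.len.symm S.leaves)))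
      refine ⟨q, fun {a} h => ?_⟩
      obtain rfl : R.len.symm S.leaves = a := by
        rw [h, Equiv.symm_apply_apply]
      exact hq
    choose φ hφ using @key
    refine ⟨Hom.mk (fun p => φ p) (fun k => ?_) (fun {S} p U h y => ?_),
      Multi.Hom.ext rfl ?_⟩
    · obtain ⟨a, rfl⟩ := R.len.surjective k
      have h3 := hφ (P.one (R.len a)) (a := a) (PTree.leaves_corolla _)
      have h4 := congrArg Subtype.val (g.one (j := a) ())
      exact eq_of_heq (Sigma.mk.inj_iff.1 (h3.symm.trans h4)).2
    · obtain ⟨a, ha⟩ := R.len.surjective S.leaves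
      -- The operations `y v` are encoded as one labelled tree, so that preservation of composites
      -- in multicategories applies.
      obtain ⟨z, hz⟩ := R.exists_eq (X := P.Cell R) (a := a) S
        (fun v => ⟨R.len.symm v.arity, ⟨⟨U v, y v⟩, (h v).trans (R.len.apply_symm_apply _).symm⟩⟩)
        ha.symm (fun v => R.len.apply_symm_apply _)
      let x : P.Cell R a := ⟨⟨S, p⟩, ha.symm⟩
      have hxz : T.map (fun _ _ => ()) z = x.s :=
        R.eq_of_shape (fun _ => inferInstanceAs (Subsingleton Unit))
          ((R.shape_map _ z).trans ((congrArg Sigma.fst hz).trans (R.e_tree x.2).symm))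
      obtain ⟨hU, e1⟩ := Cell.comp_eq hxz rfl hz (fun _ => rfl)
      have h' := Multi.Hom.compat g (i := a) (y := x) (z := z) hxz
      obtain ⟨hU', e2⟩ := Cell.comp_eq (P := Q) (x := gx x) (z := T.map g.x z) h'
        (hφ p ha.symm) (R.e_map g.x hz) (fun v => hφ (y v) _)
      have e3 := congrArg Subtype.val (g.comp (i := a) x z hxz h')
      have e4 : (gx (x.comp z hxz)).1 = ⟨_, φ (P.comp p U h y)⟩ := by
        have : x.comp z hxz = ⟨⟨_, P.comp p U h y⟩, (PTree.leaves_subst _ _ _).trans ha.symm⟩ :=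
          Subtype.ext e1
        rw [this]
        exact hφ _ _
      exact eq_of_heq (Sigma.mk.inj_iff.1 (e4.symm.trans (e3.trans e2))).2
    · funext a x
      obtain ⟨⟨S, p⟩, h⟩ := x
      exact Subtype.ext (hφ p h).symm

section

variable {N : Multi T}

theorem objects_ext (hN : Multi.OneObj T N) {a : I} {z z' : T.F N.C a}
    (h : (R.e z).1 = (R.e z').1) : z = z' :=
  R.eq_of_shape (fun i => ⟨fun c c' => by
    obtain ⟨u⟩ := hN i
    exact Subsingleton.elim c c'⟩) h

/-- The operations, with a given tree, of the combinad of a generalized multicategory. -/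
def MultiOp (N : Multi T) (S : PTree) : Type :=
  {x : Σ a, N.X a // (R.e (N.s _ x.2)).1 = S}

variable {R}

theorem MultiOp.leaves {S : PTree} (x : MultiOp R N S) : S.leaves = R.len x.1.1 :=
  (congrArg PTree.leaves x.2.symm).trans (R.leaves _)

theorem MultiOp.sigma_ext {S S' : PTree} {x : MultiOp R N S} {x' : MultiOp R N S'}
    (h : x.1 = x'.1) : (⟨S, x⟩ : Σ S, MultiOp R N S) = ⟨S', x'⟩ := by
  obtain ⟨x, rfl⟩ := x
  obtain ⟨x', rfl⟩ := x'
  obtain rfl : x = x' := h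
  rfl

theorem MultiOp.exists_arg {S : PTree} (x : MultiOp R N S) {U : S.Vert → PTree}
    (h : ∀ v, (U v).leaves = v.arity) (y : ∀ v, MultiOp R N (U v)) :
    ∃ z : T.F N.X x.1.1, R.e z = ⟨S, fun v => (y v).1⟩ :=
  R.exists_eq S _ x.leaves fun v => (y v).leaves.symm.trans (h v)

/-- The labelled tree given by operations for all the vertices of a tree. -/
noncomputable def MultiOp.arg {S : PTree} (x : MultiOp R N S) {U : S.Vert → PTree}
    (h : ∀ v, (U v).leaves = v.arity) (y : ∀ v, MultiOp R N (U v)) : T.F N.X x.1.1 :=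
  (x.exists_arg h y).choose

theorem MultiOp.e_arg {S : PTree} (x : MultiOp R N S) {U : S.Vert → PTree}
    (h : ∀ v, (U v).leaves = v.arity) (y : ∀ v, MultiOp R N (U v)) :
    R.e (x.arg h y) = ⟨S, fun v => (y v).1⟩ := (x.exists_arg h y).choose_spec

theorem MultiOp.arg_eq {S : PTree} (x : MultiOp R N S) {U : S.Vert → PTree}
    (h : ∀ v, (U v).leaves = v.arity) (y : ∀ v, MultiOp R N (U v)) {z : T.F N.X x.1.1}
    (hz : R.e z = ⟨S, fun v => (y v).1⟩) : x.arg h y = z :=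
  R.e_injective ((x.e_arg h y).trans hz.symm)

theorem MultiOp.map_arg (hN : Multi.OneObj T N) {S : PTree} (x : MultiOp R N S)
    {U : S.Vert → PTree} (h : ∀ v, (U v).leaves = v.arity) (y : ∀ v, MultiOp R N (U v)) :
    T.map N.t (x.arg h y) = N.s _ x.1.2 :=
  objects_ext R hN ((R.shape_map _ _).trans ((congrArg Sigma.fst (x.e_arg h y)).trans x.2.symm))

/-- The composition of operations. -/
noncomputable def MultiOp.comp (hN : Multi.OneObj T N) {S : PTree} (x : MultiOp R N S)
    (U : S.Vert → PTree) (h : ∀ v, (U v).leaves = v.arity) (y : ∀ v, MultiOp R N (U v)) :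
    MultiOp R N (S.subst U h) :=
  ⟨⟨x.1.1, N.comp x.1.2 (x.arg h y) (x.map_arg hN h y)⟩, by
    rw [N.s_comp]
    choose m hm using fun v => exists_eq_sigma_mk (y v).2
    obtain ⟨hU, L, hL, -⟩ := R.e_bind N.s (x.e_arg h y) hm
    exact congrArg Sigma.fst hL⟩

/-- The argument of a composite is obtained by choice, but a labelled tree determines it; any `z`
with the right tree may be used. -/
theorem MultiOp.comp_val (hN : Multi.OneObj T N) {S : PTree} {a : I} {c : N.X a}
    {x : MultiOp R N S} (hx : x.1 = ⟨a, c⟩)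
    (U : S.Vert → PTree) (h : ∀ v, (U v).leaves = v.arity) (y : ∀ v, MultiOp R N (U v))
    {z : T.F N.X a} (hz : R.e z = ⟨S, fun v => (y v).1⟩) :
    ∃ h', (x.comp hN U h y).1 = ⟨a, N.comp c z h'⟩ := by
  obtain ⟨x, hc⟩ := x
  obtain rfl : x = ⟨a, c⟩ := hx
  obtain rfl := MultiOp.arg_eq (⟨⟨a, c⟩, hc⟩ : MultiOp R N S) h y hz
  exact ⟨_, rfl⟩

variable (R)

/-- The unit operations of the combinad of a generalized multicategory with one object. -/
noncomputable def MultiOp.one (hN : Multi.OneObj T N) (k : ℕ) :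
    MultiOp R N (PTree.corolla k) :=
  ⟨⟨R.len.symm k, N.one _ (hN _).some.default⟩, by
    rw [N.s_one]
    refine (congrArg Sigma.fst (R.pure _)).trans ?_
    exact congrArg PTree.corolla (R.len.apply_symm_apply k)⟩

theorem MultiOp.one_val (hN : Multi.OneObj T N) {k : ℕ} {a : I} (h : k = R.len a) (c : N.C a) :
    (MultiOp.one R hN k).1 = ⟨a, N.one a c⟩ := by
  obtain rfl : R.len.symm k = a := by
    rw [h, Equiv.symm_apply_apply]
  exact congrArg (fun c => (⟨_, N.one _ c⟩ : Σ a, N.X a)) ((hN _).some.uniq c).symm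

end

end Combinad

/-! ### Vertices of grafted and substituted planar trees. -/

namespace PTree

theorem exists_eq_vertBase_or_vertGraft : ∀ {P : PTree} (f : Fin P.leaves → PTree)
    (w : (P.graft f).Vert), (∃ v, w = vertBase f v) ∨ ∃ x v, w = vertGraft f x v
  | .leaf, _, w => Or.inr ⟨(0 : Fin 1), w, rfl⟩
  | .node _ _, _, .root => Or.inl ⟨.root, rfl⟩
  | .node _ c, f, .child i w => by
    rcases exists_eq_vertBase_or_vertGraft (fun y => f (finSigmaFinEquiv ⟨i, y⟩)) w with
      ⟨v, hv⟩ | ⟨y, v, hv⟩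
    · exact Or.inl ⟨.child i v, congrArg (Vert.child i) hv⟩
    · exact Or.inr ⟨finSigmaFinEquiv ⟨i, y⟩, v,
        (congrArg (Vert.child i) hv).trans (LTree.vertGraft_apply f i y v).symm⟩

/-- This makes the labels of a substitution unique, since a tree presentation describes them only
along `vertSubst`. -/
theorem exists_eq_vertSubst : ∀ {P : PTree} (U : P.Vert → PTree)
    (h : ∀ v, (U v).leaves = v.arity) (w : (P.subst U h).Vert), ∃ v u, w = vertSubst U h v u
  | .leaf, _, _, w => isEmptyElim (α := PTree.leaf.Vert) w
  | .node _ c, U, h, w => by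
    rcases exists_eq_vertBase_or_vertGraft _ w with ⟨v, hv⟩ | ⟨x, w', hw⟩
    · exact ⟨.root, v, hv⟩
    · obtain ⟨v, u, hv⟩ := exists_eq_vertSubst (fun v => U (.child (Fin.cast (h .root) x) v))
        (fun v => h (.child _ v)) w'
      exact ⟨.child (Fin.cast (h .root) x) v, u, hw.trans (congrArg _ hv)⟩

end PTree

/-! ### Multicategories with one object of each sort as combinads. -/

namespace Combinad

variable {I : Type} {T : FMonad I} (R : TreeRep T) {N : Multi T}

/-- The combinad of a generalized multicategory with one object of each sort. -/
noncomputable def ofMulti (hN : Multi.OneObj T N) : Combinad where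
  Op := MultiOp R N
  one := MultiOp.one R hN
  comp x U h y := x.comp hN U h y
  one_comp {S} y := MultiOp.sigma_ext (by
    obtain ⟨⟨a, c⟩, hc⟩ := y
    have hS : S.leaves = R.len a := MultiOp.leaves ⟨⟨a, c⟩, hc⟩
    obtain ⟨h', e⟩ := MultiOp.comp_val hN (MultiOp.one_val R hN hS (N.t _ c)) (fun _ => S)
      (fun v => (PTree.arity_corolla v).symm) (fun _ => ⟨⟨a, c⟩, hc⟩) (z := T.pure c)
      ((R.pure c).trans (congrArg (fun n => (⟨PTree.corolla n, fun _ => ⟨a, c⟩⟩ :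
        Σ P : PTree, P.Vert → Σ j, N.X j)) hS.symm))
    exact e.trans (congrArg (Sigma.mk a) (N.one_comp c h')))
  comp_one {S} x := MultiOp.sigma_ext (by
    obtain ⟨⟨a, c⟩, hc⟩ := x
    obtain ⟨l, hl⟩ := exists_eq_sigma_mk hc
    obtain ⟨h', e⟩ := MultiOp.comp_val hN (x := ⟨⟨a, c⟩, hc⟩) rfl
      (fun v => PTree.corolla v.arity)
      (fun v => PTree.leaves_corolla v.arity) (fun v => MultiOp.one R hN v.arity)
      (z := T.map N.one (N.s a c))
      ((R.e_map N.one hl).trans (congrArg (Sigma.mk S) (funext fun v =>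
        (MultiOp.one_val R hN (R.arity_of_eq hl v).symm (l v).2).symm)))
    exact e.trans (congrArg (Sigma.mk a) (N.comp_one c h')))
  comp_assoc {S} x U h y V h' z := MultiOp.sigma_ext (by
    obtain ⟨⟨a, c⟩, hc⟩ := x
    have hV := fun v u => (h' (PTree.vertSubst U h v u)).trans (PTree.arity_vertSubst U h v u)
    -- At each vertex of `S`: the operation placed there, paired with the labelled tree of the
    -- operations that go into it. Associativity in `N` for this family is the associativity law of
    -- the combinad.
    obtain ⟨ζ, hζ⟩ := R.exists_eq (X := CompPair T N.t N.s) (a := a) S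
      (fun v => ⟨(y v).1.1, ⟨((y v).1.2, (y v).arg (hV v) (fun u => z (PTree.vertSubst U h v u))),
        (y v).map_arg hN (hV v) _⟩⟩) (MultiOp.leaves ⟨⟨a, c⟩, hc⟩)
      (fun v => (y v).leaves.symm.trans (h v))
    obtain ⟨h1, e1⟩ := MultiOp.comp_val hN (x := ⟨⟨a, c⟩, hc⟩) rfl U h y
      (R.e_map (fun _ p => p.1.1) hζ)
    obtain ⟨h2, L, hL, hLz⟩ := R.e_bind (fun _ p => p.1.2) hζ (fun v => (y v).e_arg (hV v) _)
    obtain rfl : L = fun w => (z w).1 := funext fun w => by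
      obtain ⟨v, u, rfl⟩ := PTree.exists_eq_vertSubst U h w
      exact hLz v u
    obtain ⟨h3, e3⟩ := MultiOp.comp_val hN e1 V h' z hL
    obtain ⟨h4, e4⟩ := MultiOp.comp_val hN (x := ⟨⟨a, c⟩, hc⟩) rfl
      (fun v => (U v).subst (fun u => V (PTree.vertSubst U h v u)) (hV v))
      (fun v => (PTree.leaves_subst _ _ _).trans (h v))
      (fun v => (y v).comp hN _ (hV v) (fun u => z (PTree.vertSubst U h v u)))
      (R.e_map (fun _ p => N.comp p.1.1 p.1.2 p.2) hζ)
    exact e3.trans ((congrArg (Sigma.mk a) (N.comp_assoc c ζ h1 h3 h4)).trans e4.symm))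

section

variable {R} {hN : Multi.OneObj T N}

/-- The arrow underlying an operation. -/
def MultiOp.sigma (q : Σ S, MultiOp R N S) : Σ a, N.X a := q.2.1

theorem exists_ofMulti_cell {a : I} (q : (ofMulti R hN).Cell R a) :
    ∃ c, MultiOp.sigma q.1 = ⟨a, c⟩ := by
  obtain ⟨⟨S, x⟩, hq⟩ := q
  exact exists_eq_sigma_mk (R.len.injective ((MultiOp.leaves x).symm.trans hq))

/-- The arrow given by an operation of the combinad of a generalized multicategory. -/
noncomputable def ofMultiCell {a : I} (q : (ofMulti R hN).Cell R a) : N.X a :=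
  (exists_ofMulti_cell q).choose

theorem ofMultiCell_spec {a : I} (q : (ofMulti R hN).Cell R a) :
    MultiOp.sigma q.1 = ⟨a, ofMultiCell q⟩ :=
  (exists_ofMulti_cell q).choose_spec

theorem ofMultiCell_eq {a : I} {q : (ofMulti R hN).Cell R a} {c : N.X a}
    (h : MultiOp.sigma q.1 = ⟨a, c⟩) : ofMultiCell q = c :=
  eq_of_heq (Sigma.mk.inj_iff.1 ((ofMultiCell_spec q).symm.trans h)).2

theorem shape_ofMultiCell {a : I} (q : (ofMulti R hN).Cell R a) :
    (R.e (N.s a (ofMultiCell q))).1 = q.1.1 := by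
  have h := ofMultiCell_spec q
  generalize ofMultiCell q = c at *
  obtain ⟨⟨S, ⟨x, hx⟩⟩, hq⟩ := q
  obtain rfl : x = ⟨a, c⟩ := h
  exact hx

end

/-- An arrow of `N` has a planar tree as its source, since the objects carry no information. Sorting
arrows by this tree gives a combinad, and the bijection with arrows is an isomorphism. -/
theorem toMulti_essImage (N : Multi T) : (toMulti R).essImage N ↔ Multi.OneObj T N := by
  constructor
  · rintro ⟨P, ⟨e⟩⟩
    exact Multi.OneObj.of_iso e fun _ => ⟨inferInstanceAs (Unique Unit)⟩
  · intro hN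
    have hC : ∀ {i : I} (c c' : N.C i), c = c' := fun {i} c c' => by
      obtain ⟨u⟩ := hN i
      exact Subsingleton.elim c c'
    let f : Multi.Hom ((ofMulti R hN).toMultiObj R) N :=
      { c := fun i _ => (hN i).some.default
        x := fun _ q => ofMultiCell (hN := hN) q
        t := fun _ => hC _ _
        s := fun q => objects_ext R hN ((shape_ofMultiCell q).trans
          ((R.shape_map _ _).trans (R.e_tree q.2)).symm)
        one := fun {a} _ => ofMultiCell_eq (MultiOp.one_val R hN rfl _)
        comp := fun {a} q z h h' => by
          apply ofMultiCell_eq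
          obtain ⟨S, p, l, hx, hz⟩ := Cell.exists_eq h
          obtain ⟨hU, e⟩ := Cell.comp_eq h hx hz (fun _ => rfl)
          refine (congrArg MultiOp.sigma e).trans ?_
          obtain ⟨h1, e1⟩ := MultiOp.comp_val hN (x := p)
            ((congrArg MultiOp.sigma hx).symm.trans (ofMultiCell_spec q)) _ hU _
            ((R.e_map (fun _ q => ofMultiCell (hN := hN) q) hz).trans
              (congrArg (Sigma.mk S) (funext fun v => (ofMultiCell_spec (l v).2).symm)))
          exact e1 }
    have := Multi.isIso_of_bijective f
      (fun _ => ⟨fun _ _ _ => rfl, fun c => ⟨(), hC _ _⟩⟩) (fun a => by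
        refine ⟨fun q q' h => Subtype.ext ?_, fun x => ⟨⟨⟨_, ⟨⟨a, x⟩, rfl⟩⟩, R.leaves _⟩,
          ofMultiCell_eq rfl⟩⟩
        exact MultiOp.sigma_ext ((ofMultiCell_spec q).trans
          ((congrArg (Sigma.mk a) h).trans (ofMultiCell_spec q').symm)))
    exact ⟨ofMulti R hN, ⟨@asIso (Multi T) _ _ _ f this⟩⟩

end Combinad

theorem oalg_zero_three : Nonempty (OAlg 0 3 ≌ Combinad) :=
  nonempty_equivalence_of_essImage (toMultiFunctor (k := 0) (m := 2) zero_le_one)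
    (Combinad.toMulti zTwoRep) fun N =>
      ((toMultiFunctor_essImage (m := 2) zero_le_one N).trans (by simp)).trans
        (Combinad.toMulti_essImage zTwoRep N).symm

end Opetopic

theorem mainTheorem6 :
    Nonempty (Opetopic.OAlg 0 0 ≌ Type) ∧
    Nonempty (Opetopic.OAlg 0 1 ≌ MonCat.{0}) ∧
    Nonempty (Opetopic.OAlg 1 1 ≌ CategoryTheory.Cat.{0, 0}) ∧
    Nonempty (Opetopic.OAlg 0 2 ≌ Opetopic.PlanarOperad) ∧
    Nonempty (Opetopic.OAlg 1 2 ≌ Opetopic.ColPlanarOperad) ∧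
    Nonempty (Opetopic.OAlg 0 3 ≌ Opetopic.Combinad) ∧
    ∀ k n : ℕ, n ≤ k →
      Nonempty (CategoryTheory.Cat.of (Opetopic.OAlg k n) ≅
        CategoryTheory.Cat.of (Opetopic.OAlg n n)) :=
  ⟨Opetopic.oalg_zero_zero, Opetopic.oalg_zero_one, Opetopic.oalg_one_one, Opetopic.oalg_zero_two,
    Opetopic.oalg_one_two, Opetopic.oalg_zero_three, fun _ _ h => Opetopic.oalg_iso h le_rfl⟩
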